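/- **Weak--strong uniqueness for the compressible Navier--Stokes--Allen--Cahn system.** Let $d\in\{2,3\}$, $T>0$, and let $\Omega$ be either the flat torus $\mathcal T^d=([-1,1]|_{\{-1,1\}})^d$ (periodic case) or a bounded domain in $\mathbb R^d$ (Dirichlet case, with $u|_{\partial\Omega}=0$, $\mathfrak c|_{\partial\Omega}=0$). Consider $$\partial_t\varrho+\operatorname{div}(\varrho u)=0,\qquad \partial_t\mathfrak c+u\cdot\nabla\mathfrak c=\mu,\qquad \mu=\Delta\mathfrak c-F'(\mathfrak c),$$ $$\partial_t(\varrho u)+\operatorname{div}(\varrho u\otimes u)+\nabla p(\varrho)=\operatorname{div}\mathbb S(\nabla u)-\operatorname{div}\big(\nabla\mathfrak c\otimes\nabla\mathfrak c-\tfrac12|\nabla\mathfrak c|^2\mathbb I\big)+\nabla F(\mathfrak c),$$ where $\mathbb S(\nabla u)=\nu(\nabla u+\nabla^tu-\frac2d\operatorname{div}u\,\mathbb I)+\lambda\operatorname{div}u\,\mathbb I$ with $\nu>0$, $\lambda\ge0$; $F(s)=(s+1)^2$ for $s\le-1$, $F(s)=\frac14(s^2-1)^2$ for $-1\le s\le1$,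 $F(s)=(s-1)^2$ for $s>1$; $p\in C[0,\infty)\cap C^\infty(0,\infty)$, $p'>0$ on $(0,\infty)$, $\liminf_{r\to\infty}p'(r)>0$; and the pressure potential $P\in C[0,\infty)$ satisfies $P'(r)r-P(r)=p(r)$ for $r>0$ and $p\le k(1+P)$ on $[0,\infty)$ for some constant $k>0$. *Dissipative weak solutions.* $(\varrho,u,\mathfrak c)$ is a dissipative weak solution in $(0,T)\times\Omega$ with initial data $(\varrho_0,m_0,\mathfrak c_0)$ and defect measures $\mathfrak E\in L^\infty(0,T;\mathcal M^+(\overline\Omega))$, $\mathfrak R\in L^\infty(0,T;\mathcal M(\Omega;\mathbb R^{d\times d}_{\rm sym}))$ (weakly-$*$ measurable in time) if: 1. $\varrho\ge0$ a.e., $\sqrt\varrho u\in L^\infty(0,T;L^2)$, $P(\varrho)\in L^\infty(0,T;L^1)$, $u\in L^2(0,T;W^{1,2})$, $\mathfrak c\in L^\infty(0,T;W^{1,2})\cap L^2(0,T;W^{2,2})$, and in the Dirichlet case $u\in L^2(0,T;W^{1,2}_0)$, $\mathfrak c\in L^\infty(0,T;W_0^{1,2})$; 2. $\int_0^T\!\int_\Omega[\varrho\partial_t\varphi+\varrho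 u\cdot\nabla\varphi]\,dx\,dt=-\int_\Omega\varrho_0\varphi(0,\cdot)\,dx$ for all $\varphi\in C^1_c([0,T)\times\overline\Omega)$; 3. for all $\phi\in C^1_c([0,T)\times\Omega;\mathbb R^d)$, $$\int_0^T\!\!\int_\Omega[\varrho u\cdot\partial_t\phi+\varrho u\otimes u:\nabla\phi+p(\varrho)\operatorname{div}\phi]\,dx\,dt=\int_0^T\!\!\int_\Omega[\mathbb S(\nabla u):\nabla\phi+\mu\nabla\mathfrak c\cdot\phi]\,dx\,dt-\int_\Omega m_0\cdot\phi(0,\cdot)\,dx+\int_0^T\!\!\int_\Omega\nabla\phi:d\mathfrak R(t)\,dt;$$ 4. $\int_0^T\!\int_\Omega[\mathfrak c\,\partial_t\varphi-u\cdot\nabla\mathfrak c\,\varphi]\,dx\,dt=-\int_0^T\!\int_\Omega\mu\varphi\,dx\,dt-\int_\Omega\mathfrak c_0\varphi(0,\cdot)\,dx$ for all $\varphi\in C^1_c([0,T)\times\Omega)$; 5. for a.e. $\tau\in(0,T)$, $$\int_\Omega\big[\tfrac12\varrho|u|^2+\tfrac12|\nabla\mathfrak c|^2+P(\varrho)+F(\mathfrak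 c)\big](\tau)\,dx+\int_0^\tau\!\!\int_\Omega[\mathbb S(\nabla u):\nabla u+\mu^2]\,dx\,dt+\int_{\overline\Omega}d\mathfrak E(\tau)\le\int_\Omega\Big[\tfrac12\tfrac{|m_0|^2}{\varrho_0}+\tfrac12|\nabla\mathfrak c_0|^2+P(\varrho_0)+F(\mathfrak c_0)\Big]dx;$$ 6. there is $\Lambda>0$ such that for a.e. $\tau\in(0,T)$ the matrix-valued measures $\Lambda\mathfrak E(\tau)\mathbb I\pm\mathfrak R(\tau)$ are positive semidefinite on $\Omega$. **Theorem.** Let $(\varrho_0,m_0,\mathfrak c_0)$ have finite initial energy (the right-hand side of 5 is finite), and let $(\varrho,u,\mathfrak c)$ be a dissipative weak solution with these data and defect measures $\mathfrak E$, $\mathfrak R$. Let $(R,U,\mathfrak C)$ be a strong solution of the same system, i.e. it satisfies the equations pointwise in $(0,T)\times\Omega$ and the same boundary conditions, in the class $$\inf_{(0,T)\times\Omega}R>0,\quad R\in C^1([0,T]\times\overline\Omega),\quad U\in C^1([0,T]\times\overline\Omega;\mathbb R^d),\quad \operatorname{div}\mathbb S(\nabla U)\in C([0,T]\times\overline\Omega;\mathbb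 R^d),\quad \mathfrak C,\nabla\mathfrak C,\Delta\mathfrak C\in C^1([0,T]\times\overline\Omega),$$ where $\operatorname{div}\mathbb S(\nabla U)$ is understood in the sense of distributions, and with the same data: $R(0,\cdot)=\varrho_0$, $R(0,\cdot)U(0,\cdot)=m_0$, $\mathfrak C(0,\cdot)=\mathfrak c_0$. Then $$\varrho=R,\quad u=U,\quad\mathfrak c=\mathfrak C\quad\text{a.e. in }(0,T)\times\Omega,$$ and $\mathfrak E(\tau)=0$, $\mathfrak R(\tau)=0$ for a.e. $\tau\in(0,T)$. -/

import Mathlib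

open MeasureTheory Set Filter Topology
open scoped ENNReal NNReal ContDiff

noncomputable section

namespace NSAC

/-- Physical space `ℝ^d` with the Euclidean norm. -/
abbrev Sp (d : ℕ) : Type := EuclideanSpace ℝ (Fin d)

/-- `∂_j f (x)`. -/
def pderiv {d : ℕ} (j : Fin d) (f : Sp d → ℝ) (x : Sp d) : ℝ :=
  fderiv ℝ f x (EuclideanSpace.single j 1)

/-- `∂_t f (t, x)`. -/
def tderiv {d : ℕ} {V : Type*} [NormedAddCommGroup V] [NormedSpace ℝ V]
    (f : ℝ → Sp d → V) (t : ℝ) (x : Sp d) : V :=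
  deriv (fun s => f s x) t

/-- The Jacobian `(∇u)_{ij} = ∂_j u_i`. -/
def jac {d : ℕ} (u : Sp d → Sp d) (x : Sp d) : Matrix (Fin d) (Fin d) ℝ :=
  Matrix.of fun i j => pderiv j (fun y => u y i) x

/-- The contraction `A : B`. -/
def ddot {d : ℕ} (A B : Matrix (Fin d) (Fin d) ℝ) : ℝ := ∑ i, ∑ j, A i j * B i j

/-- The dyadic product `a ⊗ b`. -/
def dyad {d : ℕ} (a b : Sp d) : Matrix (Fin d) (Fin d) ℝ := Matrix.of fun i j => a i * b j

/-! ### Constitutive relations -/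

/-- The Ginzburg--Landau potential. -/
def glF (s : ℝ) : ℝ :=
  if s ≤ -1 then (s + 1) ^ 2
  else if s ≤ 1 then (1 / 4) * (s ^ 2 - 1) ^ 2
  else (s - 1) ^ 2

/-- The viscosity coefficients, the pressure `p`, and a pressure potential `P`, with the structural
hypotheses. Only the values of `p` and `P` on `[0, ∞)` matter. The condition
`liminf_{r → ∞} p'(r) > 0` is written out, since a real-valued `liminf` would be a junk value
when `p'` tends to infinity. -/
structure FluidLaw where
  nu : ℝ
  lam : ℝ
  p : ℝ → ℝ
  P : ℝ → ℝ
  nu_pos : 0 < nu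
  lam_nonneg : 0 ≤ lam
  p_cont : ContinuousOn p (Ici 0)
  p_smooth : ContDiffOn ℝ ∞ p (Ioi 0)
  p_deriv_pos : ∀ r, 0 < r → 0 < deriv p r
  p_deriv_liminf : ∃ a : ℝ, 0 < a ∧ ∀ᶠ r in atTop, a ≤ deriv p r
  P_cont : ContinuousOn P (Ici 0)
  P_diff : ∀ r, 0 < r → DifferentiableAt ℝ P r
  P_eq : ∀ r, 0 < r → deriv P r * r - P r = p r
  p_le : ∃ k : ℝ, 0 < k ∧ ∀ r, 0 ≤ r → p r ≤ k * (1 + P r)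

/-- The viscous stress
`S(A) = ν (A + Aᵗ - (2/d) tr A I) + λ tr A I`, to be evaluated at `A = ∇u`. -/
def FluidLaw.stress (L : FluidLaw) {d : ℕ} (A : Matrix (Fin d) (Fin d) ℝ) :
    Matrix (Fin d) (Fin d) ℝ :=
  L.nu • (A + A.transpose - ((2 / (d : ℝ)) * A.trace) • (1 : Matrix (Fin d) (Fin d) ℝ))
    + (L.lam * A.trace) • (1 : Matrix (Fin d) (Fin d) ℝ)

/-! ### The spatial domain -/

/-- The spatial domain together with its boundary conditions: either the flat torus obtained from
`[-1,1]^d` by identifying opposite faces, or a bounded domain of `ℝ^d` with homogeneous Dirichlet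
conditions. Functions on the torus are represented by functions on `ℝ^d` that are `2`-periodic in
every coordinate, integrals over the torus by integrals over `[-1,1)^d`, and measures on
the torus by measures carried by `[-1,1)^d`. -/
inductive FlowDomain (d : ℕ) : Type
  | torus : FlowDomain d
  | dirichlet (Ω : Set (Sp d)) (isOpen : IsOpen Ω) (isBounded : Bornology.IsBounded Ω)
      (isConnected : IsConnected Ω) : FlowDomain d

namespace FlowDomain

variable {d : ℕ}

/-- Set of integration: a fundamental cell of the torus, resp. `Ω`. -/
def cell : FlowDomain d → Set (Sp d)
  | torus => {x | ∀ i, x i ∈ Ico (-1 : ℝ) 1}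
  | dirichlet Ω _ _ _ => Ω

/-- Carrier of measures on the closed domain (the torus has no boundary). -/
def closedCell : FlowDomain d → Set (Sp d)
  | torus => {x | ∀ i, x i ∈ Ico (-1 : ℝ) 1}
  | dirichlet Ω _ _ _ => closure Ω

/-- Set where functions on the domain are differentiated: all of `ℝ^d` for (periodic functions on)
the torus, resp. `Ω`. -/
def region : FlowDomain d → Set (Sp d)
  | torus => univ
  | dirichlet Ω _ _ _ => Ω

/-- Set of points at which functions on the closed domain are evaluated. -/
def closedRegion : FlowDomain d → Set (Sp d)
  | torus => univ
  | dirichlet Ω _ _ _ => closure Ω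

/-- Lebesgue measure on the domain. -/
def vol (D : FlowDomain d) : Measure (Sp d) := volume.restrict D.cell

/-- Lebesgue measure on `(0,T) × Ω`. -/
def spaceTime (D : FlowDomain d) (T : ℝ) : Measure (ℝ × Sp d) :=
  (volume.restrict (Ioo 0 T)).prod D.vol

/-- Periodicity on the torus; no condition on a bounded domain. -/
def Periodic {V : Type*} : FlowDomain d → (Sp d → V) → Prop
  | torus, f => ∀ (x : Sp d) (i : Fin d), f (x + EuclideanSpace.single i 2) = f x
  | dirichlet _ _ _ _, _ => True

/-- Smooth test functions on the domain, compactly supported in `Ω` (the torus is compact). -/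
def SmoothTest : FlowDomain d → (Sp d → ℝ) → Prop
  | torus, φ => ContDiff ℝ ∞ φ ∧ Periodic torus φ
  | dirichlet Ω _ _ _, φ => ContDiff ℝ ∞ φ ∧ HasCompactSupport φ ∧ tsupport φ ⊆ Ω

/-- `g` is the weak partial derivative `∂_j f` on the domain. -/
def IsWeakPartial (D : FlowDomain d) (j : Fin d) (f g : Sp d → ℝ) : Prop :=
  ∀ φ : Sp d → ℝ, D.SmoothTest φ →
    ∫ x, f x * pderiv j φ x ∂D.vol = -∫ x, g x * φ x ∂D.vol

/-- `G` is the weak gradient of `f`. -/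
def IsWeakGrad (D : FlowDomain d) (f : Sp d → ℝ) (G : Sp d → Sp d) : Prop :=
  ∀ j, D.IsWeakPartial j f (fun x => G x j)

/-- `V` is the distributional (row-wise) divergence of the matrix field `A`. -/
def IsWeakDiv (D : FlowDomain d) (A : Sp d → Matrix (Fin d) (Fin d) ℝ) (V : Sp d → Sp d) : Prop :=
  ∀ φ : Sp d → ℝ, D.SmoothTest φ → ∀ i,
    ∫ x, ∑ j, A x i j * pderiv j φ x ∂D.vol = -∫ x, V x i * φ x ∂D.vol

/-- On a bounded domain: `f` (with gradient `G`) belongs to `W^{1,2}_0(Ω)`, the closure of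
the smooth compactly supported functions in `W^{1,2}(Ω)`. On the torus: no condition. -/
def ZeroTrace : FlowDomain d → (Sp d → ℝ) → (Sp d → Sp d) → Prop
  | torus, _, _ => True
  | D@(dirichlet _ _ _ _), f, G =>
      ∃ φ : ℕ → Sp d → ℝ, (∀ n, D.SmoothTest (φ n)) ∧
        Tendsto (fun n => eLpNorm (fun x => φ n x - f x) 2 D.vol) atTop (𝓝 0) ∧
        ∀ j, Tendsto (fun n => eLpNorm (fun x => pderiv j (φ n) x - G x j) 2 D.vol) atTop (𝓝 0)

/-- On a bounded domain: `f` vanishes on `∂Ω`. On the torus: no condition. -/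
def VanishesOnBoundary {V : Type*} [Zero V] : FlowDomain d → (Sp d → V) → Prop
  | torus, _ => True
  | dirichlet Ω _ _ _, f => ∀ x ∈ frontier Ω, f x = 0

variable {V : Type*} [NormedAddCommGroup V] [NormedSpace ℝ V]

/-- `f ∈ C([0,T] × closure Ω; V)`. -/
def C0UpTo (D : FlowDomain d) (T : ℝ) (f : ℝ → Sp d → V) : Prop :=
  ContinuousOn (Function.uncurry f) (Icc 0 T ×ˢ D.closedRegion) ∧
    ∀ t ∈ Icc 0 T, D.Periodic (f t)

/-- `f ∈ C¹([0,T] × closure Ω; V)`: `f` is continuous on the closed cylinder, differentiable in the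
open one, and its first derivatives extend continuously to the closed cylinder. -/
def C1UpTo (D : FlowDomain d) (T : ℝ) (f : ℝ → Sp d → V) : Prop :=
  D.C0UpTo T f ∧
    ∃ (ft : ℝ → Sp d → V) (fx : ℝ → Sp d → Sp d →L[ℝ] V),
      ContinuousOn (Function.uncurry ft) (Icc 0 T ×ˢ D.closedRegion) ∧
      ContinuousOn (Function.uncurry fx) (Icc 0 T ×ˢ D.closedRegion) ∧
      ∀ t ∈ Ioo 0 T, ∀ x ∈ D.region,
        HasDerivAt (fun s => f s x) (ft t x) t ∧ HasFDerivAt (f t) (fx t x) x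

/-- `φ ∈ C¹_c([0,T) × closure Ω; V)`. -/
def TestClosed (D : FlowDomain d) (T : ℝ) (φ : ℝ → Sp d → V) : Prop :=
  D.C1UpTo T φ ∧ ∃ T' < T, ∀ t ∈ Icc 0 T, T' ≤ t → ∀ x ∈ D.closedRegion, φ t x = 0

/-- On a bounded domain: `φ(t, ·)`, `t ∈ [0,T]`, vanish outside a common compact subset of `Ω`.
On the torus: no condition. -/
def SupportedInside : FlowDomain d → ℝ → (ℝ → Sp d → V) → Prop
  | torus, _, _ => True
  | dirichlet Ω _ _ _, T, φ =>
      ∃ K, IsCompact K ∧ K ⊆ Ω ∧ ∀ t ∈ Icc 0 T, ∀ x ∈ closure Ω, x ∉ K → φ t x = 0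

/-- `φ ∈ C¹_c([0,T) × Ω; V)`. -/
def TestOpen (D : FlowDomain d) (T : ℝ) (φ : ℝ → Sp d → V) : Prop :=
  D.TestClosed T φ ∧ D.SupportedInside T φ

end FlowDomain

/-! ### Function-space and measure-theoretic conventions -/

/-- `N` is essentially bounded on `(0,T)`. -/
def EssBdd (T : ℝ) (N : ℝ → ℝ≥0∞) : Prop :=
  ∃ M : ℝ≥0, ∀ᵐ t ∂volume.restrict (Ioo 0 T), N t ≤ M

/-- The integral of `f` with respect to a (finite) signed measure. -/
def sintegral {X : Type*} [MeasurableSpace X] (s : SignedMeasure X) (f : X → ℝ) : ℝ :=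
  ∫ x, f x ∂s.toJordanDecomposition.posPart - ∫ x, f x ∂s.toJordanDecomposition.negPart

/-- A time-dependent matrix of finite signed Borel measures. -/
abbrev MatMeasure (d : ℕ) : Type := Fin d → Fin d → SignedMeasure (Sp d)

/-- `𝔈 ∈ L^∞(0,T; M⁺(closure Ω))`, where measurability in time is the weak-* one,
expressed on Borel sets. -/
def IsEnergyDefect {d : ℕ} (D : FlowDomain d) (T : ℝ) (𝔈 : ℝ → Measure (Sp d)) : Prop :=
  (∀ A, MeasurableSet A → AEMeasurable (fun t => 𝔈 t A) (volume.restrict (Ioo 0 T))) ∧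
  (∀ᵐ t ∂volume.restrict (Ioo 0 T), 𝔈 t D.closedCellᶜ = 0) ∧
  EssBdd T (fun t => 𝔈 t univ)

/-- `ℜ ∈ L^∞(0,T; M(Ω; ℝ^{d×d}_sym))`, where measurability in time is the weak-* one,
expressed on Borel sets. -/
def IsMomentumDefect {d : ℕ} (D : FlowDomain d) (T : ℝ) (ℜ : ℝ → MatMeasure d) : Prop :=
  (∀ i j A, MeasurableSet A → AEMeasurable (fun t => ℜ t i j A) (volume.restrict (Ioo 0 T))) ∧
  (∀ᵐ t ∂volume.restrict (Ioo 0 T), ∀ i j, (ℜ t i j).totalVariation D.cellᶜ = 0) ∧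
  (∀ᵐ t ∂volume.restrict (Ioo 0 T), ∀ i j, ℜ t i j = ℜ t j i) ∧
  ∀ i j, EssBdd T (fun t => (ℜ t i j).totalVariation univ)

/-- Defect compatibility `|ℜ(t)| ≲ 𝔈(t)`: there is `Λ > 0` such that for a.e. `t` the matrix-valued
measures `Λ 𝔈(t) I ± ℜ(t)` on the domain are positive semidefinite. -/
def DefectCompatible {d : ℕ} (D : FlowDomain d) (T : ℝ) (𝔈 : ℝ → Measure (Sp d))
    (ℜ : ℝ → MatMeasure d) : Prop :=
  ∃ Λ : ℝ, 0 < Λ ∧ ∀ᵐ t ∂volume.restrict (Ioo 0 T),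
    ∀ A, MeasurableSet A → A ⊆ D.cell → ∀ ξ : Sp d,
      |∑ i, ∑ j, ξ i * ξ j * ℜ t i j A| ≤ Λ * ‖ξ‖ ^ 2 * (𝔈 t).real A

/-! ### Energy -/

/-- The energy density in terms of density `r`, momentum `m`, gradient `g` and value `s` of the
order parameter. -/
def FluidLaw.energyDensity (L : FluidLaw) {d : ℕ} (r : ℝ) (m g : Sp d) (s : ℝ) : ℝ :=
  1 / 2 * (‖m‖ ^ 2 / r) + 1 / 2 * ‖g‖ ^ 2 + L.P r + glF s

/-- The initial energy is finite. In particular `c₀ ∈ W^{1,2}`, and (the usual convention for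
`|m₀|² / ϱ₀`) the momentum vanishes where the density does. -/
def FiniteInitialEnergy {d : ℕ} (L : FluidLaw) (D : FlowDomain d)
    (ϱ₀ : Sp d → ℝ) (m₀ : Sp d → Sp d) (c₀ : Sp d → ℝ) : Prop :=
  (∀ᵐ x ∂D.vol, 0 ≤ ϱ₀ x) ∧ (∀ᵐ x ∂D.vol, ϱ₀ x = 0 → m₀ x = 0) ∧
  ∃ G₀ : Sp d → Sp d, MemLp c₀ 2 D.vol ∧ MemLp G₀ 2 D.vol ∧ D.IsWeakGrad c₀ G₀ ∧
    Integrable (fun x => L.energyDensity (ϱ₀ x) (m₀ x) (G₀ x) (c₀ x)) D.vol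

/-! ### Dissipative weak solutions -/

/-- Dissipative weak solutions, with the weak derivatives `Gu = ∇u`, `Gc = ∇c`, `Hc = ∇²c`,
`G₀ = ∇c₀` displayed. -/
structure IsDissipativeWeakSolutionWith {d : ℕ} (L : FluidLaw) (D : FlowDomain d) (T : ℝ)
    (ϱ₀ : Sp d → ℝ) (m₀ : Sp d → Sp d) (c₀ : Sp d → ℝ)
    (ϱ : ℝ → Sp d → ℝ) (u : ℝ → Sp d → Sp d) (c : ℝ → Sp d → ℝ)
    (𝔈 : ℝ → Measure (Sp d)) (ℜ : ℝ → MatMeasure d)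
    (Gu : ℝ → Sp d → Matrix (Fin d) (Fin d) ℝ) (Gc : ℝ → Sp d → Sp d)
    (Hc : ℝ → Sp d → Matrix (Fin d) (Fin d) ℝ) (G₀ : Sp d → Sp d) : Prop where
  -- regularity
  rho_meas : AEStronglyMeasurable (Function.uncurry ϱ) (D.spaceTime T)
  rho_nonneg : ∀ᵐ z ∂D.spaceTime T, 0 ≤ ϱ z.1 z.2
  kinetic_bdd : EssBdd T fun t => eLpNorm (fun x => Real.sqrt (ϱ t x) • u t x) 2 D.vol
  pressure_bdd : EssBdd T fun t => eLpNorm (fun x => L.P (ϱ t x)) 1 D.vol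
  u_L2 : MemLp (Function.uncurry u) 2 (D.spaceTime T)
  gradu_L2 : ∀ i j, MemLp (fun z : ℝ × Sp d => Gu z.1 z.2 i j) 2 (D.spaceTime T)
  gradu_weak : ∀ᵐ t ∂volume.restrict (Ioo 0 T), ∀ i j,
    D.IsWeakPartial j (fun x => u t x i) (fun x => Gu t x i j)
  c_L2 : MemLp (Function.uncurry c) 2 (D.spaceTime T)
  gradc_L2 : MemLp (Function.uncurry Gc) 2 (D.spaceTime T)
  hessc_L2 : ∀ i j, MemLp (fun z : ℝ × Sp d => Hc z.1 z.2 i j) 2 (D.spaceTime T)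
  gradc_weak : ∀ᵐ t ∂volume.restrict (Ioo 0 T), D.IsWeakGrad (c t) (Gc t)
  hessc_weak : ∀ᵐ t ∂volume.restrict (Ioo 0 T), ∀ i j,
    D.IsWeakPartial j (fun x => Gc t x i) (fun x => Hc t x i j)
  c_bdd : EssBdd T fun t => eLpNorm (c t) 2 D.vol
  gradc_bdd : EssBdd T fun t => eLpNorm (Gc t) 2 D.vol
  -- boundary conditions (void on the torus)
  u_trace : ∀ᵐ t ∂volume.restrict (Ioo 0 T), ∀ i,
    D.ZeroTrace (fun x => u t x i) (fun x => WithLp.toLp 2 (Gu t x i))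
  c_trace : ∀ᵐ t ∂volume.restrict (Ioo 0 T), D.ZeroTrace (c t) (Gc t)
  -- equation of continuity
  continuity : ∀ φ : ℝ → Sp d → ℝ, D.TestClosed T φ →
    ∫ t in Ioo 0 T, ∫ x, (ϱ t x * tderiv φ t x + ϱ t x * ∑ j, u t x j * pderiv j (φ t) x) ∂D.vol
      = -∫ x, ϱ₀ x * φ 0 x ∂D.vol
  -- momentum equation
  momentum_defect : IsMomentumDefect D T ℜ
  momentum : ∀ φ : ℝ → Sp d → Sp d, D.TestOpen T φ →
    ∫ t in Ioo 0 T, ∫ x, (ϱ t x * inner ℝ (u t x) (tderiv φ t x)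
        + ϱ t x * ddot (dyad (u t x) (u t x)) (jac (φ t) x)
        + L.p (ϱ t x) * (jac (φ t) x).trace) ∂D.vol
      = (∫ t in Ioo 0 T, ∫ x, (ddot (L.stress (Gu t x)) (jac (φ t) x)
          + ((Hc t x).trace - deriv glF (c t x)) * inner ℝ (Gc t x) (φ t x)) ∂D.vol)
        - (∫ x, inner ℝ (m₀ x) (φ 0 x) ∂D.vol)
        + ∫ t in Ioo 0 T, ∑ i, ∑ j, sintegral (ℜ t i j) (fun x => jac (φ t) x i j)
  -- Allen--Cahn equation
  allenCahn : ∀ φ : ℝ → Sp d → ℝ, D.TestOpen T φ →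
    ∫ t in Ioo 0 T, ∫ x, (c t x * tderiv φ t x - inner ℝ (u t x) (Gc t x) * φ t x) ∂D.vol
      = -(∫ t in Ioo 0 T, ∫ x, ((Hc t x).trace - deriv glF (c t x)) * φ t x ∂D.vol)
        - ∫ x, c₀ x * φ 0 x ∂D.vol
  -- energy balance
  energy_defect : IsEnergyDefect D T 𝔈
  gradc0_L2 : MemLp G₀ 2 D.vol
  gradc0_weak : D.IsWeakGrad c₀ G₀
  energy : ∀ᵐ τ ∂volume.restrict (Ioo 0 T),
    (∫ x, (1 / 2 * (ϱ τ x * ‖u τ x‖ ^ 2) + 1 / 2 * ‖Gc τ x‖ ^ 2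
        + L.P (ϱ τ x) + glF (c τ x)) ∂D.vol)
      + (∫ t in Ioo 0 τ, ((∫ x, ddot (L.stress (Gu t x)) (Gu t x) ∂D.vol)
          + ∫ x, ((Hc t x).trace - deriv glF (c t x)) ^ 2 ∂D.vol))
      + (𝔈 τ).real D.closedCell
    ≤ ∫ x, L.energyDensity (ϱ₀ x) (m₀ x) (G₀ x) (c₀ x) ∂D.vol
  -- defect compatibility
  compatible : DefectCompatible D T 𝔈 ℜ

/-- `(ϱ, u, c)` is a dissipative weak solution on `(0,T) × Ω` with initial data `(ϱ₀, m₀, c₀)` and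
defect measures `𝔈`, `ℜ`. -/
def IsDissipativeWeakSolution {d : ℕ} (L : FluidLaw) (D : FlowDomain d) (T : ℝ)
    (ϱ₀ : Sp d → ℝ) (m₀ : Sp d → Sp d) (c₀ : Sp d → ℝ)
    (ϱ : ℝ → Sp d → ℝ) (u : ℝ → Sp d → Sp d) (c : ℝ → Sp d → ℝ)
    (𝔈 : ℝ → Measure (Sp d)) (ℜ : ℝ → MatMeasure d) : Prop :=
  ∃ Gu Gc Hc G₀, IsDissipativeWeakSolutionWith L D T ϱ₀ m₀ c₀ ϱ u c 𝔈 ℜ Gu Gc Hc G₀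

/-! ### Strong solutions -/

/-- The classical gradient. -/
def grad {d : ℕ} (f : Sp d → ℝ) (x : Sp d) : Sp d := WithLp.toLp 2 fun j => pderiv j f x

/-- The classical Laplacian. -/
def lap {d : ℕ} (f : Sp d → ℝ) (x : Sp d) : ℝ := ∑ j, pderiv j (pderiv j f) x

/-- The Korteweg-type stress `∇C ⊗ ∇C - ½ |∇C|² I`. -/
def capillary {d : ℕ} (f : Sp d → ℝ) (x : Sp d) : Matrix (Fin d) (Fin d) ℝ :=
  dyad (grad f x) (grad f x) - (1 / 2 * ‖grad f x‖ ^ 2) • (1 : Matrix (Fin d) (Fin d) ℝ)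

/-- Strong solutions on `[0,T] × closure Ω`. As the velocity is only assumed to be `C¹`,
`div S(∇U)` is taken in the sense of distributions and required to be a function `divS` that
is continuous on the closed cylinder; everything else is classical. -/
structure IsStrongSolution {d : ℕ} (L : FluidLaw) (D : FlowDomain d) (T : ℝ)
    (R : ℝ → Sp d → ℝ) (U : ℝ → Sp d → Sp d) (C : ℝ → Sp d → ℝ) : Prop where
  R_pos : ∃ r : ℝ, 0 < r ∧ ∀ t ∈ Ioo 0 T, ∀ x ∈ D.region, r ≤ R t x
  R_C1 : D.C1UpTo T R
  U_C1 : D.C1UpTo T U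
  C_C1 : D.C1UpTo T C
  gradC_C1 : ∃ G : ℝ → Sp d → Sp d, D.C1UpTo T G ∧
    ∀ t ∈ Ioo 0 T, ∀ x ∈ D.region, G t x = grad (C t) x
  lapC_C1 : ∃ l : ℝ → Sp d → ℝ, D.C1UpTo T l ∧
    ∀ t ∈ Ioo 0 T, ∀ x ∈ D.region, l t x = lap (C t) x
  boundary : ∀ t ∈ Icc 0 T, D.VanishesOnBoundary (U t) ∧ D.VanishesOnBoundary (C t)
  continuity : ∀ t ∈ Ioo 0 T, ∀ x ∈ D.region,
    tderiv R t x + ∑ j, pderiv j (fun y => R t y * U t y j) x = 0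
  momentum : ∃ divS : ℝ → Sp d → Sp d, D.C0UpTo T divS ∧
    (∀ t ∈ Ioo 0 T, D.IsWeakDiv (fun x => L.stress (jac (U t) x)) (divS t)) ∧
    ∀ t ∈ Ioo 0 T, ∀ x ∈ D.region, ∀ i,
      tderiv (fun s y => R s y * U s y i) t x
          + ∑ j, pderiv j (fun y => R t y * U t y i * U t y j) x
          + pderiv i (fun y => L.p (R t y)) x
        = divS t x i - ∑ j, pderiv j (fun y => capillary (C t) y i j) x
          + pderiv i (fun y => glF (C t y)) x
  allenCahn : ∀ t ∈ Ioo 0 T, ∀ x ∈ D.region,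
    tderiv C t x + inner ℝ (U t x) (grad (C t) x) = lap (C t) x - deriv glF (C t x)

end NSAC

end

noncomputable section

namespace NSAC

/-! ### The Ginzburg--Landau potential -/

/-! The proof is the relative energy method. The distance between the weak and the strong solution
is measured by the integral of e = ½ϱ|u−U|² + [P(ϱ)−P'(R)(ϱ−R)−P(R)] + ½|∇c−∇C|² +
[F(c)−F(C)−F'(C)(c−C)] + K₀ tsq(c−C) (`relDens`). The pressure part is nonnegative and vanishes only
at ϱ = R, because P'' = p'/r > 0. The double well F is not convex, so its part can be negative; but
F grows quadratically, and a large multiple of the bounded function tsq(s) = s²/(1+s²) makes it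
coercive (`exists_glF_coercive`). A bounded function with bounded derivative is needed, not a plain
square: the rate ∂ₜc = μ − u·∇c of the weak solution is only integrable, and the renormalized
equation for tsq(c−C) multiplies it by tsq'(c−C).

Expanding e gives the energy density of the weak solution, terms that are linear in ϱ, ϱu, c and ∇c
with smooth coefficients, the tsq term, and terms of the strong solution alone (`relDens_eq`). The
energy inequality handles the first. The linear terms are handled by testing the continuity equation
with ½|U|² − P'(R), the momentum equation with U and the Allen–Cahn equation with ΔC − F'(C), after
−∇c·∇C has been integrated by parts into cΔC. The initial contributions cancel since the data
coincide. The outcome is the relative energy inequality `relEnergy_weight`: weighted in time, e and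
𝔈 are bounded by the integral of an explicit rate (`relRate`) plus K∫𝔈.

In the Dirichlet case U is not compactly supported in Ω. It is cut off by χₙ with dist·|∇χₙ| bounded
(`exists_cutoff`). As U is C¹ and vanishes on the boundary, |U| ≤ B·dist (`norm_le_bdist`), so
∇(χₙU) is bounded uniformly and the passage to the limit is dominated; no regularity of ∂Ω is used.
The defect ℜ sees only the bound on the gradient, and compatibility turns it into K∫𝔈.

Pointwise, the rate is at most −S(∇(u−U)):∇(u−U) + ε|u−U|² + N e (`exists_relRate_le`). The term
ε|u−U|² cannot be avoided: near vacuum, e does not control |u−U|². It is absorbed by the dissipation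
through the inequalities of Korn and Poincaré (`exists_velocity_sub_le`). On the torus the mean of
u−U must be controlled as well; conservation of mass and superlinearity of P keep ϱ above some δ > 0
on a set of measure at least a > 0 at almost every time (`exists_density_set`), and there ϱ|u−U|²
suffices.

Grönwall's lemma is built into the time weight (a−t)₊² exp(−(N+K)t) of `relEnergy_eq_zero`. It
yields e = 0 and 𝔈 = 0, and then ℜ = 0 because the total variation of ℜ is bounded by 𝔈. -/

theorem hasDerivAt_ite_le {f g f' g' : ℝ → ℝ} {a : ℝ} (hf : ∀ x, HasDerivAt f (f' x) x)
    (hg : ∀ x, HasDerivAt g (g' x) x) (h : f a = g a) (h' : f' a = g' a) (x : ℝ) :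
    HasDerivAt (fun s => if s ≤ a then f s else g s) (if x ≤ a then f' x else g' x) x := by
  rcases lt_trichotomy x a with hx | rfl | hx
  · rw [if_pos hx.le]
    refine (hf x).congr_of_eventuallyEq ?_
    filter_upwards [Iio_mem_nhds hx] with s hs
    rw [if_pos (le_of_lt hs)]
  · rw [if_pos le_rfl]
    have h1 : HasDerivWithinAt (fun s => if s ≤ x then f s else g s) (f' x) (Iic x) x :=
      (hf x).hasDerivWithinAt.congr (fun s hs => if_pos hs) (if_pos le_rfl)
    have h2 : HasDerivWithinAt (fun s => if s ≤ x then f s else g s) (f' x) (Ici x) x := by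
      rw [h']
      refine (hg x).hasDerivWithinAt.congr (fun s hs => ?_) ?_
      · rcases eq_or_lt_of_le (show x ≤ s from hs) with rfl | hs'
        · rw [if_pos le_rfl, h]
        · rw [if_neg (not_le.2 hs')]
      · rw [if_pos le_rfl, h]
    have := h1.union h2
    rwa [Iic_union_Ici, hasDerivWithinAt_univ] at this
  · rw [if_neg (not_le.2 hx)]
    refine (hg x).congr_of_eventuallyEq ?_
    filter_upwards [Ioi_mem_nhds hx] with s hs
    rw [if_neg (not_le.2 hs)]

/-- The first derivative of the potential. -/
def glF1 (s : ℝ) : ℝ :=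
  if s ≤ -1 then 2 * (s + 1) else if s ≤ 1 then s ^ 3 - s else 2 * (s - 1)

/-- The second derivative of the potential. -/
def glF2 (s : ℝ) : ℝ := if s ≤ -1 then 2 else if s ≤ 1 then 3 * s ^ 2 - 1 else 2

theorem hasDerivAt_glF (s : ℝ) : HasDerivAt glF (glF1 s) s := by
  have h1 : ∀ x : ℝ, HasDerivAt (fun s : ℝ => (1 / 4) * (s ^ 2 - 1) ^ 2) (x ^ 3 - x) x := fun x =>
    ((((hasDerivAt_pow 2 x).sub_const 1).pow 2).const_mul (1 / 4 : ℝ)).congr_deriv (by simp; ring)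
  have h2 : ∀ x : ℝ, HasDerivAt (fun s : ℝ => (s - 1) ^ 2) (2 * (x - 1)) x := fun x =>
    (((hasDerivAt_id x).sub_const 1).pow 2).congr_deriv (by simp)
  have h3 : ∀ x : ℝ, HasDerivAt (fun s : ℝ => (s + 1) ^ 2) (2 * (x + 1)) x := fun x =>
    (((hasDerivAt_id x).add_const 1).pow 2).congr_deriv (by simp)
  have h4 := hasDerivAt_ite_le (a := 1) h1 h2 (by norm_num) (by norm_num)
  exact hasDerivAt_ite_le (a := -1) h3 h4 (by norm_num) (by norm_num) s

theorem hasDerivAt_glF1 (s : ℝ) : HasDerivAt glF1 (glF2 s) s := by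
  have h1 : ∀ x : ℝ, HasDerivAt (fun s : ℝ => s ^ 3 - s) (3 * x ^ 2 - 1) x := fun x =>
    ((hasDerivAt_pow 3 x).sub (hasDerivAt_id x)).congr_deriv (by simp)
  have h2 : ∀ x : ℝ, HasDerivAt (fun s : ℝ => 2 * (s - 1)) ((fun _ => 2) x) x := fun x =>
    (((hasDerivAt_id x).sub_const 1).const_mul 2).congr_deriv (by simp)
  have h3 : ∀ x : ℝ, HasDerivAt (fun s : ℝ => 2 * (s + 1)) ((fun _ => 2) x) x := fun x =>
    (((hasDerivAt_id x).add_const 1).const_mul 2).congr_deriv (by simp)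
  have h4 := hasDerivAt_ite_le (a := 1) h1 h2 (by norm_num) (by norm_num)
  exact hasDerivAt_ite_le (a := -1) h3 h4 (by norm_num) (by norm_num) s

theorem deriv_glF : deriv glF = glF1 := funext fun s => (hasDerivAt_glF s).deriv

/-- The single formula makes the continuity across ±1, the bound 2 and the Lipschitz constant
visible. -/
theorem glF2_eq (s : ℝ) : glF2 s = 3 * min (s ^ 2) 1 - 1 := by
  unfold glF2
  split_ifs with h1 h2
  · rw [min_eq_right (by nlinarith)]; norm_num
  · rw [min_eq_left (by nlinarith)]
  · rw [min_eq_right (by nlinarith)]; norm_num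

/-- The function min |s| 1 is 1-Lipschitz and at most 1, so its square is 2-Lipschitz; the prefactor
3 gives 6. -/
theorem glF2_lipschitz (s t : ℝ) : |glF2 s - glF2 t| ≤ 6 * |s - t| := by
  have key : ∀ s : ℝ, min (s ^ 2) 1 = (min |s| 1) ^ 2 := fun s => by
    rcases le_total |s| 1 with h | h
    · rw [min_eq_left h, sq_abs, min_eq_left (by rw [← sq_abs]; nlinarith [abs_nonneg s])]
    · rw [min_eq_right h, min_eq_right (by rw [← sq_abs]; nlinarith [abs_nonneg s])]; norm_num
  have h1 : |min |s| 1 - min |t| 1| ≤ |s - t| :=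
    (abs_min_sub_min_le_max _ _ _ _).trans (by
      rw [sub_self, abs_zero, max_eq_left (abs_nonneg _)]; exact abs_abs_sub_abs_le_abs_sub s t)
  have h2 : |min |s| 1 + min |t| 1| ≤ 2 := by
    have := abs_nonneg s; have := abs_nonneg t
    rw [abs_of_nonneg (by positivity)]
    linarith [min_le_right |s| 1, min_le_right |t| 1]
  rw [glF2_eq, glF2_eq, key, key]
  have : 3 * (min |s| 1) ^ 2 - 1 - (3 * (min |t| 1) ^ 2 - 1)
      = 3 * ((min |s| 1 - min |t| 1) * (min |s| 1 + min |t| 1)) := by ring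
  rw [this, abs_mul, abs_mul, abs_of_pos (by norm_num : (0:ℝ) < 3)]
  nlinarith [abs_nonneg (min |s| 1 - min |t| 1), abs_nonneg (min |s| 1 + min |t| 1)]

theorem abs_glF2_le (s : ℝ) : |glF2 s| ≤ 2 := by
  rw [glF2_eq, abs_le]
  have h1 : 0 ≤ min (s ^ 2) 1 := le_min (sq_nonneg _) zero_le_one
  constructor <;> linarith [min_le_right (s ^ 2) 1]

theorem continuous_glF : Continuous glF :=
  continuous_iff_continuousAt.2 fun s => (hasDerivAt_glF s).continuousAt

theorem continuous_glF1 : Continuous glF1 :=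
  continuous_iff_continuousAt.2 fun s => (hasDerivAt_glF1 s).continuousAt

theorem continuous_glF2 : Continuous glF2 := by
  have : glF2 = fun s => 3 * min (s ^ 2) 1 - 1 := funext glF2_eq
  rw [this]; fun_prop

/-- Mean value inequality on the segment `[[a, b]]`. -/
theorem abs_sub_le_of_hasDerivAt {f f' : ℝ → ℝ} {a b K : ℝ}
    (hf : ∀ x ∈ uIcc a b, HasDerivAt f (f' x) x) (hK : ∀ x ∈ uIcc a b, |f' x| ≤ K) :
    |f b - f a| ≤ K * |b - a| :=
  (convex_uIcc a b).norm_image_sub_le_of_norm_hasDerivWithin_le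
    (fun x hx => (hf x hx).hasDerivWithinAt) hK left_mem_uIcc right_mem_uIcc

theorem glF1_lipschitz (s t : ℝ) : |glF1 s - glF1 t| ≤ 2 * |s - t| :=
  abs_sub_le_of_hasDerivAt (fun x _ => hasDerivAt_glF1 x) (fun x _ => abs_glF2_le x)

theorem glF1_zero : glF1 0 = 0 := by simp [glF1]

theorem abs_glF1_le (s : ℝ) : |glF1 s| ≤ 2 * |s| := by
  simpa [glF1_zero] using glF1_lipschitz s 0

theorem abs_sub_le_of_mem_uIcc {a b x : ℝ} (hx : x ∈ uIcc a b) : |x - a| ≤ |b - a| := by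
  have := abs_sub_left_of_mem_uIcc hx
  rwa [abs_sub_comm]  at this ⊢

/-- The mean value inequality is applied to `glF1` minus its linear part at `t`. The factor ½ of
Taylor's formula is not gained, as the derivative is bounded by its maximum on the segment. -/
theorem glF1_taylor (s t : ℝ) : |glF1 s - glF1 t - glF2 t * (s - t)| ≤ 6 * (s - t) ^ 2 := by
  have h := abs_sub_le_of_hasDerivAt (a := t) (b := s) (K := 6 * |s - t|)
    (f := fun x => glF1 x - glF2 t * x) (f' := fun x => glF2 x - glF2 t)
    (fun x _ => 
      ((hasDerivAt_glF1 x).sub ((hasDerivAt_id x).const_mul (glF2 t))).congr_deriv (by simp))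
    (fun x hx => (glF2_lipschitz x t).trans (mul_le_mul_of_nonneg_left (abs_sub_le_of_mem_uIcc hx) (by norm_num)))
  rw [mul_assoc, ← abs_mul, ← sq, abs_of_nonneg (sq_nonneg (s - t))] at h
  convert h using 2
  ring

theorem glF_taylor (s t : ℝ) : |glF s - glF t - glF1 t * (s - t)| ≤ 2 * (s - t) ^ 2 := by
  have h := abs_sub_le_of_hasDerivAt (a := t) (b := s) (K := 2 * |s - t|)
    (f := fun x => glF x - glF1 t * x) (f' := fun x => glF1 x - glF1 t)
    (fun x _ => 
      ((hasDerivAt_glF x).sub ((hasDerivAt_id x).const_mul (glF1 t))).congr_deriv (by simp))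
    (fun x hx => (glF1_lipschitz x t).trans (mul_le_mul_of_nonneg_left (abs_sub_le_of_mem_uIcc hx) (by norm_num)))
  rw [mul_assoc, ← abs_mul, ← sq, abs_of_nonneg (sq_nonneg (s - t))] at h
  convert h using 2
  ring

theorem glF_lower (s : ℝ) : s ^ 2 / 2 - 1 ≤ glF s := by
  unfold glF
  split_ifs with h1 h2
  · nlinarith [sq_nonneg (s + 2)]
  · push Not at h1
    have : s ^ 2 ≤ 1 := by nlinarith
    nlinarith [sq_nonneg (s ^ 2 - 1)]
  · nlinarith [sq_nonneg (s - 2)]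

theorem glF_nonneg (s : ℝ) : 0 ≤ glF s := by
  unfold glF
  split_ifs <;> positivity

theorem glF_upper (s : ℝ) : glF s ≤ s ^ 2 + 1 := by
  unfold glF
  split_ifs with h1 h2
  · nlinarith
  · push Not at h1
    have : s ^ 2 ≤ 1 := by nlinarith
    nlinarith [sq_nonneg s]
  · nlinarith

/-- The truncated square used to control the non-convexity of the potential. -/
def tsq (s : ℝ) : ℝ := s ^ 2 / (1 + s ^ 2)

/-- Derivative of the truncated square. -/
def tsq1 (s : ℝ) : ℝ := 2 * s / (1 + s ^ 2) ^ 2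

theorem hasDerivAt_tsq (s : ℝ) : HasDerivAt tsq (tsq1 s) s := by
  have h := (hasDerivAt_pow 2 s).div ((hasDerivAt_pow 2 s).const_add 1)
    (by positivity : (1 + s ^ 2 : ℝ) ≠ 0)
  refine h.congr_deriv ?_
  unfold tsq1
  congr 1
  simp; ring

theorem tsq_nonneg (s : ℝ) : 0 ≤ tsq s := by unfold tsq; positivity

theorem tsq_le_one (s : ℝ) : tsq s ≤ 1 := by
  unfold tsq; rw [div_le_one (by positivity)]; linarith

theorem tsq_zero : tsq 0 = 0 := by simp [tsq]

/-- The bound by s² lets squares of tsq' be absorbed into the relative energy; the uniform bound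
`abs_tsq1_le` makes products with merely integrable functions meaningful. -/
theorem tsq1_sq_le (s : ℝ) : tsq1 s ^ 2 ≤ 4 * s ^ 2 := by
  unfold tsq1
  rw [div_pow, div_le_iff₀ (by positivity)]
  have : 1 ≤ ((1 + s ^ 2) ^ 2) ^ 2 := one_le_pow₀ (one_le_pow₀ (by nlinarith [sq_nonneg s]))
  nlinarith [mul_le_mul_of_nonneg_left this (by positivity : 0 ≤ 4 * s ^ 2)]

theorem abs_tsq1_le (s : ℝ) : |tsq1 s| ≤ 1 := by
  unfold tsq1
  rw [abs_div, div_le_one (by positivity), abs_mul, abs_of_pos (by norm_num : (0:ℝ) < 2),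
    abs_of_nonneg (by positivity : (0:ℝ) ≤ (1 + s ^ 2) ^ 2)]
  have : s ^ 2 = |s| ^ 2 := (sq_abs s).symm
  rw [this]
  nlinarith [sq_nonneg (|s| - 1), sq_nonneg (|s| ^ 2), abs_nonneg s]

theorem continuous_tsq1 : Continuous tsq1 := by
  unfold tsq1
  refine Continuous.div (by fun_prop) (by fun_prop) fun s => by positivity

/-- The potential becomes coercive after adding a multiple of the truncated square. -/
theorem exists_glF_coercive (m : ℝ) : ∃ K : ℝ, 0 < K ∧ ∀ s t : ℝ, |t| ≤ m →
    1 / 16 * (s - t) ^ 2 ≤ glF s - glF t - glF1 t * (s - t) + K * tsq (s - t) := by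
  -- W separates two regimes. For w² ≥ W the quadratic growth of F leaves at least 3w²/16 −
  -- (18m²+2), and W/8 = 18m²+2 is exactly the loss. For w² ≤ W one has tsq w ≥ w²/(1+W), so 3(1+W)
  -- tsq w ≥ 3w² beats the Taylor error −2w².
  set W : ℝ := 8 * (18 * m ^ 2 + 2) with hW
  have hW0 : 0 < W := by positivity
  refine ⟨3 * (1 + W), by positivity, fun s t ht => ?_⟩
  set w := s - t with hw
  have hK : 0 ≤ 3 * (1 + W) * tsq w := mul_nonneg (by positivity) (tsq_nonneg w)
  rcases le_total W (w ^ 2) with h | h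
  · have h1 := glF_lower s
    have h2 := glF_upper t
    have h3 := abs_glF1_le t
    have h4 : t ^ 2 ≤ m ^ 2 := by rw [← sq_abs]; gcongr
    have h5 : glF1 t * w ≤ w ^ 2 / 16 + 16 * m ^ 2 := by
      have h6 : glF1 t ^ 2 ≤ 4 * t ^ 2 := by
        rw [← sq_abs (glF1 t), ← sq_abs t]; nlinarith [abs_nonneg (glF1 t), abs_nonneg t]
      nlinarith [sq_nonneg (w / 4 - 2 * glF1 t)]
    have h6 : s = w + t := by rw [hw]; ring
    have h7 : w ^ 2 / 2 - t ^ 2 ≤ s ^ 2 := by rw [h6]; nlinarith [sq_nonneg (w + 2 * t)]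
    nlinarith
  · have h1 := (abs_le.1 (glF_taylor s t)).1
    have h2 : 3 * w ^ 2 ≤ 3 * (1 + W) * tsq w := by
      unfold tsq
      rw [mul_div_assoc', le_div_iff₀ (by positivity)]
      nlinarith [mul_nonneg (sq_nonneg w) (sub_nonneg.2 h)]
    nlinarith [sq_nonneg w]


/-! ### Pressure and pressure potential -/

/-- A function with `f' (x) (x - R) ≥ 0` is minimal at `R`. -/
theorem antitoneOn_monotoneOn_of_deriv_sign {f f' : ℝ → ℝ} {R : ℝ} (hR : 0 ≤ R)
    (hc : ContinuousOn f (Ici 0)) (hd : ∀ x, 0 < x → HasDerivAt f (f' x) x)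
    (hm : ∀ x, 0 < x → x ≤ R → f' x ≤ 0) (hp : ∀ x, R ≤ x → 0 < x → 0 ≤ f' x) :
    AntitoneOn f (Icc 0 R) ∧ MonotoneOn f (Ici R) := by
  constructor
  · refine antitoneOn_of_deriv_nonpos (convex_Icc 0 R) (hc.mono Icc_subset_Ici_self) ?_ ?_
    · intro x hx
      rw [interior_Icc] at hx
      exact (hd x hx.1).differentiableAt.differentiableWithinAt
    · intro x hx
      rw [interior_Icc] at hx
      rw [(hd x hx.1).deriv]
      exact hm x hx.1 hx.2.le
  · refine monotoneOn_of_deriv_nonneg (convex_Ici R) (hc.mono (Ici_subset_Ici.2 hR)) ?_ ?_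
    · intro x hx
      rw [interior_Ici] at hx
      exact (hd x (hR.trans_lt hx)).differentiableAt.differentiableWithinAt
    · intro x hx
      rw [interior_Ici] at hx
      rw [(hd x (hR.trans_lt hx)).deriv]
      exact hp x hx.le (hR.trans_lt hx)

namespace FluidLaw

variable (L : FluidLaw)

/-- The derivative of the pressure potential. -/
def P1 (r : ℝ) : ℝ := (L.P r + L.p r) / r

theorem hasDerivAt_p {r : ℝ} (hr : 0 < r) : HasDerivAt L.p (deriv L.p r) r :=
  ((L.p_smooth.differentiableOn (by simp)).differentiableAt (Ioi_mem_nhds hr)).hasDerivAt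

theorem hasDerivAt_P {r : ℝ} (hr : 0 < r) : HasDerivAt L.P (L.P1 r) r := by
  refine (L.P_diff r hr).hasDerivAt.congr_deriv ?_
  have := L.P_eq r hr
  rw [P1, eq_div_iff hr.ne']
  linarith

theorem P1_mul {r : ℝ} (hr : 0 < r) : L.P1 r * r = L.P r + L.p r := by
  rw [P1, div_mul_cancel₀ _ hr.ne']

/-- Differentiating P'r − P = p gives P'' = p'/r, the source of the convexity of P. -/
theorem hasDerivAt_P1 {r : ℝ} (hr : 0 < r) : HasDerivAt L.P1 (deriv L.p r / r) r := by
  refine (((L.hasDerivAt_P hr).add (L.hasDerivAt_p hr)).div (hasDerivAt_id r) hr.ne').congr_deriv ?_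
  have := L.P1_mul hr
  have hr' := hr.ne'
  simp only [Pi.add_apply, id]
  field_simp
  linear_combination this

theorem continuousOn_deriv_p : ContinuousOn (deriv L.p) (Ioi 0) :=
  L.p_smooth.continuousOn_deriv_of_isOpen isOpen_Ioi (by simp)

theorem contDiffOn_deriv_p : ContDiffOn ℝ 1 (deriv L.p) (Ioi 0) :=
  L.p_smooth.deriv_of_isOpen isOpen_Ioi (by norm_cast)

theorem P1_strictMono {a b m : ℝ} (ha : 0 < a) (hab : a ≤ b)
    (hm : ∀ s ∈ Icc a b, m ≤ deriv L.p s / s) : m * (b - a) ≤ L.P1 b - L.P1 a := by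
  have h : MonotoneOn (fun s => L.P1 s - m * s) (Icc a b) := by
    have hd : ∀ x ∈ Icc a b, HasDerivAt (fun s => L.P1 s - m * s) (deriv L.p x / x - m) x :=
      fun x hx => ((L.hasDerivAt_P1 (ha.trans_le hx.1)).sub
        ((hasDerivAt_id x).const_mul m)).congr_deriv (by simp)
    refine monotoneOn_of_deriv_nonneg (convex_Icc a b)
      (fun x hx => (hd x hx).continuousAt.continuousWithinAt) ?_ ?_
    · intro x hx
      exact (hd x (interior_subset hx)).differentiableAt.differentiableWithinAt
    · intro x hx
      rw [(hd x (interior_subset hx)).deriv]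
      linarith [hm x (interior_subset hx)]
  have := h (left_mem_Icc.2 hab) (right_mem_Icc.2 hab) hab
  simp only at this
  linarith

theorem P1_mono {a b : ℝ} (ha : 0 < a) (hab : a ≤ b) : L.P1 a ≤ L.P1 b := by
  have := L.P1_strictMono (m := 0) ha hab fun s hs =>
    div_nonneg (L.p_deriv_pos s (ha.trans_le hs.1)).le (ha.trans_le hs.1).le
  linarith

/-- The relative pressure potential `P(ϱ) - P'(R)(ϱ - R) - P(R)`. -/
def relP (q R : ℝ) : ℝ := L.P q - L.P1 R * (q - R) - L.P R

/-- The relative pressure `p(ϱ) - p'(R)(ϱ - R) - p(R)`. -/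
def relp (q R : ℝ) : ℝ := L.p q - deriv L.p R * (q - R) - L.p R

/-- The derivative in q is P'(q) − P'(R), which has the sign of q − R. The vacuum q = 0, where P is
only continuous, is included. -/
theorem relP_antitoneOn_monotoneOn {R : ℝ} (hR : 0 < R) :
    AntitoneOn (fun q => L.relP q R) (Icc 0 R) ∧ MonotoneOn (fun q => L.relP q R) (Ici R) := by
  refine antitoneOn_monotoneOn_of_deriv_sign (f' := fun x => L.P1 x - L.P1 R) hR.le ?_ ?_ ?_ ?_
  · unfold relP
    exact (L.P_cont.sub (by fun_prop)).sub (by fun_prop)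
  · intro x hx
    exact (((L.hasDerivAt_P hx).sub (((hasDerivAt_id x).sub_const R).const_mul
      (L.P1 R))).sub_const _).congr_deriv (by simp)
  · intro x hx hxR
    linarith [L.P1_mono hx hxR]
  · intro x hxR hx
    linarith [L.P1_mono hR hxR]

theorem relP_self (R : ℝ) : L.relP R R = 0 := by simp [relP]

theorem relP_nonneg {q R : ℝ} (hq : 0 ≤ q) (hR : 0 < R) : 0 ≤ L.relP q R := by
  rw [← L.relP_self R]
  rcases le_total q R with h | h
  · exact (L.relP_antitoneOn_monotoneOn hR).1 ⟨hq, h⟩ ⟨hR.le, le_rfl⟩ h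
  · exact (L.relP_antitoneOn_monotoneOn hR).2 (mem_Ici.2 le_rfl) h h

/-- Quadratic lower bound for the relative pressure potential on a compact interval. -/
theorem relP_quadratic {a b m : ℝ} (ha : 0 < a) (hm : ∀ s ∈ Icc a b, m ≤ deriv L.p s / s)
    {q R : ℝ} (hq : q ∈ Icc a b) (hR : R ∈ Icc a b) : m / 2 * (q - R) ^ 2 ≤ L.relP q R := by
  have hd : ∀ x ∈ Icc a b, HasDerivAt (fun s => L.relP s R - m / 2 * (s - R) ^ 2)
      (L.P1 x - L.P1 R - m * (x - R)) x := fun x hx => by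
    have h1 := (((L.hasDerivAt_P (ha.trans_le hx.1)).sub (((hasDerivAt_id x).sub_const R).const_mul
      (L.P1 R))).sub_const (L.P R))
    exact (h1.sub ((((hasDerivAt_id x).sub_const R).pow 2).const_mul (m / 2))).congr_deriv
      (by simp; ring)
  have h0 : L.relP R R - m / 2 * (R - R) ^ 2 = 0 := by simp [relP]
  rw [← sub_nonneg, ← h0]
  rcases le_total q R with h | h
  · have hs : Icc q R ⊆ Icc a b := Icc_subset_Icc hq.1 hR.2
    have : AntitoneOn (fun s => L.relP s R - m / 2 * (s - R) ^ 2) (Icc q R) := by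
      refine antitoneOn_of_deriv_nonpos (convex_Icc q R)
        (fun x hx => (hd x (hs hx)).continuousAt.continuousWithinAt) ?_ ?_
      · intro x hx
        exact (hd x (hs (interior_subset hx))).differentiableAt.differentiableWithinAt
      · intro x hx
        have hx' := interior_subset hx
        rw [(hd x (hs hx')).deriv]
        have := L.P1_strictMono (ha.trans_le (hs hx').1) hx'.2
          (fun s hs' => hm s ⟨(hs hx').1.trans hs'.1, hs'.2.trans hR.2⟩)
        linarith
    exact this (left_mem_Icc.2 h) (right_mem_Icc.2 h) h
  · have hs : Icc R q ⊆ Icc a b := Icc_subset_Icc hR.1 hq.2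
    have : MonotoneOn (fun s => L.relP s R - m / 2 * (s - R) ^ 2) (Icc R q) := by
      refine monotoneOn_of_deriv_nonneg (convex_Icc R q)
        (fun x hx => (hd x (hs hx)).continuousAt.continuousWithinAt) ?_ ?_
      · intro x hx
        exact (hd x (hs (interior_subset hx))).differentiableAt.differentiableWithinAt
      · intro x hx
        have hx' := interior_subset hx
        rw [(hd x (hs hx')).deriv]
        have := L.P1_strictMono (ha.trans_le hR.1) hx'.1
          (fun s hs' => hm s ⟨hR.1.trans hs'.1, hs'.2.trans (hs hx').2⟩)
        linarith
    exact this (left_mem_Icc.2 h) (right_mem_Icc.2 h) h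

theorem exists_deriv_p_div_lower {a b : ℝ} (ha : 0 < a) :
    ∃ m : ℝ, 0 < m ∧ ∀ s ∈ Icc a b, m ≤ deriv L.p s / s := by
  rcases (Icc a b).eq_empty_or_nonempty with h | h
  · exact ⟨1, one_pos, by simp [h]⟩
  have hc : ContinuousOn (fun s => deriv L.p s / s) (Icc a b) :=
    (L.continuousOn_deriv_p.mono fun s hs => ha.trans_le hs.1).div continuousOn_id
      fun s hs => (ha.trans_le hs.1).ne'
  obtain ⟨s, hs, hmin⟩ := isCompact_Icc.exists_isMinOn h hc
  exact ⟨_, div_pos (L.p_deriv_pos s (ha.trans_le hs.1)) (ha.trans_le hs.1), fun t ht => hmin ht⟩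

theorem p_mono {a b : ℝ} (ha : 0 ≤ a) (hab : a ≤ b) : L.p a ≤ L.p b := by
  have : MonotoneOn L.p (Ici 0) := by
    refine monotoneOn_of_deriv_nonneg (convex_Ici 0) L.p_cont ?_ ?_
    · intro x hx
      rw [interior_Ici] at hx
      exact (L.hasDerivAt_p hx).differentiableAt.differentiableWithinAt
    · intro x hx
      rw [interior_Ici] at hx
      exact (L.p_deriv_pos x hx).le
  exact this ha (ha.trans hab) hab

/-- The derivative of the potential is unbounded. -/
theorem exists_P1_ge (N : ℝ) : ∃ r : ℝ, 0 < r ∧ N ≤ L.P1 r := by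
  obtain ⟨a, ha, hev⟩ := L.p_deriv_liminf
  obtain ⟨r0, hr0⟩ := eventually_atTop.1 (hev.and (eventually_gt_atTop 0))
  have hr0p : 0 < r0 := (hr0 r0 le_rfl).2
  -- Eventually P'' = p'/s ≥ a/s, so P' grows at least like a log s.
  have hmono : MonotoneOn (fun s => L.P1 s - a * Real.log s) (Ici r0) := by
    have hd : ∀ x ∈ Ici r0, HasDerivAt (fun s => L.P1 s - a * Real.log s)
        (deriv L.p x / x - a * x⁻¹) x := fun x hx =>
      (L.hasDerivAt_P1 (hr0p.trans_le hx)).sub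
        ((Real.hasDerivAt_log (hr0p.trans_le hx).ne').const_mul a)
    refine monotoneOn_of_deriv_nonneg (convex_Ici r0)
      (fun x hx => (hd x hx).continuousAt.continuousWithinAt) ?_ ?_
    · intro x hx
      exact (hd x (interior_subset hx)).differentiableAt.differentiableWithinAt
    · intro x hx
      have hx' : r0 ≤ x := interior_subset hx
      rw [(hd x hx').deriv, div_eq_mul_inv, ← sub_mul]
      exact mul_nonneg (sub_nonneg.2 (hr0 x hx').1) (inv_nonneg.2 (hr0p.trans_le hx').le)
  have ht : Tendsto (fun s => a * Real.log s) atTop atTop :=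
    Real.tendsto_log_atTop.const_mul_atTop ha
  obtain ⟨r, hr1, hr2⟩ := ((ht.eventually_ge_atTop (N - (L.P1 r0 - a * Real.log r0))).and
    (eventually_ge_atTop r0)).exists
  refine ⟨r, hr0p.trans_le hr2, ?_⟩
  have := hmono (mem_Ici.2 le_rfl) hr2 hr2
  simp only at this
  linarith

/-- The potential is superlinear. -/
theorem exists_superlinear (N : ℝ) :
    ∃ K : ℝ, 0 ≤ K ∧ ∀ q, 0 ≤ q → N * q ≤ L.P q + K := by
  -- By convexity P lies above its tangent at r, whose slope is at least N.
  obtain ⟨r, hr, hN'⟩ := L.exists_P1_ge N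
  refine ⟨|L.P1 r * r - L.P r|, abs_nonneg _, fun q hq => ?_⟩
  have h1 := L.relP_nonneg hq hr
  have h2 := le_abs_self (L.P1 r * r - L.P r)
  unfold relP at h1
  nlinarith [mul_le_mul_of_nonneg_right hN' hq]

/-- From above this is the structural hypothesis p ≤ k(1+P); from below p ≥ p(0), as p is
increasing. -/
theorem exists_abs_p_le : ∃ K : ℝ, 0 ≤ K ∧ ∀ q, 0 ≤ q → |L.p q| ≤ K * (1 + |L.P q|) := by
  obtain ⟨k, hk, h⟩ := L.p_le
  refine ⟨k + |L.p 0|, by positivity, fun q hq => ?_⟩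
  have h1 := h q hq
  have h2 := L.p_mono le_rfl hq
  have h3 := le_abs_self (L.P q)
  have h4 := neg_abs_le (L.p 0)
  rw [abs_le]
  constructor
  · nlinarith [abs_nonneg (L.p 0), abs_nonneg (L.P q), mul_nonneg hk.le (abs_nonneg (L.P q)),
      mul_nonneg (abs_nonneg (L.p 0)) (abs_nonneg (L.P q))]
  · nlinarith [abs_nonneg (L.p 0), abs_nonneg (L.P q),
      mul_nonneg (abs_nonneg (L.p 0)) (abs_nonneg (L.P q))]

set_option maxHeartbeats 1000000 in
/-- Coercivity of the relative pressure potential, uniformly for `R` in a compact interval. -/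
theorem exists_relP_coercive {a b : ℝ} (ha : 0 < a) (hab : a ≤ b) :
    ∃ K : ℝ, 0 < K ∧ ∀ q R : ℝ, 0 ≤ q → R ∈ Icc a b →
      (a / 2 ≤ q → q ≤ 2 * b → (q - R) ^ 2 ≤ K * L.relP q R) ∧
      (q ≤ a / 2 → 1 ≤ K * L.relP q R) ∧
      (2 * b ≤ q → 1 + q ≤ K * L.relP q R) ∧
      |L.relp q R| ≤ K * L.relP q R := by
  have hb : 0 < b := ha.trans_le hab
  -- Three ranges of q are separated by a/2 and 2b, both at positive distance from the interval [a,
  -- b] of R. On [a/2, 2b] convexity is uniform with constant m; outside, monotonicity in q carries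
  -- the bound outwards.
  obtain ⟨m, hm, hmb⟩ := L.exists_deriv_p_div_lower (b := 2 * b) (half_pos ha)
  have hmid : ∀ q R : ℝ, R ∈ Icc a b → a / 2 ≤ q → q ≤ 2 * b →
      m / 2 * (q - R) ^ 2 ≤ L.relP q R := fun q R hR h1 h2 =>
    L.relP_quadratic (half_pos ha) hmb ⟨h1, h2⟩ ⟨by linarith [hR.1], by linarith [hR.2]⟩
  have hlow : ∀ q R : ℝ, 0 ≤ q → R ∈ Icc a b → q ≤ a / 2 → m / 2 * (a / 2) ^ 2 ≤ L.relP q R := by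
    intro q R hq hR h
    have h1 := hmid (a / 2) R hR le_rfl (by linarith)
    have h2 := (L.relP_antitoneOn_monotoneOn (ha.trans_le hR.1)).1
      (show q ∈ Icc 0 R from ⟨hq, by linarith [hR.1]⟩) (show a / 2 ∈ Icc 0 R from ⟨by linarith, by linarith [hR.1]⟩) h
    simp only at h2
    have h3 : (a / 2) ^ 2 ≤ (a / 2 - R) ^ 2 := by nlinarith [hR.1]
    nlinarith
  have hhigh : ∀ q R : ℝ, R ∈ Icc a b → 2 * b ≤ q →
      m / 2 * b ^ 2 + m * b * (q - 2 * b) ≤ L.relP q R := by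
    intro q R hR h
    have hRp := ha.trans_le hR.1
    have h1 := hmid (2 * b) R hR (by linarith) le_rfl
    have h3 : b ^ 2 ≤ (2 * b - R) ^ 2 := by nlinarith [hR.2]
    -- Three-point identity: relP q R = relP q (2b) + relP (2b) R + (P'(2b) − P'(R))(q − 2b). The
    -- last term is the linear growth, with slope at least mb.
    have h4 := L.relP_nonneg (q := q) (R := 2 * b) (by linarith) (by linarith)
    have h5 := L.P1_strictMono (m := m) hRp (b := 2 * b) (by linarith [hR.2])
      (fun s hs => hmb s ⟨by linarith [hs.1, hR.1], hs.2⟩)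
    have h6 : m * b ≤ L.P1 (2 * b) - L.P1 R := by nlinarith [hR.2]
    unfold relP at h1 h4 ⊢
    have := mul_le_mul_of_nonneg_right h6 (sub_nonneg.2 h)
    have := mul_le_mul_of_nonneg_left h3 (half_pos hm).le
    linarith
  -- the relative pressure
  obtain ⟨D1, hD1⟩ : ∃ D1 : ℝ, ∀ R ∈ Icc a b, |deriv L.p R| ≤ D1 := isCompact_Icc.exists_bound_of_continuousOn
    (L.continuousOn_deriv_p.mono fun s hs => ha.trans_le hs.1)
  obtain ⟨D0, hD0⟩ : ∃ D0 : ℝ, ∀ R ∈ Icc 0 b, |L.p R| ≤ D0 := isCompact_Icc.exists_bound_of_continuousOn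
    (L.p_cont.mono Icc_subset_Ici_self)
  obtain ⟨D2, hD2⟩ : ∃ D2 : ℝ, ∀ R ∈ Icc (a / 2) (2 * b), |deriv (deriv L.p) R| ≤ D2 :=
    isCompact_Icc.exists_bound_of_continuousOn
    ((L.contDiffOn_deriv_p.continuousOn_deriv_of_isOpen isOpen_Ioi le_rfl).mono
      fun s hs => (half_pos ha).trans_le hs.1)
  obtain ⟨D3, hD3⟩ : ∃ D3 : ℝ, ∀ R ∈ Icc a b, |L.P1 R| ≤ D3 := isCompact_Icc.exists_bound_of_continuousOn
    fun s hs => (L.hasDerivAt_P1 (ha.trans_le hs.1)).continuousAt.continuousWithinAt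
  obtain ⟨D4, hD4⟩ : ∃ D4 : ℝ, ∀ R ∈ Icc a b, |L.P R| ≤ D4 := isCompact_Icc.exists_bound_of_continuousOn
    (L.P_cont.mono fun s hs => ha.le.trans hs.1)
  obtain ⟨k, hk, hpk⟩ := L.p_le
  have ham : a ∈ Icc a b := ⟨le_rfl, hab⟩
  have n1 : 0 ≤ D1 := (abs_nonneg _).trans (hD1 a ham)
  have n0 : 0 ≤ D0 := (abs_nonneg _).trans (hD0 a ⟨ha.le, hab⟩)
  have n2 : 0 ≤ D2 := (abs_nonneg _).trans (hD2 a ⟨by linarith, by linarith⟩)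
  have n3 : 0 ≤ D3 := (abs_nonneg _).trans (hD3 a ham)
  have n4 : 0 ≤ D4 := (abs_nonneg _).trans (hD4 a ham)
  -- intermediate constants
  set K1 := 2 / m with hK1
  set K2 := 2 / m * (2 / a) ^ 2 with hK2
  set K3 := (2 / (m * b ^ 2)) * (1 + 2 * b) + 1 / (m * b) with hK3
  have p1 : 0 < K1 := by positivity
  have p2 : 0 < K2 := by positivity
  have p3 : 0 < K3 := by positivity
  have e1 : ∀ q R : ℝ, R ∈ Icc a b → a / 2 ≤ q → q ≤ 2 * b → (q - R) ^ 2 ≤ K1 * L.relP q R := by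
    intro q R hR h1 h2
    have := hmid q R hR h1 h2
    rw [hK1, div_mul_eq_mul_div, le_div_iff₀ hm]; linarith
  have e2 : ∀ q R : ℝ, 0 ≤ q → R ∈ Icc a b → q ≤ a / 2 → 1 ≤ K2 * L.relP q R := by
    intro q R hq hR h
    have h1 := mul_le_mul_of_nonneg_left (hlow q R hq hR h) p2.le
    have h2 : K2 * (m / 2 * (a / 2) ^ 2) = 1 := by rw [hK2]; field_simp
    linarith
  have e3 : ∀ q R : ℝ, R ∈ Icc a b → 2 * b ≤ q → 1 + q ≤ K3 * L.relP q R := by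
    intro q R hR h
    have h1 := hhigh q R hR h
    have h2 : 0 ≤ q - 2 * b := sub_nonneg.2 h
    have h3 : m / 2 * b ^ 2 ≤ L.relP q R := by
      have : 0 ≤ m * b * (q - 2 * b) := by positivity
      linarith
    have h4 : m * b * (q - 2 * b) ≤ L.relP q R := by
      have : 0 ≤ m / 2 * b ^ 2 := by positivity
      linarith
    have h5 : 1 + 2 * b ≤ (2 / (m * b ^ 2)) * (1 + 2 * b) * L.relP q R := by
      have h6 : (2 / (m * b ^ 2)) * (1 + 2 * b) * (m / 2 * b ^ 2) = 1 + 2 * b := by field_simp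
      exact h6.symm.le.trans (mul_le_mul_of_nonneg_left h3 (by positivity))
    have h7 : q - 2 * b ≤ 1 / (m * b) * L.relP q R := by
      rw [div_mul_eq_mul_div, le_div_iff₀ (by positivity)]; linarith
    rw [hK3, add_mul]; linarith
  -- The three summands bound the relative pressure in the middle, the low and the high range, in
  -- this order.
  set Q := K1 * D2 + K2 * (2 * D0 + D1 * (2 * b)) +
    (k * (1 + K3 * (D3 * (1 + b) + D4 + 1)) + K3 * (2 * D0 + D1 * (1 + b))) with hQ
  have pQ : 0 ≤ Q := by positivity
  have q1 : K1 * D2 ≤ Q := by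
    have : 0 ≤ K2 * (2 * D0 + D1 * (2 * b)) := by positivity
    have : 0 ≤ (k * (1 + K3 * (D3 * (1 + b) + D4 + 1)) + K3 * (2 * D0 + D1 * (1 + b))) := by
      positivity
    linarith
  have q2 : K2 * (2 * D0 + D1 * (2 * b)) ≤ Q := by
    have : 0 ≤ K1 * D2 := by positivity
    have : 0 ≤ (k * (1 + K3 * (D3 * (1 + b) + D4 + 1)) + K3 * (2 * D0 + D1 * (1 + b))) := by
      positivity
    linarith
  have q3 : (k * (1 + K3 * (D3 * (1 + b) + D4 + 1)) + K3 * (2 * D0 + D1 * (1 + b))) ≤ Q := by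
    have : 0 ≤ K1 * D2 := by positivity
    have : 0 ≤ K2 * (2 * D0 + D1 * (2 * b)) := by positivity
    linarith
  refine ⟨K1 + K2 + K3 + Q, by positivity, fun q R hq hR => ?_⟩
  have hRp := ha.trans_le hR.1
  have hE := L.relP_nonneg hq hRp
  have up : ∀ k' : ℝ, k' ≤ K1 + K2 + K3 + Q → k' * L.relP q R ≤ (K1 + K2 + K3 + Q) * L.relP q R :=
    fun k' hk' => mul_le_mul_of_nonneg_right hk' hE
  refine ⟨fun h1 h2 => (e1 q R hR h1 h2).trans (up _ (by linarith)),
    fun h => (e2 q R hq hR h).trans (up _ (by linarith)),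
    fun h => (e3 q R hR h).trans (up _ (by linarith)), ?_⟩
  refine le_trans ?_ (up Q (by linarith))
  have b1 := hD1 R hR
  have b0 := hD0 R ⟨hRp.le, hR.2⟩
  rcases le_total q (a / 2) with h | h
  · refine le_trans ?_ (mul_le_mul_of_nonneg_right q2 hE)
    have h0 := hD0 q ⟨hq, by linarith⟩
    have h1 : |L.relp q R| ≤ 2 * D0 + D1 * (2 * b) := by
      unfold relp
      have : |q - R| ≤ 2 * b := by rw [abs_le]; constructor <;> linarith [hR.1, hR.2]
      calc _ ≤ |L.p q| + |deriv L.p R * (q - R)| + |L.p R| := by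
            exact (abs_sub _ _).trans (add_le_add_left (abs_sub _ _) _)
        _ ≤ D0 + D1 * (2 * b) + D0 := by rw [abs_mul]; gcongr
        _ = _ := by ring
    have h2 := mul_le_mul_of_nonneg_left (e2 q R hq hR h)
      (by positivity : 0 ≤ 2 * D0 + D1 * (2 * b))
    linarith
  rcases le_total q (2 * b) with h' | h'
  · refine le_trans ?_ (mul_le_mul_of_nonneg_right q1 hE)
    have hsub : uIcc R q ⊆ Icc (a / 2) (2 * b) := by
      exact uIcc_subset_Icc ⟨by linarith [hR.1], by linarith [hR.2]⟩ ⟨h, h'⟩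
    have hd2 : ∀ x, 0 < x → HasDerivAt (deriv L.p) (deriv (deriv L.p) x) x := fun x hx =>
      ((L.contDiffOn_deriv_p.differentiableOn (by simp)).differentiableAt (Ioi_mem_nhds hx)).hasDerivAt
    have h1 := abs_sub_le_of_hasDerivAt (a := R) (b := q) (K := D2 * |q - R|)
      (f := fun x => L.p x - deriv L.p R * x) (f' := fun x => deriv L.p x - deriv L.p R)
      (fun x hx => ((L.hasDerivAt_p ((half_pos ha).trans_le (hsub hx).1)).sub
        ((hasDerivAt_id x).const_mul _)).congr_deriv (by simp))
      (fun x hx => by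
        have hs2 : uIcc R x ⊆ uIcc R q := uIcc_subset_uIcc left_mem_uIcc hx
        refine (abs_sub_le_of_hasDerivAt (a := R) (b := x) (K := D2)
          (fun y hy => hd2 y ((half_pos ha).trans_le (hsub (hs2 hy)).1))
          (fun y hy => hD2 y (hsub (hs2 hy)))).trans ?_
        exact mul_le_mul_of_nonneg_left (abs_sub_le_of_mem_uIcc hx) n2)
    rw [mul_assoc, ← abs_mul, ← sq, abs_of_nonneg (sq_nonneg (q - R))] at h1
    have h2 : L.relp q R = L.p q - deriv L.p R * q - (L.p R - deriv L.p R * R) := by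
      unfold relp; ring
    rw [h2]
    refine h1.trans ?_
    have := mul_le_mul_of_nonneg_left (e1 q R hR h h') n2
    linarith
  · refine le_trans ?_ (mul_le_mul_of_nonneg_right q3 hE)
    have h0 := e3 q R hR h'
    have hE1 : 1 ≤ K3 * L.relP q R := by linarith
    have b3 := hD3 R hR
    have b4 := hD4 R hR
    have hqR : |q - R| ≤ q + b := by
      rw [abs_le]; constructor <;> linarith [hR.2]
    -- For large q the pressure is compared with P by the structural hypothesis, and P with relP at
    -- the cost of an affine function of q, which relP dominates in this range.
    have h1 : L.p q ≤ k * (L.relP q R + D3 * (q + b) + D4 + 1) := by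
      refine (hpk q hq).trans (mul_le_mul_of_nonneg_left ?_ hk.le)
      have h2 : L.P1 R * (q - R) ≤ D3 * (q + b) :=
        (le_abs_self _).trans (by rw [abs_mul]; gcongr)
      have h3 := le_abs_self (L.P R)
      unfold relP
      linarith
    have h2 : D3 * (q + b) + D4 + 1 ≤ (D3 * (1 + b) + D4 + 1) * (1 + q) := by
      have : 0 ≤ D3 + D3 * b * q + D4 * q + q := by positivity
      linarith
    have h3 : L.p q ≤ k * (1 + K3 * (D3 * (1 + b) + D4 + 1)) * L.relP q R := by
      have h4 := mul_le_mul_of_nonneg_left h0 (by positivity : 0 ≤ D3 * (1 + b) + D4 + 1)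
      have : L.relP q R + D3 * (q + b) + D4 + 1 ≤
        (1 + K3 * (D3 * (1 + b) + D4 + 1)) * L.relP q R := by linarith
      have := mul_le_mul_of_nonneg_left this hk.le
      linarith
    have h5 : |deriv L.p R * (q - R)| ≤ D1 * (1 + b) * (1 + q) := by
      rw [abs_mul]
      calc _ ≤ D1 * (q + b) := by gcongr
        _ ≤ _ := by
          have : 0 ≤ D1 + D1 * b * q := by positivity
          linarith
    have h6 : -D0 ≤ L.p q := by
      have := L.p_mono ha.le (by linarith : a ≤ q)
      have := neg_le_of_abs_le (hD0 a ⟨ha.le, hab⟩)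
      linarith
    have h7 : D1 * (1 + b) * (1 + q) ≤ K3 * (D1 * (1 + b)) * L.relP q R := by
      have := mul_le_mul_of_nonneg_left h0 (by positivity : 0 ≤ D1 * (1 + b))
      linarith
    have h8 : D0 ≤ K3 * D0 * L.relP q R := by
      have := mul_le_mul_of_nonneg_left hE1 n0
      linarith
    have h9 := abs_le.1 h5
    have h10 := abs_le.1 b0
    have h11 : 0 ≤ k * (1 + K3 * (D3 * (1 + b) + D4 + 1)) * L.relP q R := by positivity
    unfold relp
    rw [abs_le, add_mul, mul_add K3, add_mul]
    constructor
    · linarith [h9.2, h10.2]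
    · linarith [h9.1, h10.1]

end FluidLaw


namespace FlowDomain

variable {d : ℕ}

/-! ### Geometry of the domain -/

/-- The interior of the set of integration. -/
def openCell : FlowDomain d → Set (Sp d)
  | torus => {x | ∀ i, x i ∈ Ioo (-1 : ℝ) 1}
  | dirichlet Ω _ _ _ => Ω

theorem isOpen_openCell (D : FlowDomain d) : IsOpen D.openCell := by
  cases D with
  | torus =>
    simp only [openCell, ofPred_forall]
    exact isOpen_iInter_of_finite fun i => isOpen_Ioo.preimage (by fun_prop)
  | dirichlet Ω h _ _ => exact h

theorem measurableSet_cell (D : FlowDomain d) : MeasurableSet D.cell := by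
  cases D with
  | torus =>
    simp only [cell, ofPred_forall]
    exact MeasurableSet.iInter fun i => measurableSet_Ico.preimage (by fun_prop)
  | dirichlet Ω h _ _ => exact h.measurableSet

theorem openCell_subset_cell (D : FlowDomain d) : D.openCell ⊆ D.cell := by
  cases D with
  | torus => exact fun x hx i => Ioo_subset_Ico_self (hx i)
  | dirichlet Ω h _ _ => exact subset_rfl

theorem isBounded_cell (D : FlowDomain d) : Bornology.IsBounded D.cell := by
  cases D with
  | torus =>
    have h : Bornology.IsBounded ((EuclideanSpace.equiv (Fin d) ℝ) ⁻¹' (Icc (fun _ => -1) fun _ => 1)) :=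
      ((EuclideanSpace.equiv (Fin d) ℝ).antilipschitz).isBounded_preimage (Metric.isBounded_Icc _ _)
    exact h.subset fun x hx => ⟨fun i => (hx i).1, fun i => (hx i).2.le⟩
  | dirichlet Ω _ h _ => exact h

theorem isCompact_closure_cell (D : FlowDomain d) : IsCompact (closure D.cell) :=
  D.isBounded_cell.isCompact_closure

theorem isOpen_region (D : FlowDomain d) : IsOpen D.region := by
  cases D with
  | torus => exact isOpen_univ
  | dirichlet Ω h _ _ => exact h

theorem cell_subset_region (D : FlowDomain d) : D.cell ⊆ D.region := by
  cases D with
  | torus => exact subset_univ _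
  | dirichlet Ω h _ _ => exact subset_rfl

theorem region_subset_closedRegion (D : FlowDomain d) : D.region ⊆ D.closedRegion := by
  cases D with
  | torus => exact subset_rfl
  | dirichlet Ω h _ _ => exact subset_closure

theorem closure_cell_subset (D : FlowDomain d) : closure D.cell ⊆ D.closedRegion := by
  cases D with
  | torus => exact subset_univ _
  | dirichlet Ω h _ _ => exact subset_rfl

theorem closedRegion_subset_closure_region (D : FlowDomain d) :
    D.closedRegion ⊆ closure D.region := by
  cases D with
  | torus => exact subset_closure
  | dirichlet Ω h _ _ => exact subset_rfl

theorem cell_subset_closedCell (D : FlowDomain d) : D.cell ⊆ D.closedCell := by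
  cases D with
  | torus => exact subset_rfl
  | dirichlet Ω h _ _ => exact subset_closure

theorem measurableSet_closedCell (D : FlowDomain d) : MeasurableSet D.closedCell := by
  cases D with
  | torus => exact (torus (d := d)).measurableSet_cell
  | dirichlet Ω h _ _ => exact isClosed_closure.measurableSet

theorem volume_cell_lt_top (D : FlowDomain d) : volume D.cell < ⊤ :=
  D.isBounded_cell.measure_lt_top

instance (D : FlowDomain d) : IsFiniteMeasure D.vol :=
  ⟨by rw [vol, Measure.restrict_apply_univ]; exact D.volume_cell_lt_top⟩

instance (D : FlowDomain d) (T : ℝ) : IsFiniteMeasure (D.spaceTime T) := by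
  unfold spaceTime; infer_instance

theorem spaceTime_eq (D : FlowDomain d) (T : ℝ) :
    D.spaceTime T = volume.restrict (Ioo 0 T ×ˢ D.cell) := by
  rw [spaceTime, vol, Measure.prod_restrict]; rfl

theorem ae_spaceTime_mem (D : FlowDomain d) (T : ℝ) :
    ∀ᵐ z ∂D.spaceTime T, z.1 ∈ Ioo 0 T ∧ z.2 ∈ D.cell := by
  rw [spaceTime_eq]
  exact ae_restrict_mem (measurableSet_Ioo.prod D.measurableSet_cell)

theorem ae_vol_mem (D : FlowDomain d) : ∀ᵐ x ∂D.vol, x ∈ D.cell :=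
  ae_restrict_mem D.measurableSet_cell

/-- Statements that hold almost everywhere in space-time hold, for almost every time, almost
everywhere in space. -/
theorem ae_ae_of_ae_spaceTime {D : FlowDomain d} {T : ℝ} {p : ℝ × Sp d → Prop}
    (h : ∀ᵐ z ∂D.spaceTime T, p z) :
    ∀ᵐ t ∂volume.restrict (Ioo 0 T), ∀ᵐ x ∂D.vol, p (t, x) :=
  Measure.ae_ae_of_ae_prod h

theorem toLp_preimage_cell :
    (WithLp.toLp 2 : (Fin d → ℝ) → Sp d) ⁻¹' (torus (d := d)).cell
      = univ.pi fun _ => Ico (-1 : ℝ) 1 := by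
  ext y; simp [cell]

/-- On the torus the half-open and the open cube both agree with the closed cube up to faces of
measure zero. -/
theorem ae_mem_openCell (D : FlowDomain d) : ∀ᵐ x ∂D.vol, x ∈ D.openCell := by
  cases D with
  | dirichlet Ω h _ _ => exact ae_vol_mem (dirichlet Ω h _ _)
  | torus =>
    have hmp := (PiLp.volume_preserving_toLp (Fin d))
    have hm : MeasurableSet (torus (d := d)).openCell := (torus (d := d)).isOpen_openCell.measurableSet
    rw [vol, ae_restrict_iff' (torus (d := d)).measurableSet_cell, ae_iff]
    have hs : {x : Sp d | ¬(x ∈ (torus (d := d)).cell → x ∈ (torus (d := d)).openCell)}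
        = (torus (d := d)).cell \ (torus (d := d)).openCell := by
      ext x; simp
    rw [hs, ← hmp.measure_preimage ((torus (d := d)).measurableSet_cell.diff hm).nullMeasurableSet,
      preimage_sdiff, toLp_preimage_cell]
    have h2 : (WithLp.toLp 2 : (Fin d → ℝ) → Sp d) ⁻¹' (torus (d := d)).openCell
        = univ.pi fun _ => Ioo (-1 : ℝ) 1 := by
      ext y; simp [openCell]
    rw [h2]
    have e1 := Measure.univ_pi_Ico_ae_eq_Icc (μ := fun _ : Fin d => (volume : Measure ℝ))
      (f := fun _ => (-1 : ℝ)) (g := fun _ => 1)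
    have e2 := Measure.univ_pi_Ioo_ae_eq_Icc (μ := fun _ : Fin d => (volume : Measure ℝ))
      (f := fun _ => (-1 : ℝ)) (g := fun _ => 1)
    exact ae_le_set.1 (e1.trans e2.symm).le

/-! ### Integration by parts for classical functions -/

theorem single_add_apply (x : Sp d) (i j : Fin d) (a : ℝ) :
    (x + EuclideanSpace.single i a) j = x j + if j = i then a else 0 := by
  simp

/-- The integral of a derivative of a periodic function over the cell vanishes. -/
theorem integral_periodic_deriv_eq_zero {f : Sp d → ℝ} {f' : Sp d → Sp d →L[ℝ] ℝ}
    (hf : ∀ x, HasFDerivAt f (f' x) x) (hc : Continuous f') (hp : (torus (d := d)).Periodic f)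
    (j : Fin d) : ∫ x, f' x (EuclideanSpace.single j 1) ∂(torus (d := d)).vol = 0 := by
  obtain ⟨n, rfl⟩ : ∃ n, d = n + 1 := ⟨d - 1, by have := j.pos; omega⟩
  have hmp := (PiLp.volume_preserving_toLp (Fin (n + 1)))
  have hemb : MeasurableEmbedding (WithLp.toLp 2 : (Fin (n + 1) → ℝ) → Sp (n + 1)) :=
    (MeasurableEquiv.toLp 2 (Fin (n + 1) → ℝ)).measurableEmbedding
  rw [vol, ← hmp.setIntegral_preimage_emb hemb, toLp_preimage_cell]
  have e1 := Measure.univ_pi_Ico_ae_eq_Icc (μ := fun _ : Fin (n + 1) => (volume : Measure ℝ))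
    (f := fun _ => (-1 : ℝ)) (g := fun _ => 1)
  rw [show (volume : Measure (Fin (n + 1) → ℝ)) = Measure.pi fun _ => volume from rfl,
    setIntegral_congr_set e1, ← show (volume : Measure (Fin (n + 1) → ℝ)) = Measure.pi fun _ => volume from rfl]
  set A : (Fin (n + 1) → ℝ) →L[ℝ] Sp (n + 1) :=
    ((EuclideanSpace.equiv (Fin (n + 1)) ℝ).symm : (Fin (n + 1) → ℝ) →L[ℝ] Sp (n + 1)) with hA
  have hAs : ∀ i, A (Pi.single i 1) = EuclideanSpace.single i 1 := fun i => rfl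
  have hfc : Continuous f := continuous_iff_continuousAt.2 fun x => (hf x).continuousAt
  -- Divergence theorem on the closed cube for the field f e_j: only the two faces orthogonal to e_j
  -- contribute, and they cancel by periodicity.
  have hint := integral_divergence_of_hasFDerivAt_off_countable' (E := ℝ)
    (fun _ : Fin (n + 1) => (-1 : ℝ)) (fun _ => 1) (fun _ => by norm_num)
    (fun i y => if i = j then f (A y) else 0)
    (fun i y => if i = j then (f' (A y)).comp A else 0) ∅ countable_empty
    (fun i => by
      by_cases h : i = j
      · simp only [h, if_true]; exact (hfc.comp A.continuous).continuousOn
      · simp only [h, if_false]; exact continuousOn_const)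
    (fun y _ i => by
      by_cases h : i = j
      · simp only [h, if_true]; exact (hf (A y)).comp y A.hasFDerivAt
      · simp only [h, if_false]; exact hasFDerivAt_const _ _)
    (by
      refine Continuous.integrableOn_Icc ?_
      refine continuous_finsetSum _ fun i _ => ?_
      by_cases h : i = j
      · simp only [h, if_true]
        exact ((hc.comp A.continuous).clm_comp continuous_const).clm_apply continuous_const
      · simp only [h, if_false]; exact continuous_const)
  have hL : ∀ y : Fin (n + 1) → ℝ, (∑ i, (if i = j then (f' (A y)).comp A else 0) (Pi.single i 1))
      = f' (WithLp.toLp 2 y) (EuclideanSpace.single j 1) := by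
    intro y
    rw [Finset.sum_eq_single j]
    · simp only [if_true, ContinuousLinearMap.comp_apply, hAs]; rfl
    · intro i _ hi; simp [hi]
    · simp
  simp only [hL] at hint
  rw [hint]
  refine Finset.sum_eq_zero fun i _ => ?_
  by_cases h : i = j
  · subst h
    simp only [if_true]
    rw [sub_eq_zero]
    congr 1
    ext y
    rw [← hp (A (i.insertNth (-1) y)) i]
    congr 1
    ext k
    rw [single_add_apply]
    change (i.insertNth 1 y : Fin (n + 1) → ℝ) k = (i.insertNth (-1) y : Fin (n + 1) → ℝ) k + _
    rcases Fin.eq_self_or_eq_succAbove i k with rfl | ⟨m, rfl⟩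
    · simp; norm_num
    · simp
  · simp [h]

/-- Multiplication by a test function extends by zero. -/
theorem continuous_mul_of_tsupport {Ω : Set (Sp d)} (hΩ : IsOpen Ω) {f φ : Sp d → ℝ}
    (hf : ContinuousOn f Ω) (hφ : Continuous φ) (hs : tsupport φ ⊆ Ω) :
    Continuous fun x => f x * φ x := by
  rw [continuous_iff_continuousAt]
  intro x
  by_cases hx : x ∈ tsupport φ
  · exact (hf.continuousAt (hΩ.mem_nhds (hs hx))).mul hφ.continuousAt
  · have : (fun x => f x * φ x) =ᶠ[𝓝 x] fun _ => 0 := by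
      filter_upwards [(isClosed_tsupport φ).isOpen_compl.mem_nhds hx] with y hy
      rw [image_eq_zero_of_notMem_tsupport hy, mul_zero]
    exact continuousAt_const.congr this.symm

theorem continuous_pderiv {φ : Sp d → ℝ} (hφ : ContDiff ℝ ∞ φ) (j : Fin d) :
    Continuous (pderiv j φ) :=
  (hφ.continuous_fderiv (by simp)).clm_apply continuous_const

theorem contDiff_pderiv {φ : Sp d → ℝ} (hφ : ContDiff ℝ ∞ φ) (j : Fin d) :
    ContDiff ℝ ∞ (pderiv j φ) :=
  (hφ.fderiv_right (m := ∞) (by simp)).clm_apply contDiff_const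

theorem tsupport_pderiv_subset (φ : Sp d → ℝ) (j : Fin d) :
    tsupport (pderiv j φ) ⊆ tsupport φ :=
  tsupport_fderiv_apply_subset ℝ _

theorem SmoothTest.contDiff {D : FlowDomain d} {φ : Sp d → ℝ} (h : D.SmoothTest φ) :
    ContDiff ℝ ∞ φ := by
  cases D with
  | torus => exact h.1
  | dirichlet => exact h.1

theorem SmoothTest.continuous {D : FlowDomain d} {φ : Sp d → ℝ} (h : D.SmoothTest φ) :
    Continuous φ := h.contDiff.continuous

theorem Periodic.fderiv_eq {E : Type*} [NormedAddCommGroup E] [NormedSpace ℝ E] {φ : Sp d → E}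
    (h : (torus (d := d)).Periodic φ) : (torus (d := d)).Periodic (fderiv ℝ φ) := by
  intro x i
  have : φ = fun y => φ (y + EuclideanSpace.single i 2) := funext fun y => (h y i).symm
  conv_rhs => rw [this]
  rw [fderiv_comp_add_right]

theorem SmoothTest.pderiv {D : FlowDomain d} {φ : Sp d → ℝ} (h : D.SmoothTest φ) (j : Fin d) :
    D.SmoothTest (pderiv j φ) := by
  cases D with
  | torus =>
    refine ⟨contDiff_pderiv h.1 j, fun x i => ?_⟩
    simp only [NSAC.pderiv]
    rw [Periodic.fderiv_eq h.2 x i]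
  | dirichlet Ω _ _ _ =>
    exact ⟨contDiff_pderiv h.1 j, h.2.1.mono' ((subset_tsupport _).trans (tsupport_pderiv_subset φ j)),
      (tsupport_pderiv_subset φ j).trans h.2.2⟩

/-- A continuously differentiable function has its classical partial derivatives as weak ones. -/
theorem isWeakPartial_of_hasFDerivAt (D : FlowDomain d) {f : Sp d → ℝ} {f' : Sp d → Sp d →L[ℝ] ℝ}
    (hf : ∀ x ∈ D.region, HasFDerivAt f (f' x) x) (hc : ContinuousOn f' D.region)
    (hp : D.Periodic f) (j : Fin d) :
    D.IsWeakPartial j f fun x => f' x (EuclideanSpace.single j 1) := by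
  intro φ hφ
  cases D with
  | torus =>
    have hf1 : ∀ x, HasFDerivAt f (f' x) x := fun x => hf x (mem_univ x)
    have hc1 : Continuous f' := continuousOn_univ.1 hc
    have hfc : Continuous f := continuous_iff_continuousAt.2 fun x => (hf1 x).continuousAt
    have hφd : ∀ x, HasFDerivAt φ (fderiv ℝ φ x) x := fun x =>
      (hφ.1.differentiable (by simp) x).hasFDerivAt
    have h0 := integral_periodic_deriv_eq_zero (f := fun x => f x * φ x)
      (f' := fun x => f x • fderiv ℝ φ x + φ x • f' x) (fun x => (hf1 x).mul (hφd x))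
      ((hfc.smul (hφ.1.continuous_fderiv (by simp))).add (hφ.1.continuous.smul hc1))
      (fun x i => by simp only; rw [hp x i, hφ.2 x i]) j
    have hi : ∀ g : Sp d → ℝ, Continuous g → Integrable g (torus (d := d)).vol := fun g hg =>
      (hg.continuousOn.integrableOn_compact (torus (d := d)).isCompact_closure_cell).mono_set
        subset_closure
    rw [← add_eq_zero_iff_eq_neg, ← integral_add, ← h0]
    · congr 1; ext x
      simp only [add_apply, smul_apply, smul_eq_mul, NSAC.pderiv]
      ring
    · exact hi _ (hfc.mul (continuous_pderiv hφ.1 j))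
    · exact hi _ ((hc1.clm_apply continuous_const).mul hφ.1.continuous)
  | dirichlet Ω ho hb hcn =>
    have hfc : ContinuousOn f Ω := fun x hx => (hf x hx).continuousAt.continuousWithinAt
    have hvc : ContinuousOn (fun x => f' x (EuclideanSpace.single j 1)) Ω :=
      hc.clm_apply continuousOn_const
    have hfd : ∀ x ∈ Ω, fderiv ℝ f x = f' x := fun x hx => (hf x hx).fderiv
    -- Nothing is known about f outside Ω, but its products with φ and with the derivatives of φ are
    -- continuous with compact support on the whole space.
    have c1 := continuous_mul_of_tsupport ho hvc hφ.1.continuous hφ.2.2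
    have c2 := continuous_mul_of_tsupport ho hfc (continuous_pderiv hφ.1 j)
      ((tsupport_pderiv_subset φ j).trans hφ.2.2)
    have c3 := continuous_mul_of_tsupport ho hfc hφ.1.continuous hφ.2.2
    have e1 : (fun x => f' x (EuclideanSpace.single j 1) * φ x)
        = fun x => fderiv ℝ f x (EuclideanSpace.single j 1) * φ x := by
      ext x
      by_cases hx : x ∈ tsupport φ
      · rw [hfd x (hφ.2.2 hx)]
      · rw [image_eq_zero_of_notMem_tsupport hx, mul_zero, mul_zero]
    have key := integral_mul_fderiv_eq_neg_fderiv_mul_of_integrable (μ := (volume : Measure (Sp d)))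
      (f := f) (g := φ) (v := EuclideanSpace.single j 1)
      (by rw [← e1]; exact c1.integrable_of_hasCompactSupport (hφ.2.1.mul_left))
      (c2.integrable_of_hasCompactSupport ((hφ.2.1.fderiv_apply ℝ _).mul_left))
      (c3.integrable_of_hasCompactSupport (hφ.2.1.mul_left))
      (fun x hx => (hf x (hφ.2.2 hx)).differentiableAt)
      (fun x _ => hφ.1.differentiable (by simp) x)
    rw [← e1] at key
    have hz : ∀ x, x ∉ Ω → φ x = 0 := fun x hx =>
      image_eq_zero_of_notMem_tsupport fun h => hx (hφ.2.2 h)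
    have hz' : ∀ x, x ∉ Ω → NSAC.pderiv j φ x = 0 := fun x hx =>
      image_eq_zero_of_notMem_tsupport fun h => hx (hφ.2.2 (tsupport_pderiv_subset φ j h))
    rw [vol]
    change ∫ x in Ω, _ = -∫ x in Ω, _
    rw [setIntegral_eq_integral_of_forall_compl_eq_zero (fun x hx => by rw [hz' x hx, mul_zero]),
      setIntegral_eq_integral_of_forall_compl_eq_zero (fun x hx => by rw [hz x hx, mul_zero])]
    exact key

end FlowDomain


namespace FlowDomain

variable {d : ℕ}

/-! ### Fourier series on the torus -/

section Fourier

/-- The measure on `ℝ / ℤ` is normalised to have total mass one. -/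
local instance unitCircleMeasureSpace : MeasureSpace UnitAddCircle := ⟨AddCircle.haarAddCircle⟩

local instance unitCircleIsProbability : IsProbabilityMeasure (volume : Measure UnitAddCircle) :=
  inferInstanceAs (IsProbabilityMeasure AddCircle.haarAddCircle)

/-- The quotient map onto the unit torus. -/
def toTorus (x : Sp d) : UnitAddTorus (Fin d) := fun i => ((x i / 2 : ℝ) : UnitAddCircle)

/-- The section of the quotient map with values in `(-1, 1]^d`. -/
def fromTorus (y : UnitAddTorus (Fin d)) : Sp d :=
  WithLp.toLp 2 fun i => 2 * ((UnitAddTorus.measurableEquivPiIoc (fun _ : Fin d => -(1 / 2 : ℝ)) y).1 i)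

theorem measurable_toTorus : Measurable (toTorus (d := d)) :=
  measurable_pi_lambda _ fun i => AddCircle.measurable_mk'.comp
    ((by fun_prop : Continuous fun x : Sp d => x i / 2).measurable)

theorem measurable_fromTorus : Measurable (fromTorus (d := d)) := by
  refine (MeasurableEquiv.toLp 2 (Fin d → ℝ)).measurable.comp (measurable_pi_lambda _ fun i => ?_)
  exact (measurable_const.mul ((measurable_pi_apply i).comp (measurable_subtype_coe.comp
    (UnitAddTorus.measurableEquivPiIoc (fun _ : Fin d => -(1 / 2 : ℝ))).measurable)))

theorem fromTorus_toTorus {x : Sp d} (hx : x ∈ (torus (d := d)).openCell) :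
    fromTorus (toTorus x) = x := by
  ext i
  have h : x i / 2 ∈ Ioc (-(1 / 2 : ℝ)) (-(1 / 2) + 1) := by
    have := hx i
    constructor <;> linarith [this.1, this.2]
  simp only [fromTorus, toTorus, UnitAddTorus.coe_measurableEquivPiIoc_apply]
  rw [AddCircle.equivIoc_coe_of_mem h]
  ring

/-- Halving carries the cell, up to a null set, to (−½, ½]^d, a fundamental domain for the
normalised Haar measure. The factor 2^d is the volume of the cell. -/
theorem map_toTorus : Measure.map (toTorus (d := d)) (torus (d := d)).vol
    = ENNReal.ofReal (2 ^ d) • (volume : Measure (UnitAddTorus (Fin d))) := by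
  ext s hs
  have hS : MeasurableSet ((toTorus (d := d)) ⁻¹' s) := measurable_toTorus hs
  rw [Measure.map_apply measurable_toTorus hs, Measure.smul_apply, vol, Measure.restrict_apply hS,
    ← (PiLp.volume_preserving_toLp (Fin d)).measure_preimage
      (hS.inter (torus (d := d)).measurableSet_cell).nullMeasurableSet, preimage_inter,
    toLp_preimage_cell]
  set S : Set (Fin d → ℝ) := (WithLp.toLp 2 : (Fin d → ℝ) → Sp d) ⁻¹' (toTorus ⁻¹' s) with hSdef
  have e1 := Measure.univ_pi_Ico_ae_eq_Icc (μ := fun _ : Fin d => (volume : Measure ℝ))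
    (f := fun _ => (-1 : ℝ)) (g := fun _ => 1)
  have e2 := Measure.univ_pi_Ioc_ae_eq_Icc (μ := fun _ : Fin d => (volume : Measure ℝ))
    (f := fun _ => (-1 : ℝ)) (g := fun _ => 1)
  have e3 : volume (S ∩ univ.pi fun _ => Ico (-1 : ℝ) 1) = volume (S ∩ univ.pi fun _ => Ioc (-1 : ℝ) 1) :=
    measure_congr ((ae_eq_refl S).inter (e1.trans e2.symm))
  have hm : Measurable fun (x : Fin d → ℝ) => (fun i => (x i : UnitAddCircle) : UnitAddTorus (Fin d)) :=
    measurable_pi_lambda _ fun i => AddCircle.measurable_mk'.comp (measurable_pi_apply i)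
  have e4 : volume s = volume ((fun y : Fin d → ℝ => (2 : ℝ) • y) ⁻¹' (S ∩ univ.pi fun _ => Ioc (-1 : ℝ) 1)) := by
    rw [← lintegral_indicator_one hs, UnitAddTorus.lintegral_preimage _ (fun _ : Fin d => -(1 / 2 : ℝ))]
    have : ∀ y : Fin d → ℝ, s.indicator (1 : UnitAddTorus (Fin d) → ℝ≥0∞) (fun i => (y i : UnitAddCircle))
      = ((fun (x : Fin d → ℝ) => (fun i => (x i : UnitAddCircle) : UnitAddTorus (Fin d))) ⁻¹' s).indicator 1 y :=
      fun y => rfl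
    simp only [this]
    rw [lintegral_indicator_one (hm hs), Measure.restrict_apply (hm hs)]
    congr 1
    ext y
    have ht : toTorus (WithLp.toLp 2 ((2 : ℝ) • y) : Sp d) = fun i => (y i : UnitAddCircle) := by
      funext i; simp [toTorus]
    simp only [mem_inter_iff, mem_preimage, Set.mem_pi, mem_univ, true_imp_iff, hSdef, ht,
      mem_ofPred_eq, Pi.smul_apply, smul_eq_mul, mem_Ioc]
    refine and_congr Iff.rfl (forall_congr' fun i => ?_)
    constructor <;> rintro ⟨h1, h2⟩ <;> constructor <;> linarith
  rw [e3, e4, Measure.addHaar_preimage_smul _ two_ne_zero, smul_eq_mul, ← mul_assoc,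
    ← ENNReal.ofReal_mul (by positivity), Module.finrank_fin_fun, abs_of_nonneg (by positivity),
    mul_inv_cancel₀ (by positivity), ENNReal.ofReal_one, one_mul]

theorem aestronglyMeasurable_map_toTorus {E : Type*} [NormedAddCommGroup E]
    {h : UnitAddTorus (Fin d) → E} (hh : AEStronglyMeasurable h volume) :
    AEStronglyMeasurable h (Measure.map (toTorus (d := d)) (torus (d := d)).vol) := by
  rw [map_toTorus]; exact hh.smul_measure _

theorem integral_comp_toTorus {E : Type*} [NormedAddCommGroup E] [NormedSpace ℝ E]
    {h : UnitAddTorus (Fin d) → E} (hh : AEStronglyMeasurable h volume) :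
    ∫ x, h (toTorus x) ∂(torus (d := d)).vol = (2 ^ d : ℝ) • ∫ y, h y := by
  rw [← integral_map measurable_toTorus.aemeasurable (aestronglyMeasurable_map_toTorus hh),
    map_toTorus, integral_smul_measure, ENNReal.toReal_ofReal (by positivity)]

theorem eLpNorm_comp_toTorus {E : Type*} [NormedAddCommGroup E]
    {h : UnitAddTorus (Fin d) → E} (hh : AEStronglyMeasurable h volume) :
    eLpNorm (fun x => h (toTorus x)) 2 (torus (d := d)).vol
      = ENNReal.ofReal (2 ^ d) ^ (1 / (2 : ℝ≥0∞)).toReal * eLpNorm h 2 volume := by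
  have := eLpNorm_map_measure (p := 2) (aestronglyMeasurable_map_toTorus hh) measurable_toTorus.aemeasurable
  rw [map_toTorus, eLpNorm_smul_measure_of_ne_top (by norm_num), smul_eq_mul] at this
  exact this.symm

/-- Square integrable functions on the cell as functions on the unit torus. -/
theorem exists_torus_lift {f : Sp d → ℝ} (hf : MemLp f 2 (torus (d := d)).vol) :
    ∃ F : UnitAddTorus (Fin d) → ℂ, MemLp F 2 volume ∧
      (fun x => F (toTorus x)) =ᵐ[(torus (d := d)).vol] fun x => (f x : ℂ) := by
  have hm : AEStronglyMeasurable (fun y => ((hf.1.mk f (fromTorus y) : ℝ) : ℂ))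
      (volume : Measure (UnitAddTorus (Fin d))) :=
    Complex.continuous_ofReal.comp_aestronglyMeasurable
      (hf.1.stronglyMeasurable_mk.comp_measurable measurable_fromTorus).aestronglyMeasurable
  have hae : (fun x => ((hf.1.mk f (fromTorus (toTorus x)) : ℝ) : ℂ))
      =ᵐ[(torus (d := d)).vol] fun x => (f x : ℂ) := by
    filter_upwards [hf.1.ae_eq_mk, (torus (d := d)).ae_mem_openCell] with x hx hx'
    rw [fromTorus_toTorus hx', ← hx]
  refine ⟨_, ⟨hm, ?_⟩, hae⟩
  have h1 := eLpNorm_comp_toTorus hm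
  rw [eLpNorm_congr_ae hae] at h1
  have h2 : eLpNorm (fun x => (f x : ℂ)) 2 (torus (d := d)).vol < ⊤ := hf.ofReal.2
  rw [h1] at h2
  refine lt_top_iff_ne_top.2 fun h => ?_
  rw [h, ENNReal.mul_top] at h2
  · exact lt_irrefl _ h2
  · exact (ENNReal.rpow_pos (ENNReal.ofReal_pos.2 (by positivity)) ENNReal.ofReal_ne_top).ne'

/-- The phase `π k · x`. -/
def phase (k : Fin d → ℤ) (x : Sp d) : ℝ := Real.pi * ∑ i, (k i : ℝ) * x i

theorem mFourier_toTorus (k : Fin d → ℤ) (x : Sp d) :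
    UnitAddTorus.mFourier k (toTorus x) = ⟨Real.cos (phase k x), Real.sin (phase k x)⟩ := by
  have h1 : UnitAddTorus.mFourier k (toTorus x) = Complex.exp ((phase k x : ℝ) * Complex.I) := by
    simp only [UnitAddTorus.mFourier, ContinuousMap.coe_mk, toTorus, fourier_coe_apply]
    rw [← Complex.exp_sum]
    congr 1
    rw [phase, Finset.mul_sum]
    push_cast
    rw [Finset.sum_mul]
    refine Finset.sum_congr rfl fun i _ => ?_
    ring
  rw [h1, Complex.exp_mul_I]
  apply Complex.ext <;> simp [← Complex.ofReal_cos, ← Complex.ofReal_sin]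

theorem phase_periodic (k : Fin d → ℤ) (x : Sp d) (i : Fin d) :
    phase k (x + EuclideanSpace.single i 2) = phase k x + k i * (2 * Real.pi) := by
  simp only [phase, single_add_apply, mul_add, Finset.sum_add_distrib, mul_ite, mul_zero,
    Finset.sum_ite_eq', Finset.mem_univ, if_true]
  ring

theorem hasFDerivAt_phase (k : Fin d → ℤ) (x : Sp d) :
    HasFDerivAt (phase k) (Real.pi • ∑ i, (k i : ℝ) • (EuclideanSpace.proj i : Sp d →L[ℝ] ℝ)) x := by
  have : phase k = fun x => (Real.pi • ∑ i, (k i : ℝ) • (EuclideanSpace.proj i : Sp d →L[ℝ] ℝ)) x := by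
    ext x
    simp [phase]
  rw [this]
  exact ContinuousLinearMap.hasFDerivAt _

theorem contDiff_phase (k : Fin d → ℤ) : ContDiff ℝ ∞ (phase k) := by
  unfold phase; fun_prop

/-- Real trigonometric polynomials. -/
def trig (s : Finset (Fin d → ℤ)) (a : (Fin d → ℤ) → ℂ) (x : Sp d) : ℝ :=
  ∑ k ∈ s, ((a k).re * Real.cos (phase k x) - (a k).im * Real.sin (phase k x))

theorem smoothTest_trig (s : Finset (Fin d → ℤ)) (a : (Fin d → ℤ) → ℂ) :
    (torus (d := d)).SmoothTest (trig s a) := by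
  refine ⟨?_, fun x i => ?_⟩
  · unfold trig
    refine ContDiff.sum fun k _ => ?_
    exact (contDiff_const.mul (Real.contDiff_cos.comp (contDiff_phase k))).sub
      (contDiff_const.mul (Real.contDiff_sin.comp (contDiff_phase k)))
  · simp only [trig, phase_periodic, Real.cos_add_int_mul_two_pi, Real.sin_add_int_mul_two_pi]

/-- Derivatives of trigonometric polynomials are again of the form `trig`, with coefficients
multiplied by iπk_j. Convergence of gradients thus reduces to convergence of Fourier series. -/
theorem pderiv_trig (s : Finset (Fin d → ℤ)) (a : (Fin d → ℤ) → ℂ) (j : Fin d) (x : Sp d) :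
    pderiv j (trig s a) x = trig s (fun k => Complex.I * (Real.pi * (k j : ℝ) : ℝ) * a k) x := by
  have h : HasFDerivAt (trig s a) (∑ k ∈ s,
      (((a k).re • (-Real.sin (phase k x) • (Real.pi • ∑ i, (k i : ℝ) •
        (EuclideanSpace.proj i : Sp d →L[ℝ] ℝ)))) - ((a k).im • (Real.cos (phase k x) •
        (Real.pi • ∑ i, (k i : ℝ) • (EuclideanSpace.proj i : Sp d →L[ℝ] ℝ)))))) x := by
    unfold trig
    refine HasFDerivAt.fun_sum fun k _ => ?_
    exact ((hasFDerivAt_phase k x).cos.const_mul _).sub ((hasFDerivAt_phase k x).sin.const_mul _)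
  rw [pderiv, h.fderiv, trig, sum_apply]
  refine Finset.sum_congr rfl fun k _ => ?_
  simp
  ring

theorem trig_eq_re (s : Finset (Fin d → ℤ)) (a : (Fin d → ℤ) → ℂ) (x : Sp d) :
    trig s a x = (∑ k ∈ s, a k * UnitAddTorus.mFourier k (toTorus x)).re := by
  rw [Complex.re_sum, trig]
  refine Finset.sum_congr rfl fun k _ => ?_
  rw [mFourier_toTorus, Complex.mul_re]

/-- Fourier coefficients as integrals over the cell. -/
theorem mFourierCoeff_lift {f : Sp d → ℝ} (hf : MemLp f 2 (torus (d := d)).vol)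
    {F : UnitAddTorus (Fin d) → ℂ} (hF : MemLp F 2 volume)
    (h : (fun x => F (toTorus x)) =ᵐ[(torus (d := d)).vol] fun x => (f x : ℂ)) (k : Fin d → ℤ) :
    (2 ^ d : ℝ) • UnitAddTorus.mFourierCoeff F k
      = ((∫ x, f x * Real.cos (phase k x) ∂(torus (d := d)).vol : ℝ) : ℂ)
        - Complex.I * ((∫ x, f x * Real.sin (phase k x) ∂(torus (d := d)).vol : ℝ) : ℂ) := by
  rw [UnitAddTorus.mFourierCoeff, ← integral_comp_toTorus (h := fun y => UnitAddTorus.mFourier (-k) y • F y)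
    ((UnitAddTorus.mFourier (-k)).continuous.aestronglyMeasurable.smul hF.1)]
  have hfi : Integrable f (torus (d := d)).vol := hf.integrable (by norm_num)
  have hphase : ∀ k : Fin d → ℤ, Continuous (phase k) := fun k => (contDiff_phase k).continuous
  have i1 : Integrable (fun x => f x * Real.cos (phase k x)) (torus (d := d)).vol :=
    hfi.mul_bdd (c := 1) (Real.continuous_cos.comp (hphase k)).aestronglyMeasurable
      (Eventually.of_forall fun x => Real.abs_cos_le_one _)
  have i2 : Integrable (fun x => f x * Real.sin (phase k x)) (torus (d := d)).vol :=
    hfi.mul_bdd (c := 1) (Real.continuous_sin.comp (hphase k)).aestronglyMeasurable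
      (Eventually.of_forall fun x => Real.abs_sin_le_one _)
  have e : (fun x => UnitAddTorus.mFourier (-k) (toTorus x) • F (toTorus x)) =ᵐ[(torus (d := d)).vol]
      fun x => ((f x * Real.cos (phase k x) : ℝ) : ℂ) - Complex.I * ((f x * Real.sin (phase k x) : ℝ) : ℂ) := by
    filter_upwards [h] with x hx
    rw [hx, mFourier_toTorus]
    have : phase (-k) x = -phase k x := by simp [phase]
    rw [this, Real.cos_neg, Real.sin_neg]
    apply Complex.ext <;> simp [-Complex.ofReal_cos, -Complex.ofReal_sin] <;> ring
  rw [integral_congr_ae e, integral_sub i1.ofReal (i2.ofReal.const_mul _), integral_const_mul,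
    integral_complex_ofReal, integral_complex_ofReal]

/-- Fourier coefficients of weak partial derivatives. -/
theorem mFourierCoeff_weakPartial {f g : Sp d → ℝ} {j : Fin d} (hf : MemLp f 2 (torus (d := d)).vol)
    (hg : MemLp g 2 (torus (d := d)).vol) (hw : (torus (d := d)).IsWeakPartial j f g)
    {F G : UnitAddTorus (Fin d) → ℂ} (hF : MemLp F 2 volume) (hG : MemLp G 2 volume)
    (hFf : (fun x => F (toTorus x)) =ᵐ[(torus (d := d)).vol] fun x => (f x : ℂ))
    (hGg : (fun x => G (toTorus x)) =ᵐ[(torus (d := d)).vol] fun x => (g x : ℂ)) (k : Fin d → ℤ) :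
    UnitAddTorus.mFourierCoeff G k
      = Complex.I * (Real.pi * (k j : ℝ) : ℝ) * UnitAddTorus.mFourierCoeff F k := by
  have h1 := mFourierCoeff_lift hf hF hFf k
  have h2 := mFourierCoeff_lift hg hG hGg k
  -- The coefficients 1 and −i make the test functions cos(πk·x) and sin(πk·x).
  have c1 := hw _ (smoothTest_trig {k} fun _ => 1)
  have c2 := hw _ (smoothTest_trig {k} fun _ => -Complex.I)
  simp only [pderiv_trig] at c1 c2
  simp only [trig, Finset.sum_singleton, Complex.mul_re, Complex.mul_im, Complex.I_re, Complex.I_im,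
    Complex.ofReal_re, Complex.ofReal_im, Complex.one_re, Complex.one_im, Complex.neg_re,
    Complex.neg_im, zero_mul, mul_zero, one_mul, mul_one, zero_sub, sub_zero, add_zero, zero_add,
    neg_zero, mul_neg, neg_mul, neg_neg] at c1 c2
  have e1 : ∫ x, f x * (Real.pi * (k j : ℝ) * Real.sin (phase k x)) ∂(torus (d := d)).vol
      = Real.pi * (k j : ℝ) * ∫ x, f x * Real.sin (phase k x) ∂(torus (d := d)).vol := by
    rw [← integral_const_mul]; congr 1; ext x; ring
  have e2 : ∫ x, f x * (Real.pi * (k j : ℝ) * Real.cos (phase k x)) ∂(torus (d := d)).vol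
      = Real.pi * (k j : ℝ) * ∫ x, f x * Real.cos (phase k x) ∂(torus (d := d)).vol := by
    rw [← integral_const_mul]; congr 1; ext x; ring
  rw [integral_neg, neg_inj, e1] at c1
  rw [e2] at c2
  have hne : ((2 : ℝ) ^ d) ≠ 0 := by positivity
  apply smul_right_injective ℂ hne
  simp only
  rw [h2, mul_comm (Complex.I * _), ← smul_mul_assoc, h1, ← c1,
    show ∫ x, g x * Real.sin (phase k x) ∂(torus (d := d)).vol
      = -(Real.pi * (k j : ℝ) * ∫ x, f x * Real.cos (phase k x) ∂(torus (d := d)).vol) by linarith]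
  push_cast
  ring_nf
  rw [Complex.I_sq]
  ring

/-- This is L² convergence of the Fourier series of the lift; f is real, so passing to real parts
does not increase the error. -/
theorem tendsto_trig {f : Sp d → ℝ}
    {F : UnitAddTorus (Fin d) → ℂ} (hF : MemLp F 2 volume)
    (h : (fun x => F (toTorus x)) =ᵐ[(torus (d := d)).vol] fun x => (f x : ℂ)) :
    Tendsto (fun s => eLpNorm (fun x => trig s (UnitAddTorus.mFourierCoeff F) x - f x) 2
      (torus (d := d)).vol) atTop (𝓝 0) := by
  have hco : ∀ k, UnitAddTorus.mFourierCoeff (hF.toLp F) k = UnitAddTorus.mFourierCoeff F k :=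
    fun k => integral_congr_ae (by
      filter_upwards [hF.coeFn_toLp] with y hy
      rw [hy])
  have hs := UnitAddTorus.hasSum_mFourier_series_L2 (hF.toLp F)
  simp only [hco] at hs
  set H : Finset (Fin d → ℤ) → C(UnitAddTorus (Fin d), ℂ) :=
    fun s => ∑ k ∈ s, UnitAddTorus.mFourierCoeff F k • UnitAddTorus.mFourier k with hH
  have e : (fun s : Finset (Fin d → ℤ) => ∑ k ∈ s, UnitAddTorus.mFourierCoeff F k •
      UnitAddTorus.mFourierLp 2 k) = fun s => ContinuousMap.toLp (E := ℂ) 2 volume ℂ (H s) := by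
    ext1 s
    rw [hH]
    simp only [map_sum, map_smul]
  have ht : Tendsto (fun s => ContinuousMap.toLp (E := ℂ) 2 volume ℂ (H s)) atTop (𝓝 (hF.toLp F)) := by
    rw [← e]; exact hs
  rw [Lp.tendsto_Lp_iff_tendsto_eLpNorm'] at ht
  have hb : ∀ s, eLpNorm (fun x => trig s (UnitAddTorus.mFourierCoeff F) x - f x) 2 (torus (d := d)).vol
      ≤ ENNReal.ofReal (2 ^ d) ^ (1 / (2 : ℝ≥0∞)).toReal * eLpNorm
        (⇑(ContinuousMap.toLp (E := ℂ) 2 volume ℂ (H s)) - ⇑(hF.toLp F)) 2 volume := by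
    intro s
    have e2 : eLpNorm (⇑(ContinuousMap.toLp (E := ℂ) 2 volume ℂ (H s)) - ⇑(hF.toLp F)) 2 volume
        = eLpNorm (fun y => H s y - F y) 2 volume := by
      refine eLpNorm_congr_ae ?_
      filter_upwards [ContinuousMap.coeFn_toLp (p := 2) (𝕜 := ℂ) volume (H s), hF.coeFn_toLp] with y h1 h2
      rw [Pi.sub_apply, h1, h2]
    rw [e2, ← eLpNorm_comp_toTorus (h := fun y => H s y - F y)
      ((H s).continuous.aestronglyMeasurable.sub hF.1)]
    refine eLpNorm_mono_ae ?_
    filter_upwards [h] with x hx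
    rw [hx, trig_eq_re]
    have : (∑ k ∈ s, UnitAddTorus.mFourierCoeff F k * UnitAddTorus.mFourier k (toTorus x)).re - f x
        = (H s (toTorus x) - (f x : ℂ)).re := by
      rw [Complex.sub_re, Complex.ofReal_re, hH]
      simp [ContinuousMap.sum_apply]
    rw [this]
    exact Complex.abs_re_le_norm _
  have hlim := ENNReal.Tendsto.const_mul (a := ENNReal.ofReal (2 ^ d) ^ (1 / (2 : ℝ≥0∞)).toReal) ht
    (Or.inr (ENNReal.rpow_ne_top_of_nonneg (by positivity) ENNReal.ofReal_ne_top))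
  rw [mul_zero] at hlim
  exact tendsto_of_tendsto_of_tendsto_of_le_of_le tendsto_const_nhds hlim (fun _ => zero_le) hb

/-- Density of smooth periodic functions in `W^{1,2}` of the torus. -/
theorem exists_smoothTest_torus_approx {f : Sp d → ℝ} {G : Sp d → Sp d}
    (hf : MemLp f 2 (torus (d := d)).vol) (hG : ∀ j, MemLp (fun x => G x j) 2 (torus (d := d)).vol)
    (hw : (torus (d := d)).IsWeakGrad f G) :
    ∃ φ : ℕ → Sp d → ℝ, (∀ n, (torus (d := d)).SmoothTest (φ n)) ∧
      Tendsto (fun n => eLpNorm (fun x => φ n x - f x) 2 (torus (d := d)).vol) atTop (𝓝 0) ∧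
      ∀ j, Tendsto (fun n => eLpNorm (fun x => pderiv j (φ n) x - G x j) 2 (torus (d := d)).vol)
        atTop (𝓝 0) := by
  obtain ⟨F, hF, hFf⟩ := exists_torus_lift hf
  choose H hH hHG using fun j => exists_torus_lift (hG j)
  obtain ⟨s, hs⟩ := exists_seq_tendsto (atTop : Filter (Finset (Fin d → ℤ)))
  refine ⟨fun n => trig (s n) (UnitAddTorus.mFourierCoeff F), fun n => smoothTest_trig _ _,
    (tendsto_trig hF hFf).comp hs, fun j => ?_⟩
  -- The Fourier series of a weak derivative is the formal derivative of the Fourier series, so the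
  -- same partial sums approximate f and its gradient.
  have hc : UnitAddTorus.mFourierCoeff (H j)
      = fun k => Complex.I * (Real.pi * (k j : ℝ) : ℝ) * UnitAddTorus.mFourierCoeff F k :=
    funext fun k => mFourierCoeff_weakPartial hf (hG j) (hw j) hF (hH j) hFf (hHG j) k
  simp only [pderiv_trig]
  rw [← hc]
  exact (tendsto_trig (hH j) (hHG j)).comp hs

theorem hasSum_sq_lift {f : Sp d → ℝ}
    {F : UnitAddTorus (Fin d) → ℂ} (hF : MemLp F 2 volume)
    (h : (fun x => F (toTorus x)) =ᵐ[(torus (d := d)).vol] fun x => (f x : ℂ)) :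
    HasSum (fun k => (2 ^ d : ℝ) * ‖UnitAddTorus.mFourierCoeff F k‖ ^ 2)
      (∫ x, f x ^ 2 ∂(torus (d := d)).vol) := by
  have hco : ∀ k, UnitAddTorus.mFourierCoeff (hF.toLp F) k = UnitAddTorus.mFourierCoeff F k :=
    fun k => integral_congr_ae (by
      filter_upwards [hF.coeFn_toLp] with y hy
      rw [hy])
  have hs := (UnitAddTorus.hasSum_sq_mFourierCoeff (hF.toLp F)).mul_left (2 ^ d : ℝ)
  simp only [hco] at hs
  convert! hs using 1
  have e1 : ∫ y, ‖(hF.toLp F) y‖ ^ 2 = ∫ y, ‖F y‖ ^ 2 := integral_congr_ae (by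
      filter_upwards [hF.coeFn_toLp] with y hy
      rw [hy])
  rw [e1, ← smul_eq_mul, ← integral_comp_toTorus (h := fun y => ‖F y‖ ^ 2) (hF.1.norm.pow 2)]
  refine integral_congr_ae ?_
  filter_upwards [h] with x hx
  rw [hx, Complex.norm_real, Real.norm_eq_abs, sq_abs]

/-- The Poincaré inequality on the torus. -/
theorem poincare_torus {f : Sp d → ℝ} {G : Sp d → Sp d}
    (hf : MemLp f 2 (torus (d := d)).vol) (hG : ∀ j, MemLp (fun x => G x j) 2 (torus (d := d)).vol)
    (hw : (torus (d := d)).IsWeakGrad f G) :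
    ∫ x, f x ^ 2 ∂(torus (d := d)).vol ≤ (2 ^ d : ℝ)⁻¹ * (∫ x, f x ∂(torus (d := d)).vol) ^ 2
      + ∑ j, ∫ x, G x j ^ 2 ∂(torus (d := d)).vol := by
  obtain ⟨F, hF, hFf⟩ := exists_torus_lift hf
  choose H hH hHG using fun j => exists_torus_lift (hG j)
  have h1 := hasSum_sq_lift hF hFf
  have h2 := hasSum_sum (s := Finset.univ) fun j (_ : j ∈ Finset.univ) => hasSum_sq_lift (hH j) (hHG j)
  have h3 : HasSum (fun k : Fin d → ℤ => if k = 0 then (2 ^ d : ℝ) * ‖UnitAddTorus.mFourierCoeff F 0‖ ^ 2 else 0)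
    ((2 ^ d : ℝ) * ‖UnitAddTorus.mFourierCoeff F 0‖ ^ 2) := by
    convert! hasSum_ite_eq (0 : Fin d → ℤ) _ using 1
  have h4 : (2 ^ d : ℝ) * ‖UnitAddTorus.mFourierCoeff F 0‖ ^ 2
      = (2 ^ d : ℝ)⁻¹ * (∫ x, f x ∂(torus (d := d)).vol) ^ 2 := by
    have := mFourierCoeff_lift hf hF hFf 0
    have hp : ∀ x : Sp d, phase 0 x = 0 := fun x => by simp [phase]
    simp only [hp, Real.cos_zero, Real.sin_zero, mul_one, mul_zero, integral_zero,
      Complex.ofReal_zero, sub_zero] at this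
    have h5 := congrArg norm this
    rw [norm_smul, Complex.norm_real, Real.norm_eq_abs, Real.norm_eq_abs, abs_of_nonneg (by positivity)] at h5
    rw [← sq_abs (∫ x, f x ∂(torus (d := d)).vol), ← h5]
    field_simp
  rw [← h4]
  -- Parseval's series are compared term by term. The mode k = 0 is the mean; for k ≠ 0 some |k_j| ≥
  -- 1, and the factor π|k_j| ≥ 1 in that derivative suffices.
  refine hasSum_le (fun k => ?_) h1 (h3.add h2)
  by_cases hk : k = 0
  · subst hk
    simp only [if_true]
    exact le_add_of_nonneg_right (Finset.sum_nonneg fun j _ => by positivity)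
  · simp only [hk, if_false, zero_add]
    obtain ⟨j, hj⟩ := Function.ne_iff.1 hk
    refine le_trans ?_ (Finset.single_le_sum (f := fun j => (2 ^ d : ℝ) *
      ‖UnitAddTorus.mFourierCoeff (H j) k‖ ^ 2) (fun j _ => by positivity) (Finset.mem_univ j))
    rw [mFourierCoeff_weakPartial hf (hG j) (hw j) hF (hH j) hFf (hHG j) k]
    gcongr
    rw [norm_mul, norm_mul, Complex.norm_I, one_mul, Complex.norm_real, Real.norm_eq_abs]
    refine le_mul_of_one_le_left (norm_nonneg _) ?_
    rw [abs_mul, abs_of_pos Real.pi_pos]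
    have : (1 : ℝ) ≤ |(k j : ℝ)| := by exact_mod_cast Int.one_le_abs hj
    nlinarith [Real.pi_gt_three]

end Fourier

end FlowDomain


namespace FlowDomain

variable {d : ℕ}

/-! ### Smoothing and cut-off functions -/

/-- A Lipschitz function is uniformly close to smooth functions with the same Lipschitz constant. -/
theorem exists_contDiff_lipschitz {h : Sp d → ℝ} (hh : LipschitzWith 1 h) {ε : ℝ} (hε : 0 < ε) :
    ∃ g : Sp d → ℝ, ContDiff ℝ ∞ g ∧ LipschitzWith 1 g ∧ ∀ x, |g x - h x| ≤ ε := by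
  set φ : ContDiffBump (0 : Sp d) := ⟨ε / 2, ε, half_pos hε, half_lt_self hε⟩
  set g : Sp d → ℝ := convolution (φ.normed volume) h (ContinuousLinearMap.lsmul ℝ ℝ) volume with hg
  have hcont := hh.continuous
  refine ⟨g, φ.hasCompactSupport_normed.contDiff_convolution_left _ φ.contDiff_normed
    hcont.locallyIntegrable, LipschitzWith.of_dist_le_mul fun x y => ?_, fun x => ?_⟩
  · have hi : ∀ z, Integrable (fun t => φ.normed volume t * h (z - t)) := fun z =>
      (φ.continuous_normed.mul (hcont.comp (continuous_const.sub continuous_id))).integrable_of_hasCompactSupport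
        φ.hasCompactSupport_normed.mul_right
    have e : g x - g y = ∫ t, φ.normed volume t * (h (x - t) - h (y - t)) := by
      simp only [hg, convolution_def, ContinuousLinearMap.lsmul_apply, smul_eq_mul, mul_sub]
      rw [integral_sub (hi x) (hi y)]
    rw [Real.dist_eq, e, NNReal.coe_one, one_mul]
    have hb : ∀ t, ‖φ.normed volume t * (h (x - t) - h (y - t))‖ ≤ φ.normed volume t * dist x y := by
      intro t
      rw [norm_mul, Real.norm_of_nonneg (φ.nonneg_normed t)]
      refine mul_le_mul_of_nonneg_left ?_ (φ.nonneg_normed t)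
      have := hh.dist_le_mul (x - t) (y - t)
      simpa [Real.dist_eq] using this
    refine (norm_integral_le_of_norm_le (φ.integrable_normed.mul_const _)
      (Eventually.of_forall hb)).trans ?_
    rw [integral_mul_const, φ.integral_normed, one_mul]
  · have := φ.dist_normed_convolution_le (μ := volume) (g := h) (x₀ := x) (ε := ε)
      hcont.aestronglyMeasurable fun y hy => by
        have := hh.dist_le_mul y x
        rw [NNReal.coe_one, one_mul] at this
        exact this.trans (le_of_lt hy)
    rwa [Real.dist_eq] at this

/-- Compactly supported `C¹` functions are `C¹`-close to smooth ones. -/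
theorem exists_smooth_C1_approx {Ω : Set (Sp d)} (hΩ : IsOpen Ω) {g : Sp d → ℝ} (hg : ContDiff ℝ 1 g)
    (hcs : HasCompactSupport g) (hs : tsupport g ⊆ Ω) {ε : ℝ} (hε : 0 < ε) :
    ∃ ψ : Sp d → ℝ, ContDiff ℝ ∞ ψ ∧ HasCompactSupport ψ ∧ tsupport ψ ⊆ Ω ∧
      (∀ x, |ψ x - g x| ≤ ε) ∧ ∀ x, ‖fderiv ℝ ψ x - fderiv ℝ g x‖ ≤ ε := by
  obtain ⟨δ0, hδ0, hsub⟩ := hcs.isCompact.exists_cthickening_subset_open hΩ hs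
  have hc' : Continuous (fderiv ℝ g) := hg.continuous_fderiv one_ne_zero
  obtain ⟨δ1, hδ1, h1⟩ := Metric.uniformContinuous_iff.1
    (hcs.uniformContinuous_of_continuous hg.continuous) ε hε
  obtain ⟨δ2, hδ2, h2⟩ := Metric.uniformContinuous_iff.1
    ((hcs.fderiv ℝ).uniformContinuous_of_continuous hc') ε hε
  set δ := min δ0 (min δ1 δ2) with hδdef
  -- The radius δ0 keeps the mollified support inside Ω; δ1 and δ2 are the moduli of uniform
  -- continuity of g and of its derivative.
  have hδ : 0 < δ := lt_min hδ0 (lt_min hδ1 hδ2)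
  set φ : ContDiffBump (0 : Sp d) := ⟨δ / 2, δ, half_pos hδ, half_lt_self hδ⟩ with hφ
  set ψ : Sp d → ℝ := convolution (φ.normed volume) g (ContinuousLinearMap.lsmul ℝ ℝ) volume with hψ
  have hsupp : Function.support ψ ⊆ Metric.cthickening δ0 (tsupport g) := by
    refine (support_convolution_subset _).trans ?_
    rintro _ ⟨a, ha, b, hb, rfl⟩
    rw [φ.support_normed_eq] at ha
    refine Metric.mem_cthickening_of_dist_le _ b _ _ (subset_tsupport _ hb) ?_
    have : ‖a‖ < δ := by simpa using ha
    simpa using this.le.trans (min_le_left _ _)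
  have hts : tsupport ψ ⊆ Metric.cthickening δ0 (tsupport g) :=
    closure_minimal hsupp Metric.isClosed_cthickening
  have hder : ∀ x, fderiv ℝ ψ x = convolution (φ.normed volume) (fderiv ℝ g)
      (ContinuousLinearMap.lsmul ℝ ℝ) volume x := by
    intro x
    have := (hcs.hasFDerivAt_convolution_right (μ := volume) (ContinuousLinearMap.lsmul ℝ ℝ)
      (φ.continuous_normed (μ := volume)).locallyIntegrable hg x).fderiv
    rw [hψ, this, convolution_def, convolution_def]
    congr 1
  refine ⟨ψ, φ.hasCompactSupport_normed.contDiff_convolution_left _ φ.contDiff_normed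
    hg.continuous.locallyIntegrable, HasCompactSupport.of_support_subset_isCompact hcs.isCompact.cthickening hsupp,
    hts.trans hsub, fun x => ?_, fun x => ?_⟩
  · have := φ.dist_normed_convolution_le (μ := volume) (g := g) (x₀ := x) (ε := ε)
      hg.continuous.aestronglyMeasurable fun y hy =>
        (h1 (lt_of_lt_of_le hy ((min_le_right _ _).trans (min_le_left _ _)))).le
    rwa [Real.dist_eq] at this
  · have := φ.dist_normed_convolution_le (μ := volume) (g := fderiv ℝ g) (x₀ := x) (ε := ε)
      hc'.aestronglyMeasurable fun y hy =>
        (h2 (lt_of_lt_of_le hy ((min_le_right _ _).trans (min_le_right _ _)))).le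
    rwa [dist_eq_norm, ← hder] at this

/-- Distance to the complement (a positive constant on the torus). -/
def bdist : FlowDomain d → Sp d → ℝ
  | torus, _ => 1
  | dirichlet Ω _ _ _, x => Metric.infDist x Ωᶜ

/-- On a bounded domain: `f` vanishes outside a compact subset of `Ω`. -/
def CompactInside {V : Type*} [Zero V] : FlowDomain d → (Sp d → V) → Prop
  | torus, _ => True
  | dirichlet Ω _ _ _, f => ∃ K, IsCompact K ∧ K ⊆ Ω ∧ ∀ x, x ∉ K → f x = 0

theorem compl_nonempty_of_isBounded (hd : 0 < d) {Ω : Set (Sp d)} (hb : Bornology.IsBounded Ω) :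
    Ωᶜ.Nonempty := by
  by_contra h
  rw [not_nonempty_iff_eq_empty, compl_empty_iff] at h
  rw [h] at hb
  have : Nonempty (Fin d) := ⟨⟨0, hd⟩⟩
  exact NormedSpace.unbounded_univ ℝ (Sp d) hb

/-- Smooth cut-off functions exhausting the domain. -/
theorem exists_cutoff (hd : 0 < d) (D : FlowDomain d) : ∃ χ : ℕ → Sp d → ℝ,
    (∀ n, ContDiff ℝ ∞ (χ n)) ∧ (∀ n, D.Periodic (χ n)) ∧ (∀ n x, |χ n x| ≤ 1) ∧
    (∀ n, D.CompactInside (χ n)) ∧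
    (∀ x ∈ D.region, ∀ᶠ n in atTop, χ n x = 1 ∧ fderiv ℝ (χ n) x = 0) ∧
    ∃ K, 0 ≤ K ∧ ∀ n x, D.bdist x * ‖fderiv ℝ (χ n) x‖ ≤ K := by
  cases D with
  | torus =>
    refine ⟨fun _ _ => 1, fun _ => contDiff_const, fun _ _ _ => rfl, fun _ _ => by simp,
      fun _ => trivial, fun x _ => Eventually.of_forall fun n => ⟨rfl, by simp⟩, 0, le_rfl,
      fun n x => by simp⟩
  | dirichlet Ω ho hb hc =>
    set h : Sp d → ℝ := fun x => Metric.infDist x Ωᶜ with hh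
    have hlip : LipschitzWith 1 h := Metric.lipschitz_infDist_pt _
    have hδ : ∀ n : ℕ, (0 : ℝ) < 1 / (n + 1) := fun n => Nat.one_div_pos_of_nat
    choose g hg1 hg2 hg3 using fun n : ℕ => exists_contDiff_lipschitz hlip (ε := 1 / (n + 1 : ℝ) / 4) (by
      have := hδ n; positivity)
    set S := Real.smoothTransition with hS
    have hSd : ContDiff ℝ ∞ S := Real.smoothTransition.contDiff
    obtain ⟨K0, hK0⟩ : ∃ K0, ∀ y, ‖deriv S y‖ ≤ K0 := by
      have hcd : Continuous (deriv S) := hSd.continuous_deriv (by simp)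
      obtain ⟨K0, hK0⟩ := (isCompact_Icc (a := (0:ℝ)) (b := 1)).exists_bound_of_continuousOn hcd.continuousOn
      refine ⟨max K0 0, fun y => ?_⟩
      by_cases hy : y ∈ Icc (0 : ℝ) 1
      · exact (hK0 y hy).trans (le_max_left _ _)
      · have : deriv S y = 0 := by
          rw [mem_Icc, not_and_or, not_le, not_le] at hy
          rcases hy with hy | hy
          · have : S =ᶠ[𝓝 y] fun _ => 0 := by
              filter_upwards [Iio_mem_nhds hy] with z hz
              exact Real.smoothTransition.zero_of_nonpos (le_of_lt hz)
            rw [this.deriv_eq, deriv_const]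
          · have : S =ᶠ[𝓝 y] fun _ => 1 := by
              filter_upwards [Ioi_mem_nhds hy] with z hz
              exact Real.smoothTransition.one_of_one_le (le_of_lt hz)
            rw [this.deriv_eq, deriv_const]
        rw [this, norm_zero]; exact le_max_right _ _
    have hK0n : 0 ≤ K0 := (norm_nonneg _).trans (hK0 0)
    -- The smoothed distance g is rescaled so that χ is 0 for g ≤ 1/(n+1) and 1 for g ≥ 2/(n+1). Its
    -- gradient is of size n+1 and lives where the true distance is at most 3/(n+1), so distance
    -- times gradient stays below 3K0.
    set χ : ℕ → Sp d → ℝ := fun n x => S (g n x * (n + 1) - 1) with hχ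
    have hone : ∀ (n : ℕ) (x : Sp d), 2 * (1 / (n + 1 : ℝ)) ≤ g n x → χ n x = 1 := by
      intro n x hx
      refine Real.smoothTransition.one_of_one_le ?_
      have h1 := mul_le_mul_of_nonneg_right hx (by positivity : (0:ℝ) ≤ n + 1)
      have h2 : 2 * (1 / (n + 1 : ℝ)) * (n + 1) = 2 := by field_simp
      linarith
    have hzero : ∀ (n : ℕ) (x : Sp d), g n x ≤ 1 / (n + 1 : ℝ) → χ n x = 0 := by
      intro n x hx
      refine Real.smoothTransition.zero_of_nonpos ?_
      have h1 := mul_le_mul_of_nonneg_right hx (by positivity : (0:ℝ) ≤ n + 1)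
      have h2 : 1 / (n + 1 : ℝ) * (n + 1) = 1 := by field_simp
      linarith
    have heq1 : ∀ (n : ℕ) (x : Sp d), 2 * (1 / (n + 1 : ℝ)) < g n x → χ n =ᶠ[𝓝 x] fun _ => 1 := by
      intro n x hx
      filter_upwards [(hg2 n).continuous.continuousAt.eventually (Ioi_mem_nhds hx)] with y hy
      exact hone n y (le_of_lt hy)
    have hfd : ∀ n x, ‖fderiv ℝ (χ n) x‖ ≤ K0 * (n + 1) := by
      intro n x
      have h1 : HasFDerivAt (χ n) (deriv S (g n x * (n + 1) - 1) • ((n + 1 : ℝ) • fderiv ℝ (g n) x)) x := by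
        have := (((hg1 n).differentiable (by simp) x).hasFDerivAt.mul_const (n + 1 : ℝ)).sub_const 1
        exact ((hSd.differentiable (by simp) _).hasDerivAt).comp_hasFDerivAt x this
      rw [h1.fderiv, norm_smul, norm_smul, Real.norm_of_nonneg (by positivity : (0:ℝ) ≤ n + 1)]
      have h2 : ‖fderiv ℝ (g n) x‖ ≤ 1 := by simpa using norm_fderiv_le_of_lipschitz ℝ (hg2 n)
      calc _ ≤ K0 * ((n + 1) * 1) := by gcongr; exact hK0 _
        _ = _ := by ring
    refine ⟨χ, fun n => ?_, fun _ => trivial, fun n x => ?_, fun n => ?_, fun x hx => ?_,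
      3 * K0, by positivity, fun n x => ?_⟩
    · exact hSd.comp (((hg1 n).mul contDiff_const).sub contDiff_const)
    · rw [abs_of_nonneg (Real.smoothTransition.nonneg _)]
      exact Real.smoothTransition.le_one _
    · refine ⟨{x | 1 / (n + 1 : ℝ) / 2 ≤ h x}, ?_, ?_, ?_⟩
      · refine Metric.isCompact_of_isClosed_isBounded (isClosed_le continuous_const hlip.continuous)
          (hb.subset ?_)
        intro x hx
        by_contra hx'
        have : h x = 0 := Metric.infDist_zero_of_mem hx'
        have h3 := hδ n
        simp only [mem_ofPred_eq, this] at hx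
        linarith
      · intro x hx
        by_contra hx'
        have : h x = 0 := Metric.infDist_zero_of_mem hx'
        have h3 := hδ n
        simp only [mem_ofPred_eq, this] at hx
        linarith
      · intro x hx
        simp only [mem_ofPred_eq, not_le] at hx
        refine hzero n x ?_
        have h3 := (abs_le.1 (hg3 n x)).2
        have h4 := hδ n
        linarith
    · have hpos : 0 < h x := by
        have hx' : x ∉ Ωᶜ := fun h => h hx
        exact (ho.isClosed_compl.notMem_iff_infDist_pos (compl_nonempty_of_isBounded hd hb)).1 hx'
      have ht : Tendsto (fun n : ℕ => 3 * (1 / (n + 1 : ℝ))) atTop (𝓝 (3 * 0)) :=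
        (tendsto_one_div_add_atTop_nhds_zero_nat).const_mul 3
      rw [mul_zero] at ht
      filter_upwards [ht.eventually (Iio_mem_nhds hpos)] with n hn
      have hgx : 2 * (1 / (n + 1 : ℝ)) < g n x := by
        have h3 := (abs_le.1 (hg3 n x)).1
        have h4 := hδ n
        have h5 : 3 * (1 / (n + 1 : ℝ)) < h x := hn
        linarith
      refine ⟨hone n x hgx.le, ?_⟩
      rw [(heq1 n x hgx).fderiv_eq, fderiv_fun_const]; rfl
    · change h x * _ ≤ _
      rcases lt_or_ge (2 * (1 / (n + 1 : ℝ))) (g n x) with hgx | hgx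
      · have : fderiv ℝ (χ n) x = 0 := by rw [(heq1 n x hgx).fderiv_eq, fderiv_fun_const]; rfl
        rw [this, norm_zero, mul_zero]; positivity
      · have h3 := (abs_le.1 (hg3 n x)).1
        have h4 := hδ n
        have h5 : h x ≤ 3 * (1 / (n + 1 : ℝ)) := by linarith
        calc h x * ‖fderiv ℝ (χ n) x‖ ≤ 3 * (1 / (n + 1 : ℝ)) * (K0 * (n + 1)) := by
              gcongr
              exact hfd n x
          _ = 3 * K0 := by field_simp

/-- A `C¹` function that vanishes on the boundary is bounded by the distance to the boundary. -/
theorem norm_le_bdist (hd : 0 < d) (D : FlowDomain d) {V : Type*} [NormedAddCommGroup V] [NormedSpace ℝ V]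
    {f : Sp d → V} {f' : Sp d → Sp d →L[ℝ] V} {B : ℝ}
    (hf : ∀ x ∈ D.region, HasFDerivAt f (f' x) x) (hB : ∀ x ∈ D.cell, ‖f' x‖ ≤ B)
    (hM : ∀ x ∈ D.cell, ‖f x‖ ≤ B) (hc : ContinuousOn f D.closedRegion)
    (hv : D.VanishesOnBoundary f) : ∀ x ∈ D.cell, ‖f x‖ ≤ B * D.bdist x := by
  intro x hx
  cases D with
  | torus => simpa [bdist] using hM x hx
  | dirichlet Ω ho hb hcn =>
    obtain ⟨y, hy, hxy⟩ := ho.isClosed_compl.exists_infDist_eq_dist (compl_nonempty_of_isBounded hd hb) x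
    have hball : Metric.ball x (dist x y) ⊆ Ω := by
      intro z hz
      by_contra hz'
      have := Metric.infDist_le_dist_of_mem (x := x) (show z ∈ Ωᶜ from hz')
      rw [hxy] at this
      rw [Metric.mem_ball, dist_comm] at hz
      exact absurd hz (not_lt.2 this)
    have hxy0 : dist x y ≠ 0 := by
      intro h0
      rw [dist_eq_zero] at h0
      exact hy (h0 ▸ hx)
    have hycl : y ∈ closure (Metric.ball x (dist x y)) := by
      rw [closure_ball x hxy0, Metric.mem_closedBall, dist_comm]
    have hyf : y ∈ frontier Ω := by
      rw [frontier, ho.interior_eq]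
      exact ⟨closure_mono hball hycl, hy⟩
    -- The largest ball around x inside Ω is convex, so the mean value inequality holds in it. The
    -- nearest boundary point y is reached only in the limit z → y, by continuity of f up to the
    -- boundary.
    have hle : ∀ z ∈ Metric.ball x (dist x y), ‖f x‖ ≤ B * dist x y + ‖f z‖ := by
      intro z hz
      have h1 := (convex_ball x (dist x y)).norm_image_sub_le_of_norm_hasFDerivWithin_le
        (fun w hw => (hf w (hball hw)).hasFDerivWithinAt) (fun w hw => hB w (hball hw)) hz
        (Metric.mem_ball_self (lt_of_le_of_ne dist_nonneg hxy0.symm))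
      have h2 : ‖x - z‖ ≤ dist x y := by
        rw [← dist_eq_norm, dist_comm]; exact (Metric.mem_ball.1 hz).le
      have hB0 : 0 ≤ B := (norm_nonneg _).trans (hB x hx)
      have h3 := norm_le_norm_add_norm_sub' (f x) (f z)
      nlinarith [mul_le_mul_of_nonneg_left h2 hB0]
    have hcl : ContinuousWithinAt f (Metric.ball x (dist x y)) y :=
      (hc y (frontier_subset_closure hyf)).mono (hball.trans subset_closure)
    have : (𝓝[Metric.ball x (dist x y)] y).NeBot := mem_closure_iff_nhdsWithin_neBot.1 hycl
    have hlim := hcl.norm.const_add (B * dist x y)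
    have : ‖f x‖ ≤ B * dist x y + ‖f y‖ := ge_of_tendsto hlim (eventually_nhdsWithin_of_forall hle)
    rw [show f y = 0 from hv y hyf, norm_zero, add_zero] at this
    simpa [bdist, hxy] using this

end FlowDomain


/-! ### Strong convergence in L² -/

section L2tools

variable {α : Type*} [MeasurableSpace α] {μ : Measure α}

/-- Strong `L²` convergence of both factors implies convergence of the integrals of products. -/
theorem tendsto_integral_mul {f g : α → ℝ} {F G : ℕ → α → ℝ} (hf : MemLp f 2 μ) (hg : MemLp g 2 μ)
    (hF : ∀ n, MemLp (F n) 2 μ) (hG : ∀ n, MemLp (G n) 2 μ)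
    (h1 : Tendsto (fun n => eLpNorm (fun x => F n x - f x) 2 μ) atTop (𝓝 0))
    (h2 : Tendsto (fun n => eLpNorm (fun x => G n x - g x) 2 μ) atTop (𝓝 0)) :
    Tendsto (fun n => ∫ x, F n x * G n x ∂μ) atTop (𝓝 (∫ x, f x * g x ∂μ)) := by
  have key : ∀ {a b : α → ℝ} (ha : MemLp a 2 μ) (hb : MemLp b 2 μ),
      ∫ x, a x * b x ∂μ = inner ℝ (ha.toLp a) (hb.toLp b) := by
    intro a b ha hb
    rw [L2.inner_def]
    refine integral_congr_ae ?_
    filter_upwards [ha.coeFn_toLp, hb.coeFn_toLp] with x hx hy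
    rw [hx, hy]
    simp [mul_comm]
  simp_rw [key (hF _) (hG _), key hf hg]
  exact Tendsto.inner ((Lp.tendsto_Lp_iff_tendsto_eLpNorm'' F hF f hf).2 h1)
    ((Lp.tendsto_Lp_iff_tendsto_eLpNorm'' G hG g hg).2 h2)

theorem tendsto_eLpNorm_zero_of_bdd [IsFiniteMeasure μ] {F : ℕ → α → ℝ} {K : ℝ}
    (hF : ∀ n, AEStronglyMeasurable (F n) μ) (hb : ∀ n, ∀ᵐ x ∂μ, |F n x| ≤ K)
    (h : ∀ᵐ x ∂μ, Tendsto (fun n => F n x) atTop (𝓝 0)) :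
    Tendsto (fun n => eLpNorm (F n) 2 μ) atTop (𝓝 0) := by
  have h0 : Tendsto (fun n => ∫ x, F n x ^ 2 ∂μ) atTop (𝓝 (∫ _, (0:ℝ) ∂μ)) := by
    refine tendsto_integral_of_dominated_convergence (fun _ => K ^ 2) (fun n => (hF n).pow 2)
      (integrable_const _) (fun n => ?_) ?_
    · filter_upwards [hb n] with x hx
      rw [Real.norm_eq_abs, abs_pow]
      exact pow_le_pow_left₀ (abs_nonneg _) hx 2
    · filter_upwards [h] with x hx
      simpa using hx.pow 2
  rw [integral_zero] at h0
  have hm : ∀ n, MemLp (F n) 2 μ := fun n => MemLp.of_bound (hF n) K (hb n)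
  have e : ∀ n, eLpNorm (F n) 2 μ = ENNReal.ofReal ((∫ x, F n x ^ 2 ∂μ) ^ (1 / 2 : ℝ)) := by
    intro n
    rw [(hm n).eLpNorm_eq_integral_rpow_norm (by norm_num) (by norm_num)]
    simp
  simp_rw [e]
  have := (h0.rpow_const (p := 1 / 2) (Or.inr (by norm_num)))
  rw [Real.zero_rpow (by norm_num)] at this
  simpa using ENNReal.tendsto_ofReal this

end L2tools

theorem norm_apply_single_le {d : ℕ} {V : Type*} [NormedAddCommGroup V] [NormedSpace ℝ V]
    (A : Sp d →L[ℝ] V) (j : Fin d) : ‖A (EuclideanSpace.single j 1)‖ ≤ ‖A‖ := by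
  have := A.le_opNorm (EuclideanSpace.single j 1)
  rwa [show ‖(EuclideanSpace.single j (1:ℝ) : Sp d)‖ = 1 by simp, mul_one] at this

/-! ### The closure of the test functions in W^{1,2} -/

namespace FlowDomain

variable {d : ℕ}

theorem aestronglyMeasurable_vol (D : FlowDomain d) {E : Type*} [NormedAddCommGroup E]
    {f : Sp d → E} (hf : ContinuousOn f D.region) : AEStronglyMeasurable f D.vol :=
  (hf.mono D.cell_subset_region).aestronglyMeasurable D.measurableSet_cell

theorem memLp_of_bdd (D : FlowDomain d) {f : Sp d → ℝ} (hf : AEStronglyMeasurable f D.vol) {K : ℝ}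
    (hb : ∀ x ∈ D.cell, |f x| ≤ K) {p : ℝ≥0∞} : MemLp f p D.vol :=
  MemLp.of_bound hf K (by filter_upwards [D.ae_vol_mem] with x hx using hb x hx)

theorem memLp_of_continuous (D : FlowDomain d) {f : Sp d → ℝ} (hf : Continuous f) {p : ℝ≥0∞} :
    MemLp f p D.vol := by
  obtain ⟨K, hK⟩ := D.isCompact_closure_cell.exists_bound_of_continuousOn hf.continuousOn
  exact D.memLp_of_bdd hf.aestronglyMeasurable fun x hx => hK x (subset_closure hx)

/-- `f`, with gradient `G`, belongs to the closure of the smooth test functions in `W^{1,2}`. -/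
structure IsH10 (D : FlowDomain d) (f : Sp d → ℝ) (G : Fin d → Sp d → ℝ) : Prop where
  memLp : MemLp f 2 D.vol
  grad_memLp : ∀ j, MemLp (G j) 2 D.vol
  approx : ∃ φ : ℕ → Sp d → ℝ, (∀ n, D.SmoothTest (φ n)) ∧
    Tendsto (fun n => eLpNorm (fun x => φ n x - f x) 2 D.vol) atTop (𝓝 0) ∧
    ∀ j, Tendsto (fun n => eLpNorm (fun x => pderiv j (φ n) x - G j x) 2 D.vol) atTop (𝓝 0)

/-- On a bounded domain this is the trace condition itself; on the torus the approximating sequence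
comes from Fourier series. -/
theorem IsH10.of_zeroTrace (D : FlowDomain d) {f : Sp d → ℝ} {G : Sp d → Sp d}
    (hf : MemLp f 2 D.vol) (hG : ∀ j, MemLp (fun x => G x j) 2 D.vol) (hw : D.IsWeakGrad f G)
    (ht : D.ZeroTrace f G) : D.IsH10 f fun j x => G x j := by
  cases D with
  | torus => exact ⟨hf, hG, exists_smoothTest_torus_approx hf hG hw⟩
  | dirichlet Ω h1 h2 h3 => exact ⟨hf, hG, ht⟩

theorem SmoothTest.memLp {D : FlowDomain d} {φ : Sp d → ℝ} (h : D.SmoothTest φ) {p : ℝ≥0∞} :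
    MemLp φ p D.vol := D.memLp_of_continuous h.continuous

theorem SmoothTest.sub {D : FlowDomain d} {φ ψ : Sp d → ℝ} (h : D.SmoothTest φ)
    (h' : D.SmoothTest ψ) : D.SmoothTest fun x => φ x - ψ x := by
  cases D with
  | torus => exact ⟨h.1.sub h'.1, fun x i => congrArg₂ (· - ·) (h.2 x i) (h'.2 x i)⟩
  | dirichlet Ω h1 h2 h3 =>
    exact ⟨h.1.sub h'.1, h.2.1.sub h'.2.1,
      (tsupport_sub φ ψ).trans (union_subset h.2.2 h'.2.2)⟩

theorem SmoothTest.differentiable {D : FlowDomain d} {φ : Sp d → ℝ} (h : D.SmoothTest φ) :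
    Differentiable ℝ φ := h.contDiff.differentiable (by simp)

theorem pderiv_sub {φ ψ : Sp d → ℝ} (h : Differentiable ℝ φ) (h' : Differentiable ℝ ψ) (j : Fin d)
    (x : Sp d) : pderiv j (fun x => φ x - ψ x) x = pderiv j φ x - pderiv j ψ x := by
  rw [NSAC.pderiv, fderiv_fun_sub (h x) (h' x)]; rfl

theorem tendsto_eLpNorm_sub_sub {α : Type*} [MeasurableSpace α] {μ : Measure α}
    {F G : ℕ → α → ℝ} {f g : α → ℝ} (hF : ∀ n, AEStronglyMeasurable (F n) μ)
    (hG : ∀ n, AEStronglyMeasurable (G n) μ) (hf : AEStronglyMeasurable f μ)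
    (hg : AEStronglyMeasurable g μ)
    (h1 : Tendsto (fun n => eLpNorm (fun x => F n x - f x) 2 μ) atTop (𝓝 0))
    (h2 : Tendsto (fun n => eLpNorm (fun x => G n x - g x) 2 μ) atTop (𝓝 0)) :
    Tendsto (fun n => eLpNorm (fun x => F n x - G n x - (f x - g x)) 2 μ) atTop (𝓝 0) := by
  have h3 := h1.add h2
  rw [add_zero] at h3
  refine tendsto_of_tendsto_of_tendsto_of_le_of_le tendsto_const_nhds h3 (fun _ => zero_le) fun n => ?_
  have e : (fun x => F n x - G n x - (f x - g x))
      = (fun x => F n x - f x) - fun x => G n x - g x := by ext x; simp; ring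
  rw [e]
  exact eLpNorm_sub_le ((hF n).sub hf) ((hG n).sub hg) (by norm_num)

theorem IsH10.sub {D : FlowDomain d} {f g : Sp d → ℝ} {F G : Fin d → Sp d → ℝ}
    (h : D.IsH10 f F) (h' : D.IsH10 g G) :
    D.IsH10 (fun x => f x - g x) fun j x => F j x - G j x := by
  obtain ⟨φ, hφ, h1, h2⟩ := h.approx
  obtain ⟨ψ, hψ, h3, h4⟩ := h'.approx
  refine ⟨h.memLp.sub h'.memLp, fun j => (h.grad_memLp j).sub (h'.grad_memLp j),
    fun n x => φ n x - ψ n x, fun n => (hφ n).sub (hψ n), ?_, fun j => ?_⟩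
  · exact tendsto_eLpNorm_sub_sub (fun n => (hφ n).continuous.aestronglyMeasurable)
      (fun n => (hψ n).continuous.aestronglyMeasurable) h.memLp.1 h'.memLp.1 h1 h3
  · simp_rw [pderiv_sub (hφ _).differentiable (hψ _).differentiable]
    exact tendsto_eLpNorm_sub_sub (fun n => ((hφ n).pderiv j).continuous.aestronglyMeasurable)
      (fun n => ((hψ n).pderiv j).continuous.aestronglyMeasurable) (h.grad_memLp j).1
      (h'.grad_memLp j).1 (h2 j) (h4 j)

/-- Integration by parts. -/
theorem IsH10.integral_mul {D : FlowDomain d} {f g h : Sp d → ℝ} {G : Fin d → Sp d → ℝ}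
    (hf : D.IsH10 f G) {j : Fin d} (hw : D.IsWeakPartial j g h) (hg : MemLp g 2 D.vol)
    (hh : MemLp h 2 D.vol) : ∫ x, f x * h x ∂D.vol = -∫ x, G j x * g x ∂D.vol := by
  obtain ⟨φ, hφ, h1, h2⟩ := hf.approx
  have hz : ∀ u : Sp d → ℝ, Tendsto (fun _ : ℕ => eLpNorm (fun x => u x - u x) 2 D.vol) atTop (𝓝 0) := by
    intro u; simp
  have t1 := tendsto_integral_mul hf.memLp hh (fun n => (hφ n).memLp) (fun _ => hh) h1 (hz h)
  have t2 := tendsto_integral_mul (hf.grad_memLp j) hg (fun n => ((hφ n).pderiv j).memLp)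
    (fun _ => hg) (h2 j) (hz g)
  refine tendsto_nhds_unique t1 (t2.neg.congr fun n => ?_)
  have := hw (φ n) (hφ n)
  simp_rw [mul_comm (φ n _), mul_comm (NSAC.pderiv j (φ n) _)]
  linarith

theorem IsH10.integral_div {D : FlowDomain d} {f : Sp d → ℝ} {G : Fin d → Sp d → ℝ}
    (hf : D.IsH10 f G) {A : Sp d → Matrix (Fin d) (Fin d) ℝ} {V : Sp d → Sp d}
    (hw : D.IsWeakDiv A V) (hA : ∀ i j, MemLp (fun x => A x i j) 2 D.vol)
    (hV : ∀ i, MemLp (fun x => V x i) 2 D.vol) (i : Fin d) :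
    ∫ x, ∑ j, A x i j * G j x ∂D.vol = -∫ x, V x i * f x ∂D.vol := by
  obtain ⟨φ, hφ, h1, h2⟩ := hf.approx
  have hz : ∀ u : Sp d → ℝ, Tendsto (fun _ : ℕ => eLpNorm (fun x => u x - u x) 2 D.vol) atTop (𝓝 0) := by
    intro u; simp
  have t1 := tendsto_integral_mul (hV i) hf.memLp (fun _ => hV i) (fun n => (hφ n).memLp) (hz _) h1
  have t2 : ∀ j, Tendsto (fun n => ∫ x, A x i j * NSAC.pderiv j (φ n) x ∂D.vol) atTop
      (𝓝 (∫ x, A x i j * G j x ∂D.vol)) := fun j =>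
    tendsto_integral_mul (hA i j) (hf.grad_memLp j) (fun _ => hA i j)
      (fun n => ((hφ n).pderiv j).memLp) (hz _) (h2 j)
  have t3 := tendsto_finsetSum Finset.univ fun j _ => t2 j
  have e1 : ∫ x, ∑ j, A x i j * G j x ∂D.vol = ∑ j, ∫ x, A x i j * G j x ∂D.vol :=
    integral_finsetSum _ fun j _ => MemLp.integrable_mul (p := 2) (q := 2) (hA i j) (hf.grad_memLp j)
  rw [e1]
  refine tendsto_nhds_unique t3 (t1.neg.congr fun n => ?_)
  rw [← hw (φ n) (hφ n) i]
  exact integral_finsetSum _ fun j _ =>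
    MemLp.integrable_mul (p := 2) (q := 2) (hA i j) ((hφ n).pderiv j).memLp

/-- The products χₙf approximate f. The critical term f∇χₙ is bounded, since |f| ≤ B·dist and
dist·|∇χₙ| ≤ K, and vanishes eventually at each point, so dominated convergence applies. A C¹-close
smooth function with error 1/(n+1) then replaces the C¹ product. -/
theorem IsH10.of_hasFDerivAt (hd : 0 < d) (D : FlowDomain d) {f : Sp d → ℝ}
    {f' : Sp d → Sp d →L[ℝ] ℝ} {B : ℝ} (hf : ∀ x ∈ D.region, HasFDerivAt f (f' x) x)
    (hc' : ContinuousOn f' D.region) (hc : ContinuousOn f D.closedRegion) (hp : D.Periodic f)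
    (hB : ∀ x ∈ D.cell, ‖f' x‖ ≤ B) (hM : ∀ x ∈ D.cell, ‖f x‖ ≤ B)
    (hv : D.VanishesOnBoundary f) : D.IsH10 f fun j x => f' x (EuclideanSpace.single j 1) := by
  have hm : MemLp f 2 D.vol :=
    D.memLp_of_bdd (D.aestronglyMeasurable_vol (hc.mono D.region_subset_closedRegion)) hM
  have hgb : ∀ j, ∀ x ∈ D.cell, |f' x (EuclideanSpace.single j 1)| ≤ B := fun j x hx => by
    exact (norm_apply_single_le (f' x) j).trans (hB x hx)
  have hgc : ∀ j, ContinuousOn (fun x => f' x (EuclideanSpace.single j 1)) D.region := fun j =>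
    hc'.clm_apply continuousOn_const
  have hgm : ∀ j, MemLp (fun x => f' x (EuclideanSpace.single j 1)) 2 D.vol := fun j =>
    D.memLp_of_bdd (D.aestronglyMeasurable_vol (hgc j)) (hgb j)
  obtain ⟨χ, hχ1, -, hχ3, hχ4, hχ5, K, hK, hχ6⟩ := exists_cutoff hd D
  have hbd := norm_le_bdist hd D hf hB hM hc hv
  cases D with
  | torus =>
    exact IsH10.of_zeroTrace torus (G := fun x => WithLp.toLp 2 fun j => f' x (EuclideanSpace.single j 1))
      hm hgm (fun j => isWeakPartial_of_hasFDerivAt torus hf hc' hp j) trivial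
  | dirichlet Ω ho hb hcn =>
    refine ⟨hm, hgm, ?_⟩
    choose Ks hKs1 hKs2 hKs3 using hχ4
    have hz : ∀ n, ∀ x ∉ Ks n, (fun y => χ n y * f y) =ᶠ[𝓝 x] fun _ => 0 := by
      intro n x hx
      filter_upwards [(hKs1 n).isClosed.isOpen_compl.mem_nhds hx] with y hy
      rw [hKs3 n y hy, zero_mul]
    have hfC : ContDiffOn ℝ (0 + 1) f Ω := by
      rw [contDiffOn_succ_iff_fderiv_of_isOpen ho]
      exact ⟨fun x hx => (hf x hx).differentiableAt.differentiableWithinAt, by simp,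
        contDiffOn_zero.2 (hc'.congr fun x hx => (hf x hx).fderiv)⟩
    rw [zero_add] at hfC
    have hg : ∀ n, ContDiff ℝ 1 fun y => χ n y * f y := by
      intro n
      rw [contDiff_iff_contDiffAt]
      intro x
      by_cases hx : x ∈ Ω
      · exact ((hχ1 n).of_le (by norm_cast)).contDiffAt.mul (hfC.contDiffAt (ho.mem_nhds hx))
      · exact contDiffAt_const.congr_of_eventuallyEq (hz n x fun h => hx (hKs2 n h))
    have hts : ∀ n, tsupport (fun y => χ n y * f y) ⊆ Ks n := fun n =>
      closure_minimal (fun x hx => by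
        by_contra h
        exact hx (by simp [hKs3 n x h] )) (hKs1 n).isClosed
    have hcs : ∀ n, HasCompactSupport fun y => χ n y * f y := fun n =>
      (hKs1 n).of_isClosed_subset (isClosed_tsupport _) (hts n)
    choose ψ hψ1 hψ2 hψ3 hψ4 hψ5 using fun n : ℕ => exists_smooth_C1_approx ho (hg n) (hcs n)
      ((hts n).trans (hKs2 n)) (ε := 1 / (n + 1 : ℝ)) Nat.one_div_pos_of_nat
    have hfd : ∀ n, ∀ x ∈ Ω, fderiv ℝ (fun y => χ n y * f y) x = χ n x • f' x + f x • fderiv ℝ (χ n) x :=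
      fun n x hx => ((((hχ1 n).differentiable (by simp) x).hasFDerivAt).mul (hf x hx)).fderiv
    have hn1 : ∀ n : ℕ, 1 / (n + 1 : ℝ) ≤ 1 := fun n => by
      rw [div_le_one (by positivity)]; linarith [(Nat.cast_nonneg n : (0:ℝ) ≤ n)]
    have hlim := tendsto_one_div_add_atTop_nhds_zero_nat (𝕜 := ℝ)
    refine ⟨ψ, fun n => ⟨hψ1 n, hψ2 n, hψ3 n⟩, ?_, fun j => ?_⟩
    · refine tendsto_eLpNorm_zero_of_bdd (K := 1 + (B + B)) (fun n => (hψ1 n).continuous.aestronglyMeasurable.sub hm.1)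
        (fun n => ?_) ?_
      · filter_upwards [ae_vol_mem _] with x hx
        have h1 := hψ4 n x
        have h2 : |χ n x * f x| ≤ B := by
          rw [abs_mul]
          exact (mul_le_of_le_one_left (abs_nonneg _) (hχ3 n x)).trans (hM x hx)
        have h3 := hM x hx
        rw [Real.norm_eq_abs] at h3
        have h4 := hn1 n
        rw [abs_le] at *
        constructor <;> linarith
      · filter_upwards [ae_vol_mem _] with x hx
        refine squeeze_zero_norm' ?_ hlim
        filter_upwards [hχ5 x hx] with n hn
        have := hψ4 n x
        rwa [hn.1, one_mul] at this
    · have hap : ∀ n x, |NSAC.pderiv j (ψ n) x - fderiv ℝ (fun y => χ n y * f y) x (EuclideanSpace.single j 1)| ≤ 1 / (n + 1 : ℝ) := by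
        intro n x
        exact (norm_apply_single_le (fderiv ℝ (ψ n) x - fderiv ℝ (fun y => χ n y * f y) x) j).trans (hψ5 n x)
      refine tendsto_eLpNorm_zero_of_bdd (K := 1 + (B + B * K + B)) (fun n => (continuous_pderiv (hψ1 n) j).aestronglyMeasurable.sub (hgm j).1)
        (fun n => ?_) ?_
      · filter_upwards [ae_vol_mem _] with x hx
        have h1 := hap n x
        rw [hfd n x hx] at h1
        have h2 : |(χ n x • f' x + f x • fderiv ℝ (χ n) x) (EuclideanSpace.single j 1)| ≤ B + B * K := by
          refine (norm_apply_single_le (χ n x • f' x + f x • fderiv ℝ (χ n) x) j).trans ((norm_add_le _ _).trans (add_le_add ?_ ?_))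
          · rw [norm_smul]
            exact (mul_le_of_le_one_left (norm_nonneg _) (hχ3 n x)).trans (hB x hx)
          · rw [norm_smul]
            have h3 := hbd x hx
            have hB0 : 0 ≤ B := (norm_nonneg _).trans (hM x hx)
            calc _ ≤ B * bdist _ x * ‖fderiv ℝ (χ n) x‖ := by gcongr
              _ = B * (bdist _ x * ‖fderiv ℝ (χ n) x‖) := by ring
              _ ≤ _ := by gcongr; exact hχ6 n x
        have h3 := hgb j x hx
        have h4 := hn1 n
        rw [abs_le] at *
        constructor <;> linarith
      · filter_upwards [ae_vol_mem _] with x hx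
        refine squeeze_zero_norm' ?_ hlim
        filter_upwards [hχ5 x hx] with n hn
        have := hap n x
        rwa [hfd n x hx, hn.1, hn.2, one_smul, smul_zero, add_zero] at this

end FlowDomain


/-! ### Bookkeeping of integrals with known values -/

/-- `f` is integrable with integral `I`. -/
def HasInt {α : Type*} [MeasurableSpace α] (μ : Measure α) (f : α → ℝ) (I : ℝ) : Prop :=
  Integrable f μ ∧ ∫ x, f x ∂μ = I

namespace HasInt

variable {α : Type*} [MeasurableSpace α] {μ : Measure α} {f g : α → ℝ} {I J : ℝ}

theorem _root_.MeasureTheory.Integrable.hasInt (h : Integrable f μ) : HasInt μ f (∫ x, f x ∂μ) :=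
  ⟨h, rfl⟩

theorem add (h : HasInt μ f I) (h' : HasInt μ g J) : HasInt μ (fun x => f x + g x) (I + J) :=
  ⟨h.1.add h'.1, (integral_add h.1 h'.1).trans (by rw [h.2, h'.2])⟩

theorem sub (h : HasInt μ f I) (h' : HasInt μ g J) : HasInt μ (fun x => f x - g x) (I - J) :=
  ⟨h.1.sub h'.1, (integral_sub h.1 h'.1).trans (by rw [h.2, h'.2])⟩

theorem neg (h : HasInt μ f I) : HasInt μ (fun x => -f x) (-I) :=
  ⟨h.1.neg, (integral_neg _).trans (by rw [h.2])⟩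

theorem const_mul (h : HasInt μ f I) (c : ℝ) : HasInt μ (fun x => c * f x) (c * I) :=
  ⟨h.1.const_mul c, (integral_const_mul _ _).trans (by rw [h.2])⟩

theorem const [IsFiniteMeasure μ] (c : ℝ) : HasInt μ (fun _ => c) (μ.real univ * c) :=
  ⟨integrable_const c, by rw [integral_const, smul_eq_mul]⟩

theorem sum {ι : Type*} (s : Finset ι) {f : ι → α → ℝ} {I : ι → ℝ} (h : ∀ i, HasInt μ (f i) (I i)) :
    HasInt μ (fun x => ∑ i ∈ s, f i x) (∑ i ∈ s, I i) :=
  ⟨integrable_finsetSum _ fun i _ => (h i).1,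
    (integral_finsetSum _ fun i _ => (h i).1).trans (Finset.sum_congr rfl fun i _ => (h i).2)⟩

theorem congr_ae (h : HasInt μ f I) (hfg : f =ᵐ[μ] g) : HasInt μ g I :=
  ⟨h.1.congr hfg, (integral_congr_ae hfg.symm).trans h.2⟩

theorem congr (h : HasInt μ f I) (hfg : ∀ x, f x = g x) : HasInt μ g I :=
  h.congr_ae (Eventually.of_forall hfg)

theorem congr_val (h : HasInt μ f I) (hIJ : I = J) : HasInt μ f J := hIJ ▸ h

theorem unique (h : HasInt μ f I) (h' : HasInt μ f J) : I = J := h.2.symm.trans h'.2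

theorem mono_ae (h : HasInt μ f I) (h' : HasInt μ g J) (hle : ∀ᵐ x ∂μ, f x ≤ g x) : I ≤ J := by
  rw [← h.2, ← h'.2]; exact integral_mono_ae h.1 h'.1 hle

end HasInt

theorem ddot_stress (L : FluidLaw) {d : ℕ} (A B : Matrix (Fin d) (Fin d) ℝ) :
    ddot (L.stress A) B = L.nu * (ddot A B + ddot A.transpose B - 2 / d * (A.trace * B.trace))
      + L.lam * (A.trace * B.trace) := by
  have h1 : ddot (1 : Matrix (Fin d) (Fin d) ℝ) B = B.trace := by
    simp [ddot, Matrix.trace, Matrix.one_apply]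
  have h2 : ddot (L.stress A) B = L.nu * (ddot A B + ddot A.transpose B - 2 / d * A.trace * ddot 1 B)
      + L.lam * A.trace * ddot 1 B := by
    simp only [ddot, FluidLaw.stress, Matrix.add_apply, Matrix.smul_apply, Matrix.sub_apply,
      smul_eq_mul, Finset.mul_sum, ← Finset.sum_add_distrib, ← Finset.sum_sub_distrib]
    refine Finset.sum_congr rfl fun i _ => Finset.sum_congr rfl fun j _ => ?_
    ring
  rw [h2, h1]
  ring

/-! ### Inequalities of Korn and Poincaré -/

namespace FlowDomain

variable {d : ℕ}

theorem SmoothTest.periodic {D : FlowDomain d} {φ : Sp d → ℝ} (h : D.SmoothTest φ) : D.Periodic φ := by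
  cases D with
  | torus => exact h.2
  | dirichlet => trivial

theorem SmoothTest.isWeakPartial {D : FlowDomain d} {φ : Sp d → ℝ} (h : D.SmoothTest φ) (j : Fin d) :
    D.IsWeakPartial j φ (NSAC.pderiv j φ) :=
  isWeakPartial_of_hasFDerivAt D (fun x _ => (h.differentiable x).hasFDerivAt)
    (h.contDiff.continuous_fderiv (by simp)).continuousOn h.periodic j

theorem pderiv_comm {φ : Sp d → ℝ} (h : ContDiff ℝ ∞ φ) (i j : Fin d) :
    pderiv i (pderiv j φ) = pderiv j (pderiv i φ) := by
  have key : ∀ i j x, pderiv i (pderiv j φ) x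
      = fderiv ℝ (fderiv ℝ φ) x (EuclideanSpace.single i 1) (EuclideanSpace.single j 1) := by
    intro i j x
    have h1 : DifferentiableAt ℝ (fderiv ℝ φ) x :=
      (h.fderiv_right (m := 1) (by norm_cast)).differentiable (by simp) x
    have := h1.hasFDerivAt.clm_apply (hasFDerivAt_const (EuclideanSpace.single j (1:ℝ)) x)
    change fderiv ℝ (fun y => fderiv ℝ φ y (EuclideanSpace.single j 1)) x _ = _
    rw [this.fderiv]
    simp
  ext x
  rw [key, key]
  exact (h.contDiffAt (x := x)).isSymmSndFDerivAt (by
    simp only [minSmoothness_of_isRCLikeNormedField]; norm_cast) _ _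

/-- Both sides equal −∫ φ ∂_i∂_jη. -/
theorem SmoothTest.integral_pderiv_comm {D : FlowDomain d} {φ η : Sp d → ℝ} (h : D.SmoothTest φ)
    (h' : D.SmoothTest η) (i j : Fin d) :
    ∫ x, NSAC.pderiv j φ x * NSAC.pderiv i η x ∂D.vol
      = ∫ x, NSAC.pderiv i φ x * NSAC.pderiv j η x ∂D.vol := by
  have h1 := h.isWeakPartial j _ (h'.pderiv i)
  have h2 := h.isWeakPartial i _ (h'.pderiv j)
  rw [pderiv_comm h'.contDiff i j] at h2
  linarith

theorem IsH10.integral_grad_comm {D : FlowDomain d} {f g : Sp d → ℝ} {F G : Fin d → Sp d → ℝ}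
    (h : D.IsH10 f F) (h' : D.IsH10 g G) (i j : Fin d) :
    ∫ x, F j x * G i x ∂D.vol = ∫ x, F i x * G j x ∂D.vol := by
  obtain ⟨φ, hφ, -, h2⟩ := h.approx
  obtain ⟨ψ, hψ, -, h4⟩ := h'.approx
  have t : ∀ i j, Tendsto (fun n => ∫ x, NSAC.pderiv j (φ n) x * NSAC.pderiv i (ψ n) x ∂D.vol) atTop
      (𝓝 (∫ x, F j x * G i x ∂D.vol)) := fun i j =>
    tendsto_integral_mul (h.grad_memLp j) (h'.grad_memLp i) (fun n => ((hφ n).pderiv j).memLp)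
      (fun n => ((hψ n).pderiv i).memLp) (h2 j) (h4 i)
  exact tendsto_nhds_unique (t i j) ((t j i).congr fun n => ((hφ n).integral_pderiv_comm (hψ n) i j).symm)

theorem IsH10.isWeakPartial {D : FlowDomain d} {f : Sp d → ℝ} {G : Fin d → Sp d → ℝ}
    (hf : D.IsH10 f G) (j : Fin d) : D.IsWeakPartial j f (G j) := fun _ hφ =>
  hf.integral_mul (hφ.isWeakPartial j) hφ.memLp (hφ.pderiv j).memLp

/-- Korn's inequality. -/
theorem korn (L : FluidLaw) (hd : 2 ≤ d) {D : FlowDomain d} {v : Fin d → Sp d → ℝ}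
    {A : Sp d → Matrix (Fin d) (Fin d) ℝ} (h : ∀ i, D.IsH10 (v i) fun j x => A x i j) :
    L.nu * ∑ i, ∑ j, ∫ x, A x i j ^ 2 ∂D.vol ≤ ∫ x, ddot (L.stress (A x)) (A x) ∂D.vol := by
  have hm : ∀ i j k l, Integrable (fun x => A x i j * A x k l) D.vol := fun i j k l =>
    MemLp.integrable_mul (p := 2) (q := 2) ((h i).grad_memLp j) ((h k).grad_memLp l)
  have e1 : ∫ x, ddot (A x) (A x) ∂D.vol = ∑ i, ∑ j, ∫ x, A x i j ^ 2 ∂D.vol := by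
    simp only [ddot]
    rw [integral_finsetSum _ fun i _ => integrable_finsetSum _ fun j _ => hm i j i j]
    refine Finset.sum_congr rfl fun i _ => ?_
    rw [integral_finsetSum _ fun j _ => hm i j i j]
    simp only [sq]
  -- Exchanging the two derivatives in ∫ ∂_iv_j ∂_jv_i produces the square of the divergence; no
  -- boundary term appears in the closure of the test functions.
  have e2 : ∫ x, ddot (A x).transpose (A x) ∂D.vol = ∫ x, (A x).trace * (A x).trace ∂D.vol := by
    simp only [ddot, Matrix.transpose_apply, Matrix.trace, Matrix.diag_apply, Finset.sum_mul_sum]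
    rw [integral_finsetSum _ fun i _ => integrable_finsetSum _ fun j _ => hm j i i j,
      integral_finsetSum _ fun i _ => integrable_finsetSum _ fun j _ => hm i i j j]
    refine Finset.sum_congr rfl fun i _ => ?_
    rw [integral_finsetSum _ fun j _ => hm j i i j, integral_finsetSum _ fun j _ => hm i i j j]
    refine Finset.sum_congr rfl fun j _ => ?_
    rw [(h i).integral_grad_comm (h j) j i]
    simp only [mul_comm]
  have i1 : Integrable (fun x => ddot (A x) (A x)) D.vol :=
    integrable_finsetSum _ fun i _ => integrable_finsetSum _ fun j _ => hm i j i j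
  have i2 : Integrable (fun x => ddot (A x).transpose (A x)) D.vol :=
    integrable_finsetSum _ fun i _ => integrable_finsetSum _ fun j _ => hm j i i j
  have i3 : Integrable (fun x => (A x).trace * (A x).trace) D.vol := by
    simp only [Matrix.trace, Matrix.diag_apply, Finset.sum_mul_sum]
    exact integrable_finsetSum _ fun i _ => integrable_finsetSum _ fun j _ => hm i i j j
  have h0 : 0 ≤ ∫ x, (A x).trace * (A x).trace ∂D.vol :=
    integral_nonneg fun x => mul_self_nonneg _
  simp only [ddot_stress]
  rw [(((((i1.hasInt.congr_val e1).add (i2.hasInt.congr_val e2)).sub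
    (i3.hasInt.const_mul (2 / d))).const_mul L.nu).add (i3.hasInt.const_mul L.lam)).2]
  -- Besides ν∫|A|² there remains (ν(1 − 2/d) + λ)∫(tr A)², which is nonnegative because d ≥ 2.
  have hd' : (2 : ℝ) / d ≤ 1 := by
    rw [div_le_one (by positivity)]
    exact_mod_cast hd
  nlinarith [mul_nonneg L.nu_pos.le (mul_nonneg (sub_nonneg.2 hd') h0), mul_nonneg L.lam_nonneg h0]

theorem SmoothTest.mul {D : FlowDomain d} {φ ψ : Sp d → ℝ} (h : D.SmoothTest φ)
    (h' : D.SmoothTest ψ) : D.SmoothTest fun x => φ x * ψ x := by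
  cases D with
  | torus => exact ⟨h.1.mul h'.1, fun x i => congrArg₂ (· * ·) (h.2 x i) (h'.2 x i)⟩
  | dirichlet Ω h1 h2 h3 =>
    exact ⟨h.1.mul h'.1, h.2.1.mul_right, (tsupport_mul_subset_left).trans h.2.2⟩

/-- Poincaré's inequality on a bounded domain. -/
theorem exists_poincare_dirichlet (hd : 0 < d) (Ω : Set (Sp d)) (ho hb hc) :
    ∃ K, 0 ≤ K ∧ ∀ f G, (dirichlet Ω ho hb hc).IsH10 f G →
      ∫ x, f x ^ 2 ∂(dirichlet Ω ho hb hc).vol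
        ≤ K * ∑ j, ∫ x, G j x ^ 2 ∂(dirichlet Ω ho hb hc).vol := by
  set D := dirichlet Ω ho hb hc with hD
  set i : Fin d := ⟨0, hd⟩
  obtain ⟨B, hB⟩ := hb.exists_norm_le
  have hB0 : ∀ x ∈ D.cell, |x i| ≤ B := fun x hx => (PiLp.norm_apply_le x i).trans (hB x hx)
  have hproj : ∀ x : Sp d, HasFDerivAt (fun y : Sp d => y i) (EuclideanSpace.proj i : Sp d →L[ℝ] ℝ) x :=
    fun x => (EuclideanSpace.proj i : Sp d →L[ℝ] ℝ).hasFDerivAt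
  have hx := isWeakPartial_of_hasFDerivAt D (fun x _ => hproj x) continuousOn_const trivial i
  have key : ∀ φ, D.SmoothTest φ → ∫ x, φ x * φ x ∂D.vol
      ≤ 4 * B ^ 2 * ∫ x, NSAC.pderiv i φ x * NSAC.pderiv i φ x ∂D.vol := by
    intro φ hφ
    -- Since the i-th derivative of the coordinate x_i is 1, integration by parts gives ∫φ² = −2∫
    -- x_i φ ∂_iφ, and |x_i| ≤ B on the bounded domain.
    have h1 := hx _ (hφ.mul hφ)
    have e : ∀ x, NSAC.pderiv i (fun x => φ x * φ x) x = 2 * φ x * NSAC.pderiv i φ x := by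
      intro x
      have := ((hφ.differentiable x).hasFDerivAt.mul (hφ.differentiable x).hasFDerivAt).fderiv
      change fderiv ℝ (φ * φ) x _ = _
      rw [this]
      simp [NSAC.pderiv]; ring
    have e1 : (EuclideanSpace.proj i : Sp d →L[ℝ] ℝ) (EuclideanSpace.single i 1) = 1 := by simp
    simp only [e, e1, one_mul] at h1
    have m1 := hφ.memLp (p := 2)
    have m2 := (hφ.pderiv i).memLp (p := 2)
    have j1 : Integrable (fun x => φ x * φ x) D.vol := MemLp.integrable_mul (p := 2) (q := 2) m1 m1
    have j2 : Integrable (fun x => NSAC.pderiv i φ x * NSAC.pderiv i φ x) D.vol :=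
      MemLp.integrable_mul (p := 2) (q := 2) m2 m2
    have h2 : -∫ x, x i * (2 * φ x * NSAC.pderiv i φ x) ∂D.vol
        ≤ ∫ x, (1 / 2 * (φ x * φ x) + 2 * B ^ 2 * (NSAC.pderiv i φ x * NSAC.pderiv i φ x)) ∂D.vol := by
      rw [← integral_neg]
      refine integral_mono_ae ?_ ((j1.const_mul _).add (j2.const_mul _)) ?_
      · refine Integrable.neg (MemLp.integrable (q := 1) le_rfl ?_)
        refine D.memLp_of_continuous ?_
        exact (EuclideanSpace.proj i : Sp d →L[ℝ] ℝ).continuous.mul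
          ((continuous_const.mul hφ.continuous).mul (hφ.pderiv i).continuous)
      · filter_upwards [D.ae_vol_mem] with x hx
        have h3 := hB0 x hx
        have h4 : (x i) ^ 2 ≤ B ^ 2 := sq_le_sq' (abs_le.1 h3).1 (abs_le.1 h3).2
        change -(x i * (2 * φ x * NSAC.pderiv i φ x)) ≤ _
        nlinarith [sq_nonneg (φ x + 2 * x i * NSAC.pderiv i φ x), mul_nonneg (sub_nonneg.2 h4) (sq_nonneg (NSAC.pderiv i φ x))]
    rw [integral_add (j1.const_mul _) (j2.const_mul _), integral_const_mul, integral_const_mul] at h2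
    linarith
  refine ⟨4 * B ^ 2, by positivity, fun f G hf => ?_⟩
  obtain ⟨φ, hφ, h1, h2⟩ := hf.approx
  have t1 := tendsto_integral_mul hf.memLp hf.memLp (fun n => (hφ n).memLp) (fun n => (hφ n).memLp) h1 h1
  have t2 := tendsto_integral_mul (hf.grad_memLp i) (hf.grad_memLp i) (fun n => ((hφ n).pderiv i).memLp)
    (fun n => ((hφ n).pderiv i).memLp) (h2 i) (h2 i)
  have h3 := le_of_tendsto_of_tendsto' t1 (t2.const_mul (4 * B ^ 2)) fun n => key _ (hφ n)
  simp only [← sq] at h3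
  refine h3.trans (mul_le_mul_of_nonneg_left ?_ (by positivity))
  exact Finset.single_le_sum (f := fun j => ∫ x, G j x ^ 2 ∂D.vol)
    (fun j _ => integral_nonneg fun x => sq_nonneg _) (Finset.mem_univ i)

theorem vol_torus_univ : (torus (d := d)).vol.real univ = 2 ^ d := by
  have h1 := (PiLp.volume_preserving_toLp (Fin d)).measure_preimage
    (torus (d := d)).measurableSet_cell.nullMeasurableSet
  rw [toLp_preimage_cell] at h1
  rw [vol, Measure.real, Measure.restrict_apply_univ, ← h1, Real.volume_pi_Ico]
  norm_num [ENNReal.toReal_prod]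

/-- Only the mean m of f escapes the zero-mean inequality. On A one has m² ≤ 2f² + 2(f−m)² and f² ≤
ϱf²/δ; integrating over A bounds a·m² by the weighted integral and the gradient. -/
theorem exists_poincare_torus {a δ : ℝ} (ha : 0 < a) (hδ : 0 < δ) :
    ∃ K, 0 ≤ K ∧ ∀ (f ϱ : Sp d → ℝ) (G : Fin d → Sp d → ℝ) (A : Set (Sp d)), (torus (d := d)).IsH10 f G →
      (∀ᵐ x ∂(torus (d := d)).vol, 0 ≤ ϱ x) → Integrable (fun x => ϱ x * f x ^ 2) (torus (d := d)).vol →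
      MeasurableSet A → (∀ᵐ x ∂(torus (d := d)).vol, x ∈ A → δ ≤ ϱ x) → a ≤ (torus (d := d)).vol.real A →
      ∫ x, f x ^ 2 ∂(torus (d := d)).vol
        ≤ K * (∑ j, ∫ x, G j x ^ 2 ∂(torus (d := d)).vol + ∫ x, ϱ x * f x ^ 2 ∂(torus (d := d)).vol) := by
  set μ := (torus (d := d)).vol with hμ
  set V : ℝ := 2 ^ d with hV
  have hV0 : 0 < V := by positivity
  refine ⟨2 * V / a / δ + 2 * V / a + 1, by positivity, fun f ϱ G A hf hϱ hi hA hδA haA => ?_⟩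
  have hp := poincare_torus (G := fun x => WithLp.toLp 2 fun j => G j x) hf.memLp hf.grad_memLp
    fun j => hf.isWeakPartial j
  have hp' : ∫ x, f x ^ 2 ∂μ ≤ V⁻¹ * (∫ x, f x ∂μ) ^ 2 + ∑ j, ∫ x, G j x ^ 2 ∂μ := hp
  set S := ∑ j, ∫ x, G j x ^ 2 ∂μ with hS
  set J := ∫ x, ϱ x * f x ^ 2 ∂μ with hJ
  set m := V⁻¹ * ∫ x, f x ∂μ with hm
  have i2 : Integrable (fun x => f x ^ 2) μ := hf.memLp.integrable_sq
  have i1 : Integrable f μ := hf.memLp.integrable (by norm_num)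
  have i3 : Integrable (fun x => (f x - m) ^ 2) μ := (hf.memLp.sub (memLp_const m)).integrable_sq
  have hVm : V * m = ∫ x, f x ∂μ := by rw [hm]; field_simp
  have e1 : ∫ x, (f x - m) ^ 2 ∂μ = ∫ x, f x ^ 2 ∂μ - V * m ^ 2 := by
    have : ∀ x, (f x - m) ^ 2 = f x ^ 2 - 2 * m * f x + m ^ 2 := fun x => by ring
    simp only [this]
    rw [((i2.hasInt.sub (i1.hasInt.const_mul (2 * m))).add (HasInt.const (m ^ 2))).2,
      vol_torus_univ, ← hVm]
    ring
  have h1 : ∫ x, (f x - m) ^ 2 ∂μ ≤ S := by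
    rw [e1]
    have : V⁻¹ * (∫ x, f x ∂μ) ^ 2 = V * m ^ 2 := by rw [← hVm]; field_simp
    linarith
  have hJ0 : 0 ≤ J := integral_nonneg_of_ae (by filter_upwards [hϱ] with x hx; positivity)
  have hS0 : 0 ≤ S := (integral_nonneg fun x => sq_nonneg _).trans h1
  have h2 : a * m ^ 2 ≤ 2 / δ * J + 2 * S := by
    calc a * m ^ 2 ≤ μ.real A * m ^ 2 := by gcongr
      _ = ∫ _ in A, m ^ 2 ∂μ := by rw [setIntegral_const, smul_eq_mul]
      _ ≤ ∫ x in A, (2 / δ * (ϱ x * f x ^ 2) + 2 * (f x - m) ^ 2) ∂μ := by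
          refine setIntegral_mono_ae_restrict (integrable_const _).integrableOn
            ((hi.const_mul _).add (i3.const_mul _)).integrableOn ?_
          filter_upwards [ae_restrict_of_ae hδA, ae_restrict_mem hA] with x hx hxA
          have h5 : 2 / δ * (ϱ x * f x ^ 2) ≥ 2 * f x ^ 2 := by
            rw [ge_iff_le, div_mul_eq_mul_div, le_div_iff₀ hδ]
            nlinarith [mul_nonneg (sub_nonneg.2 (hx hxA)) (sq_nonneg (f x))]
          nlinarith [sq_nonneg (f x - (f x - m) - 2 * f x + (f x - m)), sq_nonneg (f x + (f x - m))]
      _ ≤ ∫ x, (2 / δ * (ϱ x * f x ^ 2) + 2 * (f x - m) ^ 2) ∂μ := by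
          refine setIntegral_le_integral ((hi.const_mul _).add (i3.const_mul _)) ?_
          filter_upwards [hϱ] with x hx
          change (0:ℝ) ≤ _
          positivity
      _ = 2 / δ * J + 2 * ∫ x, (f x - m) ^ 2 ∂μ := by
          rw [integral_add (hi.const_mul _) (i3.const_mul _), integral_const_mul, integral_const_mul]
      _ ≤ _ := by gcongr
  have h3 : ∫ x, f x ^ 2 ∂μ ≤ V * m ^ 2 + S := by linarith
  have h4 : m ^ 2 ≤ (2 / δ * J + 2 * S) / a := by
    rw [le_div_iff₀ ha]; linarith
  calc _ ≤ V * ((2 / δ * J + 2 * S) / a) + S := by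
        refine h3.trans ?_; gcongr
    _ = 2 * V / a / δ * J + (2 * V / a + 1) * S := by field_simp; ring
    _ ≤ _ := by
        have q1 : 0 ≤ 2 * V / a / δ * S := by positivity
        have q2 : 0 ≤ (2 * V / a + 1) * J := by positivity
        linarith

/-- A Poincaré inequality that needs no zero mean on the torus, provided that the weight `ϱ` is
bounded from below on a set of positive measure. -/
theorem exists_poincare (hd : 0 < d) (D : FlowDomain d) {a δ : ℝ} (ha : 0 < a) (hδ : 0 < δ) :
    ∃ K, 0 ≤ K ∧ ∀ (f ϱ : Sp d → ℝ) (G : Fin d → Sp d → ℝ) (A : Set (Sp d)), D.IsH10 f G →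
      (∀ᵐ x ∂D.vol, 0 ≤ ϱ x) → Integrable (fun x => ϱ x * f x ^ 2) D.vol →
      MeasurableSet A → (∀ᵐ x ∂D.vol, x ∈ A → δ ≤ ϱ x) → a ≤ D.vol.real A →
      ∫ x, f x ^ 2 ∂D.vol ≤ K * (∑ j, ∫ x, G j x ^ 2 ∂D.vol + ∫ x, ϱ x * f x ^ 2 ∂D.vol) := by
  cases D with
  | torus => exact exists_poincare_torus ha hδ
  | dirichlet Ω ho hb hc =>
    obtain ⟨K, hK, h⟩ := exists_poincare_dirichlet hd Ω ho hb hc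
    refine ⟨K, hK, fun f ϱ G A hf hϱ _ _ _ _ => (h f G hf).trans (mul_le_mul_of_nonneg_left ?_ hK)⟩
    refine le_add_of_nonneg_right (integral_nonneg_of_ae ?_)
    filter_upwards [hϱ] with x hx
    change (0:ℝ) ≤ _
    positivity

end FlowDomain


/-! ### C¹ functions on the closed cylinder, periodization and the fundamental lemma -/

namespace FlowDomain

variable {d : ℕ} {V : Type*} [NormedAddCommGroup V] [NormedSpace ℝ V]
  {W : Type*} [NormedAddCommGroup W] [NormedSpace ℝ W]

/-- `f ∈ C¹([0,T] × closure Ω; V)` with the derivatives displayed. -/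
structure C1Data (D : FlowDomain d) (T : ℝ) (f : ℝ → Sp d → V) (ft : ℝ → Sp d → V)
    (fx : ℝ → Sp d → Sp d →L[ℝ] V) : Prop where
  cont : ContinuousOn (Function.uncurry f) (Icc 0 T ×ˢ D.closedRegion)
  per : ∀ t ∈ Icc 0 T, D.Periodic (f t)
  cont_t : ContinuousOn (Function.uncurry ft) (Icc 0 T ×ˢ D.closedRegion)
  cont_x : ContinuousOn (Function.uncurry fx) (Icc 0 T ×ˢ D.closedRegion)
  hasDerivAt : ∀ t ∈ Ioo 0 T, ∀ x ∈ D.region, HasDerivAt (fun s => f s x) (ft t x) t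
  hasFDerivAt : ∀ t ∈ Ioo 0 T, ∀ x ∈ D.region, HasFDerivAt (f t) (fx t x) x

theorem C1UpTo.exists_data {D : FlowDomain d} {T : ℝ} {f : ℝ → Sp d → V} (h : D.C1UpTo T f) :
    ∃ ft fx, D.C1Data T f ft fx := by
  obtain ⟨⟨h1, h2⟩, ft, fx, h3, h4, h5⟩ := h
  exact ⟨ft, fx, h1, h2, h3, h4, fun t ht x hx => (h5 t ht x hx).1, fun t ht x hx => (h5 t ht x hx).2⟩

theorem aestronglyMeasurable_spaceTime {E : Type*} [NormedAddCommGroup E] {D : FlowDomain d} {T : ℝ} {f : ℝ → Sp d → E}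
    (h : ContinuousOn (Function.uncurry f) (Icc 0 T ×ˢ D.closedRegion)) :
    AEStronglyMeasurable (fun z : ℝ × Sp d => f z.1 z.2) (D.spaceTime T) := by
  rw [spaceTime_eq]
  exact (h.mono (prod_mono Ioo_subset_Icc_self
    (D.cell_subset_region.trans D.region_subset_closedRegion))).aestronglyMeasurable
    (measurableSet_Ioo.prod D.measurableSet_cell)

theorem exists_bound_of_continuousOn {E : Type*} [NormedAddCommGroup E] {D : FlowDomain d} {T : ℝ} {f : ℝ → Sp d → E}
    (h : ContinuousOn (Function.uncurry f) (Icc 0 T ×ˢ D.closedRegion)) :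
    ∃ B, 0 ≤ B ∧ ∀ t ∈ Icc 0 T, ∀ x ∈ D.cell, ‖f t x‖ ≤ B := by
  obtain ⟨B, hB⟩ := (isCompact_Icc.prod D.isCompact_closure_cell).exists_bound_of_continuousOn
    (h.mono (prod_mono_right D.closure_cell_subset))
  exact ⟨max B 0, le_max_right _ _, fun t ht x hx => (hB (t, x) ⟨ht, subset_closure hx⟩).trans (le_max_left _ _)⟩

theorem continuousOn_slice {E : Type*} [NormedAddCommGroup E] {D : FlowDomain d} {T : ℝ} {f : ℝ → Sp d → E}
    (h : ContinuousOn (Function.uncurry f) (Icc 0 T ×ˢ D.closedRegion)) {t : ℝ} (ht : t ∈ Icc 0 T) :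
    ContinuousOn (f t) D.closedRegion :=
  h.comp (f := fun x => (t, x)) (by fun_prop) fun _ hx => ⟨ht, hx⟩

theorem continuousOn_time {E : Type*} [NormedAddCommGroup E] {D : FlowDomain d} {T : ℝ} {f : ℝ → Sp d → E}
    (h : ContinuousOn (Function.uncurry f) (Icc 0 T ×ˢ D.closedRegion)) {x : Sp d}
    (hx : x ∈ D.closedRegion) : ContinuousOn (fun t => f t x) (Icc 0 T) :=
  h.comp (f := fun t => (t, x)) (by fun_prop) fun _ ht => ⟨ht, hx⟩

theorem Periodic.comp₂ {X Y Z : Type*} {D : FlowDomain d} {f : Sp d → X} {g : Sp d → Y}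
    (hf : D.Periodic f) (hg : D.Periodic g) (Φ : X → Y → Z) : D.Periodic fun x => Φ (f x) (g x) := by
  cases D with
  | torus => exact fun x i => congrArg₂ Φ (hf x i) (hg x i)
  | dirichlet => trivial

theorem Periodic.comp {X Z : Type*} {D : FlowDomain d} {f : Sp d → X}
    (hf : D.Periodic f) (Φ : X → Z) : D.Periodic fun x => Φ (f x) :=
  hf.comp₂ hf fun a _ => Φ a

theorem periodic_const {X : Type*} (D : FlowDomain d) (a : X) : D.Periodic fun _ => a := by
  cases D with
  | torus => exact fun _ _ => rfl
  | dirichlet => trivial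

namespace C1Data

variable {D : FlowDomain d} {T : ℝ} {f ft : ℝ → Sp d → V} {fx : ℝ → Sp d → Sp d →L[ℝ] V}

theorem c1UpTo (h : D.C1Data T f ft fx) : D.C1UpTo T f :=
  ⟨⟨h.cont, h.per⟩, ft, fx, h.cont_t, h.cont_x, fun t ht x hx => ⟨h.hasDerivAt t ht x hx, h.hasFDerivAt t ht x hx⟩⟩

theorem time (D : FlowDomain d) (T : ℝ) {A A' : ℝ → ℝ} (hA : ∀ t, HasDerivAt A (A' t) t)
    (hA' : Continuous A') : D.C1Data T (fun t _ => A t) (fun t _ => A' t) fun _ _ => 0 where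
  cont := by
    have : Continuous A := continuous_iff_continuousAt.2 fun t => (hA t).continuousAt
    exact (this.comp continuous_fst).continuousOn
  per _ _ := periodic_const D _
  cont_t := (hA'.comp continuous_fst).continuousOn
  cont_x := continuousOn_const
  hasDerivAt t _ _ _ := hA t
  hasFDerivAt _ _ x _ := hasFDerivAt_const _ x

theorem space (D : FlowDomain d) (T : ℝ) {b : Sp d → ℝ} (hb : ContDiff ℝ ∞ b) (hp : D.Periodic b) :
    D.C1Data T (fun _ x => b x) (fun _ _ => 0) fun _ x => fderiv ℝ b x where
  cont := (hb.continuous.comp continuous_snd).continuousOn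
  per _ _ := hp
  cont_t := continuousOn_const
  cont_x := ((hb.continuous_fderiv (by simp)).comp continuous_snd).continuousOn
  hasDerivAt t _ _ _ := hasDerivAt_const t _
  hasFDerivAt _ _ x _ := (hb.differentiable (by simp) x).hasFDerivAt

theorem smul {a at' : ℝ → Sp d → ℝ} {ax : ℝ → Sp d → Sp d →L[ℝ] ℝ} (ha : D.C1Data T a at' ax)
    (h : D.C1Data T f ft fx) :
    D.C1Data T (fun t x => a t x • f t x) (fun t x => a t x • ft t x + at' t x • f t x)
      fun t x => a t x • fx t x + (ax t x).smulRight (f t x) where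
  cont := ha.cont.smul h.cont
  per t ht := (ha.per t ht).comp₂ (h.per t ht) fun r v => r • v
  cont_t := (ha.cont.smul h.cont_t).add (ha.cont_t.smul h.cont)
  cont_x := by
    refine (ha.cont.smul h.cont_x).add ?_
    exact ((ContinuousLinearMap.smulRightL ℝ (Sp d) V).continuous₂.comp_continuousOn
      (ha.cont_x.prodMk h.cont))
  hasDerivAt t ht x hx := (ha.hasDerivAt t ht x hx).smul (h.hasDerivAt t ht x hx)
  hasFDerivAt t ht x hx := (ha.hasFDerivAt t ht x hx).smul (h.hasFDerivAt t ht x hx)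

theorem clm (h : D.C1Data T f ft fx) (A : V →L[ℝ] W) : D.C1Data T (fun t x => A (f t x))
    (fun t x => A (ft t x)) fun t x => A ∘L fx t x where
  cont := A.continuous.comp_continuousOn h.cont
  per t ht := (h.per t ht).comp A
  cont_t := A.continuous.comp_continuousOn h.cont_t
  cont_x := (ContinuousLinearMap.compL ℝ (Sp d) V W A).continuous.comp_continuousOn h.cont_x
  hasDerivAt t ht x hx := A.hasFDerivAt.comp_hasDerivAt t (h.hasDerivAt t ht x hx)
  hasFDerivAt t ht x hx := A.hasFDerivAt.comp x (h.hasFDerivAt t ht x hx)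

theorem comp {a at' : ℝ → Sp d → ℝ} {ax : ℝ → Sp d → Sp d →L[ℝ] ℝ} (ha : D.C1Data T a at' ax)
    {Φ Φ' : ℝ → ℝ} {S : Set ℝ} (hΦ : ∀ s ∈ S, HasDerivAt Φ (Φ' s) s) (hΦ' : ContinuousOn Φ' S)
    (hS : ∀ t ∈ Icc 0 T, ∀ x ∈ D.closedRegion, a t x ∈ S) :
    D.C1Data T (fun t x => Φ (a t x)) (fun t x => Φ' (a t x) * at' t x)
      fun t x => Φ' (a t x) • ax t x where
  cont := ContinuousOn.comp (g := Φ) (fun s hs => (hΦ s hs).continuousAt.continuousWithinAt) ha.cont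
    fun z hz => hS z.1 hz.1 z.2 hz.2
  per t ht := (ha.per t ht).comp Φ
  cont_t := (hΦ'.comp ha.cont fun z hz => hS z.1 hz.1 z.2 hz.2).mul ha.cont_t
  cont_x := (hΦ'.comp ha.cont fun z hz => hS z.1 hz.1 z.2 hz.2).smul ha.cont_x
  hasDerivAt t ht x hx := (hΦ _ (hS t (Ioo_subset_Icc_self ht) x (D.region_subset_closedRegion hx))).comp t
    (ha.hasDerivAt t ht x hx)
  hasFDerivAt t ht x hx := (hΦ _ (hS t (Ioo_subset_Icc_self ht) x
    (D.region_subset_closedRegion hx))).comp_hasFDerivAt x (ha.hasFDerivAt t ht x hx)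

theorem tderiv_eq (h : D.C1Data T f ft fx) {t : ℝ} (ht : t ∈ Ioo 0 T) {x : Sp d} (hx : x ∈ D.region) :
    tderiv f t x = ft t x := (h.hasDerivAt t ht x hx).deriv

theorem exists_bound (h : D.C1Data T f ft fx) : ∃ B, 0 ≤ B ∧ ∀ t ∈ Icc 0 T, ∀ x ∈ D.cell,
    ‖f t x‖ ≤ B ∧ ‖ft t x‖ ≤ B ∧ ‖fx t x‖ ≤ B := by
  obtain ⟨B1, h1, h1'⟩ := exists_bound_of_continuousOn h.cont
  obtain ⟨B2, h2, h2'⟩ := exists_bound_of_continuousOn h.cont_t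
  obtain ⟨B3, h3, h3'⟩ := exists_bound_of_continuousOn h.cont_x
  exact ⟨B1 + B2 + B3, by positivity, fun t ht x hx => ⟨by linarith [h1' t ht x hx],
    by linarith [h2' t ht x hx], by linarith [h3' t ht x hx]⟩⟩

theorem testClosed {θ θ' : ℝ → ℝ} (h : D.C1Data T f ft fx) (hθ : ∀ t, HasDerivAt θ (θ' t) t)
    (hθ' : Continuous θ') {T' : ℝ} (hT' : T' < T) (h0 : ∀ t, T' ≤ t → θ t = 0) :
    D.TestClosed T fun t x => θ t • f t x :=
  ⟨((time D T hθ hθ').smul h).c1UpTo, T', hT', fun t _ ht x _ => by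
    change θ t • f t x = 0
    rw [h0 t ht, zero_smul]⟩

theorem pderiv_eq {a at' : ℝ → Sp d → ℝ} {ax : ℝ → Sp d → Sp d →L[ℝ] ℝ} (ha : D.C1Data T a at' ax)
    {t : ℝ} (ht : t ∈ Ioo 0 T) {x : Sp d} (hx : x ∈ D.region) (j : Fin d) :
    NSAC.pderiv j (a t) x = ax t x (EuclideanSpace.single j 1) := by
  rw [NSAC.pderiv, (ha.hasFDerivAt t ht x hx).fderiv]

theorem jac_eq {u ut : ℝ → Sp d → Sp d} {ux : ℝ → Sp d → Sp d →L[ℝ] Sp d}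
    (hu : D.C1Data T u ut ux) {t : ℝ} (ht : t ∈ Ioo 0 T) {x : Sp d} (hx : x ∈ D.region) (i j : Fin d) :
    jac (u t) x i j = ux t x (EuclideanSpace.single j 1) i :=
  (hu.clm (EuclideanSpace.proj i : Sp d →L[ℝ] ℝ)).pderiv_eq ht hx j

end C1Data

/-- Values on the closed cylinder are controlled by those in the open one. -/
theorem mem_of_closed {E : Type*} [NormedAddCommGroup E] {D : FlowDomain d} {T : ℝ} (hT : 0 < T) {f : ℝ → Sp d → E}
    (h : ContinuousOn (Function.uncurry f) (Icc 0 T ×ˢ D.closedRegion)) {S : Set E} (hS : IsClosed S)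
    (hf : ∀ t ∈ Ioo 0 T, ∀ x ∈ D.region, f t x ∈ S) :
    ∀ t ∈ Icc 0 T, ∀ x ∈ D.closedRegion, f t x ∈ S := by
  intro t ht x hx
  have hcl : (t, x) ∈ closure (Ioo 0 T ×ˢ D.region) := by
    rw [closure_prod_eq, closure_Ioo hT.ne]
    exact ⟨ht, D.closedRegion_subset_closure_region hx⟩
  have hc := (h (t, x) ⟨ht, hx⟩).mono (prod_mono Ioo_subset_Icc_self D.region_subset_closedRegion)
  have : f t x ∈ closure S := hc.mem_closure hcl fun z hz => hf z.1 hz.1 z.2 hz.2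
  rwa [hS.closure_eq] at this

/-- Smooth functions with compact support in the open fundamental cell extend periodically. -/
theorem exists_periodization {g : Sp d → ℝ} (hg : ContDiff ℝ ∞ g) (hc : HasCompactSupport g)
    (hs : tsupport g ⊆ (torus (d := d)).openCell) :
    ∃ b, (torus (d := d)).SmoothTest b ∧ ∀ x ∈ (torus (d := d)).openCell, b x = g x := by
  -- The map w reduces every coordinate modulo 2 to [−1, 1); it jumps where a coordinate is an odd
  -- integer.
  set k : Sp d → Fin d → ℤ := fun x i => ⌊(x i + 1) / 2⌋ with hk
  set w : Sp d → Sp d := fun x => WithLp.toLp 2 fun i => x i - 2 * k x i with hw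
  have hwi : ∀ x i, w x i ∈ Ico (-1 : ℝ) 1 := by
    intro x i
    have h1 := Int.floor_le ((x i + 1) / 2)
    have h2 := Int.lt_floor_add_one ((x i + 1) / 2)
    change -1 ≤ x i - 2 * (k x i : ℝ) ∧ x i - 2 * (k x i : ℝ) < 1
    constructor <;> simp only [hk] <;> linarith
  have hcell : ∀ x, x ∈ (torus (d := d)).openCell ↔ ∀ i, x i ∈ Ioo (-1 : ℝ) 1 := fun x => Iff.rfl
  have hw1 : ∀ x ∈ (torus (d := d)).openCell, w x = x := by
    intro x hx
    ext i
    have hxi := (hcell x).1 hx i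
    have : k x i = 0 := by
      rw [hk, Int.floor_eq_zero_iff]
      exact ⟨by linarith [hxi.1], by linarith [hxi.2]⟩
    change x i - 2 * (k x i : ℝ) = x i
    rw [this]; simp
  refine ⟨fun x => g (w x), ⟨?_, fun x i => ?_⟩, fun x hx => congrArg g (hw1 x hx)⟩
  · rw [contDiff_iff_contDiffAt]
    intro x
    by_cases hx : w x ∈ (torus (d := d)).openCell
    · set y0 : Sp d := WithLp.toLp 2 fun i => 2 * (k x i : ℝ) with hy0
      have hev : (fun y => g (w y)) =ᶠ[𝓝 x] fun y => g (y - y0) := by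
        have hopen : IsOpen ((fun y : Sp d => y - y0) ⁻¹' (torus (d := d)).openCell) :=
          (torus (d := d)).isOpen_openCell.preimage (by fun_prop)
        filter_upwards [hopen.mem_nhds (show x - y0 ∈ _ from hx)] with y hy
        congr 1
        ext i
        have hyi : y i - 2 * (k x i : ℝ) ∈ Ioo (-1 : ℝ) 1 := (hcell _).1 hy i
        have : k y i = k x i := by
          rw [hk, Int.floor_eq_iff]
          exact ⟨by linarith [hyi.1], by linarith [hyi.2]⟩
        change y i - 2 * (k y i : ℝ) = y i - 2 * (k x i : ℝ)
        rw [this]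
      exact (hg.comp (contDiff_id.sub contDiff_const)).contDiffAt.congr_of_eventuallyEq hev
    · obtain ⟨i, hi⟩ : ∃ i, w x i = -1 := by
        rw [hcell] at hx
        push Not at hx
        obtain ⟨i, hi⟩ := hx
        refine ⟨i, ?_⟩
        by_contra hne
        exact hi ⟨lt_of_le_of_ne (hwi x i).1 (Ne.symm hne), (hwi x i).2⟩
      -- Near such a jump g ∘ w must be shown to vanish. The function cos(πx_i) is not affected by
      -- the reduction, equals −1 at the jump, and stays above some δ > −1 on the compact support of
      -- g; being continuous, it is below δ in a neighbourhood.
      have hcos : ∀ y i, Real.cos (Real.pi * w y i) = Real.cos (Real.pi * y i) := by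
        intro y i
        have : Real.pi * w y i = Real.pi * y i - (k y i : ℤ) * (2 * Real.pi) := by
          change Real.pi * (y i - 2 * (k y i : ℝ)) = _
          push_cast; ring
        rw [this, Real.cos_sub_int_mul_two_pi]
      obtain ⟨δ, hδ, hδg⟩ : ∃ δ > -1, ∀ y, g y ≠ 0 → δ ≤ Real.cos (Real.pi * y i) := by
        rcases (tsupport g).eq_empty_or_nonempty with he | hne
        · refine ⟨0, by norm_num, fun y hy => ?_⟩
          have := subset_tsupport g hy
          rw [he] at this
          exact absurd this (notMem_empty _)
        · obtain ⟨y, hy, hmin⟩ := hc.isCompact.exists_isMinOn hne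
            (f := fun y : Sp d => Real.cos (Real.pi * y i)) (by fun_prop)
          refine ⟨_, ?_, fun z hz => hmin (subset_tsupport g hz)⟩
          have hyi := (hcell y).1 (hs hy) i
          refine lt_of_le_of_ne (Real.neg_one_le_cos _) fun h => ?_
          obtain ⟨n, hn⟩ := Real.cos_eq_neg_one_iff.1 h.symm
          have hn' : 1 + n * 2 = y i := by
            have : Real.pi * (1 + n * 2) = Real.pi * y i := by rw [← hn]; ring
            exact mul_left_cancel₀ Real.pi_ne_zero this
          have a1 : (-1 : ℝ) < n := by linarith [hyi.1]
          have a2 : (n : ℝ) < 0 := by linarith [hyi.2]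
          have a3 : (-1 : ℤ) < n := by exact_mod_cast a1
          have a4 : n < 0 := by exact_mod_cast a2
          omega
      have hev : (fun y => g (w y)) =ᶠ[𝓝 x] fun _ => 0 := by
        have hcont : Continuous fun y : Sp d => Real.cos (Real.pi * y i) := by fun_prop
        have hx1 : Real.cos (Real.pi * x i) < δ := by
          rw [← hcos, hi, mul_neg, mul_one, Real.cos_neg, Real.cos_pi]; exact hδ
        filter_upwards [hcont.continuousAt.eventually (Iio_mem_nhds hx1)] with y hy
        by_contra hne
        have := hδg _ hne
        rw [hcos] at this
        exact absurd hy (not_lt.2 this)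
      exact contDiffAt_const.congr_of_eventuallyEq hev
  · refine congrArg g ?_
    ext j
    change (x + EuclideanSpace.single i (2 : ℝ)) j
      - 2 * ((⌊((x + EuclideanSpace.single i (2 : ℝ)) j + 1) / 2⌋ : ℤ) : ℝ)
      = x j - 2 * ((⌊(x j + 1) / 2⌋ : ℤ) : ℝ)
    by_cases hij : j = i
    · subst hij
      have : (x + EuclideanSpace.single j (2:ℝ)) j = x j + 2 := by simp
      rw [this, show (x j + 2 + 1) / 2 = (x j + 1) / 2 + 1 by ring, Int.floor_add_one]
      push_cast; ring
    · have : (x + EuclideanSpace.single i (2:ℝ)) j = x j := by simp [hij]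
      rw [this]

/-- The fundamental lemma of the calculus of variations on the domain. -/
theorem ae_eq_zero_of_smoothTest (D : FlowDomain d) {f : Sp d → ℝ} (hf : Integrable f D.vol)
    (h : ∀ b, D.SmoothTest b → ∫ x, f x * b x ∂D.vol = 0) : ∀ᵐ x ∂D.vol, f x = 0 := by
  have hloc : LocallyIntegrableOn f D.openCell volume :=
    (IntegrableOn.mono_set hf D.openCell_subset_cell).locallyIntegrableOn
  have key := D.isOpen_openCell.ae_eq_zero_of_integral_contDiff_smul_eq_zero hloc fun g hg hc hs => by
    have e1 : ∫ x, g x • f x = ∫ x, f x * g x ∂D.vol := by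
      rw [vol, setIntegral_eq_integral_of_forall_compl_eq_zero]
      · simp only [smul_eq_mul, mul_comm]
      · intro x hx
        rw [image_eq_zero_of_notMem_tsupport fun h => hx (D.openCell_subset_cell (hs h)), mul_zero]
    rw [e1]
    cases D with
    | dirichlet Ω ho hb hc' => exact h g ⟨hg, hc, hs⟩
    | torus =>
      obtain ⟨b, hb, hb'⟩ := exists_periodization hg hc hs
      rw [← h b hb]
      refine integral_congr_ae ?_
      filter_upwards [ae_mem_openCell _] with x hx
      rw [hb' x hx]
  filter_upwards [ae_restrict_of_ae key, D.ae_mem_openCell] with x hx hx'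
  exact hx hx'

end FlowDomain


/-! ### Primitives of integrable functions of time -/

/-- `f` is a primitive of the integrable function `f'` on `[0,T]`. -/
structure IsPrim (T : ℝ) (f f' : ℝ → ℝ) : Prop where
  int : IntervalIntegrable f' volume 0 T
  eq : ∀ t ∈ Icc 0 T, f t = f 0 + ∫ s in 0..t, f' s

theorem isPrim_of_ac {T : ℝ} (hT : 0 ≤ T) {f f' : ℝ → ℝ} (hf : AbsolutelyContinuousOnInterval f 0 T)
    (h : ∀ᵐ t, t ∈ uIcc 0 T → HasDerivAt f (f' t) t) : IsPrim T f f' := by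
  have hd : ∀ᵐ t, t ∈ uIcc 0 T → deriv f t = f' t := by
    filter_upwards [h] with t ht hm using (ht hm).deriv
  refine ⟨hf.intervalIntegrable_deriv.congr_ae ?_, fun t ht => ?_⟩
  · rw [EventuallyEq, ae_restrict_iff' measurableSet_uIoc]
    filter_upwards [hd] with t ht hm using ht (uIoc_subset_uIcc hm)
  · have hsub : uIcc 0 t ⊆ uIcc 0 T := by
      rw [uIcc_of_le ht.1, uIcc_of_le hT]; exact Icc_subset_Icc_right ht.2
    have := (hf.mono hsub).integral_deriv_eq_sub
    rw [intervalIntegral.integral_congr_ae (g := f')] at this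
    · linarith
    · filter_upwards [hd] with s hs hm using hs (hsub (uIoc_subset_uIcc hm))

namespace IsPrim

variable {T : ℝ} {f f' g g' : ℝ → ℝ}

/-- Stated for the explicit primitive, because `f` is tied to it only on [0, T]. -/
theorem ac (hf : IsPrim T f f') :
    AbsolutelyContinuousOnInterval (fun t => f 0 + ∫ s in 0..t, f' s) 0 T := by
  have h1 := hf.int.absolutelyContinuousOnInterval_intervalIntegral (c := 0) (by simp)
  have h2 : AbsolutelyContinuousOnInterval (fun _ : ℝ => f 0) 0 T :=
    (LipschitzWith.const (f 0)).lipschitzOnWith.absolutelyContinuousOnInterval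
  exact h2.fun_add h1

theorem ae_hasDerivAt (hf : IsPrim T f f') :
    ∀ᵐ t, t ∈ uIcc 0 T → HasDerivAt (fun t => f 0 + ∫ s in 0..t, f' s) (f' t) t := by
  filter_upwards [hf.int.ae_hasDerivAt_integral] with t ht hm
  exact (ht hm 0 (by simp)).const_add _

theorem congr (hT : 0 ≤ T) (hf : IsPrim T f f') (h : ∀ t ∈ Icc 0 T, f t = g t)
    (h' : ∀ t ∈ Icc 0 T, f' t = g' t) : IsPrim T g g' := by
  refine ⟨hf.int.congr fun t ht => ?_, fun t ht => ?_⟩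
  · rw [uIoc_of_le hT] at ht
    exact h' t ⟨ht.1.le, ht.2⟩
  · rw [← h t ht, ← h 0 ⟨le_rfl, hT⟩, hf.eq t ht]
    congr 1
    refine intervalIntegral.integral_congr fun s hs => ?_
    rw [uIcc_of_le ht.1] at hs
    exact h' s ⟨hs.1, hs.2.trans ht.2⟩

theorem mul (hT : 0 ≤ T) (hf : IsPrim T f f') (hg : IsPrim T g g') :
    IsPrim T (fun t => f t * g t) fun t => f' t * g t + f t * g' t := by
  have h : IsPrim T (fun t => (f 0 + ∫ s in 0..t, f' s) * (g 0 + ∫ s in 0..t, g' s)) fun t =>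
      f' t * (g 0 + ∫ s in 0..t, g' s) + (f 0 + ∫ s in 0..t, f' s) * g' t := by
    refine isPrim_of_ac hT (hf.ac.fun_mul hg.ac) ?_
    filter_upwards [hf.ae_hasDerivAt, hg.ae_hasDerivAt] with t h1 h2 hm
    exact (h1 hm).mul (h2 hm)
  refine h.congr hT (fun t ht => ?_) fun t ht => ?_
  · rw [← hf.eq t ht, ← hg.eq t ht]
  · rw [← hf.eq t ht, ← hg.eq t ht]

/-- A Lipschitz image of an absolutely continuous function is absolutely continuous, and the chain
rule holds wherever the inner function is differentiable. -/
theorem comp (hT : 0 ≤ T) (hf : IsPrim T f f') {Φ Φ' : ℝ → ℝ} (hΦ : ∀ s, HasDerivAt Φ (Φ' s) s)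
    (hb : ∀ s, |Φ' s| ≤ 1) : IsPrim T (fun t => Φ (f t)) fun t => Φ' (f t) * f' t := by
  have hlip : ∀ a b, dist (Φ a) (Φ b) ≤ dist a b := by
    intro a b
    have := convex_univ.norm_image_sub_le_of_norm_hasDerivWithin_le (C := 1)
      (fun x _ => (hΦ x).hasDerivWithinAt) (fun x _ => hb x) (mem_univ b) (mem_univ a)
    rwa [one_mul, ← dist_eq_norm, ← dist_eq_norm] at this
  have h : IsPrim T (fun t => Φ (f 0 + ∫ s in 0..t, f' s)) fun t =>
      Φ' (f 0 + ∫ s in 0..t, f' s) * f' t := by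
    refine isPrim_of_ac hT ?_ ?_
    · rw [absolutelyContinuousOnInterval_iff]
      intro ε hε
      obtain ⟨δ, hδ, h⟩ := (absolutelyContinuousOnInterval_iff _ _ _).1 hf.ac ε hε
      exact ⟨δ, hδ, fun E hE hl => lt_of_le_of_lt (Finset.sum_le_sum fun i _ => hlip _ _) (h E hE hl)⟩
    · filter_upwards [hf.ae_hasDerivAt] with t h1 hm
      exact (hΦ _).comp t (h1 hm)
  refine h.congr hT (fun t ht => ?_) fun t ht => ?_
  · rw [← hf.eq t ht]
  · rw [← hf.eq t ht]

theorem of_hasDerivAt (hc : ContinuousOn f (Icc 0 T)) (hd : ∀ t ∈ Ioo 0 T, HasDerivAt f (f' t) t)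
    (hi : IntervalIntegrable f' volume 0 T) : IsPrim T f f' := by
  refine ⟨hi, fun t ht => ?_⟩
  have := intervalIntegral.integral_eq_sub_of_hasDerivAt_of_le ht.1
    (hc.mono (Icc_subset_Icc_right ht.2)) (fun x hx => hd x ⟨hx.1, hx.2.trans_le ht.2⟩)
    (hi.mono_set (by rw [uIcc_of_le ht.1, uIcc_of_le (ht.1.trans ht.2)]; exact Icc_subset_Icc_right ht.2))
  rw [this]; ring

theorem sub (hT : 0 ≤ T) (hf : IsPrim T f f') (hg : IsPrim T g g') :
    IsPrim T (fun t => f t - g t) fun t => f' t - g' t := by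
  refine ⟨hf.int.sub hg.int, fun t ht => ?_⟩
  have hs : uIcc 0 t ⊆ uIcc 0 T := by
    rw [uIcc_of_le ht.1, uIcc_of_le hT]; exact Icc_subset_Icc_right ht.2
  rw [intervalIntegral.integral_sub (hf.int.mono_set hs) (hg.int.mono_set hs), hf.eq t ht, hg.eq t ht]
  ring

theorem integral_eq (hT : 0 ≤ T) (hf : IsPrim T f f') : ∫ t in Ioo 0 T, f' t = f T - f 0 := by
  rw [← integral_Ioc_eq_integral_Ioo, ← intervalIntegral.integral_of_le hT, hf.eq T ⟨hT, le_rfl⟩]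
  ring

end IsPrim

theorem intervalIntegrable_of_Ioo {T : ℝ} (hT : 0 ≤ T) {k : ℝ → ℝ} (hk : IntegrableOn k (Ioo 0 T)) :
    IntervalIntegrable k volume 0 T := by
  rw [intervalIntegrable_iff_integrableOn_Ioc_of_le hT, integrableOn_Ioc_iff_integrableOn_Ioo]
  exact hk

theorem isPrim_integral {T : ℝ} (hT : 0 ≤ T) {k : ℝ → ℝ} (hk : IntegrableOn k (Ioo 0 T)) (a : ℝ) :
    IsPrim T (fun t => a + ∫ s in 0..t, k s) k :=
  ⟨intervalIntegrable_of_Ioo hT hk, fun t _ => by simp⟩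

/-- A function with integrable weak derivative and weak initial value is a primitive. -/
theorem ae_eq_of_weak_time {T : ℝ} (hT : 0 < T) {m k : ℝ → ℝ} {m0 : ℝ}
    (hm : IntegrableOn m (Ioo 0 T)) (hk : IntegrableOn k (Ioo 0 T))
    (h : ∀ A a : ℝ → ℝ, (∀ t, HasDerivAt A (a t) t) → Continuous a →
      (∃ T' < T, ∀ t, T' ≤ t → t ≤ T → A t = 0) →
      ∫ t in Ioo 0 T, (m t * a t + k t * A t) = -(m0 * A 0)) :
    ∀ᵐ t ∂volume.restrict (Ioo 0 T), m t = m0 + ∫ s in 0..t, k s := by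
  have hP := isPrim_integral hT.le hk m0
  set Z : ℝ → ℝ := fun t => m0 + ∫ s in 0..t, k s with hZ
  have hZc : ContinuousOn Z (Icc 0 T) := by
    have := hP.ac.continuousOn
    rw [uIcc_of_le hT.le] at this
    refine this.congr fun t ht => ?_
    simp [hZ]
  have hZi : IntegrableOn Z (Ioo 0 T) :=
    (hZc.integrableOn_compact isCompact_Icc).mono_set Ioo_subset_Icc_self
  have hloc : LocallyIntegrableOn (fun t => m t - Z t) (Ioo 0 T) volume :=
    (hm.sub hZi).locallyIntegrableOn
  have key := isOpen_Ioo.ae_eq_zero_of_integral_contDiff_smul_eq_zero hloc fun a ha hc hs => by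
    have hac := ha.continuous
    -- For a bump function a, the primitive A vanishing at T is an admissible test function.
    -- Integrating Z by parts against A and subtracting leaves ∫ a(m − Z) = 0.
    set A : ℝ → ℝ := fun t => (∫ s in 0..t, a s) - ∫ s in 0..T, a s with hA
    have hAd : ∀ t, HasDerivAt A (a t) t := fun t =>
      (intervalIntegral.integral_hasDerivAt_right (hac.intervalIntegrable _ _)
        (hac.stronglyMeasurableAtFilter _ _) hac.continuousAt).sub_const _
    obtain ⟨T', hT', hz⟩ : ∃ T' < T, ∀ t, T' ≤ t → t ≤ T → a t = 0 := by
      rcases (tsupport a).eq_empty_or_nonempty with he | hne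
      · refine ⟨0, hT, fun t _ _ => image_eq_zero_of_notMem_tsupport (by rw [he]; exact notMem_empty _)⟩
      · obtain ⟨t0, ht0, hmax⟩ := hc.isCompact.exists_isMaxOn hne continuousOn_id
        have ht0T := (hs ht0).2
        refine ⟨(t0 + T) / 2, by linarith, fun t ht _ => image_eq_zero_of_notMem_tsupport fun hmem => ?_⟩
        have : t ≤ t0 := hmax hmem
        linarith
    have hA0 : ∀ t, T' ≤ t → t ≤ T → A t = 0 := by
      intro t ht htT
      have : A t = -∫ s in t..T, a s := by
        rw [hA, ← intervalIntegral.integral_add_adjacent_intervals (hac.intervalIntegrable 0 t)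
          (hac.intervalIntegrable t T)]; ring
      rw [this, intervalIntegral.integral_congr (g := fun _ => 0) fun s hs => ?_]
      · simp
      · rw [uIcc_of_le htT] at hs
        exact hz s (ht.trans hs.1) hs.2
    have hAc : Continuous A := continuous_iff_continuousAt.2 fun t => (hAd t).continuousAt
    have h1 := h A a hAd hac ⟨T', hT', hA0⟩
    have hPA : IsPrim T A a := IsPrim.of_hasDerivAt hAc.continuousOn (fun t _ => hAd t) (hac.intervalIntegrable _ _)
    have h2 := (hP.mul hT.le hPA).integral_eq hT.le
    rw [hA0 T hT'.le le_rfl] at h2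
    have hi : ∀ {f : ℝ → ℝ} {b : ℝ → ℝ}, IntegrableOn f (Ioo 0 T) → Continuous b →
        IntegrableOn (fun t => f t * b t) (Ioo 0 T) := by
      intro f b hf hb
      obtain ⟨K, hK⟩ := isCompact_Icc.exists_bound_of_continuousOn (hb.continuousOn (s := Icc 0 T))
      refine Integrable.mul_bdd (c := K) hf hb.aestronglyMeasurable ?_
      filter_upwards [ae_restrict_mem measurableSet_Ioo] with t ht using hK t (Ioo_subset_Icc_self ht)
    have e1 := ((hi hm hac).hasInt.add (hi hk hAc).hasInt).2
    have e2 := ((hi hk hAc).hasInt.add (hi hZi hac).hasInt).2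
    have e3 : ∫ t in Ioo 0 T, a t * (m t - Z t)
        = (∫ t in Ioo 0 T, m t * a t) - ∫ t in Ioo 0 T, Z t * a t :=
      (((hi hm hac).hasInt.sub (hi hZi hac).hasInt).congr fun t => by ring).2
    rw [← setIntegral_eq_integral_of_forall_compl_eq_zero (s := Ioo 0 T)]
    · change ∫ t in Ioo 0 T, a t * (m t - Z t) = 0
      have hZ0 : Z 0 = m0 := by simp [hZ]
      rw [hZ0] at h2
      linarith
    · intro t ht
      rw [image_eq_zero_of_notMem_tsupport fun h => ht (hs h), zero_smul]
  rw [ae_restrict_iff' measurableSet_Ioo]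
  filter_upwards [key] with t ht hm
  exact sub_eq_zero.1 (ht hm)


/-! ### Weak time derivatives, pointwise in space -/

/-- An integrable function on a product vanishes if its integrals over all rectangles do. -/
theorem ae_eq_zero_of_setIntegral_prod {α β : Type*} [MeasurableSpace α] [MeasurableSpace β]
    {μ : Measure (α × β)} [IsFiniteMeasure μ] {f : α × β → ℝ} (hf : Integrable f μ)
    (h : ∀ s t, MeasurableSet s → MeasurableSet t → ∫ z in s ×ˢ t, f z ∂μ = 0) : f =ᵐ[μ] 0 := by
  have hfin : ∀ g : α × β → ℝ, Integrable g μ → ∫⁻ z, ENNReal.ofReal (g z) ∂μ ≠ ⊤ := fun g hg => by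
    refine ((lintegral_mono fun z => ?_).trans_lt hg.2).ne
    rw [← ofReal_norm]
    exact ENNReal.ofReal_le_ofReal (le_abs_self _)
  have hset : ∀ S, MeasurableSet S → ∫ z in S, f z ∂μ
      = (∫⁻ z in S, ENNReal.ofReal (f z) ∂μ).toReal - (∫⁻ z in S, ENNReal.ofReal (-f z) ∂μ).toReal :=
    fun S _ => integral_eq_lintegral_pos_part_sub_lintegral_neg_part hf.integrableOn
  have hle : ∀ (S : Set (α × β)) (g : α × β → ℝ), Integrable g μ →
      ∫⁻ z in S, ENNReal.ofReal (g z) ∂μ ≠ ⊤ := fun S g hg =>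
    ((setLIntegral_le_lintegral _ _).trans_lt (hfin g hg).lt_top).ne
  set ν1 := μ.withDensity fun z => ENNReal.ofReal (f z) with h1
  set ν2 := μ.withDensity fun z => ENNReal.ofReal (-f z) with h2
  have : IsFiniteMeasure ν1 := isFiniteMeasure_withDensity (hfin f hf)
  -- The positive and the negative part of f are densities of finite measures. These agree on
  -- rectangles, hence everywhere.
  have he : ν1 = ν2 := by
    refine Measure.ext_prod fun {s t} hs ht => ?_
    rw [h1, h2, withDensity_apply _ (hs.prod ht), withDensity_apply _ (hs.prod ht),
      ← ENNReal.toReal_eq_toReal_iff' (hle _ _ hf) (hle _ (fun z => -f z) hf.neg)]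
    have := hset _ (hs.prod ht)
    rw [h s t hs ht] at this
    linarith
  refine hf.ae_eq_zero_of_forall_setIntegral_eq_zero fun S hS _ => ?_
  rw [hset S hS, ← withDensity_apply _ hS, ← withDensity_apply _ hS, ← h1, ← h2, he, sub_self]

namespace FlowDomain

variable {d : ℕ}

theorem SmoothTest.exists_bound {D : FlowDomain d} {b : Sp d → ℝ} (hb : D.SmoothTest b) :
    ∃ K, ∀ᵐ x ∂D.vol, ‖b x‖ ≤ K := by
  obtain ⟨K, hK⟩ := D.isCompact_closure_cell.exists_bound_of_continuousOn hb.continuous.continuousOn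
  exact ⟨K, by filter_upwards [D.ae_vol_mem] with x hx using hK x (subset_closure hx)⟩

theorem SmoothTest.integrable_mul {D : FlowDomain d} {b f : Sp d → ℝ} (hb : D.SmoothTest b)
    (hf : Integrable f D.vol) : Integrable (fun x => f x * b x) D.vol := by
  obtain ⟨K, hK⟩ := hb.exists_bound
  exact hf.mul_bdd hb.continuous.aestronglyMeasurable hK

theorem SmoothTest.integrable_prod_mul {D : FlowDomain d} {b : Sp d → ℝ} (hb : D.SmoothTest b)
    {μ : Measure ℝ} [SFinite μ] {f : ℝ × Sp d → ℝ} (hf : Integrable f (μ.prod D.vol)) :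
    Integrable (fun z => f z * b z.2) (μ.prod D.vol) := by
  obtain ⟨K, hK⟩ := hb.exists_bound
  refine hf.mul_bdd (hb.continuous.comp continuous_snd).aestronglyMeasurable (c := K) ?_
  exact Measure.quasiMeasurePreserving_snd.ae hK

/-- The exceptional set of times may depend on the test function. Integrating first over a
measurable set B of times removes it: x ↦ ∫_B f(t, x) dt is orthogonal to all test functions and so
vanishes almost everywhere. Thus f integrates to zero over all rectangles. -/
theorem ae_eq_zero_of_smoothTest_slices (D : FlowDomain d) {T : ℝ} {f : ℝ × Sp d → ℝ}
    (hf : Integrable f (D.spaceTime T))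
    (h : ∀ b, D.SmoothTest b → ∀ᵐ t ∂volume.restrict (Ioo 0 T), ∫ x, f (t, x) * b x ∂D.vol = 0) :
    ∀ᵐ z ∂D.spaceTime T, f z = 0 := by
  set μ := volume.restrict (Ioo (0:ℝ) T) with hμ
  have hfB : ∀ B, Integrable f ((μ.restrict B).prod D.vol) := fun B => by
    have : (μ.restrict B).prod D.vol = (μ.prod D.vol).restrict (B ×ˢ univ) := by
      rw [← Measure.prod_restrict, Measure.restrict_univ]
    rw [this]
    exact hf.restrict
  refine ae_eq_zero_of_setIntegral_prod hf fun B A hB hA => ?_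
  have hB0 : ∀ᵐ x ∂D.vol, ∫ t in B, f (t, x) ∂μ = 0 := by
    refine D.ae_eq_zero_of_smoothTest (hfB B).integral_prod_right fun b hb => ?_
    have e1 : ∀ x, (∫ t in B, f (t, x) ∂μ) * b x = ∫ t in B, f (t, x) * b x ∂μ := fun x =>
      (integral_mul_const _ _).symm
    simp only [e1]
    rw [integral_integral_swap (f := fun x t => f (t, x) * b x)]
    · rw [integral_eq_zero_of_ae]
      exact ae_restrict_of_ae (h b hb)
    · exact (hb.integrable_prod_mul (hfB B)).swap
  change ∫ z in B ×ˢ A, f z ∂(μ.prod D.vol) = 0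
  rw [← Measure.prod_restrict]
  have hfBA : Integrable f ((μ.restrict B).prod (D.vol.restrict A)) := by
    rw [Measure.prod_restrict]; exact hf.restrict
  rw [integral_prod_symm _ hfBA, integral_eq_zero_of_ae]
  exact ae_restrict_of_ae hB0

theorem testOpen_mul {D : FlowDomain d} {T : ℝ} {A a : ℝ → ℝ} (hA : ∀ t, HasDerivAt A (a t) t)
    (ha : Continuous a) (h0 : ∃ T' < T, ∀ t, T' ≤ t → t ≤ T → A t = 0) {b : Sp d → ℝ}
    (hb : D.SmoothTest b) : D.TestOpen T fun t x => A t * b x := by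
  obtain ⟨T', hT', h0⟩ := h0
  refine ⟨⟨((C1Data.time D T hA ha).smul (C1Data.space D T hb.contDiff hb.periodic)).c1UpTo, T', hT',
    fun t ht htT x _ => ?_⟩, ?_⟩
  · change A t * b x = 0
    rw [h0 t htT ht.2, zero_mul]
  · cases D with
    | torus => trivial
    | dirichlet Ω ho hbd hc =>
      refine ⟨tsupport b, hb.2.1, hb.2.2, fun t _ x _ hx => ?_⟩
      change A t * b x = 0
      rw [image_eq_zero_of_notMem_tsupport hx, mul_zero]

/-- A function whose weak time derivative is integrable (tested with compactly supported functions)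
is absolutely continuous in time at almost every point. -/
theorem ae_primitive_of_weak (D : FlowDomain d) {T : ℝ} (hT : 0 < T) {c g : ℝ → Sp d → ℝ}
    {c0 : Sp d → ℝ} (hc : Integrable (fun z : ℝ × Sp d => c z.1 z.2) (D.spaceTime T))
    (hg : Integrable (fun z : ℝ × Sp d => g z.1 z.2) (D.spaceTime T)) (hc0 : Integrable c0 D.vol)
    (h : ∀ φ : ℝ → Sp d → ℝ, D.TestOpen T φ →
      ∫ t in Ioo 0 T, ∫ x, (c t x * tderiv φ t x + g t x * φ t x) ∂D.vol
        = -∫ x, c0 x * φ 0 x ∂D.vol) :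
    ∀ᵐ x ∂D.vol, IntegrableOn (fun t => g t x) (Ioo 0 T) ∧
      ∀ᵐ t ∂volume.restrict (Ioo 0 T), c t x = c0 x + ∫ s in 0..t, g s x := by
  set μ := volume.restrict (Ioo (0:ℝ) T) with hμ
  obtain ⟨gm, hgm, hgg⟩ := hg.1
  have hgi : Integrable gm (μ.prod D.vol) := hg.congr hgg
  have hgg1 : ∀ᵐ t ∂μ, ∀ᵐ x ∂D.vol, g t x = gm (t, x) := ae_ae_of_ae_spaceTime hgg
  have hgg2 : ∀ᵐ x ∂D.vol, ∀ᵐ t ∂μ, g t x = gm (t, x) :=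
    Measure.ae_ae_of_ae_prod (Measure.measurePreserving_swap.quasiMeasurePreserving.ae hgg)
  -- W(t, x) is the integral of g over (0, t). Writing it as a parameter integral of a measurable
  -- representative gives joint measurability in (t, x).
  set W : ℝ × Sp d → ℝ := fun z => ∫ s, {p : (ℝ × Sp d) × ℝ | p.2 < p.1.1}.indicator
    (fun p => gm (p.2, p.1.2)) (z, s) ∂μ with hW
  have hWm : StronglyMeasurable W := by
    refine StronglyMeasurable.integral_prod_right' (f := {p : (ℝ × Sp d) × ℝ | p.2 < p.1.1}.indicator
      (fun p => gm (p.2, p.1.2))) ?_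
    refine (hgm.comp_measurable (by fun_prop)).indicator ?_
    exact measurableSet_lt measurable_snd (measurable_fst.comp measurable_fst)
  have hWeq : ∀ t ∈ Ioo 0 T, ∀ x, W (t, x) = ∫ s in Ioo 0 t, gm (s, x) := by
    intro t ht x
    have e : ∀ s, {p : (ℝ × Sp d) × ℝ | p.2 < p.1.1}.indicator (fun p => gm (p.2, p.1.2)) ((t, x), s)
        = (Iio t).indicator (fun s => gm (s, x)) s := fun s => by
      by_cases hs : s < t <;> simp [indicator, hs]
    simp only [hW, e]
    rw [integral_indicator measurableSet_Iio, hμ, Measure.restrict_restrict measurableSet_Iio]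
    congr 2
    ext s
    simp only [mem_inter_iff, mem_Iio, mem_Ioo]
    exact ⟨fun hs => ⟨hs.2.1, hs.1⟩, fun hs => ⟨hs.2, hs.1, hs.2.trans ht.2⟩⟩
  have hN : Integrable (fun x => ∫ s, |gm (s, x)| ∂μ) D.vol := hgi.norm.integral_prod_right
  have hslice : ∀ᵐ x ∂D.vol, Integrable (fun s => gm (s, x)) μ := hgi.prod_left_ae
  have hWi : Integrable W (μ.prod D.vol) := by
    refine Integrable.mono' (g := fun z => ∫ s, |gm (s, z.2)| ∂μ) (hN.comp_snd μ) hWm.aestronglyMeasurable ?_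
    have := (Measure.quasiMeasurePreserving_snd (μ := μ)).ae hslice
    filter_upwards [this] with z hz
    refine norm_integral_le_of_norm_le hz.norm (Eventually.of_forall fun s => ?_)
    by_cases hs : s < z.1
    · simp [indicator, hs]
    · simp [indicator, hs]
  have hfi : Integrable (fun z : ℝ × Sp d => c z.1 z.2 - c0 z.2 - W z) (μ.prod D.vol) :=
    (hc.sub (hc0.comp_snd μ)).sub hWi
  -- Test functions A(t)b(x) show that ∫ c b dx is a primitive of ∫ g b dx with initial value ∫ c0 b
  -- dx. By Fubini, c − c0 − W is then orthogonal to b at almost every time.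
  have key := D.ae_eq_zero_of_smoothTest_slices hfi fun b hb => by
    have hmi : Integrable (fun t => ∫ x, c t x * b x ∂D.vol) μ :=
      (hb.integrable_prod_mul hc).integral_prod_left
    have hki : Integrable (fun t => ∫ x, g t x * b x ∂D.vol) μ :=
      (hb.integrable_prod_mul hg).integral_prod_left
    have hw := ae_eq_of_weak_time hT (m0 := ∫ x, c0 x * b x ∂D.vol) hmi hki fun A a hA ha h0 => by
      have h1 := h _ (testOpen_mul hA ha h0 hb)
      have e0 : ∫ x, c0 x * (A 0 * b x) ∂D.vol = (∫ x, c0 x * b x ∂D.vol) * A 0 := by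
        rw [← integral_mul_const]; congr 1; ext x; ring
      rw [e0] at h1
      rw [← h1]
      refine integral_congr_ae ?_
      filter_upwards [hc.prod_right_ae, hg.prod_right_ae] with t h2 h3
      have e1 : ∀ x, tderiv (fun t x => A t * b x) t x = a t * b x := fun x =>
        ((hA t).mul_const (b x)).deriv
      simp only [e1]
      have := ((hb.integrable_mul h2).hasInt.const_mul (a t)).add ((hb.integrable_mul h3).hasInt.const_mul (A t))
      rw [mul_comm _ (a t), mul_comm _ (A t), ← this.2]
      congr 1; ext x; ring
    filter_upwards [hw, hc.prod_right_ae, hWi.prod_right_ae, ae_restrict_mem measurableSet_Ioo]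
      with t h1 h2 h3 ht
    have hres : μ.restrict (Ioo 0 t) = volume.restrict (Ioo 0 t) := by
      rw [hμ, Measure.restrict_restrict measurableSet_Ioo]
      congr 1
      exact inter_eq_left.2 (Ioo_subset_Ioo_right ht.2.le)
    have e2 : ∫ s in 0..t, ∫ x, g s x * b x ∂D.vol = ∫ x, W (t, x) * b x ∂D.vol := by
      rw [intervalIntegral.integral_of_le ht.1.le, integral_Ioc_eq_integral_Ioo]
      simp only [hWeq t ht]
      have e3 : ∀ x, (∫ s in Ioo 0 t, gm (s, x)) * b x = ∫ s in Ioo 0 t, gm (s, x) * b x := fun x =>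
        (integral_mul_const _ _).symm
      simp only [e3]
      rw [integral_integral_swap (f := fun x s => gm (s, x) * b x)]
      · refine integral_congr_ae ?_
        rw [← hres]
        filter_upwards [ae_restrict_of_ae hgg1] with s hs
        refine integral_congr_ae ?_
        filter_upwards [hs] with x hx
        rw [hx]
      · refine (hb.integrable_prod_mul (f := gm) ?_).swap
        rw [← hres, ← Measure.restrict_univ (μ := D.vol), Measure.prod_restrict]
        exact hgi.restrict
    rw [e2] at h1
    have := ((hb.integrable_mul h2).hasInt.sub (hb.integrable_mul hc0).hasInt).sub (hb.integrable_mul h3).hasInt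
    have e4 := (this.congr (g := fun x => (c t x - c0 x - W (t, x)) * b x) fun x => by ring).2
    rw [e4]
    linarith
  have key2 : ∀ᵐ x ∂D.vol, ∀ᵐ t ∂μ, c t x - c0 x - W (t, x) = 0 :=
    Measure.ae_ae_of_ae_prod (Measure.measurePreserving_swap.quasiMeasurePreserving.ae key)
  filter_upwards [key2, hgg2, hslice] with x h1 h2 h3
  refine ⟨h3.congr (h2.mono fun t ht => ht.symm), ?_⟩
  filter_upwards [h1, ae_restrict_mem measurableSet_Ioo] with t h4 ht
  have hres : μ.restrict (Ioo 0 t) = volume.restrict (Ioo 0 t) := by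
    rw [hμ, Measure.restrict_restrict measurableSet_Ioo]
    congr 1
    exact inter_eq_left.2 (Ioo_subset_Ioo_right ht.2.le)
  have : ∫ s in 0..t, g s x = W (t, x) := by
    rw [intervalIntegral.integral_of_le ht.1.le, integral_Ioc_eq_integral_Ioo, hWeq t ht, ← hres]
    exact integral_congr_ae (ae_restrict_of_ae h2)
  linarith

end FlowDomain


/-! ### Strong solutions in non-conservative form -/

/-- The basis vector `e_j`. -/
abbrev ev {d : ℕ} (j : Fin d) : Sp d := EuclideanSpace.single j 1

/-- A strong solution with all derivatives displayed and the equations in non-conservative form: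
`G = ∇C`, `l = ΔC`, `s = div S(∇U)`. -/
structure StrongData {d : ℕ} (L : FluidLaw) (D : FlowDomain d) (T : ℝ) where
  (R Rt : ℝ → Sp d → ℝ)
  Rx : ℝ → Sp d → Sp d →L[ℝ] ℝ
  (U Ut : ℝ → Sp d → Sp d)
  Ux : ℝ → Sp d → Sp d →L[ℝ] Sp d
  (C Ct : ℝ → Sp d → ℝ)
  Cx : ℝ → Sp d → Sp d →L[ℝ] ℝ
  (G Gt : ℝ → Sp d → Sp d)
  Gx : ℝ → Sp d → Sp d →L[ℝ] Sp d
  (l lt : ℝ → Sp d → ℝ)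
  lx : ℝ → Sp d → Sp d →L[ℝ] ℝ
  s : ℝ → Sp d → Sp d
  r : ℝ
  r_pos : 0 < r
  R_ge : ∀ t ∈ Icc 0 T, ∀ x ∈ D.closedRegion, r ≤ R t x
  hR : D.C1Data T R Rt Rx
  hU : D.C1Data T U Ut Ux
  hC : D.C1Data T C Ct Cx
  hG : D.C1Data T G Gt Gx
  hl : D.C1Data T l lt lx
  hs : D.C0UpTo T s
  boundary : ∀ t ∈ Icc 0 T, D.VanishesOnBoundary (U t) ∧ D.VanishesOnBoundary (C t)
  Cx_eq : ∀ t ∈ Ioo 0 T, ∀ x ∈ D.region, ∀ j, Cx t x (ev j) = G t x j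
  l_eq : ∀ t ∈ Ioo 0 T, ∀ x ∈ D.region, l t x = ∑ j, Gx t x (ev j) j
  weakDiv : ∀ t ∈ Ioo 0 T, D.IsWeakDiv (fun x => L.stress (jac (U t) x)) (s t)
  continuity : ∀ t ∈ Ioo 0 T, ∀ x ∈ D.region,
    Rt t x + ∑ j, (Rx t x (ev j) * U t x j + R t x * Ux t x (ev j) j) = 0
  momentum : ∀ t ∈ Ioo 0 T, ∀ x ∈ D.region, ∀ i,
    R t x * (Ut t x i + ∑ j, Ux t x (ev j) i * U t x j) + deriv L.p (R t x) * Rx t x (ev i)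
      = s t x i - (l t x - glF1 (C t x)) * G t x i
  allenCahn : ∀ t ∈ Ioo 0 T, ∀ x ∈ D.region,
    Ct t x + ∑ j, U t x j * G t x j = l t x - glF1 (C t x)

open FlowDomain

theorem sum_single_smul_eq {d : ℕ} (A : Sp d →L[ℝ] ℝ) (g : Sp d) (h : ∀ j, A (ev j) = g j) :
    A = innerSL ℝ g := by
  ext v
  have hv : v = ∑ j, v j • (ev j : Sp d) := by
    ext i
    simp [ev, Pi.single_apply]
  conv_lhs => rw [hv]
  rw [map_sum, innerSL_apply_apply, PiLp.inner_apply]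
  refine Finset.sum_congr rfl fun j _ => ?_
  rw [map_smul, h j]
  simp [mul_comm]

/-- Expansion of the divergence of the capillary stress. -/
theorem sum_pderiv_capillary {d : ℕ} {f : Sp d → ℝ} {G : Sp d → Sp d} {Gx : Sp d →L[ℝ] Sp d}
    {O : Set (Sp d)} (hO : IsOpen O) {x : Sp d} (hx : x ∈ O) (hg : ∀ y ∈ O, G y = grad f y)
    (hf : ∀ y ∈ O, HasFDerivAt f (innerSL ℝ (G y)) y) (hG : HasFDerivAt G Gx x) (i : Fin d) :
    ∑ j, pderiv j (fun y => capillary f y i j) x = (∑ j, Gx (ev j) j) * G x i := by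
  -- The derivative of G is the second derivative of f, hence symmetric. So Σ_j G_j∂_jG_i = Σ_j
  -- G_j∂_iG_j, which cancels the derivative of ½|G|² and leaves the Laplacian times G_i.
  have hsymm : ∀ i j, Gx (ev j) i = Gx (ev i) j := by
    intro i j
    have h1 : HasFDerivAt (fun y => (innerSL ℝ (G y) : Sp d →L[ℝ] ℝ)) ((innerSL ℝ : Sp d →L[ℝ] Sp d →L[ℝ] ℝ) ∘L Gx) x :=
      (innerSL ℝ : Sp d →L[ℝ] Sp d →L[ℝ] ℝ).hasFDerivAt.comp x hG
    have h2 := second_derivative_symmetric_of_eventually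
      (f' := fun y => (innerSL ℝ (G y) : Sp d →L[ℝ] ℝ)) (by
        filter_upwards [hO.mem_nhds hx] with y hy using hf y hy) h1 (ev j) (ev i)
    change inner ℝ (Gx (ev j)) (ev i) = inner ℝ (Gx (ev i)) (ev j) at h2
    simpa [ev, EuclideanSpace.inner_single_right] using h2
  have hGi : ∀ i, HasFDerivAt (fun y => G y i) ((EuclideanSpace.proj i : Sp d →L[ℝ] ℝ) ∘L Gx) x := fun i =>
    (EuclideanSpace.proj i : Sp d →L[ℝ] ℝ).hasFDerivAt.comp x hG
  have key : ∀ j, pderiv j (fun y => capillary f y i j) x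
      = G x i * Gx (ev j) j + G x j * Gx (ev j) i
        - (1 : Matrix (Fin d) (Fin d) ℝ) i j * ∑ k, G x k * Gx (ev j) k := by
    intro j
    have h1 := ((hGi i).mul (hGi j)).sub
      ((hG.norm_sq.const_mul (1 / 2)).mul_const ((1 : Matrix (Fin d) (Fin d) ℝ) i j))
    have h2 : (fun y => capillary f y i j) =ᶠ[𝓝 x] fun y =>
        G y i * G y j - 1 / 2 * ‖G y‖ ^ 2 * (1 : Matrix (Fin d) (Fin d) ℝ) i j := by
      filter_upwards [hO.mem_nhds hx] with y hy
      simp only [capillary, dyad, Matrix.sub_apply, Matrix.of_apply, Matrix.smul_apply, smul_eq_mul, hg y hy]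
    rw [pderiv, h2.fderiv_eq]
    refine (congrArg (fun A : Sp d →L[ℝ] ℝ => A (ev j)) h1.fderiv).trans ?_
    simp [PiLp.inner_apply, mul_comm]
  simp only [key, Finset.sum_sub_distrib, Finset.sum_add_distrib, Matrix.one_apply, ite_mul, one_mul,
    zero_mul, Finset.sum_ite_eq, Finset.mem_univ, if_true]
  rw [show ∑ j, G x j * Gx (ev j) i = ∑ j, G x j * Gx (ev i) j from
    Finset.sum_congr rfl fun j _ => by rw [hsymm i j], ← Finset.mul_sum]
  ring

/-- The product rule and U_i times the continuity equation bring the momentum equation into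
non-conservative form. The capillary force −ΔC∇C and ∇F(C) = F'(C)∇C combine into −(ΔC − F'(C))∇C.
The lower bound on R extends to the closed cylinder by continuity. -/
theorem IsStrongSolution.exists_data {d : ℕ} {L : FluidLaw} {D : FlowDomain d} {T : ℝ} (hT : 0 < T)
    {R : ℝ → Sp d → ℝ} {U : ℝ → Sp d → Sp d} {C : ℝ → Sp d → ℝ} (h : IsStrongSolution L D T R U C) :
    ∃ S : StrongData L D T, S.R = R ∧ S.U = U ∧ S.C = C := by
  obtain ⟨r, hr, hRr⟩ := h.R_pos
  obtain ⟨Rt, Rx, hR⟩ := h.R_C1.exists_data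
  obtain ⟨Ut, Ux, hU⟩ := h.U_C1.exists_data
  obtain ⟨Ct, Cx, hC⟩ := h.C_C1.exists_data
  obtain ⟨G, hG1, hGe⟩ := h.gradC_C1
  obtain ⟨Gt, Gx, hG⟩ := hG1.exists_data
  obtain ⟨l, hl1, hle⟩ := h.lapC_C1
  obtain ⟨lt, lx, hl⟩ := hl1.exists_data
  obtain ⟨s, hs, hw, hm⟩ := h.momentum
  have hCx : ∀ t ∈ Ioo 0 T, ∀ x ∈ D.region, ∀ j, Cx t x (ev j) = G t x j := fun t ht x hx j => by
    rw [hGe t ht x hx]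
    exact (hC.pderiv_eq ht hx j).symm
  have hCi : ∀ t ∈ Ioo 0 T, ∀ x ∈ D.region, HasFDerivAt (C t) (innerSL ℝ (G t x)) x :=
    fun t ht x hx => by
      rw [← sum_single_smul_eq _ _ (hCx t ht x hx)]
      exact hC.hasFDerivAt t ht x hx
  have hleq : ∀ t ∈ Ioo 0 T, ∀ x ∈ D.region, l t x = ∑ j, Gx t x (ev j) j := fun t ht x hx => by
    rw [hle t ht x hx, lap]
    refine Finset.sum_congr rfl fun j _ => ?_
    have h1 : pderiv j (C t) =ᶠ[𝓝 x] fun y => G t y j := by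
      filter_upwards [D.isOpen_region.mem_nhds hx] with y hy
      rw [hGe t ht y hy]; rfl
    rw [pderiv, h1.fderiv_eq]
    exact (hG.clm (EuclideanSpace.proj j : Sp d →L[ℝ] ℝ)).pderiv_eq ht hx j
  have hRge : ∀ t ∈ Icc 0 T, ∀ x ∈ D.closedRegion, r ≤ R t x :=
    mem_of_closed hT hR.cont isClosed_Ici hRr
  have hUi := fun i => hU.clm (EuclideanSpace.proj i : Sp d →L[ℝ] ℝ)
  have hcont : ∀ t ∈ Ioo 0 T, ∀ x ∈ D.region,
      Rt t x + ∑ j, (Rx t x (ev j) * U t x j + R t x * Ux t x (ev j) j) = 0 := fun t ht x hx => by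
    have h1 := h.continuity t ht x hx
    rw [hR.tderiv_eq ht hx] at h1
    rw [← h1]
    congr 1
    refine Finset.sum_congr rfl fun j _ => ?_
    have h2 : pderiv j (fun y => R t y * U t y j) x = _ := (hR.smul (hUi j)).pderiv_eq ht hx j
    rw [h2]
    simp
    ring
  have hpR := hR.comp (S := Ioi 0) (fun a ha => L.hasDerivAt_p ha) L.continuousOn_deriv_p
    fun t ht x hx => lt_of_lt_of_le hr (hRge t ht x hx)
  have hFC := hC.comp (S := univ) (fun a _ => hasDerivAt_glF a) continuous_glF1.continuousOn
    fun t ht x hx => mem_univ _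
  refine ⟨⟨R, Rt, Rx, U, Ut, Ux, C, Ct, Cx, G, Gt, Gx, l, lt, lx, s, r, hr, hRge, hR, hU, hC, hG, hl, hs,
    h.boundary, hCx, hleq, hw, hcont, fun t ht x hx i => ?_, fun t ht x hx => ?_⟩, rfl, rfl, rfl⟩
  · have h1 := hm t ht x hx i
    have e1 : tderiv (fun s y => R s y * U s y i) t x = _ := (hR.smul (hUi i)).tderiv_eq ht hx
    have e2 : ∀ j, pderiv j (fun y => R t y * U t y i * U t y j) x = _ := fun j =>
      ((hR.smul (hUi i)).smul (hUi j)).pderiv_eq ht hx j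
    have e3 : pderiv i (fun y => L.p (R t y)) x = _ := hpR.pderiv_eq ht hx i
    have e4 : pderiv i (fun y => glF (C t y)) x = _ := hFC.pderiv_eq ht hx i
    have e5 := sum_pderiv_capillary D.isOpen_region hx (hGe t ht) (hCi t ht) (hG.hasFDerivAt t ht x hx) i
    rw [e1, e3, e4, e5, Finset.sum_congr rfl fun j _ => e2 j, ← hleq t ht x hx] at h1
    have e6 : (Cx t x) (EuclideanSpace.single i 1) = G t x i := hCx t ht x hx i
    simp only [add_apply, smul_apply, ContinuousLinearMap.smulRight_apply,
      smul_eq_mul, ContinuousLinearMap.comp_apply, PiLp.proj_apply, e6] at h1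
    have e7 := hcont t ht x hx
    have e8 : ∑ j, (R t x * U t x i * Ux t x (EuclideanSpace.single j 1) j
        + (R t x * Ux t x (EuclideanSpace.single j 1) i + Rx t x (EuclideanSpace.single j 1) * U t x i) * U t x j)
        = U t x i * ∑ j, (Rx t x (ev j) * U t x j + R t x * Ux t x (ev j) j)
          + R t x * ∑ j, Ux t x (ev j) i * U t x j := by
      simp only [Finset.mul_sum, ← Finset.sum_add_distrib]
      refine Finset.sum_congr rfl fun j _ => ?_
      ring
    rw [e8] at h1
    linear_combination h1 - U t x i * e7
  · have h1 := h.allenCahn t ht x hx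
    rw [hC.tderiv_eq ht hx, ← hGe t ht x hx, ← hle t ht x hx, deriv_glF] at h1
    rw [← h1, PiLp.inner_apply]
    simp [mul_comm]


/-! ### Time slices and differentiation under the integral -/

namespace FlowDomain

variable {d : ℕ} {D : FlowDomain d} {T : ℝ}

theorem memLp_slice {f : ℝ → Sp d → ℝ}
    (h : ContinuousOn (Function.uncurry f) (Icc 0 T ×ˢ D.closedRegion)) {t : ℝ} (ht : t ∈ Icc 0 T)
    {p : ℝ≥0∞} : MemLp (f t) p D.vol := by
  obtain ⟨B, -, hB⟩ := exists_bound_of_continuousOn h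
  exact D.memLp_of_bdd (D.aestronglyMeasurable_vol
    ((continuousOn_slice h ht).mono D.region_subset_closedRegion)) fun x hx => hB t ht x hx

theorem integrable_slice {f : ℝ → Sp d → ℝ}
    (h : ContinuousOn (Function.uncurry f) (Icc 0 T ×ˢ D.closedRegion)) {t : ℝ} (ht : t ∈ Icc 0 T) :
    Integrable (f t) D.vol := (memLp_slice h ht).integrable (q := 1) le_rfl

theorem continuousOn_integral {f : ℝ → Sp d → ℝ}
    (h : ContinuousOn (Function.uncurry f) (Icc 0 T ×ˢ D.closedRegion)) :
    ContinuousOn (fun t => ∫ x, f t x ∂D.vol) (Icc 0 T) := by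
  obtain ⟨B, -, hB⟩ := exists_bound_of_continuousOn h
  refine continuousOn_of_dominated (bound := fun _ => B) (fun t ht => (integrable_slice h ht).1)
    (fun t ht => ?_) (integrable_const _) ?_
  · filter_upwards [D.ae_vol_mem] with x hx using hB t ht x hx
  · filter_upwards [D.ae_vol_mem] with x hx
    exact continuousOn_time h (D.region_subset_closedRegion (D.cell_subset_region hx))

/-- The strong solution satisfies its equations only for 0 < t < T; identities reach the initial
time by continuity. -/
theorem integral_eq_zero_of_Ioo (hT : 0 < T) {f : ℝ → Sp d → ℝ}
    (h : ContinuousOn (Function.uncurry f) (Icc 0 T ×ˢ D.closedRegion))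
    (h0 : ∀ t ∈ Ioo 0 T, ∫ x, f t x ∂D.vol = 0) : ∀ t ∈ Icc 0 T, ∫ x, f t x ∂D.vol = 0 := by
  intro t ht
  have hcl : t ∈ closure (Ioo 0 T) := by rwa [closure_Ioo hT.ne]
  have := ((continuousOn_integral h t ht).mono Ioo_subset_Icc_self).mem_closure hcl
    (t := {(0:ℝ)}) fun s hs => h0 s hs
  simpa using this

namespace C1Data

variable {a a' : ℝ → Sp d → ℝ} {ax : ℝ → Sp d → Sp d →L[ℝ] ℝ}

theorem cont_ev {V : Type*} [NormedAddCommGroup V] [NormedSpace ℝ V] {f ft : ℝ → Sp d → V}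
    {fx : ℝ → Sp d → Sp d →L[ℝ] V} (h : D.C1Data T f ft fx) (j : Fin d) :
    ContinuousOn (Function.uncurry fun t x => fx t x (ev j)) (Icc 0 T ×ˢ D.closedRegion) :=
  h.cont_x.clm_apply continuousOn_const

theorem isWeakPartial (h : D.C1Data T a a' ax) {t : ℝ} (ht : t ∈ Ioo 0 T) (j : Fin d) :
    D.IsWeakPartial j (a t) fun x => ax t x (ev j) :=
  isWeakPartial_of_hasFDerivAt D (h.hasFDerivAt t ht)
    ((continuousOn_slice h.cont_x (Ioo_subset_Icc_self ht)).mono D.region_subset_closedRegion)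
    (h.per t (Ioo_subset_Icc_self ht)) j

theorem isH10 (hd : 0 < d) (h : D.C1Data T a a' ax) {t : ℝ} (ht : t ∈ Ioo 0 T)
    (hv : D.VanishesOnBoundary (a t)) : D.IsH10 (a t) fun j x => ax t x (ev j) := by
  obtain ⟨B, -, hB⟩ := h.exists_bound
  have ht' := Ioo_subset_Icc_self ht
  exact IsH10.of_hasFDerivAt hd D (h.hasFDerivAt t ht)
    ((continuousOn_slice h.cont_x ht').mono D.region_subset_closedRegion)
    (continuousOn_slice h.cont ht') (h.per t ht') (fun x hx => (hB t ht' x hx).2.2)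
    (fun x hx => (hB t ht' x hx).1) hv

theorem hasDerivAt_integral_mul (h : D.C1Data T a a' ax) {f : Sp d → ℝ} (hf : Integrable f D.vol)
    {t : ℝ} (ht : t ∈ Ioo 0 T) :
    HasDerivAt (fun s => ∫ x, f x * a s x ∂D.vol) (∫ x, f x * a' t x ∂D.vol) t := by
  obtain ⟨B, -, hB⟩ := h.exists_bound
  have hi : ∀ {b : ℝ → Sp d → ℝ}, ContinuousOn (Function.uncurry b) (Icc 0 T ×ˢ D.closedRegion) →
      ∀ s ∈ Ioo 0 T, Integrable (fun x => f x * b s x) D.vol := fun {b} hb s hs => by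
    obtain ⟨K, -, hK⟩ := exists_bound_of_continuousOn hb
    refine hf.mul_bdd (c := K) (integrable_slice hb (Ioo_subset_Icc_self hs)).1 ?_
    filter_upwards [D.ae_vol_mem] with x hx using hK s (Ioo_subset_Icc_self hs) x hx
  refine (hasDerivAt_integral_of_dominated_loc_of_deriv_le (bound := fun x => |f x| * B)
    (F' := fun s x => f x * a' s x) (isOpen_Ioo.mem_nhds ht) ?_ (hi h.cont t ht) (hi h.cont_t t ht).1 ?_
    (hf.norm.mul_const B) ?_).2
  · filter_upwards [isOpen_Ioo.mem_nhds ht] with s hs using (hi h.cont s hs).1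
  · filter_upwards [D.ae_vol_mem] with x hx s hs
    rw [norm_mul]
    exact mul_le_mul_of_nonneg_left (hB s (Ioo_subset_Icc_self hs) x hx).2.1 (abs_nonneg _)
  · filter_upwards [D.ae_vol_mem] with x hx s hs
    exact (h.hasDerivAt s hs x (D.cell_subset_region hx)).const_mul (f x)

theorem integral_deriv_eq {b b' : ℝ → Sp d → ℝ} {bx : ℝ → Sp d → Sp d →L[ℝ] ℝ}
    (h : D.C1Data T a a' ax) (h' : D.C1Data T b b' bx) {f g : Sp d → ℝ} (hf : Integrable f D.vol)
    (hg : Integrable g D.vol)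
    (he : ∀ t ∈ Ioo 0 T, ∫ x, f x * a t x ∂D.vol = ∫ x, g x * b t x ∂D.vol) :
    ∀ t ∈ Ioo 0 T, ∫ x, f x * a' t x ∂D.vol = ∫ x, g x * b' t x ∂D.vol := by
  intro t ht
  have h1 := h.hasDerivAt_integral_mul hf ht
  have h2 := h'.hasDerivAt_integral_mul hg ht
  refine h1.unique (h2.congr_of_eventuallyEq ?_)
  filter_upwards [isOpen_Ioo.mem_nhds ht] with s hs using he s hs

end C1Data

end FlowDomain

open FlowDomain

theorem ContinuousOn.proj {d : ℕ} {X : Type*} [TopologicalSpace X] {f : X → Sp d} {S : Set X}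
    (h : ContinuousOn f S) (i : Fin d) : ContinuousOn (fun x => f x i) S :=
  (EuclideanSpace.proj i : Sp d →L[ℝ] ℝ).continuous.comp_continuousOn h

/-! ### Integrations by parts with the strong solution -/

namespace StrongData

variable {d : ℕ} {L : FluidLaw} {D : FlowDomain d} {T : ℝ} (S : StrongData L D T)

/-- The Jacobian `∇U`. -/
def B (t : ℝ) (x : Sp d) : Matrix (Fin d) (Fin d) ℝ := Matrix.of fun i j => S.Ux t x (ev j) i

/-- The chemical potential `ΔC - F'(C)`. -/
def M (t : ℝ) (x : Sp d) : ℝ := S.l t x - glF1 (S.C t x)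

/-- The time derivative of the chemical potential. -/
def Mt (t : ℝ) (x : Sp d) : ℝ := S.lt t x - glF2 (S.C t x) * S.Ct t x

theorem R_pos {t : ℝ} (ht : t ∈ Icc 0 T) {x : Sp d} (hx : x ∈ D.cell) : 0 < S.R t x :=
  S.r_pos.trans_le (S.R_ge t ht x (D.region_subset_closedRegion (D.cell_subset_region hx)))

theorem hUi (i : Fin d) : D.C1Data T (fun t x => S.U t x i) (fun t x => S.Ut t x i)
    fun t x => (EuclideanSpace.proj i : Sp d →L[ℝ] ℝ) ∘L S.Ux t x :=
  S.hU.clm (EuclideanSpace.proj i : Sp d →L[ℝ] ℝ)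

theorem hGi (i : Fin d) : D.C1Data T (fun t x => S.G t x i) (fun t x => S.Gt t x i)
    fun t x => (EuclideanSpace.proj i : Sp d →L[ℝ] ℝ) ∘L S.Gx t x :=
  S.hG.clm (EuclideanSpace.proj i : Sp d →L[ℝ] ℝ)

theorem hp : D.C1Data T (fun t x => L.p (S.R t x)) (fun t x => deriv L.p (S.R t x) * S.Rt t x)
    fun t x => deriv L.p (S.R t x) • S.Rx t x :=
  S.hR.comp (S := Ioi 0) (fun _ ha => L.hasDerivAt_p ha) L.continuousOn_deriv_p
    fun t ht x hx => lt_of_lt_of_le S.r_pos (S.R_ge t ht x hx)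

theorem hP1 : D.C1Data T (fun t x => L.P1 (S.R t x)) (fun t x => deriv L.p (S.R t x) / S.R t x * S.Rt t x)
    fun t x => (deriv L.p (S.R t x) / S.R t x) • S.Rx t x :=
  S.hR.comp (S := Ioi 0) (Φ' := fun r => deriv L.p r / r) (fun _ ha => L.hasDerivAt_P1 ha)
    (L.continuousOn_deriv_p.div continuousOn_id fun _ ha => (ne_of_gt ha))
    fun t ht x hx => lt_of_lt_of_le S.r_pos (S.R_ge t ht x hx)

theorem isH10_U (hd : 0 < d) {t : ℝ} (ht : t ∈ Ioo 0 T) (i : Fin d) :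
    D.IsH10 (fun x => S.U t x i) fun j x => S.B t x i j := by
  refine (S.hUi i).isH10 hd ht ?_
  have := (S.boundary t (Ioo_subset_Icc_self ht)).1
  cases D with
  | torus => trivial
  | dirichlet Ω _ _ _ =>
    intro x hx
    change S.U t x i = 0
    rw [this x hx]; rfl

theorem isH10_C (hd : 0 < d) {t : ℝ} (ht : t ∈ Ioo 0 T) :
    D.IsH10 (S.C t) fun j x => S.Cx t x (ev j) :=
  S.hC.isH10 hd ht (S.boundary t (Ioo_subset_Icc_self ht)).2

theorem cont_B (i j : Fin d) :
    ContinuousOn (Function.uncurry fun t x => S.B t x i j) (Icc 0 T ×ˢ D.closedRegion) :=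
  ContinuousOn.proj (S.hU.cont_ev j) i

theorem jac_eq {t : ℝ} (ht : t ∈ Ioo 0 T) {x : Sp d} (hx : x ∈ D.region) : jac (S.U t) x = S.B t x := by
  ext i j
  exact S.hU.jac_eq ht hx i j

theorem ae_jac_eq {t : ℝ} (ht : t ∈ Ioo 0 T) : ∀ᵐ x ∂D.vol, jac (S.U t) x = S.B t x := by
  filter_upwards [D.ae_vol_mem] with x hx using S.jac_eq ht (D.cell_subset_region hx)

/-- Integration by parts in the viscous term. -/
theorem integral_stress {t : ℝ} (ht : t ∈ Ioo 0 T) {v : Fin d → Sp d → ℝ}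
    {A : Sp d → Matrix (Fin d) (Fin d) ℝ} (h : ∀ i, D.IsH10 (v i) fun j x => A x i j) :
    HasInt D.vol (fun x => ddot (L.stress (S.B t x)) (A x) + ∑ i, S.s t x i * v i x) 0 := by
  have ht' := Ioo_subset_Icc_self ht
  have hB : ∀ i j, MemLp (fun x => S.B t x i j) 2 D.vol := fun i j => memLp_slice (S.cont_B i j) ht'
  have htr : MemLp (fun x => (S.B t x).trace) 2 D.vol := by
    simp only [Matrix.trace, Matrix.diag_apply]
    exact memLp_finsetSum _ fun i _ => hB i i
  have hS : ∀ i j, MemLp (fun x => L.stress (S.B t x) i j) 2 D.vol := by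
    intro i j
    simp only [FluidLaw.stress, Matrix.add_apply, Matrix.smul_apply, Matrix.sub_apply,
      Matrix.transpose_apply, smul_eq_mul]
    exact ((((hB i j).add (hB j i)).sub ((htr.const_mul _).mul_const _)).const_mul _).add
      ((htr.const_mul _).mul_const _)
  have hs : ∀ i, MemLp (fun x => S.s t x i) 2 D.vol := fun i =>
    memLp_slice (f := fun t x => S.s t x i) (ContinuousOn.proj S.hs.1 i) ht'
  have hw : D.IsWeakDiv (fun x => L.stress (S.B t x)) (S.s t) := by
    intro φ hφ i
    rw [← S.weakDiv t ht φ hφ i]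
    refine integral_congr_ae ?_
    filter_upwards [S.ae_jac_eq ht] with x hx
    rw [hx]
  have key : ∀ i, HasInt D.vol (fun x => (∑ j, L.stress (S.B t x) i j * A x i j) + S.s t x i * v i x) 0 := by
    intro i
    have h1 : HasInt D.vol (fun x => ∑ j, L.stress (S.B t x) i j * A x i j) _ := Integrable.hasInt
      (integrable_finsetSum _ fun j _ => MemLp.integrable_mul (p := 2) (q := 2) (hS i j) ((h i).grad_memLp j))
    have h2 : HasInt D.vol (fun x => S.s t x i * v i x) _ :=
      Integrable.hasInt (MemLp.integrable_mul (p := 2) (q := 2) (hs i) (h i).memLp)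
    refine (h1.add h2).congr_val ?_
    rw [(h i).integral_div hw hS hs i]
    ring
  refine ((HasInt.sum Finset.univ key).congr fun x => ?_).congr_val (by simp)
  rw [Finset.sum_add_distrib]; rfl

/-- The pressure does no net work. -/
theorem integral_pressure (hd : 0 < d) {t : ℝ} (ht : t ∈ Ioo 0 T) :
    HasInt D.vol (fun x => (∑ i, S.U t x i * (deriv L.p (S.R t x) * S.Rx t x (ev i)))
      + L.p (S.R t x) * (S.B t x).trace) 0 := by
  have ht' := Ioo_subset_Icc_self ht
  have key : ∀ i, HasInt D.vol (fun x => S.U t x i * (deriv L.p (S.R t x) * S.Rx t x (ev i))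
      + S.B t x i i * L.p (S.R t x)) 0 := by
    intro i
    have hU := S.isH10_U hd ht i
    have m1 : MemLp (fun x => L.p (S.R t x)) 2 D.vol := memLp_slice S.hp.cont ht'
    have m2 : MemLp (fun x => deriv L.p (S.R t x) * S.Rx t x (ev i)) 2 D.vol :=
      memLp_slice (S.hp.cont_ev i) ht'
    have h1 : HasInt D.vol (fun x => S.U t x i * (deriv L.p (S.R t x) * S.Rx t x (ev i))) _ :=
      Integrable.hasInt (MemLp.integrable_mul (p := 2) (q := 2) hU.memLp m2)
    have h2 : HasInt D.vol (fun x => S.B t x i i * L.p (S.R t x)) _ :=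
      Integrable.hasInt (MemLp.integrable_mul (p := 2) (q := 2) (hU.grad_memLp i) m1)
    refine (h1.add h2).congr_val ?_
    have h3 := hU.integral_mul (h := fun x => deriv L.p (S.R t x) * S.Rx t x (ev i))
      (S.hp.isWeakPartial ht i) m1 m2
    linarith
  refine ((HasInt.sum Finset.univ key).congr fun x => ?_).congr_val (by simp)
  rw [Finset.sum_add_distrib, ← Finset.sum_mul, mul_comm (L.p _)]; rfl

theorem integral_grad_mul {t : ℝ} (ht : t ∈ Ioo 0 T) {f : Sp d → ℝ} {g : Fin d → Sp d → ℝ}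
    (hf : D.IsH10 f g) : HasInt D.vol (fun x => (∑ j, g j x * S.G t x j) + f x * S.l t x) 0 := by
  have ht' := Ioo_subset_Icc_self ht
  have key : ∀ j, HasInt D.vol (fun x => g j x * S.G t x j + f x * S.Gx t x (ev j) j) 0 := by
    intro j
    have m1 : MemLp (fun x => S.G t x j) 2 D.vol := memLp_slice (S.hGi j).cont ht'
    have m2 : MemLp (fun x => S.Gx t x (ev j) j) 2 D.vol := memLp_slice ((S.hGi j).cont_ev j) ht'
    have h1 : HasInt D.vol (fun x => g j x * S.G t x j) _ :=
      Integrable.hasInt (MemLp.integrable_mul (p := 2) (q := 2) (hf.grad_memLp j) m1)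
    have h2 : HasInt D.vol (fun x => f x * S.Gx t x (ev j) j) _ :=
      Integrable.hasInt (MemLp.integrable_mul (p := 2) (q := 2) hf.memLp m2)
    refine (h1.add h2).congr_val ?_
    have h3 := hf.integral_mul (h := fun x => S.Gx t x (ev j) j) ((S.hGi j).isWeakPartial ht j) m1 m2
    linarith
  refine ((HasInt.sum Finset.univ key).congr_ae ?_).congr_val (by simp)
  filter_upwards [D.ae_vol_mem] with x hx
  rw [Finset.sum_add_distrib, ← Finset.mul_sum, ← S.l_eq t ht x (D.cell_subset_region hx)]

/-- Here C carries the boundary condition; nothing is asked of g at the boundary, so g may be the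
gradient of the weak order parameter. -/
theorem integral_hess_mul (hd : 0 < d) {t : ℝ} (ht : t ∈ Ioo 0 T) {g H : Fin d → Sp d → ℝ}
    (hg : ∀ j, MemLp (g j) 2 D.vol) (hH : ∀ j, MemLp (H j) 2 D.vol)
    (hw : ∀ j, D.IsWeakPartial j (g j) (H j)) :
    HasInt D.vol (fun x => (∑ j, g j x * S.G t x j) + (∑ j, H j x) * S.C t x) 0 := by
  have hC := S.isH10_C hd ht
  have key : ∀ j, HasInt D.vol (fun x => S.Cx t x (ev j) * g j x + S.C t x * H j x) 0 := by
    intro j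
    have h1 : HasInt D.vol (fun x => S.Cx t x (ev j) * g j x) _ :=
      Integrable.hasInt (MemLp.integrable_mul (p := 2) (q := 2) (hC.grad_memLp j) (hg j))
    have h2 : HasInt D.vol (fun x => S.C t x * H j x) _ :=
      Integrable.hasInt (MemLp.integrable_mul (p := 2) (q := 2) hC.memLp (hH j))
    refine (h1.add h2).congr_val ?_
    rw [hC.integral_mul (hw j) (hg j) (hH j)]
    ring
  refine ((HasInt.sum Finset.univ key).congr_ae ?_).congr_val (by simp)
  filter_upwards [D.ae_vol_mem] with x hx
  rw [Finset.sum_add_distrib, Finset.sum_mul]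
  congr 1
  · exact Finset.sum_congr rfl fun j _ => by
      rw [S.Cx_eq t ht x (D.cell_subset_region hx), mul_comm]
  · exact Finset.sum_congr rfl fun j _ => mul_comm _ _

/-- The Laplacian is symmetric, also after differentiation in time. -/
theorem integral_lt (hd : 0 < d) {f : Sp d → ℝ} {g H : Fin d → Sp d → ℝ} (hf : D.IsH10 f g)
    (hH : ∀ j, MemLp (H j) 2 D.vol) (hw : ∀ j, D.IsWeakPartial j (g j) (H j)) :
    ∀ t ∈ Ioo 0 T, ∫ x, f x * S.lt t x ∂D.vol = ∫ x, (∑ j, H j x) * S.Ct t x ∂D.vol := by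
  have hHs : MemLp (fun x => ∑ j, H j x) 2 D.vol := memLp_finsetSum _ fun j _ => hH j
  -- With f frozen in time, the identity ∫ f ΔC = ∫ Δf C holds for all t and is differentiated in t.
  -- No spatial derivative of ∂ₜC is needed.
  refine C1Data.integral_deriv_eq S.hl S.hC (hf.memLp.integrable (by norm_num))
    (hHs.integrable (by norm_num)) fun t ht => ?_
  have h1 := S.integral_grad_mul ht hf
  have h2 := S.integral_hess_mul hd ht hf.grad_memLp hH hw
  have ht' := Ioo_subset_Icc_self ht
  have h3 : HasInt D.vol (fun x => f x * S.l t x) _ := Integrable.hasInt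
    (MemLp.integrable_mul (p := 2) (q := 2) hf.memLp (memLp_slice S.hl.cont ht'))
  have h4 : HasInt D.vol (fun x => (∑ j, H j x) * S.C t x) _ := Integrable.hasInt
    (MemLp.integrable_mul (p := 2) (q := 2) hHs (memLp_slice S.hC.cont ht'))
  have := ((h1.sub h2).congr (g := fun x => f x * S.l t x - (∑ j, H j x) * S.C t x) fun x => by ring).unique
    (h3.sub h4)
  linarith

theorem integral_C_lt (hd : 0 < d) {t : ℝ} (ht : t ∈ Ioo 0 T) :
    ∫ x, S.C t x * S.lt t x ∂D.vol = ∫ x, S.l t x * S.Ct t x ∂D.vol := by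
  have ht' := Ioo_subset_Icc_self ht
  have hw : ∀ j, D.IsWeakPartial j (fun x => S.Cx t x (ev j)) fun x => S.Gx t x (ev j) j := by
    intro j φ hφ
    refine Eq.trans ?_ ((S.hGi j).isWeakPartial ht j φ hφ)
    refine integral_congr_ae ?_
    filter_upwards [D.ae_vol_mem] with x hx
    rw [S.Cx_eq t ht x (D.cell_subset_region hx)]
  rw [S.integral_lt hd (S.isH10_C hd ht) (fun j => memLp_slice ((S.hGi j).cont_ev j) ht') hw t ht]
  refine integral_congr_ae ?_
  filter_upwards [D.ae_vol_mem] with x hx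
  rw [S.l_eq t ht x (D.cell_subset_region hx)]
  rfl

theorem integral_energy_G (hT : 0 < T) (hd : 0 < d) : ∀ t ∈ Icc 0 T,
    ∫ x, ((∑ j, S.G t x j * S.G t x j) + S.C t x * S.l t x) ∂D.vol = 0 := by
  refine integral_eq_zero_of_Ioo hT (f := fun t x => (∑ j, S.G t x j * S.G t x j) + S.C t x * S.l t x) ?_ fun t ht => ?_
  · exact (continuousOn_finsetSum _ fun j _ => (S.hGi j).cont.mul (S.hGi j).cont).add
      (S.hC.cont.mul S.hl.cont)
  · rw [← (S.integral_grad_mul ht (S.isH10_C hd ht)).2]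
    refine integral_congr_ae ?_
    filter_upwards [D.ae_vol_mem] with x hx
    simp only [S.Cx_eq t ht x (D.cell_subset_region hx)]

/-- At t = 0 the function C is not assumed differentiable in space, but the weak form of G = ∇C
passes to the limit t → 0. -/
theorem isWeakGrad_zero (hT : 0 < T) : D.IsWeakGrad (S.C 0) (S.G 0) := by
  intro j φ hφ
  have h0 : (0:ℝ) ∈ Icc 0 T := ⟨le_rfl, hT.le⟩
  have h1 : HasInt D.vol (fun x => S.C 0 x * pderiv j φ x) _ :=
    Integrable.hasInt ((hφ.pderiv j).integrable_mul (integrable_slice S.hC.cont h0))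
  have h2 : HasInt D.vol (fun x => S.G 0 x j * φ x) _ :=
    Integrable.hasInt (hφ.integrable_mul (integrable_slice (S.hGi j).cont h0))
  have h3 := integral_eq_zero_of_Ioo (D := D) hT (f := fun t x => S.C t x * pderiv j φ x + S.G t x j * φ x)
    ((S.hC.cont.mul ((hφ.pderiv j).continuous.comp continuous_snd).continuousOn).add
      ((S.hGi j).cont.mul (hφ.continuous.comp continuous_snd).continuousOn)) (fun t ht => by
        have ht' := Ioo_subset_Icc_self ht
        have h4 : HasInt D.vol (fun x => S.C t x * pderiv j φ x) _ :=
          Integrable.hasInt ((hφ.pderiv j).integrable_mul (integrable_slice S.hC.cont ht'))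
        have h5 : HasInt D.vol (fun x => S.G t x j * φ x) _ :=
          Integrable.hasInt (hφ.integrable_mul (integrable_slice (S.hGi j).cont ht'))
        rw [(h4.add h5).2, S.hC.isWeakPartial ht j φ hφ]
        rw [neg_add_eq_zero]
        refine integral_congr_ae ?_
        filter_upwards [D.ae_vol_mem] with x hx
        rw [S.Cx_eq t ht x (D.cell_subset_region hx)]) 0 h0
  rw [(h1.add h2).2] at h3
  linarith

end StrongData

/-- Weak gradients are unique. -/
theorem ae_eq_of_isWeakGrad {d : ℕ} {D : FlowDomain d} {f : Sp d → ℝ} {G G' : Sp d → Sp d}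
    (h : D.IsWeakGrad f G) (h' : D.IsWeakGrad f G') (hG : ∀ j, Integrable (fun x => G x j) D.vol)
    (hG' : ∀ j, Integrable (fun x => G' x j) D.vol) : G =ᵐ[D.vol] G' := by
  have : ∀ j, ∀ᵐ x ∂D.vol, G x j - G' x j = 0 := fun j =>
    D.ae_eq_zero_of_smoothTest ((hG j).sub (hG' j)) fun b hb => by
      have h1 := h j b hb
      have h2 := h' j b hb
      have := ((hb.integrable_mul (hG j)).hasInt.sub (hb.integrable_mul (hG' j)).hasInt).congr
        (g := fun x => (G x j - G' x j) * b x) fun x => by ring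
      rw [this.2]
      linarith
  filter_upwards [ae_all_iff.2 this] with x hx
  ext j
  exact sub_eq_zero.1 (hx j)


/-! ### Equations integrated against time weights -/

open FlowDomain

/-- Time weights: `C¹`, nonnegative, nonincreasing, vanishing near `T`. -/
structure Weight (T : ℝ) (θ θ' : ℝ → ℝ) : Prop where
  hasDerivAt : ∀ t, HasDerivAt θ (θ' t) t
  cont : Continuous θ'
  nonneg : ∀ t, 0 ≤ θ t
  deriv_nonpos : ∀ t, θ' t ≤ 0
  vanish : ∃ T' < T, ∀ t, T' ≤ t → θ t = 0

namespace Weight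

variable {T : ℝ} {θ θ' : ℝ → ℝ}

theorem continuous (hθ : Weight T θ θ') : Continuous θ :=
  continuous_iff_continuousAt.2 fun t => (hθ.hasDerivAt t).continuousAt

theorem isPrim (hθ : Weight T θ θ') : IsPrim T θ θ' :=
  IsPrim.of_hasDerivAt hθ.continuous.continuousOn (fun t _ => hθ.hasDerivAt t)
    (hθ.cont.intervalIntegrable _ _)

theorem eq_zero (hθ : Weight T θ θ') : θ T = 0 := by
  obtain ⟨T', hT', h⟩ := hθ.vanish
  exact h T hT'.le

end Weight

namespace FlowDomain

variable {d : ℕ} {D : FlowDomain d} {T : ℝ}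

theorem C1Data.sub {V : Type*} [NormedAddCommGroup V] [NormedSpace ℝ V] {f ft g gt : ℝ → Sp d → V}
    {fx gx : ℝ → Sp d → Sp d →L[ℝ] V} (h : D.C1Data T f ft fx)
    (h' : D.C1Data T g gt gx) : D.C1Data T (fun t x => f t x - g t x) (fun t x => ft t x - gt t x)
      fun t x => fx t x - gx t x where
  cont := h.cont.sub h'.cont
  per t ht := (h.per t ht).comp₂ (h'.per t ht) fun r v => r - v
  cont_t := h.cont_t.sub h'.cont_t
  cont_x := h.cont_x.sub h'.cont_x
  hasDerivAt t ht x hx := (h.hasDerivAt t ht x hx).sub (h'.hasDerivAt t ht x hx)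
  hasFDerivAt t ht x hx := (h.hasFDerivAt t ht x hx).sub (h'.hasFDerivAt t ht x hx)

theorem C1Data.isPrim {a a' : ℝ → Sp d → ℝ} {ax : ℝ → Sp d → Sp d →L[ℝ] ℝ} (hT : 0 ≤ T)
    (h : D.C1Data T a a' ax) {x : Sp d} (hx : x ∈ D.cell) :
    IsPrim T (fun t => a t x) fun t => a' t x := by
  have hx' := D.cell_subset_region hx
  refine IsPrim.of_hasDerivAt (continuousOn_time h.cont (D.region_subset_closedRegion hx'))
    (fun t ht => h.hasDerivAt t ht x hx') ?_
  refine ContinuousOn.intervalIntegrable ?_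
  rw [uIcc_of_le hT]
  exact continuousOn_time h.cont_t (D.region_subset_closedRegion hx')

theorem ae_spaceTime_of_forall {p : ℝ × Sp d → Prop} (h : ∀ t ∈ Ioo 0 T, ∀ x ∈ D.cell, p (t, x)) :
    ∀ᵐ z ∂D.spaceTime T, p z := by
  filter_upwards [D.ae_spaceTime_mem T] with z hz using h z.1 hz.1 z.2 hz.2

theorem integrable_mul_cont {a : ℝ → Sp d → ℝ}
    (ha : ContinuousOn (Function.uncurry a) (Icc 0 T ×ˢ D.closedRegion)) {f : ℝ × Sp d → ℝ}
    (hf : Integrable f (D.spaceTime T)) : Integrable (fun z => a z.1 z.2 * f z) (D.spaceTime T) := by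
  obtain ⟨B, -, hB⟩ := exists_bound_of_continuousOn ha
  exact hf.bdd_mul (c := B) (aestronglyMeasurable_spaceTime ha)
    (ae_spaceTime_of_forall fun t ht x hx => hB t (Ioo_subset_Icc_self ht) x hx)

theorem integrable_cont {a : ℝ → Sp d → ℝ}
    (ha : ContinuousOn (Function.uncurry a) (Icc 0 T ×ˢ D.closedRegion)) :
    Integrable (fun z : ℝ × Sp d => a z.1 z.2) (D.spaceTime T) := by
  simpa using integrable_mul_cont ha (integrable_const (1:ℝ))

theorem memLp_cont {a : ℝ → Sp d → ℝ}
    (ha : ContinuousOn (Function.uncurry a) (Icc 0 T ×ˢ D.closedRegion)) {p : ℝ≥0∞} :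
    MemLp (fun z : ℝ × Sp d => a z.1 z.2) p (D.spaceTime T) := by
  obtain ⟨B, -, hB⟩ := exists_bound_of_continuousOn ha
  exact MemLp.of_bound (aestronglyMeasurable_spaceTime ha) B
    (ae_spaceTime_of_forall fun t ht x hx => hB t (Ioo_subset_Icc_self ht) x hx)

theorem cont_time {θ : ℝ → ℝ} (hθ : Continuous θ) :
    ContinuousOn (Function.uncurry fun t (_ : Sp d) => θ t) (Icc 0 T ×ˢ D.closedRegion) :=
  (hθ.comp continuous_fst).continuousOn

theorem integrable_time_mul {θ : ℝ → ℝ} (hθ : Continuous θ) {f : ℝ × Sp d → ℝ}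
    (hf : Integrable f (D.spaceTime T)) : Integrable (fun z => θ z.1 * f z) (D.spaceTime T) :=
  integrable_mul_cont (cont_time hθ) hf

theorem hasInt_of_time {F : ℝ × Sp d → ℝ} (hF : Integrable F (D.spaceTime T)) {b : Sp d → ℝ}
    (h : ∀ᵐ x ∂D.vol, ∫ t in Ioo 0 T, F (t, x) = b x) : HasInt (D.spaceTime T) F (∫ x, b x ∂D.vol) := by
  refine ⟨hF, ?_⟩
  rw [spaceTime, integral_prod_symm _ hF]
  exact integral_congr_ae h

theorem hasInt_of_space {F : ℝ × Sp d → ℝ} (hF : Integrable F (D.spaceTime T)) {b : ℝ → ℝ}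
    (h : ∀ᵐ t ∂volume.restrict (Ioo 0 T), ∫ x, F (t, x) ∂D.vol = b t) :
    HasInt (D.spaceTime T) F (∫ t in Ioo 0 T, b t) := by
  refine ⟨hF, ?_⟩
  rw [spaceTime, integral_prod _ hF]
  exact integral_congr_ae h

theorem C1Data.hasInt_weight {a a' : ℝ → Sp d → ℝ} {ax : ℝ → Sp d → Sp d →L[ℝ] ℝ} (hT : 0 ≤ T)
    (h : D.C1Data T a a' ax) {θ θ' : ℝ → ℝ} (hθ : Weight T θ θ') :
    HasInt (D.spaceTime T) (fun z => θ' z.1 * a z.1 z.2 + θ z.1 * a' z.1 z.2)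
      (∫ x, -(θ 0 * a 0 x) ∂D.vol) := by
  refine hasInt_of_time ((integrable_time_mul hθ.cont (integrable_cont h.cont)).fun_add
    (integrable_time_mul hθ.continuous (integrable_cont h.cont_t))) ?_
  filter_upwards [D.ae_vol_mem] with x hx
  rw [(hθ.isPrim.mul hT (h.isPrim hT hx)).integral_eq hT, hθ.eq_zero]
  ring

/-- Primitives in time, tested with a weight. -/
theorem hasInt_weight_of_primitive (hT : 0 ≤ T) {c g : ℝ → Sp d → ℝ} {c0 : Sp d → ℝ}
    (hc : Integrable (fun z : ℝ × Sp d => c z.1 z.2) (D.spaceTime T))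
    (hg : Integrable (fun z : ℝ × Sp d => g z.1 z.2) (D.spaceTime T))
    (h : ∀ᵐ x ∂D.vol, IntegrableOn (fun t => g t x) (Ioo 0 T) ∧
      ∀ᵐ t ∂volume.restrict (Ioo 0 T), c t x = c0 x + ∫ s in 0..t, g s x)
    {a a' : ℝ → Sp d → ℝ} {ax : ℝ → Sp d → Sp d →L[ℝ] ℝ} (ha : D.C1Data T a a' ax)
    {θ θ' : ℝ → ℝ} (hθ : Weight T θ θ') :
    HasInt (D.spaceTime T) (fun z => θ' z.1 * (a z.1 z.2 * c z.1 z.2)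
      + θ z.1 * (a' z.1 z.2 * c z.1 z.2 + a z.1 z.2 * g z.1 z.2))
      (∫ x, -(θ 0 * (a 0 x * c0 x)) ∂D.vol) := by
  refine hasInt_of_time ((integrable_time_mul hθ.cont (integrable_mul_cont ha.cont hc)).fun_add
    (integrable_time_mul hθ.continuous ((integrable_mul_cont ha.cont_t hc).fun_add
      (integrable_mul_cont ha.cont hg)))) ?_
  filter_upwards [D.ae_vol_mem, h] with x hx hp
  have hZ := isPrim_integral hT hp.1 (c0 x)
  have h1 := (hθ.isPrim.mul hT ((ha.isPrim hT hx).mul hT hZ)).integral_eq hT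
  simp only [hθ.eq_zero, intervalIntegral.integral_same, add_zero, zero_mul, zero_sub] at h1
  rw [← h1]
  refine integral_congr_ae ?_
  filter_upwards [hp.2] with t ht
  rw [← ht]

/-- The renormalized equation for the difference of a primitive and a smooth function with the same
initial value. -/
theorem hasInt_weight_comp (hT : 0 ≤ T) {c g : ℝ → Sp d → ℝ}
    (hc : AEStronglyMeasurable (fun z : ℝ × Sp d => c z.1 z.2) (D.spaceTime T))
    (hg : Integrable (fun z : ℝ × Sp d => g z.1 z.2) (D.spaceTime T))
    {a a' : ℝ → Sp d → ℝ} {ax : ℝ → Sp d → Sp d →L[ℝ] ℝ} (ha : D.C1Data T a a' ax)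
    (h : ∀ᵐ x ∂D.vol, IntegrableOn (fun t => g t x) (Ioo 0 T) ∧
      ∀ᵐ t ∂volume.restrict (Ioo 0 T), c t x = a 0 x + ∫ s in 0..t, g s x)
    {θ θ' : ℝ → ℝ} (hθ : Weight T θ θ') {Φ Φ' : ℝ → ℝ} (hΦ : ∀ s, HasDerivAt Φ (Φ' s) s)
    (hΦ' : Continuous Φ') (hb : ∀ s, |Φ' s| ≤ 1) (hb0 : ∀ s, |Φ s| ≤ 1) (h0 : Φ 0 = 0) :
    HasInt (D.spaceTime T) (fun z => θ' z.1 * Φ (c z.1 z.2 - a z.1 z.2)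
      + θ z.1 * (Φ' (c z.1 z.2 - a z.1 z.2) * (g z.1 z.2 - a' z.1 z.2))) 0 := by
  have hw := hc.sub (aestronglyMeasurable_spaceTime ha.cont)
  have hΦc : Continuous Φ := continuous_iff_continuousAt.2 fun s => (hΦ s).continuousAt
  have i1 : Integrable (fun z : ℝ × Sp d => Φ (c z.1 z.2 - a z.1 z.2)) (D.spaceTime T) :=
    (MemLp.of_bound (p := 1) (hΦc.comp_aestronglyMeasurable hw) 1 (Eventually.of_forall fun z => hb0 _)).integrable le_rfl
  have i2 : Integrable (fun z : ℝ × Sp d => Φ' (c z.1 z.2 - a z.1 z.2) * (g z.1 z.2 - a' z.1 z.2)) (D.spaceTime T) :=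
    (hg.sub (integrable_cont ha.cont_t)).bdd_mul (c := 1) (hΦ'.comp_aestronglyMeasurable hw)
      (Eventually.of_forall fun z => hb _)
  have := hasInt_of_time (D := D) (T := T) (F := fun z => θ' z.1 * Φ (c z.1 z.2 - a z.1 z.2)
      + θ z.1 * (Φ' (c z.1 z.2 - a z.1 z.2) * (g z.1 z.2 - a' z.1 z.2))) (b := fun _ => 0)
    ((integrable_time_mul hθ.cont i1).fun_add (integrable_time_mul hθ.continuous i2)) (by
    filter_upwards [D.ae_vol_mem, h] with x hx hp
    have hZ := (isPrim_integral hT hp.1 (a 0 x)).sub hT (ha.isPrim hT hx)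
    -- The difference starts from 0 and Φ(0) = 0, while θ(T) = 0; both boundary terms vanish.
    have h1 := (hθ.isPrim.mul hT (hZ.comp hT hΦ hb)).integral_eq hT
    simp only [hθ.eq_zero, intervalIntegral.integral_same, add_zero, zero_mul, sub_self, h0,
      mul_zero] at h1
    refine Eq.trans (integral_congr_ae ?_) h1
    filter_upwards [hp.2] with t ht
    rw [← ht])
  simpa using this

theorem memLp_of_essBdd {E : Type*} [NormedAddCommGroup E] {F : ℝ → Sp d → E}
    (hF : AEStronglyMeasurable (fun z : ℝ × Sp d => F z.1 z.2) (D.spaceTime T)) {p : ℝ≥0∞}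
    (hp0 : p ≠ 0) (hp : p ≠ ⊤) (h : EssBdd T fun t => eLpNorm (F t) p D.vol) :
    MemLp (fun z : ℝ × Sp d => F z.1 z.2) p (D.spaceTime T) := by
  refine ⟨hF, ?_⟩
  rw [eLpNorm_lt_top_iff_lintegral_rpow_enorm_lt_top hp0 hp]
  obtain ⟨M, hM⟩ := h
  have hp' : 0 < p.toReal := ENNReal.toReal_pos hp0 hp
  rw [spaceTime, lintegral_prod _ (hF.enorm.pow_const _)]
  calc ∫⁻ t in Ioo 0 T, ∫⁻ x, ‖F t x‖ₑ ^ p.toReal ∂D.vol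
      ≤ ∫⁻ _ in Ioo 0 T, (M : ℝ≥0∞) ^ p.toReal := by
        refine lintegral_mono_ae ?_
        filter_upwards [hM] with t ht
        rw [← ENNReal.rpow_le_rpow_iff (z := 1 / p.toReal) (by positivity), ← ENNReal.rpow_mul,
          mul_one_div_cancel hp'.ne', ENNReal.rpow_one, ← eLpNorm_eq_lintegral_rpow_enorm_toReal hp0 hp]
        exact ht
    _ < ⊤ := by
        rw [lintegral_const]
        refine ENNReal.mul_lt_top ?_ ?_
        · exact ENNReal.rpow_lt_top_of_nonneg hp'.le ENNReal.coe_ne_top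
        · simp

end FlowDomain

namespace StrongData

variable {d : ℕ} {L : FluidLaw} {D : FlowDomain d} {T : ℝ} (S : StrongData L D T)

theorem hM : D.C1Data T S.M S.Mt fun t x => S.lx t x - glF2 (S.C t x) • S.Cx t x :=
  S.hl.sub (S.hC.comp (S := univ) (fun a _ => hasDerivAt_glF1 a) continuous_glF2.continuousOn
    fun _ _ _ _ => mem_univ _)

end StrongData

/-! ### Integrability of the weak solution -/

/-- The chemical potential `Δc - F'(c)` of the weak solution. -/
def chem {d : ℕ} (c : ℝ → Sp d → ℝ) (Hc : ℝ → Sp d → Matrix (Fin d) (Fin d) ℝ) (t : ℝ) (x : Sp d) : ℝ :=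
  (Hc t x).trace - glF1 (c t x)

namespace IsDissipativeWeakSolutionWith

variable {d : ℕ} {L : FluidLaw} {D : FlowDomain d} {T : ℝ} {ϱ₀ : Sp d → ℝ} {m₀ : Sp d → Sp d}
  {c₀ : Sp d → ℝ} {ϱ : ℝ → Sp d → ℝ} {u : ℝ → Sp d → Sp d} {c : ℝ → Sp d → ℝ}
  {𝔈 : ℝ → Measure (Sp d)} {ℜ : ℝ → MatMeasure d} {Gu : ℝ → Sp d → Matrix (Fin d) (Fin d) ℝ}
  {Gc : ℝ → Sp d → Sp d} {Hc : ℝ → Sp d → Matrix (Fin d) (Fin d) ℝ} {G₀ : Sp d → Sp d}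

theorem _root_.MeasureTheory.MemLp.coord {α : Type*} [MeasurableSpace α] {μ : Measure α} {p : ℝ≥0∞}
    {f : α → Sp d} (hf : MemLp f p μ) (i : Fin d) : MemLp (fun x => f x i) p μ :=
  hf.of_le ((EuclideanSpace.proj i : Sp d →L[ℝ] ℝ).continuous.comp_aestronglyMeasurable hf.1)
    (Eventually.of_forall fun x => PiLp.norm_apply_le (f x) i)

theorem _root_.MeasureTheory.MemLp.int_mul {α : Type*} [MeasurableSpace α] {μ : Measure α}
    {f g : α → ℝ} (hf : MemLp f 2 μ) (hg : MemLp g 2 μ) : Integrable (fun x => f x * g x) μ :=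
  MemLp.integrable_mul (p := 2) (q := 2) hf hg

theorem memLp_u (h : IsDissipativeWeakSolutionWith L D T ϱ₀ m₀ c₀ ϱ u c 𝔈 ℜ Gu Gc Hc G₀) (i : Fin d) :
    MemLp (fun z : ℝ × Sp d => u z.1 z.2 i) 2 (D.spaceTime T) := h.u_L2.coord i

theorem memLp_Gc (h : IsDissipativeWeakSolutionWith L D T ϱ₀ m₀ c₀ ϱ u c 𝔈 ℜ Gu Gc Hc G₀) (i : Fin d) :
    MemLp (fun z : ℝ × Sp d => Gc z.1 z.2 i) 2 (D.spaceTime T) := h.gradc_L2.coord i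

theorem memLp_c (h : IsDissipativeWeakSolutionWith L D T ϱ₀ m₀ c₀ ϱ u c 𝔈 ℜ Gu Gc Hc G₀) :
    MemLp (fun z : ℝ × Sp d => c z.1 z.2) 2 (D.spaceTime T) := h.c_L2

theorem memLp_trace (h : IsDissipativeWeakSolutionWith L D T ϱ₀ m₀ c₀ ϱ u c 𝔈 ℜ Gu Gc Hc G₀) :
    MemLp (fun z : ℝ × Sp d => (Hc z.1 z.2).trace) 2 (D.spaceTime T) :=
  memLp_finsetSum _ fun i _ => h.hessc_L2 i i

theorem memLp_chem (h : IsDissipativeWeakSolutionWith L D T ϱ₀ m₀ c₀ ϱ u c 𝔈 ℜ Gu Gc Hc G₀) :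
    MemLp (fun z : ℝ × Sp d => chem c Hc z.1 z.2) 2 (D.spaceTime T) := by
  refine h.memLp_trace.sub ((h.memLp_c.const_mul 2).of_le
    (continuous_glF1.comp_aestronglyMeasurable h.memLp_c.1) (Eventually.of_forall fun z => ?_))
  rw [Real.norm_eq_abs, Real.norm_eq_abs, abs_mul, abs_two]
  exact abs_glF1_le _

theorem integrable_P (h : IsDissipativeWeakSolutionWith L D T ϱ₀ m₀ c₀ ϱ u c 𝔈 ℜ Gu Gc Hc G₀) :
    Integrable (fun z : ℝ × Sp d => L.P (ϱ z.1 z.2)) (D.spaceTime T) := by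
  -- P is continuous only on [0, ∞). Composition with max q 0 is continuous everywhere and changes
  -- nothing, since ϱ ≥ 0 almost everywhere.
  have hc : Continuous fun q : ℝ => L.P (max q 0) :=
    L.P_cont.comp_continuous (by fun_prop) fun q => mem_Ici.2 (le_max_right _ _)
  have hm : AEStronglyMeasurable (fun z : ℝ × Sp d => L.P (ϱ z.1 z.2)) (D.spaceTime T) := by
    refine (hc.comp_aestronglyMeasurable h.rho_meas).congr ?_
    filter_upwards [h.rho_nonneg] with z hz
    change L.P (max (ϱ z.1 z.2) 0) = _
    rw [max_eq_left hz]
  exact (memLp_of_essBdd (F := fun t x => L.P (ϱ t x)) hm one_ne_zero ENNReal.one_ne_top h.pressure_bdd).integrable le_rfl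

/-- Integrability of ϱ is not part of the definition; it follows from superlinear growth of P. -/
theorem integrable_rho (h : IsDissipativeWeakSolutionWith L D T ϱ₀ m₀ c₀ ϱ u c 𝔈 ℜ Gu Gc Hc G₀) :
    Integrable (fun z : ℝ × Sp d => ϱ z.1 z.2) (D.spaceTime T) := by
  obtain ⟨K, hK, hb⟩ := L.exists_superlinear 1
  refine (h.integrable_P.norm.add (integrable_const K)).mono' h.rho_meas ?_
  filter_upwards [h.rho_nonneg] with z hz
  rw [Real.norm_of_nonneg hz]
  have := hb _ hz
  simp only [Pi.add_apply, Real.norm_eq_abs]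
  linarith [le_abs_self (L.P (ϱ z.1 z.2))]

theorem integrable_p (h : IsDissipativeWeakSolutionWith L D T ϱ₀ m₀ c₀ ϱ u c 𝔈 ℜ Gu Gc Hc G₀) :
    Integrable (fun z : ℝ × Sp d => L.p (ϱ z.1 z.2)) (D.spaceTime T) := by
  obtain ⟨K, hK, hb⟩ := L.exists_abs_p_le
  have hc : Continuous fun q : ℝ => L.p (max q 0) :=
    L.p_cont.comp_continuous (by fun_prop) fun q => mem_Ici.2 (le_max_right _ _)
  refine (((integrable_const (1:ℝ)).add h.integrable_P.norm).const_mul K).mono' ?_ ?_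
  · refine (hc.comp_aestronglyMeasurable h.rho_meas).congr ?_
    filter_upwards [h.rho_nonneg] with z hz
    change L.p (max (ϱ z.1 z.2) 0) = _
    rw [max_eq_left hz]
  · filter_upwards [h.rho_nonneg] with z hz using hb _ hz

theorem memLp_sqrt (h : IsDissipativeWeakSolutionWith L D T ϱ₀ m₀ c₀ ϱ u c 𝔈 ℜ Gu Gc Hc G₀) :
    MemLp (fun z : ℝ × Sp d => Real.sqrt (ϱ z.1 z.2)) 2 (D.spaceTime T) := by
  refine (memLp_two_iff_integrable_sq (Real.continuous_sqrt.comp_aestronglyMeasurable h.rho_meas)).2 ?_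
  refine h.integrable_rho.congr ?_
  filter_upwards [h.rho_nonneg] with z hz
  exact (Real.sq_sqrt hz).symm

theorem memLp_sqrt_u (h : IsDissipativeWeakSolutionWith L D T ϱ₀ m₀ c₀ ϱ u c 𝔈 ℜ Gu Gc Hc G₀) (i : Fin d) :
    MemLp (fun z : ℝ × Sp d => Real.sqrt (ϱ z.1 z.2) * u z.1 z.2 i) 2 (D.spaceTime T) :=
  (memLp_of_essBdd (F := fun t x => Real.sqrt (ϱ t x) • u t x)
    ((Real.continuous_sqrt.comp_aestronglyMeasurable h.rho_meas).smul h.u_L2.1)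
    two_ne_zero ENNReal.ofNat_ne_top h.kinetic_bdd).coord i

/-- The momentum is the product of √ϱ and √ϱ u, both square integrable. -/
theorem integrable_rho_u (h : IsDissipativeWeakSolutionWith L D T ϱ₀ m₀ c₀ ϱ u c 𝔈 ℜ Gu Gc Hc G₀) (i : Fin d) :
    Integrable (fun z : ℝ × Sp d => ϱ z.1 z.2 * u z.1 z.2 i) (D.spaceTime T) := by
  refine (h.memLp_sqrt.int_mul (h.memLp_sqrt_u i)).congr ?_
  filter_upwards [h.rho_nonneg] with z hz
  rw [← mul_assoc, Real.mul_self_sqrt hz]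

theorem integrable_rho_u_u (h : IsDissipativeWeakSolutionWith L D T ϱ₀ m₀ c₀ ϱ u c 𝔈 ℜ Gu Gc Hc G₀) (i j : Fin d) :
    Integrable (fun z : ℝ × Sp d => ϱ z.1 z.2 * (u z.1 z.2 i * u z.1 z.2 j)) (D.spaceTime T) := by
  refine ((h.memLp_sqrt_u i).int_mul (h.memLp_sqrt_u j)).congr ?_
  filter_upwards [h.rho_nonneg] with z hz
  rw [mul_mul_mul_comm, Real.mul_self_sqrt hz]

theorem integrable_F (h : IsDissipativeWeakSolutionWith L D T ϱ₀ m₀ c₀ ϱ u c 𝔈 ℜ Gu Gc Hc G₀) :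
    Integrable (fun z : ℝ × Sp d => glF (c z.1 z.2)) (D.spaceTime T) := by
  refine (h.memLp_c.integrable_sq.add (integrable_const (1:ℝ))).mono'
    (continuous_glF.comp_aestronglyMeasurable h.memLp_c.1) (Eventually.of_forall fun z => ?_)
  rw [Real.norm_of_nonneg (glF_nonneg _)]
  exact glF_upper _

/-- The time derivative `μ - u · ∇c` of the order parameter. -/
theorem integrable_rate (h : IsDissipativeWeakSolutionWith L D T ϱ₀ m₀ c₀ ϱ u c 𝔈 ℜ Gu Gc Hc G₀) :
    Integrable (fun z : ℝ × Sp d => chem c Hc z.1 z.2 - ∑ j, u z.1 z.2 j * Gc z.1 z.2 j) (D.spaceTime T) :=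
  (h.memLp_chem.integrable (by norm_num)).sub (integrable_finsetSum _ fun j _ => (h.memLp_u j).int_mul (h.memLp_Gc j))

/-- The equation of continuity tested with `θ(t) ψ(t,x)`. -/
theorem continuity_weight (h : IsDissipativeWeakSolutionWith L D T ϱ₀ m₀ c₀ ϱ u c 𝔈 ℜ Gu Gc Hc G₀)
    {ψ ψt : ℝ → Sp d → ℝ} {ψx : ℝ → Sp d → Sp d →L[ℝ] ℝ} (hψ : D.C1Data T ψ ψt ψx) {θ θ' : ℝ → ℝ}
    (hθ : Weight T θ θ') :
    HasInt (D.spaceTime T) (fun z => θ' z.1 * (ψ z.1 z.2 * ϱ z.1 z.2)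
      + θ z.1 * (ψt z.1 z.2 * ϱ z.1 z.2 + ∑ j, ψx z.1 z.2 (ev j) * (ϱ z.1 z.2 * u z.1 z.2 j)))
      (-(θ 0 * ∫ x, ϱ₀ x * ψ 0 x ∂D.vol)) := by
  have hi : Integrable (fun z : ℝ × Sp d => θ' z.1 * (ψ z.1 z.2 * ϱ z.1 z.2)
      + θ z.1 * (ψt z.1 z.2 * ϱ z.1 z.2 + ∑ j, ψx z.1 z.2 (ev j) * (ϱ z.1 z.2 * u z.1 z.2 j))) (D.spaceTime T) :=
    (integrable_time_mul hθ.cont (integrable_mul_cont hψ.cont h.integrable_rho)).add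
      (integrable_time_mul hθ.continuous ((integrable_mul_cont hψ.cont_t h.integrable_rho).add
        (integrable_finsetSum _ fun j _ => integrable_mul_cont (hψ.cont_ev j) (h.integrable_rho_u j))))
  refine ⟨hi, ?_⟩
  obtain ⟨T', hT', h0⟩ := hθ.vanish
  have h1 := h.continuity _ (hψ.testClosed hθ.hasDerivAt hθ.cont hT' h0)
  have hd := (C1Data.time D T hθ.hasDerivAt hθ.cont).smul hψ
  rw [spaceTime, integral_prod _ hi]
  have e0 : ∫ x, ϱ₀ x * (θ 0 • ψ 0 x) ∂D.vol = θ 0 * ∫ x, ϱ₀ x * ψ 0 x ∂D.vol := by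
    rw [← integral_const_mul]
    refine integral_congr_ae (Eventually.of_forall fun x => ?_)
    simp only [smul_eq_mul]; ring
  rw [← e0, ← h1]
  refine setIntegral_congr_fun measurableSet_Ioo fun t ht => ?_
  refine integral_congr_ae ?_
  filter_upwards [D.ae_vol_mem] with x hx
  have hx' := D.cell_subset_region hx
  rw [hd.tderiv_eq ht hx']
  simp only [hd.pderiv_eq ht hx']
  simp only [smul_eq_mul, add_apply, smul_apply, ContinuousLinearMap.smulRight_apply, zero_apply,
    zero_mul, add_zero, mul_add, Finset.mul_sum]
  have : ∀ j, θ t * (ψx t x (ev j) * (ϱ t x * u t x j)) = ϱ t x * (u t x j * (θ t * ψx t x (EuclideanSpace.single j 1))) :=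
    fun j => by ring
  simp only [this]
  ring

end IsDissipativeWeakSolutionWith


/-! ### The energy inequality with a time weight -/

open FlowDomain

theorem integrableOn_cont_mul {T : ℝ} {θ f : ℝ → ℝ} (hθ : Continuous θ) (hf : IntegrableOn f (Ioo 0 T)) :
    IntegrableOn (fun t => θ t * f t) (Ioo 0 T) := by
  obtain ⟨B, hB⟩ := (isCompact_Icc (a := (0:ℝ)) (b := T)).exists_bound_of_continuousOn hθ.continuousOn
  refine hf.bdd_mul (c := B) hθ.aestronglyMeasurable ?_
  filter_upwards [ae_restrict_mem measurableSet_Ioo] with t ht using hB t (Ioo_subset_Icc_self ht)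

theorem IsEnergyDefect.integrableOn {d : ℕ} {D : FlowDomain d} {T : ℝ} {𝔈 : ℝ → Measure (Sp d)}
    (h : IsEnergyDefect D T 𝔈) {A : Set (Sp d)} (hA : MeasurableSet A) :
    IntegrableOn (fun t => (𝔈 t).real A) (Ioo 0 T) := by
  obtain ⟨M, hM⟩ := h.2.2
  refine Integrable.mono' (integrable_const (M : ℝ)) (h.1 A hA).ennreal_toReal.aestronglyMeasurable ?_
  filter_upwards [hM] with t ht
  rw [Real.norm_of_nonneg measureReal_nonneg]
  exact ENNReal.toReal_le_of_le_ofReal M.coe_nonneg (by simpa using (measure_mono (subset_univ A)).trans ht)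

theorem Weight.integral_neg_deriv {T : ℝ} (hT : 0 ≤ T) {θ θ' : ℝ → ℝ} (hθ : Weight T θ θ') :
    ∫ t in Ioo 0 T, -θ' t = θ 0 := by
  rw [integral_neg, hθ.isPrim.integral_eq hT, hθ.eq_zero]
  ring

theorem integrable_ddot_stress {α : Type*} [MeasurableSpace α] {μ : Measure α} {d : ℕ} (L : FluidLaw)
    {A B : α → Matrix (Fin d) (Fin d) ℝ} (hA : ∀ i j, MemLp (fun z => A z i j) 2 μ)
    (hB : ∀ i j, MemLp (fun z => B z i j) 2 μ) : Integrable (fun z => ddot (L.stress (A z)) (B z)) μ := by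
  have htr : MemLp (fun z => (A z).trace) 2 μ := memLp_finsetSum _ fun i _ => hA i i
  have htr' : MemLp (fun z => (B z).trace) 2 μ := memLp_finsetSum _ fun i _ => hB i i
  simp only [ddot_stress]
  refine Integrable.add (Integrable.const_mul (Integrable.sub (Integrable.add ?_ ?_) ?_) _) ?_
  · exact integrable_finsetSum _ fun i _ => integrable_finsetSum _ fun j _ => (hA i j).int_mul (hB i j)
  · exact integrable_finsetSum _ fun i _ => integrable_finsetSum _ fun j _ => (hA j i).int_mul (hB i j)
  · exact (htr.int_mul htr').const_mul _
  · exact (htr.int_mul htr').const_mul _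

namespace IsDissipativeWeakSolutionWith

variable {d : ℕ} {L : FluidLaw} {D : FlowDomain d} {T : ℝ} {ϱ₀ : Sp d → ℝ} {m₀ : Sp d → Sp d}
  {c₀ : Sp d → ℝ} {ϱ : ℝ → Sp d → ℝ} {u : ℝ → Sp d → Sp d} {c : ℝ → Sp d → ℝ}
  {𝔈 : ℝ → Measure (Sp d)} {ℜ : ℝ → MatMeasure d} {Gu : ℝ → Sp d → Matrix (Fin d) (Fin d) ℝ}
  {Gc : ℝ → Sp d → Sp d} {Hc : ℝ → Sp d → Matrix (Fin d) (Fin d) ℝ} {G₀ : Sp d → Sp d}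

theorem integrable_energy (h : IsDissipativeWeakSolutionWith L D T ϱ₀ m₀ c₀ ϱ u c 𝔈 ℜ Gu Gc Hc G₀) :
    Integrable (fun z : ℝ × Sp d => 1 / 2 * (∑ i, ϱ z.1 z.2 * (u z.1 z.2 i * u z.1 z.2 i))
      + 1 / 2 * (∑ i, Gc z.1 z.2 i * Gc z.1 z.2 i) + L.P (ϱ z.1 z.2) + glF (c z.1 z.2)) (D.spaceTime T) :=
  ((((integrable_finsetSum _ fun i _ => h.integrable_rho_u_u i i).const_mul _).add
    ((integrable_finsetSum _ fun i _ => (h.memLp_Gc i).int_mul (h.memLp_Gc i)).const_mul _)).add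
      h.integrable_P).add h.integrable_F

theorem integrable_stress_mul (h : IsDissipativeWeakSolutionWith L D T ϱ₀ m₀ c₀ ϱ u c 𝔈 ℜ Gu Gc Hc G₀)
    {A : ℝ × Sp d → Matrix (Fin d) (Fin d) ℝ} (hA : ∀ i j, MemLp (fun z => A z i j) 2 (D.spaceTime T)) :
    Integrable (fun z : ℝ × Sp d => ddot (L.stress (Gu z.1 z.2)) (A z)) (D.spaceTime T) :=
  integrable_ddot_stress L h.gradu_L2 hA

theorem integrable_diss (h : IsDissipativeWeakSolutionWith L D T ϱ₀ m₀ c₀ ϱ u c 𝔈 ℜ Gu Gc Hc G₀) :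
    Integrable (fun z : ℝ × Sp d => ddot (L.stress (Gu z.1 z.2)) (Gu z.1 z.2) + chem c Hc z.1 z.2 ^ 2)
      (D.spaceTime T) :=
  (h.integrable_stress_mul h.gradu_L2).add h.memLp_chem.integrable_sq

/-- The energy inequality tested with `-θ'`. -/
theorem energy_weight (h : IsDissipativeWeakSolutionWith L D T ϱ₀ m₀ c₀ ϱ u c 𝔈 ℜ Gu Gc Hc G₀)
    (hT : 0 ≤ T) {θ θ' : ℝ → ℝ} (hθ : Weight T θ θ') :
    (∫ z, -θ' z.1 * (1 / 2 * (∑ i, ϱ z.1 z.2 * (u z.1 z.2 i * u z.1 z.2 i))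
      + 1 / 2 * (∑ i, Gc z.1 z.2 i * Gc z.1 z.2 i) + L.P (ϱ z.1 z.2) + glF (c z.1 z.2)) ∂D.spaceTime T)
      + (∫ z, θ z.1 * (ddot (L.stress (Gu z.1 z.2)) (Gu z.1 z.2) + chem c Hc z.1 z.2 ^ 2) ∂D.spaceTime T)
      + ∫ t in Ioo 0 T, -θ' t * (𝔈 t).real D.closedCell
    ≤ θ 0 * ∫ x, L.energyDensity (ϱ₀ x) (m₀ x) (G₀ x) (c₀ x) ∂D.vol := by
  set e : ℝ → Sp d → ℝ := fun t x => 1 / 2 * (∑ i, ϱ t x * (u t x i * u t x i))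
      + 1 / 2 * (∑ i, Gc t x i * Gc t x i) + L.P (ϱ t x) + glF (c t x) with he
  set dd : ℝ → Sp d → ℝ := fun t x => ddot (L.stress (Gu t x)) (Gu t x) + chem c Hc t x ^ 2 with hdd
  set W : ℝ → ℝ := fun t => 0 + ∫ s in 0..t, ∫ x, dd s x ∂D.vol with hW
  set E0 := ∫ x, L.energyDensity (ϱ₀ x) (m₀ x) (G₀ x) (c₀ x) ∂D.vol with hE0
  have hi1 : Integrable (fun z : ℝ × Sp d => -θ' z.1 * e z.1 z.2) (D.spaceTime T) :=
    integrable_time_mul hθ.cont.neg h.integrable_energy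
  have hi2 : Integrable (fun z : ℝ × Sp d => θ z.1 * dd z.1 z.2) (D.spaceTime T) :=
    integrable_time_mul hθ.continuous h.integrable_diss
  have hdi : IntegrableOn (fun s => ∫ x, dd s x ∂D.vol) (Ioo 0 T) := h.integrable_diss.integral_prod_left
  have hei : IntegrableOn (fun s => ∫ x, e s x ∂D.vol) (Ioo 0 T) := h.integrable_energy.integral_prod_left
  have hWp : IsPrim T W fun s => ∫ x, dd s x ∂D.vol := isPrim_integral hT hdi 0
  -- As W(0) = 0 and θ(T) = 0, the integral of θ'W + θW' vanishes. This converts the dissipation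
  -- accumulated up to time t, weighted by −θ', into the dissipation weighted by θ.
  have hp := (hθ.isPrim.mul hT hWp).integral_eq hT
  have hW0 : W 0 = 0 := by simp [hW]
  rw [hθ.eq_zero, hW0, zero_mul, mul_zero, sub_zero] at hp
  have hWc : IntegrableOn W (Ioo 0 T) := by
    have := (hWp.ac.continuousOn.integrableOn_compact (μ := volume) isCompact_uIcc)
    rw [uIcc_of_le hT] at this
    refine (this.mono_set Ioo_subset_Icc_self).congr ?_
    exact Eventually.of_forall fun t => by simp [hW]
  have j1 : HasInt (volume.restrict (Ioo 0 T)) (fun t => -θ' t * ∫ x, e t x ∂D.vol)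
      (∫ t in Ioo 0 T, -θ' t * ∫ x, e t x ∂D.vol) :=
    (integrableOn_cont_mul hθ.cont.neg hei).hasInt
  have j2 : HasInt (volume.restrict (Ioo 0 T)) (fun t => θ t * ∫ x, dd t x ∂D.vol)
      (∫ t in Ioo 0 T, θ t * ∫ x, dd t x ∂D.vol) :=
    (integrableOn_cont_mul hθ.continuous hdi).hasInt
  have j3 : HasInt (volume.restrict (Ioo 0 T)) (fun t => -θ' t * (𝔈 t).real D.closedCell)
      (∫ t in Ioo 0 T, -θ' t * (𝔈 t).real D.closedCell) :=
    (integrableOn_cont_mul hθ.cont.neg (h.energy_defect.integrableOn D.measurableSet_closedCell)).hasInt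
  have j4 : HasInt (volume.restrict (Ioo 0 T)) (fun t => -θ' t * W t)
      (∫ t in Ioo 0 T, -θ' t * W t) :=
    (integrableOn_cont_mul hθ.cont.neg hWc).hasInt
  have j5 : HasInt (volume.restrict (Ioo 0 T)) (fun t => -θ' t) (θ 0) := by
    refine ⟨?_, hθ.integral_neg_deriv hT⟩
    have : Integrable (fun t => -θ' t * 1) (volume.restrict (Ioo 0 T)) :=
      integrableOn_cont_mul (T := T) hθ.cont.neg (f := fun _ => 1) (integrable_const _)
    simpa only [mul_one] using this
  have hj := (j2.sub j4).2
  rw [show ∫ t in Ioo 0 T, ((θ t * ∫ x, dd t x ∂D.vol) - -θ' t * W t) = 0 from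
    (integral_congr_ae (Eventually.of_forall fun t => by ring)).trans hp] at hj
  have e1 : ∫ z, -θ' z.1 * e z.1 z.2 ∂D.spaceTime T = ∫ t in Ioo 0 T, -θ' t * ∫ x, e t x ∂D.vol := by
    rw [spaceTime, integral_prod _ hi1]
    simp only [integral_const_mul]
  have e2 : ∫ z, θ z.1 * dd z.1 z.2 ∂D.spaceTime T = ∫ t in Ioo 0 T, θ t * ∫ x, dd t x ∂D.vol := by
    rw [spaceTime, integral_prod _ hi2]
    simp only [integral_const_mul]
  change (∫ z, -θ' z.1 * e z.1 z.2 ∂D.spaceTime T) + (∫ z, θ z.1 * dd z.1 z.2 ∂D.spaceTime T) + _ ≤ _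
  rw [e1, e2]
  have key := HasInt.mono_ae ((j1.add j4).add j3) (j5.const_mul E0) (by
    filter_upwards [h.energy, ae_restrict_mem measurableSet_Ioo,
      (ae_restrict_mem measurableSet_Ioo : ∀ᵐ t ∂volume.restrict (Ioo 0 T), t ∈ Ioo 0 T)] with t ht htT _
    have e3 : ∫ x, (1 / 2 * (ϱ t x * ‖u t x‖ ^ 2) + 1 / 2 * ‖Gc t x‖ ^ 2
        + L.P (ϱ t x) + glF (c t x)) ∂D.vol = ∫ x, e t x ∂D.vol := by
      refine integral_congr_ae (Eventually.of_forall fun x => ?_)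
      simp only [he]
      rw [EuclideanSpace.real_norm_sq_eq, EuclideanSpace.real_norm_sq_eq]
      simp only [Finset.mul_sum, sq]
    have e4 : ∫ s in Ioo 0 t, ((∫ x, ddot (L.stress (Gu s x)) (Gu s x) ∂D.vol)
          + ∫ x, ((Hc s x).trace - deriv glF (c s x)) ^ 2 ∂D.vol) = W t := by
      rw [hW]
      simp only [zero_add]
      rw [intervalIntegral.integral_of_le htT.1.le, integral_Ioc_eq_integral_Ioo]
      refine integral_congr_ae ?_
      have hsub : Ioo 0 t ⊆ Ioo 0 T := Ioo_subset_Ioo_right htT.2.le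
      filter_upwards [ae_restrict_of_ae_restrict_of_subset hsub (h.integrable_stress_mul h.gradu_L2).prod_right_ae,
        ae_restrict_of_ae_restrict_of_subset hsub h.memLp_chem.integrable_sq.prod_right_ae] with s h1 h2
      rw [hdd]
      simp only [deriv_glF]
      exact (integral_add h1 h2).symm
    rw [e3, e4] at ht
    have := mul_le_mul_of_nonneg_left ht (neg_nonneg.2 (hθ.deriv_nonpos t))
    linarith)
  linarith

end IsDissipativeWeakSolutionWith


/-! ### Order parameter, mass, and a set of positive density -/

open FlowDomain

theorem FlowDomain.vol_pos {d : ℕ} (D : FlowDomain d) : 0 < D.vol.real univ := by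
  rw [measureReal_def, ENNReal.toReal_pos_iff]
  refine ⟨?_, measure_lt_top _ _⟩
  cases D with
  | torus =>
    have h := vol_torus_univ (d := d)
    by_contra h0
    rw [not_lt, nonpos_iff_eq_zero] at h0
    rw [measureReal_def, h0] at h
    exact (pow_pos two_pos d).ne h
  | dirichlet Ω ho hb hc =>
    rw [vol, Measure.restrict_apply_univ]
    exact ho.measure_pos _ hc.nonempty

namespace IsDissipativeWeakSolutionWith

variable {d : ℕ} {L : FluidLaw} {D : FlowDomain d} {T : ℝ} {ϱ₀ : Sp d → ℝ} {m₀ : Sp d → Sp d}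
  {c₀ : Sp d → ℝ} {ϱ : ℝ → Sp d → ℝ} {u : ℝ → Sp d → Sp d} {c : ℝ → Sp d → ℝ}
  {𝔈 : ℝ → Measure (Sp d)} {ℜ : ℝ → MatMeasure d} {Gu : ℝ → Sp d → Matrix (Fin d) (Fin d) ℝ}
  {Gc : ℝ → Sp d → Sp d} {Hc : ℝ → Sp d → Matrix (Fin d) (Fin d) ℝ} {G₀ : Sp d → Sp d}

/-- The order parameter is absolutely continuous in time at almost every point. -/
theorem allenCahn_primitive (h : IsDissipativeWeakSolutionWith L D T ϱ₀ m₀ c₀ ϱ u c 𝔈 ℜ Gu Gc Hc G₀)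
    (hT : 0 < T) (hc0 : Integrable c₀ D.vol) :
    ∀ᵐ x ∂D.vol, IntegrableOn (fun t => chem c Hc t x - ∑ j, u t x j * Gc t x j) (Ioo 0 T) ∧
      ∀ᵐ t ∂volume.restrict (Ioo 0 T),
        c t x = c₀ x + ∫ s in 0..t, (chem c Hc s x - ∑ j, u s x j * Gc s x j) := by
  refine D.ae_primitive_of_weak hT (h.memLp_c.integrable (by norm_num)) h.integrable_rate hc0 fun φ hφ => ?_
  have h1 := h.allenCahn φ hφ
  obtain ⟨φt, φx, hd⟩ := hφ.1.1.exists_data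
  have i1 : Integrable (fun z : ℝ × Sp d => φt z.1 z.2 * c z.1 z.2) (D.spaceTime T) :=
    integrable_mul_cont hd.cont_t (h.memLp_c.integrable (by norm_num))
  have i2 : Integrable (fun z : ℝ × Sp d => φ z.1 z.2 * ∑ j, u z.1 z.2 j * Gc z.1 z.2 j) (D.spaceTime T) :=
    integrable_mul_cont hd.cont (integrable_finsetSum _ fun j _ => (h.memLp_u j).int_mul (h.memLp_Gc j))
  have i3 : Integrable (fun z : ℝ × Sp d => φ z.1 z.2 * chem c Hc z.1 z.2) (D.spaceTime T) :=
    integrable_mul_cont hd.cont (h.memLp_chem.integrable (by norm_num))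
  have e2 : ∫ t in Ioo 0 T, ∫ x, (c t x * tderiv φ t x - inner ℝ (u t x) (Gc t x) * φ t x) ∂D.vol
      = ∫ z, (φt z.1 z.2 * c z.1 z.2 - φ z.1 z.2 * ∑ j, u z.1 z.2 j * Gc z.1 z.2 j) ∂D.spaceTime T := by
    refine Eq.trans ?_ (integral_prod _ (i1.sub i2)).symm
    refine setIntegral_congr_fun measurableSet_Ioo fun t ht => integral_congr_ae ?_
    filter_upwards [D.ae_vol_mem] with x hx
    rw [hd.tderiv_eq ht (D.cell_subset_region hx), PiLp.inner_apply]
    simp only [RCLike.inner_apply, conj_trivial, Pi.sub_apply, mul_comm]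
  have e3 : ∫ t in Ioo 0 T, ∫ x, ((Hc t x).trace - deriv glF (c t x)) * φ t x ∂D.vol
      = ∫ z, φ z.1 z.2 * chem c Hc z.1 z.2 ∂D.spaceTime T := by
    refine Eq.trans ?_ (integral_prod _ i3).symm
    simp only [deriv_glF, chem, mul_comm]
  have e4 : ∫ t in Ioo 0 T, ∫ x, (c t x * tderiv φ t x
        + (chem c Hc t x - ∑ j, u t x j * Gc t x j) * φ t x) ∂D.vol
      = ∫ z, ((φt z.1 z.2 * c z.1 z.2 - φ z.1 z.2 * ∑ j, u z.1 z.2 j * Gc z.1 z.2 j)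
        + φ z.1 z.2 * chem c Hc z.1 z.2) ∂D.spaceTime T := by
    refine Eq.trans ?_ (integral_prod _ ((i1.sub i2).add i3)).symm
    refine setIntegral_congr_fun measurableSet_Ioo fun t ht => integral_congr_ae ?_
    filter_upwards [D.ae_vol_mem] with x hx
    rw [hd.tderiv_eq ht (D.cell_subset_region hx)]
    simp only [Pi.sub_apply, Pi.add_apply]
    ring
  rw [e2, e3] at h1
  rw [e4, ((i1.hasInt.sub i2.hasInt).add i3.hasInt).2, ← (i1.hasInt.sub i2.hasInt).2, h1]
  ring

/-- Conservation of mass. -/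
theorem mass (h : IsDissipativeWeakSolutionWith L D T ϱ₀ m₀ c₀ ϱ u c 𝔈 ℜ Gu Gc Hc G₀) (hT : 0 < T) :
    ∀ᵐ t ∂volume.restrict (Ioo 0 T), ∫ x, ϱ t x ∂D.vol = ∫ x, ϱ₀ x ∂D.vol := by
  have key := ae_eq_of_weak_time (m := fun t => ∫ x, ϱ t x ∂D.vol) (k := fun _ => 0)
    (m0 := ∫ x, ϱ₀ x ∂D.vol) hT h.integrable_rho.integral_prod_left (integrable_zero _ _ _)
    fun A a hA ha h0 => by
      obtain ⟨T', hT', h0⟩ := h0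
      have hd := C1Data.time D T hA ha
      -- Functions of time alone are admissible here, since test functions in the continuity
      -- equation need not vanish on the boundary.
      have h1 := h.continuity (fun t _ => A t) ⟨hd.c1UpTo, T', hT', fun t ht htT x _ => h0 t htT ht.2⟩
      rw [integral_mul_const] at h1
      rw [← h1]
      refine setIntegral_congr_fun measurableSet_Ioo fun t ht => ?_
      simp only [zero_mul, add_zero]
      rw [← integral_mul_const]
      refine integral_congr_ae (Eventually.of_forall fun x => ?_)
      have : tderiv (fun t (_ : Sp d) => A t) t x = a t := (hA t).deriv
      simp [this, NSAC.pderiv]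
  filter_upwards [key] with t ht
  simpa using ht

/-- The density is bounded below on a set of measure bounded below. -/
theorem exists_density_set (h : IsDissipativeWeakSolutionWith L D T ϱ₀ m₀ c₀ ϱ u c 𝔈 ℜ Gu Gc Hc G₀)
    (hT : 0 < T) (h0 : 0 < ∫ x, ϱ₀ x ∂D.vol) :
    ∃ a δ : ℝ, 0 < a ∧ 0 < δ ∧ ∀ᵐ t ∂volume.restrict (Ioo 0 T), ∃ A : Set (Sp d), MeasurableSet A ∧
      (∀ᵐ x ∂D.vol, x ∈ A → δ ≤ ϱ t x) ∧ a ≤ D.vol.real A := by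
  set m := ∫ x, ϱ₀ x ∂D.vol
  set V := D.vol.real univ with hVdef
  have hV : 0 < V := D.vol_pos
  obtain ⟨M, hM⟩ := h.pressure_bdd
  -- The mass m is split. Where ϱ < m/(4V) it is at most m/4. Elsewhere ϱ ≤ (|P(ϱ)| + K)/N; this N
  -- makes the first part at most m/4. The remaining m/2 is bounded by (K/N) times the measure of A.
  set N : ℝ := 4 * (M + 1) / m with hN
  have hN0 : 0 < N := by positivity
  obtain ⟨K, hK, hKs⟩ := L.exists_superlinear N
  refine ⟨m * N / (2 * (K + 1)), m / (4 * V), by positivity, by positivity, ?_⟩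
  filter_upwards [h.mass hT, hM, h.integrable_rho.prod_right_ae, h.integrable_P.prod_right_ae,
    ae_ae_of_ae_spaceTime h.rho_nonneg] with t ht hMt hi hP hnn
  set g := hi.1.mk (fun x => ϱ t x) with hg
  have hgm : Measurable g := hi.1.stronglyMeasurable_mk.measurable
  have hge : ∀ᵐ x ∂D.vol, ϱ t x = g x := hi.1.ae_eq_mk
  have hA : MeasurableSet {x | m / (4 * V) ≤ g x} := measurableSet_le measurable_const hgm
  refine ⟨{x | m / (4 * V) ≤ g x}, hA, ?_, ?_⟩
  · filter_upwards [hge] with x hx hxA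
    rw [hx]; exact hxA
  · set A := {x | m / (4 * V) ≤ g x}
    have hPM : ∫ x, ‖L.P (ϱ t x)‖ ∂D.vol ≤ M := by
      rw [integral_norm_eq_lintegral_enorm hP.1, ← eLpNorm_one_eq_lintegral_enorm]
      exact ENNReal.toReal_le_of_le_ofReal M.coe_nonneg (by simpa using hMt)
    have i1 : HasInt D.vol (fun _ => m / (4 * V)) (m / (4 * V) * V) := by
      refine (HasInt.const _).congr_val ?_
      simp [hVdef, mul_comm]
    have i2 : HasInt D.vol (fun x => N⁻¹ * ‖L.P (ϱ t x)‖) _ := (hP.norm.hasInt).const_mul N⁻¹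
    have i3 : HasInt D.vol (fun x => N⁻¹ * K * A.indicator (fun _ => (1:ℝ)) x) (N⁻¹ * K * D.vol.real A) := by
      refine HasInt.const_mul (⟨(integrable_const (1:ℝ)).indicator hA, ?_⟩) _
      rw [integral_indicator hA]; simp
    have key := HasInt.mono_ae hi.hasInt ((i1.add i2).add i3) (by
      filter_upwards [hge, hnn] with x hx hx0
      have hKx := hKs _ hx0
      have hle : ϱ t x ≤ N⁻¹ * (‖L.P (ϱ t x)‖ + K) := by
        rw [← div_eq_inv_mul, le_div_iff₀ hN0, Real.norm_eq_abs]
        linarith [le_abs_self (L.P (ϱ t x))]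
      by_cases hxA : x ∈ A
      · rw [indicator_of_mem hxA]
        have : 0 < m / (4 * V) := by positivity
        linarith
      · rw [indicator_of_notMem hxA]
        have h1 : ϱ t x < m / (4 * V) := by rw [hx]; exact not_le.1 hxA
        have h2 : 0 ≤ N⁻¹ * ‖L.P (ϱ t x)‖ := by positivity
        linarith)
    rw [ht] at key
    have e1 : m / (4 * V) * V = m / 4 := by field_simp
    have e2 : N⁻¹ * (∫ x, ‖L.P (ϱ t x)‖ ∂D.vol) ≤ m / 4 := by
      have : N⁻¹ * (∫ x, ‖L.P (ϱ t x)‖ ∂D.vol) ≤ N⁻¹ * (M + 1) :=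
        mul_le_mul_of_nonneg_left (by linarith) (by positivity)
      refine this.trans (le_of_eq ?_)
      rw [hN]; field_simp
    have e3 : m / 2 ≤ N⁻¹ * K * D.vol.real A := by
      change m ≤ _ at key
      linarith
    have e4 : N⁻¹ * K * D.vol.real A ≤ N⁻¹ * (K + 1) * D.vol.real A := by
      gcongr; linarith
    rw [div_le_iff₀ (by positivity)]
    have e5 := mul_le_mul_of_nonneg_left (e3.trans e4) hN0.le
    have e6 : N * (N⁻¹ * (K + 1) * D.vol.real A) = (K + 1) * D.vol.real A := by field_simp
    rw [e6] at e5
    linarith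

end IsDissipativeWeakSolutionWith


/-! ### Defect measures and the form of the momentum equation -/

open FlowDomain

/-- The two sets of a Hahn decomposition are disjoint, so the bounds for the positive and the
negative part add up without a factor 2. -/
theorem totalVariation_real_le {X : Type*} [MeasurableSpace X] {s : SignedMeasure X} {E : Measure X}
    [IsFiniteMeasure E] {S : Set X} (hS : MeasurableSet S) (h0 : s.totalVariation Sᶜ = 0) {K : ℝ}
    (h : ∀ A, MeasurableSet A → A ⊆ S → |s A| ≤ K * E.real A) :
    s.totalVariation.real univ ≤ K * E.real S := by
  obtain ⟨i, hi, hp, hn, e1, e2⟩ := s.toJordanDecomposition_spec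
  have h1 : s.totalVariation.real univ = s.totalVariation.real S := by
    rw [measureReal_def, measureReal_def, ← measure_add_measure_compl hS, h0, add_zero]
  rw [h1, SignedMeasure.totalVariation, measureReal_add_apply, e1, e2,
    SignedMeasure.toMeasureOfZeroLE_real_apply _ hp hi hS,
    SignedMeasure.toMeasureOfLEZero_real_apply _ hn hi.compl hS]
  have h2 := (le_abs_self _).trans (h (i ∩ S) (hi.inter hS) inter_subset_right)
  have h3 := (neg_le_abs _).trans (h (iᶜ ∩ S) (hi.compl.inter hS) inter_subset_right)
  have h4 : E.real S = E.real (i ∩ S) + E.real (iᶜ ∩ S) := by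
    rw [← measureReal_inter_add_sdiff hi, inter_comm, sdiff_eq, inter_comm S iᶜ]
  rw [h4, mul_add]
  exact add_le_add h2 h3

theorem abs_sintegral_le {X : Type*} [MeasurableSpace X] {s : SignedMeasure X} {S : Set X}
    (h0 : s.totalVariation Sᶜ = 0) {f : X → ℝ} {b : ℝ} (hf : ∀ x ∈ S, |f x| ≤ b) :
    |sintegral s f| ≤ b * s.totalVariation.real univ := by
  rw [SignedMeasure.totalVariation, Measure.add_apply, add_eq_zero] at h0
  have h1 : ∀ {μ : Measure X}, μ Sᶜ = 0 → ∀ᵐ x ∂μ, ‖f x‖ ≤ b := fun hμ => by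
    filter_upwards [compl_mem_ae_iff.2 hμ] with x hx
    exact hf x (by simpa using hx)
  have h2 := norm_integral_le_of_norm_le_const (h1 h0.1)
  have h3 := norm_integral_le_of_norm_le_const (h1 h0.2)
  rw [SignedMeasure.totalVariation, measureReal_add_apply, mul_add, sintegral]
  exact (abs_sub _ _).trans (add_le_add h2 h3)

/-- Polarization with e_a, e_b and e_a + e_b. As |e_a + e_b|² ≤ 4, twice the entry is at most 4e + e
+ e. -/
theorem abs_entry_le {d : ℕ} {m : Fin d → Fin d → ℝ} {e : ℝ}
    (hs : ∀ i j, m i j = m j i) (h : ∀ ξ : Sp d, |∑ i, ∑ j, ξ i * ξ j * m i j| ≤ ‖ξ‖ ^ 2 * e) (he : 0 ≤ e)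
    (a b : Fin d) : |m a b| ≤ 3 * e := by
  have hq : ∀ ξ η : Fin d → ℝ, ∀ a b, ξ = Pi.single a 1 → η = Pi.single b 1 →
      ∑ i, ∑ j, ξ i * η j * m i j = m a b := by
    rintro _ _ a b rfl rfl
    simp [Pi.single_apply, ite_mul]
  have h1 : ∀ a, |m a a| ≤ e := fun a => by
    have := h (ev a)
    rw [hq (ev a : Sp d) (ev a : Sp d) a a rfl rfl] at this
    simpa using this
  have h2 := h (ev a + ev b)
  have h3 : ∑ i, ∑ j, (ev a + ev b : Sp d) i * (ev a + ev b : Sp d) j * m i j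
      = m a a + m a b + m b a + m b b := by
    rw [← hq (ev a : Sp d) (ev a : Sp d) a a rfl rfl, ← hq (ev a : Sp d) (ev b : Sp d) a b rfl rfl,
      ← hq (ev b : Sp d) (ev a : Sp d) b a rfl rfl, ← hq (ev b : Sp d) (ev b : Sp d) b b rfl rfl]
    simp only [← Finset.sum_add_distrib]
    refine Finset.sum_congr rfl fun i _ => Finset.sum_congr rfl fun j _ => ?_
    simp only [PiLp.add_apply]
    ring
  rw [h3, hs b a] at h2
  have h4 : ‖(ev a + ev b : Sp d)‖ ≤ 2 := by
    refine (norm_add_le _ _).trans ?_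
    simp
    norm_num
  have h5 : ‖(ev a + ev b : Sp d)‖ ^ 2 * e ≤ 4 * e := by
    refine mul_le_mul_of_nonneg_right ?_ he
    nlinarith [norm_nonneg (ev a + ev b : Sp d)]
  have h6 := abs_le.1 (h2.trans h5)
  have h7 := abs_le.1 (h1 a)
  have h8 := abs_le.1 (h1 b)
  rw [abs_le]
  constructor <;> linarith [h6.1, h6.2, h7.1, h7.2, h8.1, h8.2]

/-- The momentum defect is controlled by the energy defect. -/
theorem DefectCompatible.exists_totalVariation_le {d : ℕ} {D : FlowDomain d} {T : ℝ}
    {𝔈 : ℝ → Measure (Sp d)} {ℜ : ℝ → MatMeasure d} (h : DefectCompatible D T 𝔈 ℜ)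
    (hR : IsMomentumDefect D T ℜ) (hE : IsEnergyDefect D T 𝔈) :
    ∃ Λ : ℝ, 0 ≤ Λ ∧ ∀ᵐ t ∂volume.restrict (Ioo 0 T), ∀ i j,
      (ℜ t i j).totalVariation.real univ ≤ Λ * (𝔈 t).real D.closedCell := by
  obtain ⟨Λ, hΛ, h⟩ := h
  obtain ⟨M, hM⟩ := hE.2.2
  refine ⟨3 * Λ, by positivity, ?_⟩
  filter_upwards [h, hM, hR.2.1, hR.2.2.1] with t h1 h2 h3 h4 i j
  have : IsFiniteMeasure (𝔈 t) := ⟨h2.trans_lt ENNReal.coe_lt_top⟩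
  have h5 := totalVariation_real_le (E := 𝔈 t) (K := 3 * Λ) D.measurableSet_cell (h3 i j) fun A hA hAs => by
    have := abs_entry_le (m := fun i j => ℜ t i j A) (e := Λ * (𝔈 t).real A)
      (fun i j => by simp only [h4 i j]) (fun ξ => (h1 A hA hAs ξ).trans (le_of_eq (by ring)))
      (by positivity) i j
    simpa only [mul_assoc] using this
  exact h5.trans (mul_le_mul_of_nonneg_left (measureReal_mono D.cell_subset_closedCell) (by positivity))

namespace IsDissipativeWeakSolutionWith

variable {d : ℕ} {L : FluidLaw} {D : FlowDomain d} {T : ℝ} {ϱ₀ : Sp d → ℝ} {m₀ : Sp d → Sp d}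
  {c₀ : Sp d → ℝ} {ϱ : ℝ → Sp d → ℝ} {u : ℝ → Sp d → Sp d} {c : ℝ → Sp d → ℝ}
  {𝔈 : ℝ → Measure (Sp d)} {ℜ : ℝ → MatMeasure d} {Gu : ℝ → Sp d → Matrix (Fin d) (Fin d) ℝ}
  {Gc : ℝ → Sp d → Sp d} {Hc : ℝ → Sp d → Matrix (Fin d) (Fin d) ℝ} {G₀ : Sp d → Sp d}

/-- The momentum balance as a linear form in the time derivative `a`, the gradient `b` and the
value `e` of the test function. -/
def _root_.NSAC.momForm (L : FluidLaw) (q : ℝ) (v : Sp d) (A : Matrix (Fin d) (Fin d) ℝ) (g : Sp d) (mu : ℝ)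
    (a : Sp d) (b : Matrix (Fin d) (Fin d) ℝ) (e : Sp d) : ℝ :=
  (∑ i, a i * (q * v i)) + (∑ i, ∑ j, b i j * (q * (v i * v j))) + b.trace * L.p q
    - ddot (L.stress A) b - ∑ i, e i * (mu * g i)

theorem integrable_momForm (h : IsDissipativeWeakSolutionWith L D T ϱ₀ m₀ c₀ ϱ u c 𝔈 ℜ Gu Gc Hc G₀)
    {a e : ℝ → Sp d → Sp d} {b : ℝ → Sp d → Matrix (Fin d) (Fin d) ℝ}
    (ha : ∀ i, ContinuousOn (Function.uncurry fun t x => a t x i) (Icc 0 T ×ˢ D.closedRegion))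
    (he : ∀ i, ContinuousOn (Function.uncurry fun t x => e t x i) (Icc 0 T ×ˢ D.closedRegion))
    (hb : ∀ i j, ContinuousOn (Function.uncurry fun t x => b t x i j) (Icc 0 T ×ˢ D.closedRegion)) :
    Integrable (fun z : ℝ × Sp d => momForm L (ϱ z.1 z.2) (u z.1 z.2) (Gu z.1 z.2) (Gc z.1 z.2)
      (chem c Hc z.1 z.2) (a z.1 z.2) (b z.1 z.2) (e z.1 z.2)) (D.spaceTime T) := by
  refine ((((integrable_finsetSum _ fun i _ => integrable_mul_cont (ha i) (h.integrable_rho_u i)).add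
    (integrable_finsetSum _ fun i _ => integrable_finsetSum _ fun j _ =>
      integrable_mul_cont (hb i j) (h.integrable_rho_u_u i j))).add ?_).sub
    (h.integrable_stress_mul fun i j => memLp_cont (hb i j))).sub
    (integrable_finsetSum _ fun i _ => integrable_mul_cont (he i) (h.memLp_chem.int_mul (h.memLp_Gc i)))
  exact integrable_mul_cont (a := fun t x => ∑ i, b t x i i)
    (continuousOn_finsetSum _ fun i _ => hb i i) h.integrable_p

/-- The momentum equation for a test function with displayed derivatives. -/
theorem momentum_eq (h : IsDissipativeWeakSolutionWith L D T ϱ₀ m₀ c₀ ϱ u c 𝔈 ℜ Gu Gc Hc G₀)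
    {φ φt : ℝ → Sp d → Sp d} {φx : ℝ → Sp d → Sp d →L[ℝ] Sp d} (hd : D.C1Data T φ φt φx)
    (hφ : D.TestOpen T φ) :
    HasInt (D.spaceTime T) (fun z => momForm L (ϱ z.1 z.2) (u z.1 z.2) (Gu z.1 z.2) (Gc z.1 z.2)
      (chem c Hc z.1 z.2) (φt z.1 z.2) (Matrix.of fun i j => φx z.1 z.2 (ev j) i) (φ z.1 z.2))
      (-(∫ x, inner ℝ (m₀ x) (φ 0 x) ∂D.vol)
        + ∫ t in Ioo 0 T, ∑ i, ∑ j, sintegral (ℜ t i j) (fun x => jac (φ t) x i j)) := by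
  have hb : ∀ i j, ContinuousOn (Function.uncurry fun t x => φx t x (ev j) i) (Icc 0 T ×ˢ D.closedRegion) :=
    fun i j => ContinuousOn.proj (hd.cont_ev j) i
  have hi := h.integrable_momForm (a := φt) (e := φ) (b := fun t x => Matrix.of fun i j => φx t x (ev j) i)
    (fun i => ContinuousOn.proj hd.cont_t i) (fun i => ContinuousOn.proj hd.cont i) hb
  refine ⟨hi, ?_⟩
  have i1 : Integrable (fun z : ℝ × Sp d => (∑ i, φt z.1 z.2 i * (ϱ z.1 z.2 * u z.1 z.2 i))
      + (∑ i, ∑ j, φx z.1 z.2 (ev j) i * (ϱ z.1 z.2 * (u z.1 z.2 i * u z.1 z.2 j)))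
      + (∑ i, φx z.1 z.2 (ev i) i) * L.p (ϱ z.1 z.2)) (D.spaceTime T) := by
    refine ((integrable_finsetSum _ fun i _ => integrable_mul_cont (a := fun t x => φt t x i) (ContinuousOn.proj hd.cont_t i) (h.integrable_rho_u i)).add
      (integrable_finsetSum _ fun i _ => integrable_finsetSum _ fun j _ =>
      integrable_mul_cont (hb i j) (h.integrable_rho_u_u i j))).add ?_
    exact integrable_mul_cont (a := fun t x => ∑ i, φx t x (ev i) i)
      (continuousOn_finsetSum _ fun i _ => hb i i) h.integrable_p
  have i2 : Integrable (fun z : ℝ × Sp d => ddot (L.stress (Gu z.1 z.2)) (Matrix.of fun i j => φx z.1 z.2 (ev j) i)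
      + ∑ i, φ z.1 z.2 i * (chem c Hc z.1 z.2 * Gc z.1 z.2 i)) (D.spaceTime T) :=
    (h.integrable_stress_mul (A := fun z => Matrix.of fun i j => φx z.1 z.2 (ev j) i) fun i j => memLp_cont (hb i j)).add
      (integrable_finsetSum _ fun i _ => integrable_mul_cont (a := fun t x => φ t x i) (ContinuousOn.proj hd.cont i) (h.memLp_chem.int_mul (h.memLp_Gc i)))
  obtain ⟨J1, j1⟩ : ∃ J, HasInt (D.spaceTime T) _ J := ⟨_, i1.hasInt⟩
  obtain ⟨J2, j2⟩ : ∃ J, HasInt (D.spaceTime T) _ J := ⟨_, i2.hasInt⟩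
  have hj : ∀ t ∈ Ioo 0 T, ∀ x ∈ D.cell, jac (φ t) x = Matrix.of fun i j => φx t x (ev j) i :=
    fun t ht x hx => by
      ext i j
      exact hd.jac_eq ht (D.cell_subset_region hx) i j
  have h1 := h.momentum φ hφ
  have e1 : ∫ t in Ioo 0 T, ∫ x, (ϱ t x * inner ℝ (u t x) (tderiv φ t x)
        + ϱ t x * ddot (dyad (u t x) (u t x)) (jac (φ t) x)
        + L.p (ϱ t x) * (jac (φ t) x).trace) ∂D.vol = J1 := by
    refine Eq.trans ?_ ((integral_prod _ i1).symm.trans j1.2)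
    refine setIntegral_congr_fun measurableSet_Ioo fun t ht => integral_congr_ae ?_
    filter_upwards [D.ae_vol_mem] with x hx
    rw [hd.tderiv_eq ht (D.cell_subset_region hx), hj t ht x hx, PiLp.inner_apply]
    simp only [RCLike.inner_apply, conj_trivial, ddot, dyad, Matrix.of_apply, Matrix.trace,
      Matrix.diag_apply, Finset.mul_sum]
    congr 1
    · congr 1
      · exact Finset.sum_congr rfl fun i _ => by ring
      · exact Finset.sum_congr rfl fun i _ => Finset.sum_congr rfl fun j _ => by ring
    · rw [← Finset.mul_sum, mul_comm]
  have e2 : ∫ t in Ioo 0 T, ∫ x, (ddot (L.stress (Gu t x)) (jac (φ t) x)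
          + ((Hc t x).trace - deriv glF (c t x)) * inner ℝ (Gc t x) (φ t x)) ∂D.vol = J2 := by
    refine Eq.trans ?_ ((integral_prod _ i2).symm.trans j2.2)
    refine setIntegral_congr_fun measurableSet_Ioo fun t ht => integral_congr_ae ?_
    filter_upwards [D.ae_vol_mem] with x hx
    rw [hj t ht x hx, PiLp.inner_apply, deriv_glF]
    simp only [RCLike.inner_apply, conj_trivial, chem, Finset.mul_sum]
    congr 1
    exact Finset.sum_congr rfl fun i _ => by ring
  rw [e1, e2] at h1
  have h2 := (j1.sub j2).congr (g := fun z => momForm L (ϱ z.1 z.2) (u z.1 z.2) (Gu z.1 z.2) (Gc z.1 z.2)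
      (chem c Hc z.1 z.2) (φt z.1 z.2) (Matrix.of fun i j => φx z.1 z.2 (ev j) i) (φ z.1 z.2)) fun z => by
    simp only [momForm, Matrix.trace, Matrix.diag_apply, Matrix.of_apply]
    ring
  rw [h2.2, h1]
  ring

end IsDissipativeWeakSolutionWith


/-! ### Testing the momentum equation with the strong velocity -/

open FlowDomain

/-- The sum of the absolute values of the coefficients of `momForm`. -/
def momSize {d : ℕ} (L : FluidLaw) (q : ℝ) (v : Sp d) (A : Matrix (Fin d) (Fin d) ℝ) (g : Sp d) (mu : ℝ) : ℝ :=
  (∑ i, |q * v i|) + (∑ i, ∑ j, |q * (v i * v j)|) + (∑ _i : Fin d, |L.p q|)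
    + (∑ i, ∑ j, |L.stress A i j|) + ∑ i, |mu * g i|

/-- Supplies the dominating function for the limit of the cut-offs: `momSize` does not depend on the
test function. -/
theorem abs_momForm_le {d : ℕ} (L : FluidLaw) (q : ℝ) (v : Sp d) (A : Matrix (Fin d) (Fin d) ℝ) (g : Sp d) (mu : ℝ)
    {a e : Sp d} {b : Matrix (Fin d) (Fin d) ℝ} {J : ℝ} (ha : ∀ i, |a i| ≤ J) (he : ∀ i, |e i| ≤ J)
    (hb : ∀ i j, |b i j| ≤ J) : |momForm L q v A g mu a b e| ≤ J * momSize L q v A g mu := by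
  have h1 : |∑ i, a i * (q * v i)| ≤ J * ∑ i, |q * v i| := by
    rw [Finset.mul_sum]
    refine (Finset.abs_sum_le_sum_abs _ _).trans (Finset.sum_le_sum fun i _ => ?_)
    rw [abs_mul]
    exact mul_le_mul_of_nonneg_right (ha i) (abs_nonneg _)
  have h2 : |∑ i, ∑ j, b i j * (q * (v i * v j))| ≤ J * ∑ i, ∑ j, |q * (v i * v j)| := by
    simp only [Finset.mul_sum]
    refine (Finset.abs_sum_le_sum_abs _ _).trans (Finset.sum_le_sum fun i _ =>
      (Finset.abs_sum_le_sum_abs _ _).trans (Finset.sum_le_sum fun j _ => ?_))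
    rw [abs_mul]
    exact mul_le_mul_of_nonneg_right (hb i j) (abs_nonneg _)
  have h3 : |b.trace * L.p q| ≤ J * ∑ _i : Fin d, |L.p q| := by
    rw [Finset.mul_sum, Matrix.trace, Finset.sum_mul]
    refine (Finset.abs_sum_le_sum_abs _ _).trans (Finset.sum_le_sum fun i _ => ?_)
    rw [abs_mul]
    exact mul_le_mul_of_nonneg_right (hb i i) (abs_nonneg _)
  have h4 : |ddot (L.stress A) b| ≤ J * ∑ i, ∑ j, |L.stress A i j| := by
    simp only [Finset.mul_sum, ddot]
    refine (Finset.abs_sum_le_sum_abs _ _).trans (Finset.sum_le_sum fun i _ =>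
      (Finset.abs_sum_le_sum_abs _ _).trans (Finset.sum_le_sum fun j _ => ?_))
    rw [abs_mul, mul_comm]
    exact mul_le_mul_of_nonneg_right (hb i j) (abs_nonneg _)
  have h5 : |∑ i, e i * (mu * g i)| ≤ J * ∑ i, |mu * g i| := by
    rw [Finset.mul_sum]
    refine (Finset.abs_sum_le_sum_abs _ _).trans (Finset.sum_le_sum fun i _ => ?_)
    rw [abs_mul]
    exact mul_le_mul_of_nonneg_right (he i) (abs_nonneg _)
  rw [momForm, momSize]
  rw [abs_le] at *
  constructor <;> linarith [h1.1, h1.2, h2.1, h2.2, h3.1, h3.2, h4.1, h4.2, h5.1, h5.2]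

theorem abs_apply_le {d : ℕ} (v : Sp d) (i : Fin d) : |v i| ≤ ‖v‖ := PiLp.norm_apply_le v i

theorem abs_ev_apply_le {d : ℕ} (A : Sp d →L[ℝ] Sp d) (i j : Fin d) : |A (ev j) i| ≤ ‖A‖ :=
  (abs_apply_le _ i).trans ((A.le_opNorm _).trans (by simp))

namespace IsDissipativeWeakSolutionWith

variable {d : ℕ} {L : FluidLaw} {D : FlowDomain d} {T : ℝ} {ϱ₀ : Sp d → ℝ} {m₀ : Sp d → Sp d}
  {c₀ : Sp d → ℝ} {ϱ : ℝ → Sp d → ℝ} {u : ℝ → Sp d → Sp d} {c : ℝ → Sp d → ℝ}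
  {𝔈 : ℝ → Measure (Sp d)} {ℜ : ℝ → MatMeasure d} {Gu : ℝ → Sp d → Matrix (Fin d) (Fin d) ℝ}
  {Gc : ℝ → Sp d → Sp d} {Hc : ℝ → Sp d → Matrix (Fin d) (Fin d) ℝ} {G₀ : Sp d → Sp d}

theorem integrable_momSize (h : IsDissipativeWeakSolutionWith L D T ϱ₀ m₀ c₀ ϱ u c 𝔈 ℜ Gu Gc Hc G₀) :
    Integrable (fun z : ℝ × Sp d => momSize L (ϱ z.1 z.2) (u z.1 z.2) (Gu z.1 z.2) (Gc z.1 z.2)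
      (chem c Hc z.1 z.2)) (D.spaceTime T) := by
  refine ((((integrable_finsetSum _ fun i _ => (h.integrable_rho_u i).abs).add
    (integrable_finsetSum _ fun i _ => integrable_finsetSum _ fun j _ => (h.integrable_rho_u_u i j).abs)).add
    (integrable_finsetSum _ fun _ _ => h.integrable_p.abs)).add
    (integrable_finsetSum _ fun i _ => integrable_finsetSum _ fun j _ => Integrable.abs ?_)).add
    (integrable_finsetSum _ fun i _ => (h.memLp_chem.int_mul (h.memLp_Gc i)).abs)
  -- Contraction with a matrix unit extracts one entry of the stress.
  have := h.integrable_stress_mul (A := fun _ => Matrix.single i j 1) fun k l => memLp_const _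
  refine this.congr (Eventually.of_forall fun z => ?_)
  simp [ddot, Matrix.single_apply, ite_and]

/-- The momentum equation tested with `θ U`. -/
theorem momentum_weight (h : IsDissipativeWeakSolutionWith L D T ϱ₀ m₀ c₀ ϱ u c 𝔈 ℜ Gu Gc Hc G₀)
    (hd : 0 < d) (hT : 0 < T) (S : StrongData L D T)
    (hm : Integrable (fun x => inner ℝ (m₀ x) (S.U 0 x)) D.vol) :
    ∃ K, 0 ≤ K ∧ ∀ θ θ' : ℝ → ℝ, Weight T θ θ' → ∃ J,
      HasInt (D.spaceTime T) (fun z => momForm L (ϱ z.1 z.2) (u z.1 z.2) (Gu z.1 z.2) (Gc z.1 z.2)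
        (chem c Hc z.1 z.2) (θ z.1 • S.Ut z.1 z.2 + θ' z.1 • S.U z.1 z.2) (θ z.1 • S.B z.1 z.2)
        (θ z.1 • S.U z.1 z.2)) J ∧
      |J + θ 0 * ∫ x, inner ℝ (m₀ x) (S.U 0 x) ∂D.vol|
        ≤ K * ∫ t in Ioo 0 T, θ t * (𝔈 t).real D.closedCell := by
  obtain ⟨χ, hχ, hper, hle, hcomp, hlim, K, hK, hχK⟩ := exists_cutoff hd D
  obtain ⟨Λ, hΛ, hdef⟩ := h.compatible.exists_totalVariation_le h.momentum_defect h.energy_defect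
  obtain ⟨B, hB, hUB⟩ := S.hU.exists_bound
  have hbd : ∀ t ∈ Ioo 0 T, ∀ x ∈ D.cell, ‖S.U t x‖ ≤ B * D.bdist x := fun t ht =>
    norm_le_bdist hd D (S.hU.hasFDerivAt t ht) (fun x hx => (hUB t (Ioo_subset_Icc_self ht) x hx).2.2)
      (fun x hx => (hUB t (Ioo_subset_Icc_self ht) x hx).1) (continuousOn_slice S.hU.cont (Ioo_subset_Icc_self ht))
      (S.boundary t (Ioo_subset_Icc_self ht)).1
  -- There are d² entries, each with test gradient at most θB(1+K) and total variation at most Λ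
  -- times the energy defect. The constant does not depend on θ.
  refine ⟨d * (d * (B * (1 + K) * Λ)), by positivity, fun θ θ' hθ => ?_⟩
  have hC := fun n => (C1Data.time D T hθ.hasDerivAt hθ.cont).smul ((C1Data.space D T (hχ n) (hper n)).smul S.hU)
  obtain ⟨T', hT', hv⟩ := hθ.vanish
  have hopen : ∀ n, D.TestOpen T fun t x => θ t • (χ n x • S.U t x) := fun n => by
    refine ⟨((C1Data.space D T (hχ n) (hper n)).smul S.hU).testClosed hθ.hasDerivAt hθ.cont hT' hv, ?_⟩
    have := hcomp n
    cases D with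
    | torus => trivial
    | dirichlet Ω _ _ _ =>
      obtain ⟨k, hk, hkΩ, hk0⟩ := this
      refine ⟨k, hk, hkΩ, fun t _ x _ hx => ?_⟩
      change θ t • (χ n x • S.U t x) = 0
      rw [hk0 x hx, zero_smul, smul_zero]
  have hI := fun n => h.momentum_eq (hC n) (hopen n)
  set F : ℕ → ℝ × Sp d → ℝ := fun n z => momForm L (ϱ z.1 z.2) (u z.1 z.2) (Gu z.1 z.2) (Gc z.1 z.2)
      (chem c Hc z.1 z.2)
      (θ z.1 • (χ n z.2 • S.Ut z.1 z.2 + (0:ℝ) • S.U z.1 z.2) + θ' z.1 • (χ n z.2 • S.U z.1 z.2))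
      (Matrix.of fun i j => (θ z.1 • (χ n z.2 • S.Ux z.1 z.2 + (fderiv ℝ (χ n) z.2).smulRight (S.U z.1 z.2))
        + (0 : Sp d →L[ℝ] ℝ).smulRight (χ n z.2 • S.U z.1 z.2)) (ev j) i)
      (θ z.1 • (χ n z.2 • S.U z.1 z.2)) with hF
  -- In ∇(χₙU) = χₙ∇U + U ⊗ ∇χₙ the first part is at most B. The second is at most BK, because |U| ≤
  -- B·dist and dist·|∇χₙ| ≤ K.
  have hgrad : ∀ n, ∀ t ∈ Ioo 0 T, ∀ x ∈ D.cell,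
      ‖θ t • (χ n x • S.Ux t x + (fderiv ℝ (χ n) x).smulRight (S.U t x))
        + (0 : Sp d →L[ℝ] ℝ).smulRight (χ n x • S.U t x)‖ ≤ θ t * (B * (1 + K)) := fun n t ht x hx => by
    have e0 : (0 : Sp d →L[ℝ] ℝ).smulRight (χ n x • S.U t x) = 0 := by ext; simp
    rw [e0, add_zero, norm_smul, Real.norm_of_nonneg (hθ.nonneg t)]
    refine mul_le_mul_of_nonneg_left ((norm_add_le _ _).trans ?_) (hθ.nonneg t)
    rw [norm_smul, ContinuousLinearMap.norm_smulRight_apply]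
    have h1 : ‖χ n x‖ * ‖S.Ux t x‖ ≤ 1 * B :=
      mul_le_mul (hle n x) (hUB t (Ioo_subset_Icc_self ht) x hx).2.2 (norm_nonneg _) zero_le_one
    have h2 : ‖fderiv ℝ (χ n) x‖ * ‖S.U t x‖ ≤ ‖fderiv ℝ (χ n) x‖ * (B * D.bdist x) :=
      mul_le_mul_of_nonneg_left (hbd t ht x hx) (norm_nonneg _)
    have h3 := mul_le_mul_of_nonneg_left (hχK n x) hB
    linarith
  obtain ⟨Θ, hΘ⟩ := (isCompact_Icc (a := (0:ℝ)) (b := T)).exists_bound_of_continuousOn hθ.continuous.continuousOn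
  obtain ⟨Θ', hΘ'⟩ := (isCompact_Icc (a := (0:ℝ)) (b := T)).exists_bound_of_continuousOn hθ.cont.continuousOn
  have hΘ0 : 0 ≤ Θ := (norm_nonneg _).trans (hΘ 0 ⟨le_rfl, hT.le⟩)
  have hΘ0' : 0 ≤ Θ' := (norm_nonneg _).trans (hΘ' 0 ⟨le_rfl, hT.le⟩)
  set J : ℝ := Θ * (B * (1 + K)) + Θ' * B with hJ
  have hFJ : ∀ n, ∀ᵐ z ∂D.spaceTime T, ‖F n z‖ ≤ J * momSize L (ϱ z.1 z.2) (u z.1 z.2) (Gu z.1 z.2) (Gc z.1 z.2)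
      (chem c Hc z.1 z.2) := fun n => ae_spaceTime_of_forall fun t ht x hx => by
    have ht' := Ioo_subset_Icc_self ht
    have hχ1 : ‖χ n x‖ ≤ 1 := hle n x
    have hs : ∀ v : Sp d, ‖v‖ ≤ B → ‖χ n x • v‖ ≤ B := fun v hv => by
      rw [norm_smul]
      calc ‖χ n x‖ * ‖v‖ ≤ 1 * B := mul_le_mul hχ1 hv (norm_nonneg _) zero_le_one
        _ = B := one_mul _
    have hBK : B ≤ B * (1 + K) := le_mul_of_one_le_right hB (by linarith)
    have hBJ : Θ * B ≤ Θ * (B * (1 + K)) := mul_le_mul_of_nonneg_left hBK hΘ0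
    have hB' : 0 ≤ Θ' * B := mul_nonneg hΘ0' hB
    refine abs_momForm_le _ _ _ _ _ _ (fun i => ?_) (fun i => ?_) fun i j => ?_
    · refine (abs_apply_le _ i).trans ((norm_add_le _ _).trans ?_)
      rw [zero_smul, add_zero, norm_smul, norm_smul (θ' _)]
      have h1 : ‖θ t‖ * ‖χ n x • S.Ut t x‖ ≤ Θ * B :=
        mul_le_mul (hΘ t ht') (hs _ (hUB t ht' x hx).2.1) (norm_nonneg _) hΘ0
      have h2 : ‖θ' t‖ * ‖χ n x • S.U t x‖ ≤ Θ' * B :=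
        mul_le_mul (hΘ' t ht') (hs _ (hUB t ht' x hx).1) (norm_nonneg _) hΘ0'
      change _ ≤ Θ * (B * (1 + K)) + Θ' * B
      exact add_le_add (h1.trans hBJ) h2
    · refine (abs_apply_le _ i).trans ?_
      rw [norm_smul]
      have h1 : ‖θ t‖ * ‖χ n x • S.U t x‖ ≤ Θ * B :=
        mul_le_mul (hΘ t ht') (hs _ (hUB t ht' x hx).1) (norm_nonneg _) hΘ0
      change _ ≤ Θ * (B * (1 + K)) + Θ' * B
      linarith
    · refine (abs_ev_apply_le _ i j).trans ((hgrad n t ht x hx).trans ?_)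
      have h1 : θ t * (B * (1 + K)) ≤ Θ * (B * (1 + K)) :=
        mul_le_mul_of_nonneg_right ((le_abs_self _).trans (hΘ t ht')) (by positivity)
      change _ ≤ Θ * (B * (1 + K)) + Θ' * B
      linarith
  set F' : ℝ × Sp d → ℝ := fun z => momForm L (ϱ z.1 z.2) (u z.1 z.2) (Gu z.1 z.2) (Gc z.1 z.2)
        (chem c Hc z.1 z.2) (θ z.1 • S.Ut z.1 z.2 + θ' z.1 • S.U z.1 z.2) (θ z.1 • S.B z.1 z.2)
        (θ z.1 • S.U z.1 z.2) with hF'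
  have hFlim : ∀ᵐ z ∂D.spaceTime T, Tendsto (fun n => F n z) atTop (𝓝 (F' z)) :=
    ae_spaceTime_of_forall fun t ht x hx => by
      refine tendsto_const_nhds.congr' ?_
      filter_upwards [hlim x (D.cell_subset_region hx)] with n hn
      simp only [hF, hF', hn.1, hn.2, one_smul, zero_smul, add_zero]
      congr 1
      ext i j
      simp [StrongData.B]
  have hFi : Integrable F' (D.spaceTime T) := by
    have := h.integrable_momForm (a := fun t x => θ t • S.Ut t x + θ' t • S.U t x) (e := fun t x => θ t • S.U t x)
      (b := fun t x => θ t • S.B t x)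
      (fun i => ContinuousOn.proj (f := fun z : ℝ × Sp d => θ z.1 • S.Ut z.1 z.2 + θ' z.1 • S.U z.1 z.2)
        (((hθ.continuous.comp continuous_fst).continuousOn.smul S.hU.cont_t).add
          ((hθ.cont.comp continuous_fst).continuousOn.smul S.hU.cont)) i)
      (fun i => ContinuousOn.proj (f := fun z : ℝ × Sp d => θ z.1 • S.U z.1 z.2)
        ((hθ.continuous.comp continuous_fst).continuousOn.smul S.hU.cont) i)
      (fun i j => (hθ.continuous.comp continuous_fst).continuousOn.smul (S.cont_B i j))
    exact this
  refine ⟨_, hFi.hasInt, ?_⟩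
  have l1 : Tendsto (fun n => ∫ z, F n z ∂D.spaceTime T) atTop (𝓝 (∫ z, F' z ∂D.spaceTime T)) :=
    tendsto_integral_of_dominated_convergence _ (fun n => (hI n).1.1) (h.integrable_momSize.const_mul J) hFJ hFlim
  have l2 : Tendsto (fun n => ∫ x, inner ℝ (m₀ x) (θ 0 • (χ n x • S.U 0 x)) ∂D.vol) atTop
      (𝓝 (∫ x, θ 0 * inner ℝ (m₀ x) (S.U 0 x) ∂D.vol)) := by
    have e : ∀ n x, inner ℝ (m₀ x) (θ 0 • (χ n x • S.U 0 x)) = χ n x * (θ 0 * inner ℝ (m₀ x) (S.U 0 x)) :=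
      fun n x => by
        rw [inner_smul_right, inner_smul_right]; ring
    simp only [e]
    refine tendsto_integral_of_dominated_convergence (fun x => ‖θ 0 * inner ℝ (m₀ x) (S.U 0 x)‖)
      (fun n => ((hχ n).continuous.aestronglyMeasurable.mul (hm.const_mul (θ 0)).1)) (hm.const_mul (θ 0)).norm
      (fun n => Eventually.of_forall fun x => ?_) ?_
    · rw [norm_mul]
      exact mul_le_of_le_one_left (norm_nonneg _) (hle n x)
    · filter_upwards [D.ae_vol_mem] with x hx
      refine tendsto_const_nhds.congr' ?_
      filter_upwards [hlim x (D.cell_subset_region hx)] with n hn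
      rw [hn.1, one_mul]
  rw [integral_const_mul] at l2
  -- All other terms converge as n → ∞. For the defect term a bound uniform in n is enough, which is
  -- why the conclusion is an inequality.
  refine le_of_tendsto (l1.add l2).abs (Eventually.of_forall fun n => ?_)
  have e1 : ∫ z, F n z ∂D.spaceTime T + ∫ x, inner ℝ (m₀ x) (θ 0 • (χ n x • S.U 0 x)) ∂D.vol
      = ∫ t in Ioo 0 T, ∑ i, ∑ j, sintegral (ℜ t i j) (fun x => jac (fun x => θ t • (χ n x • S.U t x)) x i j) := by
    rw [(hI n).2]; ring
  rw [e1, ← integral_const_mul, ← Real.norm_eq_abs]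
  refine norm_integral_le_of_norm_le ((integrableOn_cont_mul hθ.continuous
    (h.energy_defect.integrableOn D.measurableSet_closedCell)).const_mul _) ?_
  filter_upwards [hdef, h.momentum_defect.2.1, ae_restrict_mem measurableSet_Ioo] with t h1 h2 ht
  have h3 : ∀ i j, |sintegral (ℜ t i j) (fun x => jac (fun x => θ t • (χ n x • S.U t x)) x i j)|
      ≤ B * (1 + K) * Λ * (θ t * (𝔈 t).real D.closedCell) := fun i j => by
    have h4 := abs_sintegral_le (h2 i j) (f := fun x => jac (fun x => θ t • (χ n x • S.U t x)) x i j)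
      (b := θ t * (B * (1 + K))) fun x hx => by
        rw [(hC n).jac_eq ht (D.cell_subset_region hx) i j]
        exact (abs_ev_apply_le _ i j).trans (hgrad n t ht x hx)
    refine h4.trans ((mul_le_mul_of_nonneg_left (h1 i j) (mul_nonneg (hθ.nonneg t) (by positivity))).trans
      (le_of_eq (by ring)))
  rw [Real.norm_eq_abs]
  calc |∑ i, ∑ j, sintegral (ℜ t i j) (fun x => jac (fun x => θ t • (χ n x • S.U t x)) x i j)|
      ≤ ∑ i : Fin d, ∑ j : Fin d, B * (1 + K) * Λ * (θ t * (𝔈 t).real D.closedCell) :=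
        (Finset.abs_sum_le_sum_abs _ _).trans (Finset.sum_le_sum fun i _ =>
          (Finset.abs_sum_le_sum_abs _ _).trans (Finset.sum_le_sum fun j _ => h3 i j))
    _ = d * (d * (B * (1 + K) * Λ)) * (θ t * (𝔈 t).real D.closedCell) := by
        simp only [Finset.sum_const, Finset.card_univ, Fintype.card_fin, nsmul_eq_mul]
        ring

end IsDissipativeWeakSolutionWith


/-! ### Algebra of the relative energy rate -/

open FlowDomain

theorem ddot_stress_sub {d : ℕ} (L : FluidLaw) (A B : Matrix (Fin d) (Fin d) ℝ) :
    ddot (L.stress (A - B)) (A - B)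
      = ddot (L.stress A) A - ddot (L.stress A) B - ddot (L.stress B) (A - B) := by
  have h1 : ∀ A B C : Matrix (Fin d) (Fin d) ℝ, ddot A (B - C) = ddot A B - ddot A C := fun A B C => by
    simp only [ddot, Matrix.sub_apply, mul_sub, Finset.sum_sub_distrib]
  have h2 : ∀ A B C : Matrix (Fin d) (Fin d) ℝ, ddot (A - B) C = ddot A C - ddot B C := fun A B C => by
    simp only [ddot, Matrix.sub_apply, sub_mul, Finset.sum_sub_distrib]
  simp only [ddot_stress, Matrix.transpose_sub, Matrix.trace_sub, h1, h2]
  ring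

/-- The right-hand side of the relative energy balance. -/
def relRate {d : ℕ} (L : FluidLaw) (K0 q R : ℝ) (u U s g G : Sp d) (A B : Matrix (Fin d) (Fin d) ℝ)
    (mu M c C Ct : ℝ) : ℝ :=
  -ddot (L.stress (A - B)) (A - B) - (mu - M) ^ 2
    + (1 - q / R) * (∑ i, (u i - U i) * s i)
    - q * (∑ i, ∑ j, B i j * ((u i - U i) * (u j - U j)))
    - L.relp q R * B.trace
    + (q / R - 1) * M * (∑ i, (u i - U i) * G i)
    + (mu - M) * (∑ i, U i * (g i - G i)) - M * (∑ i, (u i - U i) * (g i - G i))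
    + (glF1 c - glF1 C - glF2 C * (c - C)) * Ct
    + K0 * (tsq1 (c - C) * (mu - (∑ i, u i * g i) - Ct))

/-- The right-hand side lists what the tested equations contribute as factors of θ, together with
combinations whose spatial integrals vanish. The identity follows from the strong equations:
continuity with factor −(1 − q/R)p'(R), momentum with (q/R)(u − U), Allen–Cahn with −(μ − M).
Everything that survives is quadratic in differences. -/
theorem relRate_eq {d : ℕ} (hd : d = 2 ∨ d = 3) (L : FluidLaw) {K0 q R Rt : ℝ} {Rx u U Ut s g G : Sp d}
    {A B : Matrix (Fin d) (Fin d) ℝ} {h l lt c C Ct : ℝ} (hR : R ≠ 0)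
    (h1 : Rt + ∑ j, (Rx j * U j + R * B j j) = 0)
    (h2 : ∀ i, R * (Ut i + ∑ j, B i j * U j) + deriv L.p R * Rx i = s i - (l - glF1 C) * G i)
    (h3 : Ct + ∑ j, U j * G j = l - glF1 C) :
    relRate L K0 q R u U s g G A B (h - glF1 c) (l - glF1 C) c C Ct
      = -(ddot (L.stress A) A + (h - glF1 c) ^ 2)
        - ((∑ i, Ut i * (q * u i)) + (∑ i, ∑ j, B i j * (q * (u i * u j))) + B.trace * L.p q
            - ddot (L.stress A) B - ∑ i, U i * ((h - glF1 c) * g i))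
        + (1 / 2 * ∑ i, ((U i * Ut i + Ut i * U i) * q + ∑ j, (U i * B i j + B i j * U i) * (q * u j))
            - (deriv L.p R / R * Rt * q + ∑ j, deriv L.p R / R * Rx j * (q * u j)))
        + deriv L.p R * Rt
        + (-1 / 2 * (C * lt + Ct * l) - glF1 C * Ct + (glF1 C * Ct + glF2 C * Ct * C))
        + ((lt - glF2 C * Ct) * c + (l - glF1 C) * (h - glF1 c - ∑ i, u i * g i))
        + K0 * (tsq1 (c - C) * (h - glF1 c - (∑ i, u i * g i) - Ct))
        + (ddot (L.stress B) (A - B) + ∑ i, s i * (u i - U i))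
        - (c * lt - h * Ct) + 1 / 2 * (C * lt - l * Ct)
        + ((∑ i, U i * (deriv L.p R * Rx i)) + L.p R * B.trace) := by
  -- The substitutions q = XR and p'(R) = YR clear all denominators, so that the identity becomes
  -- polynomial.
  obtain ⟨X, rfl⟩ : ∃ X, q = X * R := ⟨q / R, by field_simp⟩
  obtain ⟨Y, hY⟩ : ∃ Y, deriv L.p R = Y * R := ⟨deriv L.p R / R, by field_simp⟩
  simp only [relRate, FluidLaw.relp, hY, mul_div_cancel_right₀ _ hR, ddot_stress_sub] at h2 ⊢
  rcases hd with rfl | rfl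
  · simp only [Fin.sum_univ_two, Matrix.trace, Matrix.diag_apply] at h1 h2 h3 ⊢
    linear_combination -((1 - X) * (Y * R)) * h1 + X * (u 0 - U 0) * h2 0 + X * (u 1 - U 1) * h2 1
      - (h - glF1 c - (l - glF1 C)) * h3
  · simp only [Fin.sum_univ_three, Matrix.trace, Matrix.diag_apply] at h1 h2 h3 ⊢
    linear_combination -((1 - X) * (Y * R)) * h1 + X * (u 0 - U 0) * h2 0 + X * (u 1 - U 1) * h2 1
      + X * (u 2 - U 2) * h2 2 - (h - glF1 c - (l - glF1 C)) * h3


/-! ### Pointwise estimate of the rate -/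

open FlowDomain

theorem mul_le_young {a b δ : ℝ} (hδ : 0 < δ) : a * b ≤ δ * a ^ 2 + b ^ 2 / (4 * δ) := by
  have h1 : δ * a ^ 2 + b ^ 2 / (4 * δ) - a * b = (2 * δ * a - b) ^ 2 / (4 * δ) := by
    field_simp; ring
  have : 0 ≤ (2 * δ * a - b) ^ 2 / (4 * δ) := by positivity
  linarith

/-- Near vacuum qV² is useless, so bV is split by Young into ηV² and a constant, which relP
dominates there. In the middle range Young leaves (q−R)², again controlled by relP. For large q one
has |q−R| ≤ q and qV ≤ q/2 + qV²/2. -/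
theorem FluidLaw.exists_abs_sub_mul_le (L : FluidLaw) {a b : ℝ} (ha : 0 < a) (hab : a ≤ b) {η : ℝ} (hη : 0 < η) :
    ∃ C, 0 ≤ C ∧ ∀ q R V : ℝ, 0 ≤ q → R ∈ Icc a b → 0 ≤ V →
      |q - R| * V ≤ η * V ^ 2 + C * (L.relP q R + q * V ^ 2) := by
  obtain ⟨K, hK, h⟩ := L.exists_relP_coercive ha hab
  have hb : 0 < b := ha.trans_le hab
  refine ⟨K / (4 * η) + b ^ 2 / (4 * η) * K + K / 2 + 1 / 2, by positivity, fun q R V hq hR hV => ?_⟩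
  obtain ⟨h1, h2, h3, -⟩ := h q R hq hR
  have hP := L.relP_nonneg hq (ha.trans_le hR.1)
  have hqV : 0 ≤ q * V ^ 2 := by positivity
  set P := L.relP q R
  have c1 : 0 ≤ K / (4 * η) * P := by positivity
  have c2 : 0 ≤ b ^ 2 / (4 * η) * K * P := by positivity
  have c3 : 0 ≤ K / 2 * P := by positivity
  have c4 : 0 ≤ (K / (4 * η) + b ^ 2 / (4 * η) * K + K / 2) * (q * V ^ 2) := by positivity
  have c5 : 0 ≤ η * V ^ 2 := by positivity
  rcases le_total q (a / 2) with hq1 | hq1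
  · have h4 : |q - R| ≤ b := by rw [abs_le]; constructor <;> linarith [hR.1, hR.2]
    have h5 := mul_le_mul_of_nonneg_right h4 hV
    have h6 := mul_le_young (a := V) (b := b) hη
    have h7 := mul_le_mul_of_nonneg_left (h2 hq1) (by positivity : 0 ≤ b ^ 2 / (4 * η))
    nlinarith
  · rcases le_total q (2 * b) with hq2 | hq2
    · have h6 := mul_le_young (a := V) (b := |q - R|) hη
      rw [sq_abs] at h6
      have h7 := mul_le_mul_of_nonneg_left (h1 hq1 hq2) (by positivity : 0 ≤ 1 / (4 * η))
      have h8 : 1 / (4 * η) * (q - R) ^ 2 = (q - R) ^ 2 / (4 * η) := by ring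
      have h9 : 1 / (4 * η) * (K * P) = K / (4 * η) * P := by ring
      nlinarith
    · have h4 : |q - R| ≤ q := by rw [abs_le]; constructor <;> linarith [hR.1, hR.2]
      have h5 := mul_le_mul_of_nonneg_right h4 hV
      have h6 : q * V ≤ q / 2 + 1 / 2 * (q * V ^ 2) := by nlinarith [mul_nonneg hq (sq_nonneg (V - 1))]
      have h7 := h3 hq2
      nlinarith

/-- The relative energy density. -/
def relDens {d : ℕ} (L : FluidLaw) (K0 q R : ℝ) (u U g G : Sp d) (c C : ℝ) : ℝ :=
  1 / 2 * (∑ i, q * ((u i - U i) * (u i - U i))) + L.relP q R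
    + 1 / 2 * (∑ i, (g i - G i) * (g i - G i))
    + (glF c - glF C - glF1 C * (c - C) + K0 * tsq (c - C))

theorem sum_sub_mul_self {d : ℕ} (u U : Sp d) : ∑ i, (u i - U i) * (u i - U i) = ‖u - U‖ ^ 2 := by
  rw [EuclideanSpace.real_norm_sq_eq]
  simp [sq]

theorem abs_sum_mul_le {d : ℕ} (u v : Sp d) : |∑ i, u i * v i| ≤ ‖u‖ * ‖v‖ := by
  have := abs_real_inner_le_norm u v
  rw [PiLp.inner_apply] at this
  simpa [mul_comm] using this

theorem abs_quadratic_le {d : ℕ} {B : Matrix (Fin d) (Fin d) ℝ} {b : ℝ} (hb : ∀ i j, |B i j| ≤ b) (v : Sp d) :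
    |∑ i, ∑ j, B i j * (v i * v j)| ≤ d * (d * (b * ‖v‖ ^ 2)) := by
  calc |∑ i, ∑ j, B i j * (v i * v j)| ≤ ∑ _i : Fin d, ∑ _j : Fin d, b * ‖v‖ ^ 2 :=
        (Finset.abs_sum_le_sum_abs _ _).trans (Finset.sum_le_sum fun i _ =>
          (Finset.abs_sum_le_sum_abs _ _).trans (Finset.sum_le_sum fun j _ => by
            rw [abs_mul, abs_mul, sq]
            exact mul_le_mul (hb i j) (mul_le_mul (abs_apply_le v i) (abs_apply_le v j) (abs_nonneg _) (norm_nonneg _))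
              (by positivity) ((abs_nonneg _).trans (hb i j))))
    _ = _ := by simp only [Finset.sum_const, Finset.card_univ, Fintype.card_fin, nsmul_eq_mul]

theorem abs_trace_le {d : ℕ} {B : Matrix (Fin d) (Fin d) ℝ} {b : ℝ} (hb : ∀ i j, |B i j| ≤ b) :
    |B.trace| ≤ d * b := by
  calc |B.trace| ≤ ∑ _i : Fin d, b := (Finset.abs_sum_le_sum_abs _ _).trans (Finset.sum_le_sum fun i _ => hb i i)
    _ = _ := by simp

set_option maxHeartbeats 1000000 in
-- Every term is estimated by Young's inequality. The available square −(μ−M)² is spent by two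
-- quarters, in `t4` and `t7`; the term ε|u−U|² collects four quarters, from `t1'`, `t5`, `t8` and
-- `t9`; all else is bounded by multiples of e through `e1`–`e4`.
theorem exists_relRate_le (d : ℕ) (L : FluidLaw) {r b β K0 : ℝ} (hr : 0 < r) (hrb : r ≤ b) (hβ : 0 ≤ β) (hK0 : 0 ≤ K0)
    {ε : ℝ} (hε : 0 < ε) :
    ∃ N, 0 ≤ N ∧ ∀ (q R : ℝ) (u U s g G : Sp d) (A B : Matrix (Fin d) (Fin d) ℝ) (mu M c C Ct : ℝ),
      0 ≤ q → R ∈ Icc r b → ‖U‖ ≤ β → ‖s‖ ≤ β → ‖G‖ ≤ β → (∀ i j, |B i j| ≤ β) → |M| ≤ β → |Ct| ≤ β →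
      Ct + ∑ j, U j * G j = M →
      1 / 16 * (c - C) ^ 2 ≤ glF c - glF C - glF1 C * (c - C) + K0 * tsq (c - C) →
      relRate L K0 q R u U s g G A B mu M c C Ct
        ≤ -ddot (L.stress (A - B)) (A - B) + ε * ‖u - U‖ ^ 2 + N * relDens L K0 q R u U g G c C := by
  obtain ⟨K, hK, hcoer⟩ := L.exists_relP_coercive hr hrb
  set k : ℝ := β / r + β * β / r with hk
  have hk0 : 0 ≤ k := by positivity
  -- This η gives kη ≤ ε/4; the shift k + 1 avoids division by zero.
  obtain ⟨C1, hC1, hsub⟩ := L.exists_abs_sub_mul_le hr hrb (η := ε / (4 * (k + 1))) (by positivity)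
  refine ⟨k * C1 * 3 + d * (d * β) * 2 + K * (d * β) + β ^ 2 * 2 + β ^ 2 / ε * 2 + 6 * β * 16
    + 4 * K0 ^ 2 * 16 + K0 ^ 2 / ε * 2 + 4 * (K0 * β) ^ 2 / ε * 16 + (4 * K0 ^ 2 * 16 + β ^ 2 * 2), by positivity, ?_⟩
  intro q R u U s g G A B mu M c C Ct hq hR hU hs hG hB hM hCt hAC hw
  have hR0 : 0 < R := hr.trans_le hR.1
  set e := relDens L K0 q R u U g G c C with he
  set v := u - U with hv
  set γ := g - G with hγ
  set V := ‖v‖ with hV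
  set Γ := ‖γ‖ with hΓ
  set w := c - C with hwdef
  set P := L.relP q R with hP
  have hV0 : 0 ≤ V := norm_nonneg _
  have hΓ0 : 0 ≤ Γ := norm_nonneg _
  have hP0 : 0 ≤ P := L.relP_nonneg hq hR0
  have hqV0 : 0 ≤ q * V ^ 2 := by positivity
  have hΓ2 : 0 ≤ Γ ^ 2 := sq_nonneg Γ
  have hee : e = 1 / 2 * (q * V ^ 2) + P + 1 / 2 * Γ ^ 2
      + (glF c - glF C - glF1 C * w + K0 * tsq w) := by
    rw [he, relDens, ← Finset.mul_sum, sum_sub_mul_self, sum_sub_mul_self]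
  have hw0 : 0 ≤ 1 / 16 * w ^ 2 := by positivity
  have e1 : q * V ^ 2 ≤ 2 * e := by linarith only [hee, hΓ2, hP0, hqV0, hw0, hw]
  have e2 : P ≤ e := by linarith only [hee, hΓ2, hP0, hqV0, hw0, hw]
  have e3 : Γ ^ 2 ≤ 2 * e := by linarith only [hee, hΓ2, hP0, hqV0, hw0, hw]
  have e4 : w ^ 2 ≤ 16 * e := by linarith only [hee, hΓ2, hP0, hqV0, hw0, hw]
  have hX : |1 - q / R| ≤ |q - R| / r := by
    rw [show 1 - q / R = (R - q) / R by field_simp, abs_div, abs_of_pos hR0, abs_sub_comm]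
    gcongr
    exact hR.1
  have t1 : (1 - q / R) * (∑ i, (u i - U i) * s i) + (q / R - 1) * M * (∑ i, (u i - U i) * G i)
      ≤ k * (|q - R| * V) := by
    have a1 : |∑ i, (u i - U i) * s i| ≤ V * β := (abs_sum_mul_le v s).trans (mul_le_mul_of_nonneg_left hs hV0)
    have a2 : |∑ i, (u i - U i) * G i| ≤ V * β := (abs_sum_mul_le v G).trans (mul_le_mul_of_nonneg_left hG hV0)
    have a3 : |(1 - q / R) * (∑ i, (u i - U i) * s i)| ≤ |q - R| / r * (V * β) := by
      rw [abs_mul]; exact mul_le_mul hX a1 (abs_nonneg _) (by positivity)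
    have a4 : |(q / R - 1) * M * (∑ i, (u i - U i) * G i)| ≤ |q - R| / r * β * (V * β) := by
      rw [abs_mul, abs_mul, abs_sub_comm]
      exact mul_le_mul (mul_le_mul hX hM (abs_nonneg _) (by positivity)) a2 (abs_nonneg _) (by positivity)
    refine (add_le_add ((le_abs_self _).trans a3) ((le_abs_self _).trans a4)).trans (le_of_eq ?_)
    rw [hk]; field_simp
  have t1' : k * (|q - R| * V) ≤ ε / 4 * V ^ 2 + k * C1 * 3 * e := by
    have a1 := mul_le_mul_of_nonneg_left (hsub q R V hq hR hV0) hk0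
    have a2 : k * (ε / (4 * (k + 1)) * V ^ 2) ≤ ε / 4 * V ^ 2 := by
      rw [← mul_assoc]
      refine mul_le_mul_of_nonneg_right ?_ (sq_nonneg _)
      rw [← mul_div_assoc, div_le_div_iff₀ (by positivity) (by positivity)]
      linarith only [hε, mul_nonneg hk0 hε.le]
    have a3 : k * (C1 * (P + q * V ^ 2)) ≤ k * (C1 * (3 * e)) := by gcongr; linarith only [e1, e2]
    linarith only [a1, a2, a3]
  have t2 : -(q * (∑ i, ∑ j, B i j * ((u i - U i) * (u j - U j)))) ≤ d * (d * β) * 2 * e := by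
    have a1 := mul_le_mul_of_nonneg_left ((neg_le_abs _).trans (abs_quadratic_le hB v)) hq
    have a2 : (d:ℝ) * (d * β) * (q * V ^ 2) ≤ d * (d * β) * (2 * e) := by gcongr
    have a3 : ∀ i j, v i * v j = (u i - U i) * (u j - U j) := fun i j => rfl
    simp only [a3] at a1
    linarith only [a1, a2]
  have t3 : -(L.relp q R * B.trace) ≤ K * (d * β) * e := by
    have a1 : |L.relp q R * B.trace| ≤ K * P * (d * β) := by
      rw [abs_mul]
      exact mul_le_mul (hcoer q R hq hR).2.2.2 (abs_trace_le hB) (abs_nonneg _) (by positivity)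
    have a2 : K * P * (d * β) ≤ K * e * (d * β) := by gcongr
    linarith only [a1, a2, neg_le_abs (L.relp q R * B.trace)]
  have hUγ : |∑ i, U i * (g i - G i)| ≤ β * Γ :=
    (abs_sum_mul_le U γ).trans (mul_le_mul_of_nonneg_right hU hΓ0)
  have hvγ : |∑ i, (u i - U i) * (g i - G i)| ≤ V * Γ := abs_sum_mul_le v γ
  have hvG : |∑ i, (u i - U i) * G i| ≤ V * β := (abs_sum_mul_le v G).trans (mul_le_mul_of_nonneg_left hG hV0)
  have t4 : (mu - M) * (∑ i, U i * (g i - G i)) ≤ 1 / 4 * (mu - M) ^ 2 + β ^ 2 * 2 * e := by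
    have a1 := mul_le_young (a := mu - M) (b := ∑ i, U i * (g i - G i)) (δ := 1 / 4) (by norm_num)
    have a2 : (∑ i, U i * (g i - G i)) ^ 2 ≤ (β * Γ) ^ 2 := sq_le_sq' (by linarith only [(abs_le.1 hUγ).1]) (abs_le.1 hUγ).2
    have a3 : β ^ 2 * Γ ^ 2 ≤ β ^ 2 * (2 * e) := by gcongr
    norm_num at a1
    linarith only [a1, a2, a3, mul_pow β Γ 2]
  have t5 : -(M * (∑ i, (u i - U i) * (g i - G i))) ≤ ε / 4 * V ^ 2 + β ^ 2 / ε * 2 * e := by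
    have a1 : |M * (∑ i, (u i - U i) * (g i - G i))| ≤ β * (V * Γ) := by
      rw [abs_mul]; exact mul_le_mul hM hvγ (abs_nonneg _) hβ
    have a2 := mul_le_young (a := V) (b := β * Γ) (δ := ε / 4) (by positivity)
    have a3 : (β * Γ) ^ 2 / (4 * (ε / 4)) = β ^ 2 / ε * Γ ^ 2 := by field_simp
    have a4 : β ^ 2 / ε * Γ ^ 2 ≤ β ^ 2 / ε * (2 * e) := by gcongr
    linarith only [a1, a2, a3, a4, neg_le_abs (M * (∑ i, (u i - U i) * (g i - G i)))]
  have t6 : (glF1 c - glF1 C - glF2 C * w) * Ct ≤ 6 * β * 16 * e := by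
    have a1 : |(glF1 c - glF1 C - glF2 C * w) * Ct| ≤ 6 * w ^ 2 * β := by
      rw [abs_mul]
      exact mul_le_mul (glF1_taylor c C) hCt (abs_nonneg _) (by positivity)
    have a2 : 6 * w ^ 2 * β ≤ 6 * (16 * e) * β := by gcongr
    linarith only [a1, a2, le_abs_self ((glF1 c - glF1 C - glF2 C * w) * Ct)]
  have hτ := abs_tsq1_le w
  have hτ2 := tsq1_sq_le w
  set τ := tsq1 w with hτdef
  have hτe : τ ^ 2 ≤ 4 * (16 * e) := by linarith only [hτ2, e4]
  -- By the strong Allen–Cahn equation, the rate of c − C contains a difference in every summand.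
  have hrate : mu - (∑ i, u i * g i) - Ct = (mu - M) - (∑ i, (u i - U i) * (g i - G i))
      - (∑ i, (u i - U i) * G i) - ∑ i, U i * (g i - G i) := by
    have : (∑ i, u i * g i) = (∑ i, (u i - U i) * (g i - G i)) + (∑ i, (u i - U i) * G i)
        + (∑ i, U i * (g i - G i)) + ∑ i, U i * G i := by
      simp only [← Finset.sum_add_distrib]
      exact Finset.sum_congr rfl fun i _ => by ring
    linarith only [this, hAC]
  have t7 : K0 * (τ * (mu - M)) ≤ 1 / 4 * (mu - M) ^ 2 + 4 * K0 ^ 2 * 16 * e := by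
    have a1 := mul_le_young (a := mu - M) (b := K0 * τ) (δ := 1 / 4) (by norm_num)
    have a2 : K0 ^ 2 * τ ^ 2 ≤ K0 ^ 2 * (4 * (16 * e)) := by gcongr
    norm_num at a1
    linarith only [a1, a2, mul_pow K0 τ 2]
  -- The product VΓ is already quadratic, so |τ| ≤ 1 suffices here. In `t9` only V is small and the
  -- second factor comes from τ² ≤ 4w².
  have t8 : -(K0 * (τ * (∑ i, (u i - U i) * (g i - G i)))) ≤ ε / 4 * V ^ 2 + K0 ^ 2 / ε * 2 * e := by
    have a1 : |K0 * (τ * (∑ i, (u i - U i) * (g i - G i)))| ≤ K0 * (1 * (V * Γ)) := by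
      rw [abs_mul, abs_mul, abs_of_nonneg hK0]
      exact mul_le_mul_of_nonneg_left (mul_le_mul hτ hvγ (abs_nonneg _) zero_le_one) hK0
    have a2 := mul_le_young (a := V) (b := K0 * Γ) (δ := ε / 4) (by positivity)
    have a3 : (K0 * Γ) ^ 2 / (4 * (ε / 4)) = K0 ^ 2 / ε * Γ ^ 2 := by field_simp
    have a4 : K0 ^ 2 / ε * Γ ^ 2 ≤ K0 ^ 2 / ε * (2 * e) := by gcongr
    linarith only [a1, a2, a3, a4, neg_le_abs (K0 * (τ * (∑ i, (u i - U i) * (g i - G i))))]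
  have t9 : -(K0 * (τ * (∑ i, (u i - U i) * G i))) ≤ ε / 4 * V ^ 2 + 4 * (K0 * β) ^ 2 / ε * 16 * e := by
    have a1 : |K0 * (τ * (∑ i, (u i - U i) * G i))| ≤ K0 * (|τ| * (V * β)) := by
      rw [abs_mul, abs_mul, abs_of_nonneg hK0]
      exact mul_le_mul_of_nonneg_left (mul_le_mul_of_nonneg_left hvG (abs_nonneg _)) hK0
    have a2 := mul_le_young (a := V) (b := K0 * β * |τ|) (δ := ε / 4) (by positivity)
    have a3 : (K0 * β * |τ|) ^ 2 / (4 * (ε / 4)) = (K0 * β) ^ 2 / ε * τ ^ 2 := by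
      rw [mul_pow, sq_abs]; field_simp
    have a4 : (K0 * β) ^ 2 / ε * τ ^ 2 ≤ (K0 * β) ^ 2 / ε * (4 * (16 * e)) := by gcongr
    have a5 : (K0 * β) ^ 2 / ε * (4 * (16 * e)) = 4 * (K0 * β) ^ 2 / ε * 16 * e := by ring
    linarith only [a1, a2, a3, a4, a5, neg_le_abs (K0 * (τ * (∑ i, (u i - U i) * G i)))]
  have t10 : -(K0 * (τ * (∑ i, U i * (g i - G i)))) ≤ (4 * K0 ^ 2 * 16 + β ^ 2 * 2) * e := by
    have a1 : |K0 * (τ * (∑ i, U i * (g i - G i)))| ≤ K0 * (|τ| * (β * Γ)) := by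
      rw [abs_mul, abs_mul, abs_of_nonneg hK0]
      exact mul_le_mul_of_nonneg_left (mul_le_mul_of_nonneg_left hUγ (abs_nonneg _)) hK0
    have a2 : K0 * (|τ| * (β * Γ)) ≤ K0 ^ 2 * τ ^ 2 + β ^ 2 * Γ ^ 2 := by
      rw [← sq_abs τ]
      linarith only [sq_nonneg (K0 * |τ| - β * Γ), sq_nonneg (K0 * |τ|), sq_nonneg (β * Γ)]
    have a3 : K0 ^ 2 * τ ^ 2 ≤ K0 ^ 2 * (4 * (16 * e)) := by gcongr
    have a4 : β ^ 2 * Γ ^ 2 ≤ β ^ 2 * (2 * e) := by gcongr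
    linarith only [a1, a2, a3, a4, neg_le_abs (K0 * (τ * (∑ i, U i * (g i - G i))))]
  rw [relRate, hrate]
  linarith only [sq_nonneg (mu - M), t1, t1', t2, t3, t4, t5, t6, t7, t8, t9, t10]


/-! ### Identities for the relative energy, weighted in time -/

open FlowDomain

/-- Isolates the energy of the weak solution and terms linear in its unknowns, apart from the tsq
term. With l = ΔC the last two brackets have zero integral: they trade −∇c·∇C + ½|∇C|² for cΔC −
½CΔC. The pressure p(R) appears as P'(R)R − P(R). -/
theorem relDens_eq {d : ℕ} (hd : d = 2 ∨ d = 3) (L : FluidLaw) (K0 q : ℝ) {R : ℝ} (hR : 0 < R)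
    (u U g G : Sp d) (c C l : ℝ) :
    relDens L K0 q R u U g G c C
      = (1 / 2 * (∑ i, q * (u i * u i)) + 1 / 2 * (∑ i, g i * g i) + L.P q + glF c)
        - (∑ i, U i * (q * u i)) + (1 / 2 * ∑ i, U i * U i * q - L.P1 R * q) + L.p R
        + (-1 / 2 * (C * l) - glF C + glF1 C * C) + (l - glF1 C) * c + K0 * tsq (c - C)
        - ((∑ i, g i * G i) + c * l) + 1 / 2 * ((∑ i, G i * G i) + C * l) := by
  have h := L.P1_mul hR
  simp only [relDens, FluidLaw.relP]
  rcases hd with rfl | rfl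
  · simp only [Fin.sum_univ_two]
    linear_combination h
  · simp only [Fin.sum_univ_three]
    linear_combination h

theorem FlowDomain.memLp_slice_ae {d : ℕ} {D : FlowDomain d} {T : ℝ} {f : ℝ × Sp d → ℝ}
    (hf : MemLp f 2 (D.spaceTime T)) :
    ∀ᵐ t ∂volume.restrict (Ioo 0 T), MemLp (fun x => f (t, x)) 2 D.vol := by
  filter_upwards [hf.1.prodMk_left, hf.integrable_sq.prod_right_ae] with t h1 h2
  exact (memLp_two_iff_integrable_sq h1).2 h2

theorem FlowDomain.hasInt_weight_zero {d : ℕ} {D : FlowDomain d} {T : ℝ} {η : ℝ → ℝ} (hη : Continuous η)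
    {F : ℝ × Sp d → ℝ} (hF : Integrable F (D.spaceTime T))
    (h : ∀ᵐ t ∂volume.restrict (Ioo 0 T), ∫ x, F (t, x) ∂D.vol = 0) :
    HasInt (D.spaceTime T) (fun z => η z.1 * F z) 0 := by
  refine (hasInt_of_space (integrable_time_mul hη hF) (b := fun _ => 0) ?_).congr_val (by simp)
  filter_upwards [h] with t ht
  rw [integral_const_mul, ht, mul_zero]

namespace IsDissipativeWeakSolutionWith

variable {d : ℕ} {L : FluidLaw} {D : FlowDomain d} {T : ℝ} {ϱ₀ : Sp d → ℝ} {m₀ : Sp d → Sp d}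
  {c₀ : Sp d → ℝ} {ϱ : ℝ → Sp d → ℝ} {u : ℝ → Sp d → Sp d} {c : ℝ → Sp d → ℝ}
  {𝔈 : ℝ → Measure (Sp d)} {ℜ : ℝ → MatMeasure d} {Gu : ℝ → Sp d → Matrix (Fin d) (Fin d) ℝ}
  {Gc : ℝ → Sp d → Sp d} {Hc : ℝ → Sp d → Matrix (Fin d) (Fin d) ℝ} {G₀ : Sp d → Sp d}

theorem ae_isH10_u (h : IsDissipativeWeakSolutionWith L D T ϱ₀ m₀ c₀ ϱ u c 𝔈 ℜ Gu Gc Hc G₀) :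
    ∀ᵐ t ∂volume.restrict (Ioo 0 T), ∀ i, D.IsH10 (fun x => u t x i) fun j x => Gu t x i j := by
  have h1 : ∀ᵐ t ∂volume.restrict (Ioo 0 T), ∀ i, MemLp (fun x => u t x i) 2 D.vol :=
    ae_all_iff.2 fun i => memLp_slice_ae (h.memLp_u i)
  have h2 : ∀ᵐ t ∂volume.restrict (Ioo 0 T), ∀ i j, MemLp (fun x => Gu t x i j) 2 D.vol :=
    ae_all_iff.2 fun i => ae_all_iff.2 fun j => memLp_slice_ae (h.gradu_L2 i j)
  filter_upwards [h1, h2, h.gradu_weak, h.u_trace] with t h1 h2 h3 h4 i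
  exact IsH10.of_zeroTrace D (G := fun x => WithLp.toLp 2 (Gu t x i)) (h1 i) (h2 i) (h3 i) (h4 i)

theorem ae_isH10_c (h : IsDissipativeWeakSolutionWith L D T ϱ₀ m₀ c₀ ϱ u c 𝔈 ℜ Gu Gc Hc G₀) :
    ∀ᵐ t ∂volume.restrict (Ioo 0 T), D.IsH10 (c t) fun j x => Gc t x j := by
  have h1 : ∀ᵐ t ∂volume.restrict (Ioo 0 T), ∀ i, MemLp (fun x => Gc t x i) 2 D.vol :=
    ae_all_iff.2 fun i => memLp_slice_ae (h.memLp_Gc i)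
  filter_upwards [memLp_slice_ae h.memLp_c, h1, h.gradc_weak, h.c_trace] with t h1 h2 h3 h4
  exact IsH10.of_zeroTrace D h1 h2 h3 h4

variable {η : ℝ → ℝ}

theorem weight_stress (h : IsDissipativeWeakSolutionWith L D T ϱ₀ m₀ c₀ ϱ u c 𝔈 ℜ Gu Gc Hc G₀)
    (hd : 0 < d) (S : StrongData L D T) (hη : Continuous η) :
    HasInt (D.spaceTime T) (fun z => η z.1 * (ddot (L.stress (S.B z.1 z.2)) (Gu z.1 z.2 - S.B z.1 z.2)
      + ∑ i, S.s z.1 z.2 i * (u z.1 z.2 i - S.U z.1 z.2 i))) 0 := by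
  refine hasInt_weight_zero hη ?_ ?_
  · have hB : ∀ i j, MemLp (fun z : ℝ × Sp d => S.B z.1 z.2 i j) 2 (D.spaceTime T) := fun i j =>
      memLp_cont (S.cont_B i j)
    exact (integrable_ddot_stress L hB fun i j => (h.gradu_L2 i j).sub (hB i j)).add
      (integrable_finsetSum _ fun i _ => integrable_mul_cont (a := fun t x => S.s t x i)
        (ContinuousOn.proj S.hs.1 i) (((h.memLp_u i).sub (memLp_cont (S.hUi i).cont)).integrable (by norm_num)))
  · filter_upwards [h.ae_isH10_u, ae_restrict_mem measurableSet_Ioo] with t h1 ht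
    exact (S.integral_stress ht (v := fun i x => u t x i - S.U t x i) (A := fun x => Gu t x - S.B t x)
      fun i => (h1 i).sub (S.isH10_U hd ht i)).2

theorem weight_lap (h : IsDissipativeWeakSolutionWith L D T ϱ₀ m₀ c₀ ϱ u c 𝔈 ℜ Gu Gc Hc G₀)
    (hd : 0 < d) (S : StrongData L D T) (hη : Continuous η) :
    HasInt (D.spaceTime T) (fun z => η z.1 * (c z.1 z.2 * S.lt z.1 z.2
      - (Hc z.1 z.2).trace * S.Ct z.1 z.2)) 0 := by
  have i1 : Integrable (fun z : ℝ × Sp d => c z.1 z.2 * S.lt z.1 z.2) (D.spaceTime T) :=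
    h.memLp_c.int_mul (memLp_cont S.hl.cont_t)
  have i2 : Integrable (fun z : ℝ × Sp d => (Hc z.1 z.2).trace * S.Ct z.1 z.2) (D.spaceTime T) :=
    h.memLp_trace.int_mul (memLp_cont S.hC.cont_t)
  refine hasInt_weight_zero hη (i1.sub i2) ?_
  have h2 : ∀ᵐ t ∂volume.restrict (Ioo 0 T), ∀ j, MemLp (fun x => Hc t x j j) 2 D.vol :=
    ae_all_iff.2 fun j => memLp_slice_ae (h.hessc_L2 j j)
  filter_upwards [h.ae_isH10_c, h2, h.hessc_weak, i1.prod_right_ae, i2.prod_right_ae,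
    ae_restrict_mem measurableSet_Ioo] with t h1 h2 h3 j1 j2 ht
  -- The symmetry holds for a function frozen in time; it is used with c at time t and evaluated at
  -- the same t.
  have := S.integral_lt hd h1 h2 (fun j => h3 j j) t ht
  refine (integral_sub j1 j2).trans ?_
  rw [sub_eq_zero]
  exact this

theorem _root_.NSAC.StrongData.weight_lap (hd : 0 < d) (S : StrongData L D T) (hη : Continuous η) :
    HasInt (D.spaceTime T) (fun z => η z.1 * (S.C z.1 z.2 * S.lt z.1 z.2 - S.l z.1 z.2 * S.Ct z.1 z.2)) 0 := by
  have i1 := integrable_mul_cont S.hC.cont (integrable_cont S.hl.cont_t)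
  have i2 := integrable_mul_cont S.hl.cont (integrable_cont S.hC.cont_t)
  refine hasInt_weight_zero hη (i1.sub i2) ?_
  filter_upwards [i1.prod_right_ae, i2.prod_right_ae, ae_restrict_mem measurableSet_Ioo] with t j1 j2 ht
  refine (integral_sub j1 j2).trans ?_
  rw [sub_eq_zero]
  exact S.integral_C_lt hd ht

theorem _root_.NSAC.StrongData.weight_pressure (hd : 0 < d) (S : StrongData L D T) (hη : Continuous η) :
    HasInt (D.spaceTime T) (fun z => η z.1 * ((∑ i, S.U z.1 z.2 i * (deriv L.p (S.R z.1 z.2) * S.Rx z.1 z.2 (ev i)))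
      + L.p (S.R z.1 z.2) * (S.B z.1 z.2).trace)) 0 := by
  refine hasInt_weight_zero hη ?_ ?_
  · refine (integrable_finsetSum _ fun i _ => integrable_mul_cont (S.hUi i).cont
      (integrable_cont (a := fun t x => deriv L.p (S.R t x) * S.Rx t x (ev i)) ?_)).add
      (integrable_mul_cont S.hp.cont (integrable_cont (a := fun t x => ∑ i, S.B t x i i)
        (continuousOn_finsetSum _ fun i _ => S.cont_B i i)))
    exact S.hp.cont_ev i
  · filter_upwards [ae_restrict_mem measurableSet_Ioo] with t ht
    exact (S.integral_pressure hd ht).2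

theorem weight_grad (h : IsDissipativeWeakSolutionWith L D T ϱ₀ m₀ c₀ ϱ u c 𝔈 ℜ Gu Gc Hc G₀)
    (S : StrongData L D T) (hη : Continuous η) :
    HasInt (D.spaceTime T) (fun z => η z.1 * ((∑ i, Gc z.1 z.2 i * S.G z.1 z.2 i)
      + c z.1 z.2 * S.l z.1 z.2)) 0 := by
  refine hasInt_weight_zero hη ((integrable_finsetSum _ fun i _ => (h.memLp_Gc i).int_mul
    (memLp_cont (S.hGi i).cont)).add (h.memLp_c.int_mul (memLp_cont S.hl.cont))) ?_
  filter_upwards [h.ae_isH10_c, ae_restrict_mem measurableSet_Ioo] with t h1 ht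
  exact (S.integral_grad_mul ht h1).2

theorem _root_.NSAC.StrongData.weight_grad (hT : 0 < T) (hd : 0 < d) (S : StrongData L D T) (hη : Continuous η) :
    HasInt (D.spaceTime T) (fun z => η z.1 * ((∑ i, S.G z.1 z.2 i * S.G z.1 z.2 i)
      + S.C z.1 z.2 * S.l z.1 z.2)) 0 := by
  refine hasInt_weight_zero hη ((integrable_finsetSum _ fun i _ => integrable_mul_cont (S.hGi i).cont
    (integrable_cont (S.hGi i).cont)).add (integrable_mul_cont S.hC.cont (integrable_cont S.hl.cont))) ?_
  filter_upwards [ae_restrict_mem measurableSet_Ioo] with t ht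
  exact S.integral_energy_G hT hd t (Ioo_subset_Icc_self ht)

end IsDissipativeWeakSolutionWith


/-! ### Cancellation of the initial data -/

open FlowDomain

theorem momForm_weight {d : ℕ} (L : FluidLaw) (q : ℝ) (v : Sp d) (A : Matrix (Fin d) (Fin d) ℝ) (g : Sp d)
    (mu a b : ℝ) (U Ut : Sp d) (B : Matrix (Fin d) (Fin d) ℝ) :
    momForm L q v A g mu (a • Ut + b • U) (a • B) (a • U)
      = b * (∑ i, U i * (q * v i)) + a * ((∑ i, Ut i * (q * v i)) + (∑ i, ∑ j, B i j * (q * (v i * v j)))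
        + B.trace * L.p q - ddot (L.stress A) B - ∑ i, U i * (mu * g i)) := by
  have h1 : ddot (L.stress A) (a • B) = a * ddot (L.stress A) B := by
    simp only [ddot, Matrix.smul_apply, smul_eq_mul, Finset.mul_sum]
    exact Finset.sum_congr rfl fun i _ => Finset.sum_congr rfl fun j _ => by ring
  rw [momForm, h1, Matrix.trace_smul]
  simp only [PiLp.add_apply, PiLp.smul_apply, smul_eq_mul, Matrix.smul_apply, add_mul, Finset.sum_add_distrib,
    mul_assoc, ← Finset.mul_sum]
  ring

namespace StrongData

variable {d : ℕ} {L : FluidLaw} {D : FlowDomain d} {T : ℝ}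

/-- The relative energy of the initial data vanishes. -/
theorem initial_balance (S : StrongData L D T) (hT : 0 < T) (hd : 0 < d) {ϱ₀ c₀ : Sp d → ℝ} {m₀ G₀ : Sp d → Sp d}
    (hR₀ : ∀ᵐ x ∂D.vol, S.R 0 x = ϱ₀ x) (hU₀ : ∀ᵐ x ∂D.vol, S.R 0 x • S.U 0 x = m₀ x)
    (hC₀ : ∀ᵐ x ∂D.vol, S.C 0 x = c₀ x) (hG₀ : ∀ᵐ x ∂D.vol, S.G 0 x = G₀ x) (a : ℝ) :
    Integrable (fun x => inner ℝ (m₀ x) (S.U 0 x)) D.vol ∧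
    a * (∫ x, L.energyDensity (ϱ₀ x) (m₀ x) (G₀ x) (c₀ x) ∂D.vol) - a * (∫ x, inner ℝ (m₀ x) (S.U 0 x) ∂D.vol)
      - (1 / 2 * (∑ i, -(a * ∫ x, ϱ₀ x * (S.U 0 x i * S.U 0 x i) ∂D.vol)) - -(a * ∫ x, ϱ₀ x * L.P1 (S.R 0 x) ∂D.vol))
      - (∫ x, -(a * L.p (S.R 0 x)) ∂D.vol)
      - (-1 / 2 * (∫ x, -(a * (S.C 0 x * S.l 0 x)) ∂D.vol) - (∫ x, -(a * glF (S.C 0 x)) ∂D.vol)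
        + ∫ x, -(a * (glF1 (S.C 0 x) * S.C 0 x)) ∂D.vol)
      - (∫ x, -(a * (S.M 0 x * c₀ x)) ∂D.vol) = 0 := by
  have h0 : (0:ℝ) ∈ Icc 0 T := ⟨le_rfl, hT.le⟩
  have hF := S.hC.comp (S := univ) (fun a _ => hasDerivAt_glF a) continuous_glF1.continuousOn
    fun _ _ _ _ => mem_univ _
  have hF1 := S.hC.comp (S := univ) (fun a _ => hasDerivAt_glF1 a) continuous_glF2.continuousOn
    fun _ _ _ _ => mem_univ _
  have hUU : Integrable (fun x => ∑ i, S.R 0 x * (S.U 0 x i * S.U 0 x i)) D.vol :=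
    integrable_finsetSum _ fun i _ => integrable_slice (f := fun t x => S.R t x * (S.U t x i * S.U t x i))
      (S.hR.cont.mul ((S.hUi i).cont.mul (S.hUi i).cont)) h0
  have em : ∀ᵐ x ∂D.vol, ∑ i, S.R 0 x * (S.U 0 x i * S.U 0 x i) = inner ℝ (m₀ x) (S.U 0 x) := by
    filter_upwards [hU₀] with x hx
    rw [← hx, PiLp.inner_apply]
    refine Finset.sum_congr rfl fun i _ => ?_
    simp only [PiLp.smul_apply, smul_eq_mul, RCLike.inner_apply, conj_trivial]
    ring
  have im : HasInt D.vol (fun x => inner ℝ (m₀ x) (S.U 0 x)) _ := (hUU.congr em).hasInt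
  have iG : Integrable (fun x => ∑ i, S.G 0 x i * S.G 0 x i) D.vol :=
    integrable_finsetSum _ fun i _ => integrable_slice (f := fun t x => S.G t x i * S.G t x i)
      ((S.hGi i).cont.mul (S.hGi i).cont) h0
  have iP : Integrable (fun x => L.P1 (S.R 0 x) * S.R 0 x) D.vol :=
    integrable_slice (f := fun t x => L.P1 (S.R t x) * S.R t x) (S.hP1.cont.mul S.hR.cont) h0
  have ip : Integrable (fun x => L.p (S.R 0 x)) D.vol := integrable_slice S.hp.cont h0
  have iF : Integrable (fun x => glF (S.C 0 x)) D.vol := integrable_slice hF.cont h0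
  have iF1 : Integrable (fun x => glF1 (S.C 0 x) * S.C 0 x) D.vol :=
    integrable_slice (f := fun t x => glF1 (S.C t x) * S.C t x) (hF1.cont.mul S.hC.cont) h0
  have iCl : Integrable (fun x => S.C 0 x * S.l 0 x) D.vol :=
    integrable_slice (f := fun t x => S.C t x * S.l t x) (S.hC.cont.mul S.hl.cont) h0
  have iMc : Integrable (fun x => S.M 0 x * c₀ x) D.vol := by
    refine (integrable_slice (f := fun t x => S.M t x * S.C t x) (S.hM.cont.mul S.hC.cont) h0).congr ?_
    filter_upwards [hC₀] with x hx
    rw [hx]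
  have iE : Integrable (fun x => L.energyDensity (ϱ₀ x) (m₀ x) (G₀ x) (c₀ x)) D.vol := by
    refine ((((hUU.const_mul (1 / 2)).add (iG.const_mul (1 / 2))).add (iP.sub ip)).add iF).congr ?_
    filter_upwards [D.ae_vol_mem, hR₀, hU₀, hC₀, hG₀] with x hx h1 h2 h3 h4
    have hR := S.R_pos h0 hx
    have e1 : ‖m₀ x‖ ^ 2 / ϱ₀ x = ∑ i, S.R 0 x * (S.U 0 x i * S.U 0 x i) := by
      rw [← h1, ← h2, norm_smul, mul_pow, EuclideanSpace.real_norm_sq_eq, Real.norm_of_nonneg hR.le, ← Finset.mul_sum]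
      simp only [sq]
      field_simp
    have e2 : ‖G₀ x‖ ^ 2 = ∑ i, S.G 0 x i * S.G 0 x i := by
      rw [← h4, EuclideanSpace.real_norm_sq_eq]; simp only [sq]
    rw [FluidLaw.energyDensity, e1, e2, ← h3, ← h1]
    simp only [Pi.add_apply, Pi.sub_apply]
    rw [L.P1_mul hR]
    ring
  have i3 : ∀ i, HasInt D.vol (fun x => -(a * (ϱ₀ x * (S.U 0 x i * S.U 0 x i))))
      (-(a * ∫ x, ϱ₀ x * (S.U 0 x i * S.U 0 x i) ∂D.vol)) := fun i => by
    have : Integrable (fun x => ϱ₀ x * (S.U 0 x i * S.U 0 x i)) D.vol := by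
      refine (integrable_slice (f := fun t x => S.R t x * (S.U t x i * S.U t x i))
        (S.hR.cont.mul ((S.hUi i).cont.mul (S.hUi i).cont)) h0).congr ?_
      filter_upwards [hR₀] with x hx
      rw [hx]
    exact (this.hasInt.const_mul a).neg
  have i4 : HasInt D.vol (fun x => -(a * (ϱ₀ x * L.P1 (S.R 0 x)))) (-(a * ∫ x, ϱ₀ x * L.P1 (S.R 0 x) ∂D.vol)) := by
    have : Integrable (fun x => ϱ₀ x * L.P1 (S.R 0 x)) D.vol := by
      refine iP.congr ?_
      filter_upwards [hR₀] with x hx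
      rw [← hx, mul_comm]
    exact (this.hasInt.const_mul a).neg
  refine ⟨im.1, ?_⟩
  have tot := (((((iE.hasInt.const_mul a).sub (im.const_mul a)).sub
      (((HasInt.sum Finset.univ i3).const_mul (1 / 2)).sub i4)).sub (ip.const_mul a).neg.hasInt).sub
      ((((iCl.const_mul a).neg.hasInt.const_mul (-1 / 2)).sub (iF.const_mul a).neg.hasInt).add
        (iF1.const_mul a).neg.hasInt)).sub (iMc.const_mul a).neg.hasInt
  -- The combined initial integrand collapses, by P'(R)R − P(R) = p(R), to (a/2)(|∇C|² + CΔC), whose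
  -- integral is zero.
  refine tot.unique ((HasInt.const_mul (⟨iG.add iCl, S.integral_energy_G hT hd 0 h0⟩) (a / 2)).congr_ae ?_ |>.congr_val (mul_zero _))
  filter_upwards [D.ae_vol_mem, hR₀, hU₀, hC₀, hG₀, em] with x hx h1 h2 h3 h4 h5
  have hR := S.R_pos h0 hx
  have e1 : ‖m₀ x‖ ^ 2 / ϱ₀ x = ∑ i, S.R 0 x * (S.U 0 x i * S.U 0 x i) := by
    rw [← h1, ← h2, norm_smul, mul_pow, EuclideanSpace.real_norm_sq_eq, Real.norm_of_nonneg hR.le, ← Finset.mul_sum]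
    simp only [sq]
    field_simp
  have e2 : ‖G₀ x‖ ^ 2 = ∑ i, S.G 0 x i * S.G 0 x i := by
    rw [← h4, EuclideanSpace.real_norm_sq_eq]; simp only [sq]
  have e3 := L.P1_mul hR
  simp only [Pi.neg_apply, Pi.add_apply]
  rw [FluidLaw.energyDensity, e1, e2, ← h5, ← h3, ← h1]
  simp only [Finset.sum_neg_distrib, ← Finset.mul_sum, M]
  linear_combination a * e3

end StrongData


/-! ### The relative energy inequality -/

open FlowDomain

namespace IsDissipativeWeakSolutionWith

variable {d : ℕ} {L : FluidLaw} {D : FlowDomain d} {T : ℝ} {ϱ₀ : Sp d → ℝ} {m₀ : Sp d → Sp d}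
  {c₀ : Sp d → ℝ} {ϱ : ℝ → Sp d → ℝ} {u : ℝ → Sp d → Sp d} {c : ℝ → Sp d → ℝ}
  {𝔈 : ℝ → Measure (Sp d)} {ℜ : ℝ → MatMeasure d} {Gu : ℝ → Sp d → Matrix (Fin d) (Fin d) ℝ}
  {Gc : ℝ → Sp d → Sp d} {Hc : ℝ → Sp d → Matrix (Fin d) (Fin d) ℝ} {G₀ : Sp d → Sp d}

/-- The field G₀ is known only as a weak gradient of c₀; so is ∇C at time 0, and weak gradients are
unique. -/
theorem ae_gradient_eq (h : IsDissipativeWeakSolutionWith L D T ϱ₀ m₀ c₀ ϱ u c 𝔈 ℜ Gu Gc Hc G₀)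
    (hT : 0 < T) (S : StrongData L D T) (hC₀ : ∀ᵐ x ∂D.vol, S.C 0 x = c₀ x) :
    ∀ᵐ x ∂D.vol, S.G 0 x = G₀ x := by
  refine ae_eq_of_isWeakGrad (f := c₀) ?_ h.gradc0_weak (fun j => integrable_slice (S.hGi j).cont ⟨le_rfl, hT.le⟩)
    fun j => (h.gradc0_L2.coord j).integrable (by norm_num)
  intro j φ hφ
  refine Eq.trans (integral_congr_ae ?_) (S.isWeakGrad_zero hT j φ hφ)
  filter_upwards [hC₀] with x hx
  rw [hx]

theorem continuity_velocity (h : IsDissipativeWeakSolutionWith L D T ϱ₀ m₀ c₀ ϱ u c 𝔈 ℜ Gu Gc Hc G₀)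
    (S : StrongData L D T) {θ θ' : ℝ → ℝ} (hθ : Weight T θ θ') :
    HasInt (D.spaceTime T) (fun z => θ' z.1 * (∑ i, S.U z.1 z.2 i * S.U z.1 z.2 i * ϱ z.1 z.2)
      + θ z.1 * (∑ i, ((S.U z.1 z.2 i * S.Ut z.1 z.2 i + S.Ut z.1 z.2 i * S.U z.1 z.2 i) * ϱ z.1 z.2
        + ∑ j, (S.U z.1 z.2 i * S.B z.1 z.2 i j + S.B z.1 z.2 i j * S.U z.1 z.2 i) * (ϱ z.1 z.2 * u z.1 z.2 j))))
      (∑ i, -(θ 0 * ∫ x, ϱ₀ x * (S.U 0 x i * S.U 0 x i) ∂D.vol)) := by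
  refine (HasInt.sum Finset.univ fun i => h.continuity_weight ((S.hUi i).smul (S.hUi i)) hθ).congr fun z => ?_
  rw [Finset.sum_add_distrib, ← Finset.mul_sum, ← Finset.mul_sum]
  rfl

theorem integrable_relDens (h : IsDissipativeWeakSolutionWith L D T ϱ₀ m₀ c₀ ϱ u c 𝔈 ℜ Gu Gc Hc G₀)
    (hd : d = 2 ∨ d = 3) (S : StrongData L D T) (K0 : ℝ) :
    Integrable (fun z : ℝ × Sp d => relDens L K0 (ϱ z.1 z.2) (S.R z.1 z.2) (u z.1 z.2) (S.U z.1 z.2) (Gc z.1 z.2)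
      (S.G z.1 z.2) (c z.1 z.2) (S.C z.1 z.2)) (D.spaceTime T) := by
  have hF := S.hC.comp (S := univ) (fun a _ => hasDerivAt_glF a) continuous_glF1.continuousOn
    fun _ _ _ _ => mem_univ _
  have hF1 := S.hC.comp (S := univ) (fun a _ => hasDerivAt_glF1 a) continuous_glF2.continuousOn
    fun _ _ _ _ => mem_univ _
  have hw : AEStronglyMeasurable (fun z : ℝ × Sp d => c z.1 z.2 - S.C z.1 z.2) (D.spaceTime T) :=
    h.memLp_c.1.sub (aestronglyMeasurable_spaceTime S.hC.cont)
  have htc : Continuous tsq := continuous_iff_continuousAt.2 fun s => (hasDerivAt_tsq s).continuousAt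
  have i0 := h.integrable_energy
  have i1 : Integrable (fun z : ℝ × Sp d => ∑ i, S.U z.1 z.2 i * (ϱ z.1 z.2 * u z.1 z.2 i)) (D.spaceTime T) :=
    integrable_finsetSum _ fun i _ => integrable_mul_cont (S.hUi i).cont (h.integrable_rho_u i)
  have i2 : Integrable (fun z : ℝ × Sp d => ∑ i, S.U z.1 z.2 i * S.U z.1 z.2 i * ϱ z.1 z.2) (D.spaceTime T) :=
    integrable_finsetSum _ fun i _ => integrable_mul_cont (a := fun t x => S.U t x i * S.U t x i)
      ((S.hUi i).cont.mul (S.hUi i).cont) h.integrable_rho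
  have i3 := integrable_mul_cont S.hP1.cont h.integrable_rho
  have i4 := integrable_cont S.hp.cont
  have i5 : Integrable (fun z : ℝ × Sp d => -1 / 2 * (S.C z.1 z.2 * S.l z.1 z.2) - glF (S.C z.1 z.2)
      + glF1 (S.C z.1 z.2) * S.C z.1 z.2) (D.spaceTime T) :=
    (((integrable_mul_cont S.hC.cont (integrable_cont S.hl.cont)).const_mul _).sub
      (integrable_cont hF.cont)).add (integrable_mul_cont hF1.cont (integrable_cont S.hC.cont))
  have i6 := integrable_mul_cont S.hM.cont (h.memLp_c.integrable (by norm_num))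
  have i7 : Integrable (fun z : ℝ × Sp d => tsq (c z.1 z.2 - S.C z.1 z.2)) (D.spaceTime T) :=
    (MemLp.of_bound (p := 1) (htc.comp_aestronglyMeasurable hw) 1 (Eventually.of_forall fun z => by
      rw [Real.norm_of_nonneg (tsq_nonneg _)]; exact tsq_le_one _)).integrable le_rfl
  have i8 : Integrable (fun z : ℝ × Sp d => (∑ i, Gc z.1 z.2 i * S.G z.1 z.2 i) + c z.1 z.2 * S.l z.1 z.2) (D.spaceTime T) :=
    (integrable_finsetSum _ fun i _ => (h.memLp_Gc i).int_mul
      (memLp_cont (S.hGi i).cont)).add (h.memLp_c.int_mul (memLp_cont S.hl.cont))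
  have i9 : Integrable (fun z : ℝ × Sp d => (∑ i, S.G z.1 z.2 i * S.G z.1 z.2 i) + S.C z.1 z.2 * S.l z.1 z.2) (D.spaceTime T) :=
    (integrable_finsetSum _ fun i _ => integrable_mul_cont (S.hGi i).cont
      (integrable_cont (S.hGi i).cont)).add (integrable_mul_cont S.hC.cont (integrable_cont S.hl.cont))
  refine ((((((((i0.sub i1).add ((i2.const_mul (1 / 2)).sub i3)).add i4).add i5).add i6).add (i7.const_mul K0)).sub
    i8).add (i9.const_mul (1 / 2))).congr ?_
  refine ae_spaceTime_of_forall fun t ht x hx => ?_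
  refine Eq.trans ?_ (relDens_eq hd L K0 _ (S.R_pos (Ioo_subset_Icc_self ht) hx) _ _ _ _ _ _ (S.l t x)).symm
  simp only [Pi.add_apply, Pi.sub_apply, StrongData.M]

/-- The relative energy inequality, tested with a time weight. -/
theorem relEnergy_weight (h : IsDissipativeWeakSolutionWith L D T ϱ₀ m₀ c₀ ϱ u c 𝔈 ℜ Gu Gc Hc G₀)
    (hd : d = 2 ∨ d = 3) (hT : 0 < T) (S : StrongData L D T)
    (hR₀ : ∀ᵐ x ∂D.vol, S.R 0 x = ϱ₀ x) (hU₀ : ∀ᵐ x ∂D.vol, S.R 0 x • S.U 0 x = m₀ x)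
    (hC₀ : ∀ᵐ x ∂D.vol, S.C 0 x = c₀ x) (K0 : ℝ) :
    ∃ K, 0 ≤ K ∧ ∀ θ θ' : ℝ → ℝ, Weight T θ θ' → ∃ I J,
      HasInt (D.spaceTime T) (fun z => -θ' z.1 * relDens L K0 (ϱ z.1 z.2) (S.R z.1 z.2) (u z.1 z.2) (S.U z.1 z.2)
        (Gc z.1 z.2) (S.G z.1 z.2) (c z.1 z.2) (S.C z.1 z.2)) I ∧
      HasInt (D.spaceTime T) (fun z => θ z.1 * relRate L K0 (ϱ z.1 z.2) (S.R z.1 z.2) (u z.1 z.2) (S.U z.1 z.2)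
        (S.s z.1 z.2) (Gc z.1 z.2) (S.G z.1 z.2) (Gu z.1 z.2) (S.B z.1 z.2) (chem c Hc z.1 z.2) (S.M z.1 z.2)
        (c z.1 z.2) (S.C z.1 z.2) (S.Ct z.1 z.2)) J ∧
      I + ∫ t in Ioo 0 T, -θ' t * (𝔈 t).real D.closedCell
        ≤ J + K * ∫ t in Ioo 0 T, θ t * (𝔈 t).real D.closedCell := by
  have hd0 : 0 < d := by rcases hd with rfl | rfl <;> norm_num
  have hF := S.hC.comp (S := univ) (fun a _ => hasDerivAt_glF a) continuous_glF1.continuousOn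
    fun _ _ _ _ => mem_univ _
  have hF1 := S.hC.comp (S := univ) (fun a _ => hasDerivAt_glF1 a) continuous_glF2.continuousOn
    fun _ _ _ _ => mem_univ _
  have hG₀ := h.ae_gradient_eq hT S hC₀
  have hc0 : Integrable c₀ D.vol := (integrable_slice S.hC.cont ⟨le_rfl, hT.le⟩).congr hC₀
  obtain ⟨K, hK, hmom⟩ := h.momentum_weight hd0 hT S (S.initial_balance hT hd0 hR₀ hU₀ hC₀ hG₀ 0).1
  refine ⟨K, hK, fun θ θ' hθ => ?_⟩
  have hinit := (S.initial_balance hT hd0 hR₀ hU₀ hC₀ hG₀ (θ 0)).2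
  obtain ⟨J3, t3, hJ3⟩ := hmom θ θ' hθ
  have hen := h.energy_weight hT.le hθ
  replace t3 := t3.congr fun z => momForm_weight L _ _ _ _ _ _ _ _ _ _
  have t1 := Integrable.hasInt (f := fun z : ℝ × Sp d => -θ' z.1 * (1 / 2 * (∑ i, ϱ z.1 z.2 * (u z.1 z.2 i * u z.1 z.2 i))
      + 1 / 2 * (∑ i, Gc z.1 z.2 i * Gc z.1 z.2 i) + L.P (ϱ z.1 z.2) + glF (c z.1 z.2)))
    (integrable_time_mul hθ.cont.neg h.integrable_energy)
  have t2 := (integrable_time_mul hθ.continuous h.integrable_diss).hasInt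
  have t4 := h.continuity_velocity S hθ
  have t4' := h.continuity_weight S.hP1 hθ
  have t5 := S.hp.hasInt_weight hT.le hθ
  have t6 := (S.hC.smul S.hl).hasInt_weight hT.le hθ
  have t6' := hF.hasInt_weight hT.le hθ
  have t6'' := (hF1.smul S.hC).hasInt_weight hT.le hθ
  have hprim := h.allenCahn_primitive hT hc0
  have t7 := hasInt_weight_of_primitive hT.le (h.memLp_c.integrable (by norm_num)) h.integrable_rate hprim S.hM hθ
  have hprim' : ∀ᵐ x ∂D.vol, IntegrableOn (fun t => chem c Hc t x - ∑ j, u t x j * Gc t x j) (Ioo 0 T) ∧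
      ∀ᵐ t ∂volume.restrict (Ioo 0 T),
        c t x = S.C 0 x + ∫ s in 0..t, (chem c Hc s x - ∑ j, u s x j * Gc s x j) := by
    filter_upwards [hprim, hC₀] with x hx hx'
    rw [hx']; exact hx
  have t8 := hasInt_weight_comp hT.le h.memLp_c.1 h.integrable_rate S.hC hprim' hθ hasDerivAt_tsq
    continuous_tsq1 abs_tsq1_le (fun s => by rw [abs_of_nonneg (tsq_nonneg s)]; exact tsq_le_one s) tsq_zero
  simp only [smul_eq_mul] at t6 t6''
  have z1 := h.weight_stress hd0 S hθ.continuous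
  have za := h.weight_lap hd0 S hθ.continuous
  have zb := S.weight_lap hd0 hθ.continuous
  have z3 := S.weight_pressure hd0 hθ.continuous
  have z4 := h.weight_grad S hθ.cont
  have z5 := S.weight_grad hT hd0 hθ.cont
  have tI := Integrable.hasInt (f := fun z : ℝ × Sp d => -θ' z.1 * relDens L K0 (ϱ z.1 z.2) (S.R z.1 z.2)
      (u z.1 z.2) (S.U z.1 z.2) (Gc z.1 z.2) (S.G z.1 z.2) (c z.1 z.2) (S.C z.1 z.2))
    (integrable_time_mul hθ.cont.neg (h.integrable_relDens hd S K0))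
  -- Energy, dissipation and momentum, minus continuity tested with ½|U|² − P'(R), minus the purely
  -- strong terms, Allen–Cahn tested with M, and the renormalized equation. The terms z4, z5
  -- weighted by θ' and z1, za, zb, z3 weighted by θ have value zero and supply the spatial
  -- integrations by parts.
  have tot := ((((((((t1.add t2).add t3).sub ((t4.const_mul (1 / 2)).sub t4')).sub t5).sub
    (((t6.const_mul (-1 / 2)).sub t6').add t6'')).sub t7).sub (t8.const_mul K0)).add
    (z4.sub (z5.const_mul (1 / 2)))).sub (((z1.sub za).add (zb.const_mul (1 / 2))).add z3)
  -- The parts with θ' cancel by `relDens_eq`; the parts with θ form the rate by `relRate_eq`.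
  have tJ := (tI.sub tot).congr_ae (g := fun z => θ z.1 * relRate L K0 (ϱ z.1 z.2) (S.R z.1 z.2) (u z.1 z.2) (S.U z.1 z.2)
        (S.s z.1 z.2) (Gc z.1 z.2) (S.G z.1 z.2) (Gu z.1 z.2) (S.B z.1 z.2) (chem c Hc z.1 z.2) (S.M z.1 z.2)
        (c z.1 z.2) (S.C z.1 z.2) (S.Ct z.1 z.2)) (by
    refine ae_spaceTime_of_forall fun t ht x hx => ?_
    have hR := S.R_pos (Ioo_subset_Icc_self ht) hx
    have hx' := D.cell_subset_region hx
    have a1 := relDens_eq hd L K0 (ϱ t x) hR (u t x) (S.U t x) (Gc t x) (S.G t x) (c t x) (S.C t x) (S.l t x)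
    have a2 := relRate_eq hd L (K0 := K0) (q := ϱ t x) (Rx := WithLp.toLp 2 fun j => S.Rx t x (ev j)) (u := u t x)
      (U := S.U t x) (Ut := S.Ut t x) (s := S.s t x) (g := Gc t x) (G := S.G t x) (A := Gu t x) (B := S.B t x)
      (h := (Hc t x).trace) (l := S.l t x) (lt := S.lt t x) (c := c t x) (C := S.C t x) (Ct := S.Ct t x) hR.ne'
      (S.continuity t ht x hx') (S.momentum t ht x hx') (S.allenCahn t ht x hx')
    simp only [smul_eq_mul, chem, StrongData.M, StrongData.Mt, smul_apply] at a1 a2 ⊢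
    rw [a1, a2]
    ring)
  refine ⟨_, _, tI, tJ, ?_⟩
  -- Only the upper bound on the tested momentum is needed. Added to the energy inequality, its
  -- initial values cancel by `hinit`.
  have hJ3' := (abs_le.1 hJ3).2
  linarith

end IsDissipativeWeakSolutionWith


/-! ### Absorbing the velocity by the dissipation -/

open FlowDomain

theorem StrongData.exists_bounds {d : ℕ} {L : FluidLaw} {D : FlowDomain d} {T : ℝ} (S : StrongData L D T) :
    ∃ b β, S.r ≤ b ∧ 0 ≤ β ∧ ∀ t ∈ Ioo 0 T, ∀ x ∈ D.cell, S.R t x ∈ Icc S.r b ∧ ‖S.U t x‖ ≤ β ∧ ‖S.s t x‖ ≤ β ∧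
      ‖S.G t x‖ ≤ β ∧ (∀ i j, |S.B t x i j| ≤ β) ∧ |S.M t x| ≤ β ∧ |S.Ct t x| ≤ β ∧ |S.C t x| ≤ β := by
  obtain ⟨b, hb, h0⟩ := exists_bound_of_continuousOn S.hR.cont
  obtain ⟨b1, hb1, h1⟩ := exists_bound_of_continuousOn S.hU.cont
  obtain ⟨b2, hb2, h2⟩ := exists_bound_of_continuousOn S.hs.1
  obtain ⟨b3, hb3, h3⟩ := exists_bound_of_continuousOn S.hG.cont
  obtain ⟨b4, hb4, h4⟩ := exists_bound_of_continuousOn S.hU.cont_x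
  obtain ⟨b5, hb5, h5⟩ := exists_bound_of_continuousOn S.hM.cont
  obtain ⟨b6, hb6, h6⟩ := exists_bound_of_continuousOn S.hC.cont_t
  obtain ⟨b7, hb7, h7⟩ := exists_bound_of_continuousOn S.hC.cont
  refine ⟨max S.r b, b1 + b2 + b3 + b4 + b5 + b6 + b7, le_max_left _ _, by positivity, fun t ht x hx => ?_⟩
  have ht' := Ioo_subset_Icc_self ht
  refine ⟨⟨S.R_ge t ht' x (D.region_subset_closedRegion (D.cell_subset_region hx)),
    (le_abs_self _).trans ((h0 t ht' x hx).trans (le_max_right _ _))⟩,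
    (h1 t ht' x hx).trans (by linarith), (h2 t ht' x hx).trans (by linarith), (h3 t ht' x hx).trans (by linarith),
    fun i j => ?_, (h5 t ht' x hx).trans (by linarith), (h6 t ht' x hx).trans (by linarith),
    (h7 t ht' x hx).trans (by linarith)⟩
  have e1 : |S.B t x i j| ≤ ‖S.Ux t x (ev j)‖ := PiLp.norm_apply_le (S.Ux t x (ev j)) i
  have e2 : ‖S.Ux t x (ev j)‖ ≤ ‖S.Ux t x‖ := by
    simpa using (S.Ux t x).le_opNorm (ev j)
  linarith [h4 t ht' x hx]

theorem relDens_bounds {d : ℕ} (L : FluidLaw) {K0 q R : ℝ} (hq : 0 ≤ q) (hR : 0 < R) (u U g G : Sp d) {c C : ℝ}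
    (hc : 1 / 16 * (c - C) ^ 2 ≤ glF c - glF C - glF1 C * (c - C) + K0 * tsq (c - C)) :
    q * ‖u - U‖ ^ 2 ≤ 2 * relDens L K0 q R u U g G c C ∧ L.relP q R ≤ relDens L K0 q R u U g G c C ∧
      1 / 16 * (c - C) ^ 2 ≤ relDens L K0 q R u U g G c C := by
  have h1 : 0 ≤ q * ‖u - U‖ ^ 2 := by positivity
  have h2 : 0 ≤ ∑ i, (g i - G i) * (g i - G i) := Finset.sum_nonneg fun i _ => mul_self_nonneg _
  have h3 := L.relP_nonneg hq hR
  have h4 : 0 ≤ (c - C) ^ 2 := sq_nonneg _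
  rw [relDens, ← Finset.mul_sum, sum_sub_mul_self]
  refine ⟨?_, ?_, ?_⟩ <;> linarith only [h1, h2, h3, h4, hc]

namespace IsDissipativeWeakSolutionWith

variable {d : ℕ} {L : FluidLaw} {D : FlowDomain d} {T : ℝ} {ϱ₀ : Sp d → ℝ} {m₀ : Sp d → Sp d}
  {c₀ : Sp d → ℝ} {ϱ : ℝ → Sp d → ℝ} {u : ℝ → Sp d → Sp d} {c : ℝ → Sp d → ℝ}
  {𝔈 : ℝ → Measure (Sp d)} {ℜ : ℝ → MatMeasure d} {Gu : ℝ → Sp d → Matrix (Fin d) (Fin d) ℝ}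
  {Gc : ℝ → Sp d → Sp d} {Hc : ℝ → Sp d → Matrix (Fin d) (Fin d) ℝ} {G₀ : Sp d → Sp d}

theorem integrable_rho_sub_sq (h : IsDissipativeWeakSolutionWith L D T ϱ₀ m₀ c₀ ϱ u c 𝔈 ℜ Gu Gc Hc G₀)
    (S : StrongData L D T) (i : Fin d) :
    Integrable (fun z : ℝ × Sp d => ϱ z.1 z.2 * (u z.1 z.2 i - S.U z.1 z.2 i) ^ 2) (D.spaceTime T) := by
  refine (((h.integrable_rho_u_u i i).sub ((integrable_mul_cont (S.hUi i).cont (h.integrable_rho_u i)).const_mul 2)).add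
    (integrable_mul_cont (S.hUi i).cont (integrable_mul_cont (S.hUi i).cont h.integrable_rho))).congr
    (Eventually.of_forall fun z => ?_)
  simp only [Pi.add_apply, Pi.sub_apply]
  ring

/-- Korn and Poincaré inequalities for the relative velocity. -/
theorem exists_velocity_sub_le (h : IsDissipativeWeakSolutionWith L D T ϱ₀ m₀ c₀ ϱ u c 𝔈 ℜ Gu Gc Hc G₀)
    (hd : 2 ≤ d) (hT : 0 < T) (S : StrongData L D T) (hR₀ : ∀ᵐ x ∂D.vol, S.R 0 x = ϱ₀ x) :
    ∃ K, 0 ≤ K ∧ ∀ᵐ t ∂volume.restrict (Ioo 0 T),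
      0 ≤ ∫ x, ddot (L.stress (Gu t x - S.B t x)) (Gu t x - S.B t x) ∂D.vol ∧
      ∫ x, ‖u t x - S.U t x‖ ^ 2 ∂D.vol
        ≤ K * (∫ x, ddot (L.stress (Gu t x - S.B t x)) (Gu t x - S.B t x) ∂D.vol
          + ∫ x, ϱ t x * ‖u t x - S.U t x‖ ^ 2 ∂D.vol) := by
  have hd0 : 0 < d := by omega
  have h0 : 0 < ∫ x, ϱ₀ x ∂D.vol := by
    have hi : Integrable (S.R 0) D.vol := integrable_slice S.hR.cont (left_mem_Icc.2 hT.le)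
    rw [← integral_congr_ae hR₀]
    have h1 : ∫ _x, S.r ∂D.vol ≤ ∫ x, S.R 0 x ∂D.vol := by
      refine integral_mono_ae (integrable_const _) hi ?_
      filter_upwards [D.ae_vol_mem] with x hx
      exact S.R_ge 0 (left_mem_Icc.2 hT.le) x (D.region_subset_closedRegion (D.cell_subset_region hx))
    rw [integral_const, smul_eq_mul] at h1
    exact (mul_pos D.vol_pos S.r_pos).trans_le h1
  obtain ⟨a, δ, ha, hδ, hA⟩ := h.exists_density_set hT h0
  obtain ⟨K, hK, hp⟩ := exists_poincare hd0 D ha hδ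
  have hi : ∀ᵐ t ∂volume.restrict (Ioo 0 T), ∀ i,
      Integrable (fun x => ϱ t x * (u t x i - S.U t x i) ^ 2) D.vol :=
    ae_all_iff.2 fun i => (h.integrable_rho_sub_sq S i).prod_right_ae
  have hϱ : ∀ᵐ t ∂volume.restrict (Ioo 0 T), ∀ᵐ x ∂D.vol, 0 ≤ ϱ t x := Measure.ae_ae_of_ae_prod h.rho_nonneg
  -- Korn's inequality bounds the gradient by ν⁻¹ times the dissipation, and the weighted Poincaré
  -- inequality bounds the velocity by the gradient and ϱ|u−U|².
  refine ⟨K * ((L.nu)⁻¹ + 1), by have := L.nu_pos; positivity, ?_⟩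
  filter_upwards [hA, hi, hϱ, h.ae_isH10_u, ae_restrict_mem measurableSet_Ioo] with t ⟨A, hAm, hAδ, haA⟩ hi hϱ hu ht
  have hv : ∀ i, D.IsH10 (fun x => u t x i - S.U t x i) fun j x => (Gu t x - S.B t x) i j := fun i =>
    (hu i).sub (S.isH10_U hd0 ht i)
  have hk := korn L hd hv
  set Q := ∫ x, ddot (L.stress (Gu t x - S.B t x)) (Gu t x - S.B t x) ∂D.vol
  set X := ∑ i, ∑ j, ∫ x, (Gu t x - S.B t x) i j ^ 2 ∂D.vol
  have hX : 0 ≤ X := Finset.sum_nonneg fun i _ => Finset.sum_nonneg fun j _ => integral_nonneg fun x => sq_nonneg _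
  have hQ : 0 ≤ Q := (mul_nonneg L.nu_pos.le hX).trans hk
  refine ⟨hQ, ?_⟩
  have e1 : ∫ x, ‖u t x - S.U t x‖ ^ 2 ∂D.vol = ∑ i, ∫ x, (u t x i - S.U t x i) ^ 2 ∂D.vol := by
    rw [← integral_finsetSum _ fun i _ => (hv i).memLp.integrable_sq]
    simp only [EuclideanSpace.real_norm_sq_eq, PiLp.sub_apply]
  have e2 : ∫ x, ϱ t x * ‖u t x - S.U t x‖ ^ 2 ∂D.vol = ∑ i, ∫ x, ϱ t x * (u t x i - S.U t x i) ^ 2 ∂D.vol := by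
    rw [← integral_finsetSum _ fun i _ => hi i]
    simp only [EuclideanSpace.real_norm_sq_eq, PiLp.sub_apply, Finset.mul_sum]
  have hY : 0 ≤ ∫ x, ϱ t x * ‖u t x - S.U t x‖ ^ 2 ∂D.vol := by
    refine integral_nonneg_of_ae ?_
    filter_upwards [hϱ] with x hx
    exact mul_nonneg hx (sq_nonneg _)
  have e3 : ∑ i, ∫ x, (u t x i - S.U t x i) ^ 2 ∂D.vol
      ≤ K * (X + ∫ x, ϱ t x * ‖u t x - S.U t x‖ ^ 2 ∂D.vol) := by
    rw [e2, ← Finset.sum_add_distrib, Finset.mul_sum]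
    exact Finset.sum_le_sum fun i _ => hp _ _ _ A (hv i) hϱ (hi i) hAm hAδ haA
  have e4 : X ≤ (L.nu)⁻¹ * Q := by
    rw [inv_mul_eq_div, le_div_iff₀ L.nu_pos, mul_comm]; exact hk
  rw [e1]
  refine e3.trans ?_
  rw [mul_assoc]
  refine mul_le_mul_of_nonneg_left ?_ hK
  have := mul_nonneg (inv_nonneg.2 L.nu_pos.le) hY
  linarith

/-- The rate of the relative energy is controlled by the relative energy. -/
theorem exists_relRate_integral_le (h : IsDissipativeWeakSolutionWith L D T ϱ₀ m₀ c₀ ϱ u c 𝔈 ℜ Gu Gc Hc G₀)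
    (hd : d = 2 ∨ d = 3) (hT : 0 < T) (S : StrongData L D T) (hR₀ : ∀ᵐ x ∂D.vol, S.R 0 x = ϱ₀ x) {K0 : ℝ}
    (hK0 : 0 ≤ K0) (hc : ∀ t ∈ Ioo 0 T, ∀ x ∈ D.cell, ∀ s,
      1 / 16 * (s - S.C t x) ^ 2 ≤ glF s - glF (S.C t x) - glF1 (S.C t x) * (s - S.C t x) + K0 * tsq (s - S.C t x)) :
    ∃ N, 0 ≤ N ∧ ∀ (θ : ℝ → ℝ) (I J : ℝ), Continuous θ → (∀ t, 0 ≤ θ t) →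
      HasInt (D.spaceTime T) (fun z => θ z.1 * relDens L K0 (ϱ z.1 z.2) (S.R z.1 z.2) (u z.1 z.2) (S.U z.1 z.2)
        (Gc z.1 z.2) (S.G z.1 z.2) (c z.1 z.2) (S.C z.1 z.2)) I →
      HasInt (D.spaceTime T) (fun z => θ z.1 * relRate L K0 (ϱ z.1 z.2) (S.R z.1 z.2) (u z.1 z.2) (S.U z.1 z.2)
        (S.s z.1 z.2) (Gc z.1 z.2) (S.G z.1 z.2) (Gu z.1 z.2) (S.B z.1 z.2) (chem c Hc z.1 z.2) (S.M z.1 z.2)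
        (c z.1 z.2) (S.C z.1 z.2) (S.Ct z.1 z.2)) J →
      J ≤ N * I := by
  obtain ⟨b, β, hb, hβ, hbd⟩ := S.exists_bounds
  obtain ⟨K, hK, hKP⟩ := h.exists_velocity_sub_le (by omega) hT S hR₀
  -- With εK ≤ 1, the dissipation absorbs ε∫|u−U|² up to εK∫ϱ|u−U|², which costs at most 2εK times
  -- the relative energy.
  set ε : ℝ := (K + 1)⁻¹ with hε
  have hε0 : 0 < ε := by positivity
  have hεK : ε * K ≤ 1 := by
    rw [hε, inv_mul_le_one₀ (by positivity)]; linarith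
  obtain ⟨N, hN, hle⟩ := exists_relRate_le d L (K0 := K0) S.r_pos hb hβ hK0 hε0
  refine ⟨2 * (ε * K) + N, by positivity, fun θ I J hθ hθ0 hI hJ => ?_⟩
  have hmem : ∀ i j, MemLp (fun z : ℝ × Sp d => (Gu z.1 z.2 - S.B z.1 z.2) i j) 2 (D.spaceTime T) := fun i j =>
    (h.gradu_L2 i j).sub (memLp_cont (S.cont_B i j))
  have i1 := integrable_ddot_stress L hmem hmem
  have i2 : Integrable (fun z : ℝ × Sp d => ‖u z.1 z.2 - S.U z.1 z.2‖ ^ 2) (D.spaceTime T) := by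
    refine (integrable_finsetSum Finset.univ fun i _ =>
      ((h.memLp_u i).sub (memLp_cont (S.hUi i).cont)).integrable_sq).congr (Eventually.of_forall fun z => ?_)
    simp only [EuclideanSpace.real_norm_sq_eq, PiLp.sub_apply, Pi.sub_apply]
  have i3 : Integrable (fun z : ℝ × Sp d => ϱ z.1 z.2 * ‖u z.1 z.2 - S.U z.1 z.2‖ ^ 2) (D.spaceTime T) := by
    refine (integrable_finsetSum Finset.univ fun i _ => h.integrable_rho_sub_sq S i).congr
      (Eventually.of_forall fun z => ?_)
    simp only [EuclideanSpace.real_norm_sq_eq, PiLp.sub_apply, Finset.mul_sum]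
  have i4 : Integrable (fun z : ℝ × Sp d => -ddot (L.stress (Gu z.1 z.2 - S.B z.1 z.2)) (Gu z.1 z.2 - S.B z.1 z.2)
      + ε * ‖u z.1 z.2 - S.U z.1 z.2‖ ^ 2 - ε * K * (ϱ z.1 z.2 * ‖u z.1 z.2 - S.U z.1 z.2‖ ^ 2)) (D.spaceTime T) :=
    (i1.neg.add (i2.const_mul _)).sub (i3.const_mul _)
  have k1 := (integrable_time_mul hθ i4).hasInt (f := fun z : ℝ × Sp d => θ z.1 *
    (-ddot (L.stress (Gu z.1 z.2 - S.B z.1 z.2)) (Gu z.1 z.2 - S.B z.1 z.2)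
      + ε * ‖u z.1 z.2 - S.U z.1 z.2‖ ^ 2 - ε * K * (ϱ z.1 z.2 * ‖u z.1 z.2 - S.U z.1 z.2‖ ^ 2)))
  -- The absorption holds only after integration in space, for almost every time; it is therefore
  -- separated from the pointwise estimate.
  have k2 : ∫ z : ℝ × Sp d, θ z.1 * (-ddot (L.stress (Gu z.1 z.2 - S.B z.1 z.2)) (Gu z.1 z.2 - S.B z.1 z.2)
      + ε * ‖u z.1 z.2 - S.U z.1 z.2‖ ^ 2 - ε * K * (ϱ z.1 z.2 * ‖u z.1 z.2 - S.U z.1 z.2‖ ^ 2)) ∂D.spaceTime T ≤ 0 := by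
    rw [spaceTime, integral_prod _ k1.1]
    refine integral_nonpos_of_ae ?_
    filter_upwards [hKP, i1.prod_right_ae, i2.prod_right_ae, i3.prod_right_ae] with t ⟨hQ, ht⟩ j1 j2 j3
    change ∫ x, θ t * _ ∂D.vol ≤ 0
    rw [integral_const_mul]
    refine mul_nonpos_of_nonneg_of_nonpos (hθ0 t) ?_
    have e := ((j1.hasInt.neg.add (j2.hasInt.const_mul ε)).sub (j3.hasInt.const_mul (ε * K))).2
    refine e.le.trans ?_
    have := mul_le_mul_of_nonneg_left ht hε0.le
    have := mul_le_mul_of_nonneg_right hεK hQ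
    simp only at *
    linarith
  have k3 := hJ.mono_ae (k1.add (hI.const_mul (2 * (ε * K) + N))) ?_
  · linarith
  have hall : ∀ᵐ z ∂D.spaceTime T, z.1 ∈ Ioo 0 T ∧ z.2 ∈ D.cell := ae_spaceTime_of_forall fun t ht x hx => ⟨ht, hx⟩
  filter_upwards [h.rho_nonneg, hall] with ⟨t, x⟩ hq ⟨ht, hx⟩
  simp only at hq ht hx ⊢
  obtain ⟨b0, b1, b2, b3, b4, b5, b6, -⟩ := hbd t ht x hx
  have r1 := hle (ϱ t x) (S.R t x) (u t x) (S.U t x) (S.s t x) (Gc t x) (S.G t x) (Gu t x) (S.B t x) (chem c Hc t x)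
    (S.M t x) (c t x) (S.C t x) (S.Ct t x) hq b0 b1 b2 b3 b4 b5 b6
    (S.allenCahn t ht x (D.cell_subset_region hx)) (hc t ht x hx _)
  obtain ⟨r2, -, -⟩ := relDens_bounds L hq (S.R_pos (Ioo_subset_Icc_self ht) hx) (u t x) (S.U t x) (Gc t x) (S.G t x)
    (hc t ht x hx (c t x))
  have r3 := mul_le_mul_of_nonneg_left r2 (by positivity : 0 ≤ ε * K)
  refine (mul_le_mul_of_nonneg_left (r1.trans (b := _) (c := -ddot (L.stress (Gu t x - S.B t x)) (Gu t x - S.B t x)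
      + ε * ‖u t x - S.U t x‖ ^ 2 - ε * K * (ϱ t x * ‖u t x - S.U t x‖ ^ 2) + (2 * (ε * K) + N) * relDens L K0 (ϱ t x) (S.R t x) (u t x) (S.U t x)
        (Gc t x) (S.G t x) (c t x) (S.C t x)) ?_) (hθ0 t)).trans (le_of_eq ?_)
  · linarith only [r3]
  · ring

end IsDissipativeWeakSolutionWith


/-! ### Grönwall argument and conclusion -/

open FlowDomain

theorem hasDerivAt_max_zero_sq (x : ℝ) : HasDerivAt (fun y : ℝ => max y 0 ^ 2) (2 * max x 0) x := by
  rcases lt_trichotomy x 0 with h | rfl | h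
  · rw [max_eq_right h.le, mul_zero]
    refine (hasDerivAt_const x (0 : ℝ)).congr_of_eventuallyEq ?_
    filter_upwards [Iio_mem_nhds h] with y hy
    rw [max_eq_right (le_of_lt hy)]
    norm_num
  · have h0 : HasDerivAt (fun y : ℝ => y ^ 2) 0 0 := (hasDerivAt_pow 2 (0 : ℝ)).congr_deriv (by norm_num)
    rw [max_self, mul_zero, hasDerivAt_iff_isLittleO] at *
    refine Asymptotics.IsBigO.trans_isLittleO (Asymptotics.IsBigO.of_bound 1 (Eventually.of_forall fun y => ?_)) h0
    simp only [max_self, smul_zero, sub_zero, one_mul, ne_eq, OfNat.ofNat_ne_zero, not_false_eq_true, zero_pow, norm_pow]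
    refine pow_le_pow_left₀ (norm_nonneg _) ?_ 2
    rw [Real.norm_of_nonneg (le_max_right _ _)]
    exact max_le (le_abs_self _) (abs_nonneg _)
  · rw [max_eq_left h.le]
    refine HasDerivAt.congr_of_eventuallyEq ((hasDerivAt_pow 2 x).congr_deriv (by norm_num)) ?_
    filter_upwards [Ioi_mem_nhds h] with y hy
    rw [max_eq_left (le_of_lt hy)]

/-- The weight `(a - t)₊² exp (-K t)`. -/
theorem weight_max_sq_exp {T a K : ℝ} (ha : a < T) (hK : 0 ≤ K) :
    Weight T (fun t => max (a - t) 0 ^ 2 * Real.exp (-(K * t)))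
      fun t => -(K * (max (a - t) 0 ^ 2 * Real.exp (-(K * t))) + 2 * (max (a - t) 0 * Real.exp (-(K * t)))) where
  hasDerivAt t := by
    have h1 := (hasDerivAt_max_zero_sq (a - t)).comp t ((hasDerivAt_id t).const_sub a)
    have h2 : HasDerivAt (fun s => Real.exp (-(K * s))) (Real.exp (-(K * t)) * -(K * 1)) t :=
      (((hasDerivAt_id t).const_mul K).neg).exp
    refine (h1.mul h2).congr_deriv ?_
    simp only [Function.comp_apply]
    ring
  cont := by fun_prop
  nonneg t := by positivity
  deriv_nonpos t := by
    have : 0 ≤ max (a - t) 0 := le_max_right _ _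
    rw [neg_nonpos]
    positivity
  vanish := ⟨a, ha, fun t ht => by
    rw [max_eq_right (by linarith)]
    norm_num⟩

namespace IsDissipativeWeakSolutionWith

variable {d : ℕ} {L : FluidLaw} {D : FlowDomain d} {T : ℝ} {ϱ₀ : Sp d → ℝ} {m₀ : Sp d → Sp d}
  {c₀ : Sp d → ℝ} {ϱ : ℝ → Sp d → ℝ} {u : ℝ → Sp d → Sp d} {c : ℝ → Sp d → ℝ}
  {𝔈 : ℝ → Measure (Sp d)} {ℜ : ℝ → MatMeasure d} {Gu : ℝ → Sp d → Matrix (Fin d) (Fin d) ℝ}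
  {Gc : ℝ → Sp d → Sp d} {Hc : ℝ → Sp d → Matrix (Fin d) (Fin d) ℝ} {G₀ : Sp d → Sp d}

/-- The relative energy vanishes. -/
theorem relEnergy_eq_zero (h : IsDissipativeWeakSolutionWith L D T ϱ₀ m₀ c₀ ϱ u c 𝔈 ℜ Gu Gc Hc G₀)
    (hd : d = 2 ∨ d = 3) (hT : 0 < T) (S : StrongData L D T)
    (hR₀ : ∀ᵐ x ∂D.vol, S.R 0 x = ϱ₀ x) (hU₀ : ∀ᵐ x ∂D.vol, S.R 0 x • S.U 0 x = m₀ x)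
    (hC₀ : ∀ᵐ x ∂D.vol, S.C 0 x = c₀ x) {K0 : ℝ} (hK0 : 0 ≤ K0) (hc : ∀ t ∈ Ioo 0 T, ∀ x ∈ D.cell, ∀ s,
      1 / 16 * (s - S.C t x) ^ 2 ≤ glF s - glF (S.C t x) - glF1 (S.C t x) * (s - S.C t x) + K0 * tsq (s - S.C t x)) :
    (∀ᵐ z ∂D.spaceTime T, relDens L K0 (ϱ z.1 z.2) (S.R z.1 z.2) (u z.1 z.2) (S.U z.1 z.2)
        (Gc z.1 z.2) (S.G z.1 z.2) (c z.1 z.2) (S.C z.1 z.2) = 0) ∧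
      ∀ᵐ t ∂volume.restrict (Ioo 0 T), (𝔈 t).real D.closedCell = 0 := by
  obtain ⟨K, hK, hmain⟩ := h.relEnergy_weight hd hT S hR₀ hU₀ hC₀ K0
  obtain ⟨N, hN, hrate⟩ := h.exists_relRate_integral_le hd hT S hR₀ hK0 hc
  have hall : ∀ᵐ z ∂D.spaceTime T, z.1 ∈ Ioo 0 T ∧ z.2 ∈ D.cell := ae_spaceTime_of_forall fun t ht x hx => ⟨ht, hx⟩
  have hnn : ∀ᵐ z ∂D.spaceTime T, 0 ≤ relDens L K0 (ϱ z.1 z.2) (S.R z.1 z.2) (u z.1 z.2) (S.U z.1 z.2)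
        (Gc z.1 z.2) (S.G z.1 z.2) (c z.1 z.2) (S.C z.1 z.2) := by
    filter_upwards [h.rho_nonneg, hall] with z hq ⟨ht, hx⟩
    have h1 := S.R_pos (Ioo_subset_Icc_self ht) hx
    exact (L.relP_nonneg hq h1).trans (relDens_bounds L hq h1 _ _ _ _ (hc z.1 ht z.2 hx _)).2.1
  have hE : IntegrableOn (fun t => (𝔈 t).real D.closedCell) (Ioo 0 T) :=
    h.energy_defect.integrableOn D.measurableSet_closedCell
  have hi := h.integrable_relDens hd S K0
  have key : ∀ n : ℕ,
      (∀ᵐ z ∂D.spaceTime T, z.1 < T - 1 / (n + 1) →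
        relDens L K0 (ϱ z.1 z.2) (S.R z.1 z.2) (u z.1 z.2) (S.U z.1 z.2)
          (Gc z.1 z.2) (S.G z.1 z.2) (c z.1 z.2) (S.C z.1 z.2) = 0) ∧
      ∀ᵐ t ∂volume.restrict (Ioo 0 T), t < T - 1 / (n + 1) → (𝔈 t).real D.closedCell = 0 := by
    intro n
    set a : ℝ := T - 1 / (n + 1)
    have ha : a < T := sub_lt_self T (by positivity)
    have hw := weight_max_sq_exp ha (add_nonneg hN hK)
    -- This weight satisfies −θ' = (N+K)θ + 2η. The first summand outweighs N∫θe + K∫θ𝔈 on the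
    -- right-hand side and 2η is left over. The square makes θ continuously differentiable at a.
    set θ : ℝ → ℝ := fun t => max (a - t) 0 ^ 2 * Real.exp (-((N + K) * t))
    set η : ℝ → ℝ := fun t => max (a - t) 0 * Real.exp (-((N + K) * t)) with hη
    have hηc : Continuous η := by fun_prop
    have hη0 : ∀ t, 0 ≤ η t := fun t => mul_nonneg (le_max_right _ _) (Real.exp_pos _).le
    have hηpos : ∀ t, t < a → η t ≠ 0 := fun t ht =>
      (mul_pos (lt_max_of_lt_left (sub_pos.2 ht)) (Real.exp_pos _)).ne'
    obtain ⟨I, J, hI, hJ, hle⟩ := hmain _ _ hw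
    have tθ := (integrable_time_mul hw.continuous hi).hasInt
    have tη := (integrable_time_mul hηc hi).hasInt
    have eθ := (integrableOn_cont_mul hw.continuous hE).hasInt
    have eη := (integrableOn_cont_mul hηc hE).hasInt
    have hJ' := hrate _ _ _ hw.continuous hw.nonneg tθ hJ
    have hI' := hI.unique (((tθ.const_mul (N + K)).add (tη.const_mul 2)).congr fun z => by ring)
    have hE' := (((eθ.const_mul (N + K)).add (eη.const_mul 2)).congr
      (g := fun t => -(-((N + K) * θ t + 2 * η t)) * (𝔈 t).real D.closedCell) fun t => by ring).2
    rw [hE', hI'] at hle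
    have p1 : 0 ≤ᵐ[D.spaceTime T] fun z => θ z.1 * relDens L K0 (ϱ z.1 z.2) (S.R z.1 z.2) (u z.1 z.2) (S.U z.1 z.2)
        (Gc z.1 z.2) (S.G z.1 z.2) (c z.1 z.2) (S.C z.1 z.2) := by
      filter_upwards [hnn] with z hz using mul_nonneg (hw.nonneg _) hz
    have p2 : 0 ≤ᵐ[D.spaceTime T] fun z => η z.1 * relDens L K0 (ϱ z.1 z.2) (S.R z.1 z.2) (u z.1 z.2) (S.U z.1 z.2)
        (Gc z.1 z.2) (S.G z.1 z.2) (c z.1 z.2) (S.C z.1 z.2) := by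
      filter_upwards [hnn] with z hz using mul_nonneg (hη0 _) hz
    have p3 : 0 ≤ᵐ[volume.restrict (Ioo 0 T)] fun t => θ t * (𝔈 t).real D.closedCell :=
      Eventually.of_forall fun t => mul_nonneg (hw.nonneg _) measureReal_nonneg
    have p4 : 0 ≤ᵐ[volume.restrict (Ioo 0 T)] fun t => η t * (𝔈 t).real D.closedCell :=
      Eventually.of_forall fun t => mul_nonneg (hη0 _) measureReal_nonneg
    have q1 := mul_nonneg hK (integral_nonneg_of_ae p1)
    have q2 := integral_nonneg_of_ae p2
    have q3 := mul_nonneg hN (integral_nonneg_of_ae p3)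
    have q4 := integral_nonneg_of_ae p4
    -- After cancellation, K∫θe + N∫θ𝔈 + 2∫ηe + 2∫η𝔈 ≤ 0 with all four terms nonnegative; η > 0
    -- before time a.
    have z2 := (integral_eq_zero_iff_of_nonneg_ae p2 tη.1).1 (by linarith only [hle, hJ', q1, q2, q3, q4])
    have z4 := (integral_eq_zero_iff_of_nonneg_ae p4 eη.1).1 (by linarith only [hle, hJ', q1, q2, q3, q4])
    refine ⟨?_, ?_⟩
    · filter_upwards [z2] with z hz hza
      exact (mul_eq_zero.1 hz).resolve_left (hηpos _ hza)
    · filter_upwards [z4] with t ht hta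
      exact (mul_eq_zero.1 ht).resolve_left (hηpos _ hta)
  have hlt : ∀ t < T, ∃ n : ℕ, t < T - 1 / ((n : ℝ) + 1) := fun t ht => by
    obtain ⟨n, hn⟩ := exists_nat_one_div_lt (sub_pos.2 ht)
    exact ⟨n, by linarith⟩
  refine ⟨?_, ?_⟩
  · filter_upwards [ae_all_iff.2 fun n => (key n).1, hall] with z hz ⟨ht, _⟩
    obtain ⟨n, hn⟩ := hlt z.1 ht.2
    exact hz n hn
  · filter_upwards [ae_all_iff.2 fun n => (key n).2, ae_restrict_mem measurableSet_Ioo] with t hz ht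
    obtain ⟨n, hn⟩ := hlt t ht.2
    exact hz n hn

/-- A weak solution coincides with the strong solution with the same data. -/
theorem eq_strongData (h : IsDissipativeWeakSolutionWith L D T ϱ₀ m₀ c₀ ϱ u c 𝔈 ℜ Gu Gc Hc G₀)
    (hd : d = 2 ∨ d = 3) (hT : 0 < T) (S : StrongData L D T)
    (hR₀ : ∀ᵐ x ∂D.vol, S.R 0 x = ϱ₀ x) (hU₀ : ∀ᵐ x ∂D.vol, S.R 0 x • S.U 0 x = m₀ x)
    (hC₀ : ∀ᵐ x ∂D.vol, S.C 0 x = c₀ x) :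
    (∀ᵐ z ∂D.spaceTime T, ϱ z.1 z.2 = S.R z.1 z.2 ∧ u z.1 z.2 = S.U z.1 z.2 ∧ c z.1 z.2 = S.C z.1 z.2) ∧
      (∀ᵐ t ∂volume.restrict (Ioo 0 T), 𝔈 t = 0 ∧ ℜ t = 0) := by
  obtain ⟨b, β, hb, hβ, hbd⟩ := S.exists_bounds
  obtain ⟨K0, hK0, hF⟩ := exists_glF_coercive β
  obtain ⟨K1, hK1, hP⟩ := L.exists_relP_coercive S.r_pos hb
  have hc : ∀ t ∈ Ioo 0 T, ∀ x ∈ D.cell, ∀ s, 1 / 16 * (s - S.C t x) ^ 2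
      ≤ glF s - glF (S.C t x) - glF1 (S.C t x) * (s - S.C t x) + K0 * tsq (s - S.C t x) :=
    fun t ht x hx s => hF s _ (hbd t ht x hx).2.2.2.2.2.2.2
  obtain ⟨h1, h2⟩ := h.relEnergy_eq_zero hd hT S hR₀ hU₀ hC₀ hK0.le hc
  have hall : ∀ᵐ z ∂D.spaceTime T, z.1 ∈ Ioo 0 T ∧ z.2 ∈ D.cell := ae_spaceTime_of_forall fun t ht x hx => ⟨ht, hx⟩
  refine ⟨?_, ?_⟩
  · filter_upwards [h1, h.rho_nonneg, hall] with z hz hq ⟨ht, hx⟩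
    have hRb := (hbd z.1 ht z.2 hx).1
    have hR := S.r_pos.trans_le hRb.1
    obtain ⟨r1, r2, r3⟩ := relDens_bounds L hq hR (u z.1 z.2) (S.U z.1 z.2) (Gc z.1 z.2) (S.G z.1 z.2)
      (hc z.1 ht z.2 hx (c z.1 z.2))
    rw [hz] at r1 r2 r3
    have hrel : L.relP (ϱ z.1 z.2) (S.R z.1 z.2) = 0 := le_antisymm r2 (L.relP_nonneg hq hR)
    obtain ⟨c1, c2, c3, -⟩ := hP _ _ hq hRb
    rw [hrel, mul_zero] at c1 c2 c3
    -- Where the relative potential vanishes, ϱ can lie neither in the low nor in the high range, so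
    -- the quadratic bound gives ϱ = R. Then ϱ > 0, and ϱ|u−U|² = 0 yields u = U.
    have hlow : S.r / 2 ≤ ϱ z.1 z.2 := by
      by_contra! hlt
      linarith [c2 hlt.le]
    have hhigh : ϱ z.1 z.2 ≤ 2 * b := by
      by_contra! hlt
      linarith [c3 hlt.le]
    have hqpos : 0 < ϱ z.1 z.2 := (half_pos S.r_pos).trans_le hlow
    refine ⟨sub_eq_zero.1 (pow_eq_zero_iff two_ne_zero |>.1 (le_antisymm (c1 hlow hhigh) (sq_nonneg _))), ?_,
      sub_eq_zero.1 (pow_eq_zero_iff two_ne_zero |>.1 (le_antisymm (by linarith) (sq_nonneg _)))⟩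
    rw [mul_zero] at r1
    exact sub_eq_zero.1 (norm_eq_zero.1 (pow_eq_zero_iff two_ne_zero |>.1
      (le_antisymm (le_of_mul_le_mul_left (r1.trans_eq (mul_zero _).symm) hqpos) (sq_nonneg _))))
  -- The energy defect vanishes on the closed cell by the Grönwall argument and off it by
  -- definition; the total variation of every entry of ℜ is bounded by it.
  · obtain ⟨Λ, hΛ, hR⟩ := h.compatible.exists_totalVariation_le h.momentum_defect h.energy_defect
    obtain ⟨M, hM⟩ := h.energy_defect.2.2
    filter_upwards [h2, hR, hM, h.energy_defect.2.1] with t ht hR hM hc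
    refine ⟨?_, ?_⟩
    · have hfin : 𝔈 t D.closedCell ≠ ⊤ := ne_top_of_le_ne_top ENNReal.coe_ne_top ((measure_mono (subset_univ _)).trans hM)
      have h0 : 𝔈 t D.closedCell = 0 := (measureReal_eq_zero_iff hfin).1 ht
      rw [← Measure.measure_univ_eq_zero, ← union_compl_self D.closedCell]
      exact measure_union_null h0 hc
    · funext i j
      have h0 := hR i j
      rw [ht, mul_zero] at h0
      have h3 : (ℜ t i j).totalVariation univ = 0 :=
        (measureReal_eq_zero_iff (measure_ne_top _ _)).1 (le_antisymm h0 measureReal_nonneg)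
      ext A hA
      exact SignedMeasure.null_of_totalVariation_zero _ (measure_mono_null (subset_univ A) h3)

end IsDissipativeWeakSolutionWith

end NSAC

end

theorem mainTheorem2 {d : ℕ} (hd : d = 2 ∨ d = 3)
    (L : NSAC.FluidLaw) (D : NSAC.FlowDomain d) (T : ℝ) (hT : 0 < T)
    (ϱ₀ : NSAC.Sp d → ℝ) (m₀ : NSAC.Sp d → NSAC.Sp d) (c₀ : NSAC.Sp d → ℝ)
    (hE₀ : NSAC.FiniteInitialEnergy L D ϱ₀ m₀ c₀)
    (ϱ : ℝ → NSAC.Sp d → ℝ) (u : ℝ → NSAC.Sp d → NSAC.Sp d) (c : ℝ → NSAC.Sp d → ℝ)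
    (𝔈 : ℝ → Measure (NSAC.Sp d)) (ℜ : ℝ → NSAC.MatMeasure d)
    (hweak : NSAC.IsDissipativeWeakSolution L D T ϱ₀ m₀ c₀ ϱ u c 𝔈 ℜ)
    (R : ℝ → NSAC.Sp d → ℝ) (U : ℝ → NSAC.Sp d → NSAC.Sp d) (C : ℝ → NSAC.Sp d → ℝ)
    (hstrong : NSAC.IsStrongSolution L D T R U C)
    (hR₀ : ∀ᵐ x ∂D.vol, R 0 x = ϱ₀ x)
    (hU₀ : ∀ᵐ x ∂D.vol, R 0 x • U 0 x = m₀ x)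
    (hC₀ : ∀ᵐ x ∂D.vol, C 0 x = c₀ x) :
    (∀ᵐ z ∂D.spaceTime T, ϱ z.1 z.2 = R z.1 z.2 ∧ u z.1 z.2 = U z.1 z.2 ∧ c z.1 z.2 = C z.1 z.2) ∧
      (∀ᵐ t ∂volume.restrict (Ioo 0 T), 𝔈 t = 0 ∧ ℜ t = 0) := by
  obtain ⟨Gu, Gc, Hc, G₀, h⟩ := hweak
  obtain ⟨S, rfl, rfl, rfl⟩ := hstrong.exists_data hT
  exact h.eq_strongData hd hT S hR₀ hU₀ hC₀
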